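/- Conventions. All locally compact groups are Hausdorff and second countable. For a standard Borel space $X$ with a measure class and a Polish abelian group $A$, let $L(X,A)$ be the group of Borel functions $X\to A$ modulo equality almost everywhere, with the topology of convergence in measure for a finite measure in the class. A Polish $G$-module is an abelian Polish group with a jointly continuous action of $G$ by automorphisms. For a locally compact group $G$ and a Polish $G$-module $A$, the measurable cohomology $H^n(G,A)$, $n\ge 0$, is the cohomology of the complex $(L(G^n,A))_{n\ge 0}$ (Haar measure class) with the usual inhomogeneous coboundary. Let $G_1,G_2\subset G$ be a matched pair: closed subgroups of a locally compact group $G$ with $G_1\cap G_2=\{e\}$ and $G\setminus G_1G_2$ of Haar measure zero. Let $A$ be a Polish $G$-module. Let $\Gamma_{pq}$ be the space of grids with $p$ rows and $q$ columns of squares, with vertical edges $g_{ij}\in G_1$ ($1\le i\le p$, $0\le j\le q$) and horizontal edges $s_{ij}\in G_2$ ($0\le i\le p$, $1\le j\le q$), such that $s_{i-1,j}\,g_{ij}=g_{i,j-1}\,s_{ij}$ for every square; its measure class comes from $G_1^p\times G_2^q$ by taking the first column and the first row. With the faces $\partial^h_i,\partial^v_j$ that contract the $i$-th column or $j$-th row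 of vertices, multiplying adjacent edges (for $i=0$, $j=0$ and for the last index: dropping the outer column or row), put $$(d^hF)(X)=s_{01}\cdot F(\partial^h_0X)+\sum_{i=1}^{q+1}(-1)^iF(\partial^h_iX),\qquad (d^vF)(X)=g_{10}\cdot F(\partial^v_0X)+\sum_{j=1}^{p+1}(-1)^jF(\partial^v_jX)$$ for $F\in L(\Gamma_{pq},A)$. Let $D^n(A)=\bigoplus_{p+q=n}L(\Gamma_{pq},A)$, $p,q\ge 0$, with $d=d^h+(-1)^qd^v$ on $L(\Gamma_{pq},A)$, and let $J:D^n(A)\to L(G_1^n,A)\oplus L(G_2^n,A)$ be the projection to the summands $\Gamma_{n0}=G_1^n$ and $\Gamma_{0n}=G_2^n$ (for $n=0$: $a\mapsto(a,a)$). The Kac cohomology $H^n(\mathrm{m.p.},A)$, $n\ge 0$, is the cohomology of the mapping cone $M^n=D^{n+1}(A)\oplus L(G_1^n,A)\oplus L(G_2^n,A)$, $n\ge -1$ (without the last two summands for $n=-1$), with $d(F,K)=(dF,-dK+JF)$. Let $B=L(G/G_1\sqcup G/G_2,A)$, with $(g\cdot F)(x)=g\cdot F(g^{-1}x)$ and with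 the $G$-invariant measure class on $G/G_1\sqcup G/G_2$. Embed $A$ in $B$ as constant functions. Theorem. $B$ and $B/A$ are Polish $G$-modules and $A\to B$ is a closed embedding. The Kac cohomology is the measurable cohomology of $G$ with coefficients in $B/A$: $$H^n(\mathrm{m.p.},A)\;\cong\; H^n\bigl(G,\;L(G/G_1\sqcup G/G_2,A)/A\bigr)\qquad (n\ge 0).$$ Moreover, the Kac sequence $$0\to H^0(D(A))\to H^0(G_1,A)\oplus H^0(G_2,A)\to H^0(\mathrm{m.p.},A)\to H^1(D(A))\to H^1(G_1,A)\oplus H^1(G_2,A)\to H^1(\mathrm{m.p.},A)\to\cdots$$ with maps induced by $J$, $K\mapsto(0,K)$ and $(F,K)\mapsto F$ is exact, and it is isomorphic to the long exact cohomology sequence of $0\to A\to B\to B/A\to 0$: there are isomorphisms $H^n(D(A))\cong H^n(G,A)$, $H^n(G_1,A)\oplus H^n(G_2,A)\cong H^n(G,B)$ and $H^n(\mathrm{m.p.},A)\cong H^n(G,B/A)$, for all $n\ge 0$, that commute with all maps of the two sequences. -/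

import Mathlib

open MeasureTheory MeasureTheory.Measure Topology
open scoped Pointwise ENNReal

universe u v w

noncomputable section

namespace KacCohomology

/-! ### Complexes of measurable cochains and their cohomology

Measurable cochain groups are groups `L(X, A)` of measurable functions modulo almost everywhere
equality.  We work with representatives: in each degree there is a group of all functions, the
subgroup `meas` of (almost everywhere equal to a) measurable ones, the subgroup `null` of those
vanishing almost everywhere, and the coboundary is given by its formula on functions.  The cochain
group of the complex is `meas n / null n`. -/

/-- The data of a complex of measurable cochains, on the level of representatives. -/
structure MeasComplex where
  /-- all functions of degree `n` -/
  C : ℕ → Type w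
  /-- pointwise addition -/
  [grp : ∀ n, AddCommGroup (C n)]
  /-- the measurable functions -/
  meas : ∀ n, AddSubgroup (C n)
  /-- the functions that vanish almost everywhere -/
  null : ∀ n, AddSubgroup (C n)
  /-- the coboundary -/
  d : ∀ n, C n →+ C (n + 1)

attribute [instance] MeasComplex.grp

namespace MeasComplex

variable (K : MeasComplex.{w})

/-- Cocycles: measurable `F` with `d F = 0` almost everywhere. -/
def cocycles (n : ℕ) : AddSubgroup (K.C n) := K.meas n ⊓ (K.null (n + 1)).comap (K.d n)

/-- Coboundaries: functions which are almost everywhere equal to `d H`, with `H` measurable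
(in degree `0`: almost everywhere equal to `0`). -/
def coboundaries : (n : ℕ) → AddSubgroup (K.C n)
  | 0 => K.null 0
  | n + 1 => K.null (n + 1) ⊔ (K.meas n).map (K.d n)

/-- The `n`-th cohomology group: cocycles modulo those cocycles that are coboundaries. -/
abbrev H (n : ℕ) : Type w := K.cocycles n ⧸ (K.coboundaries n).addSubgroupOf (K.cocycles n)

/-- The cohomology class of a cocycle. -/
def cls {n : ℕ} (c : K.cocycles n) : K.H n := QuotientAddGroup.mk c

variable {K} {K' : MeasComplex.{v}}

/-- The homomorphism on cohomology induced by an additive map that maps cocycles to cocycles and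
coboundaries to coboundaries. -/
def mapH {n m : ℕ} (φ : K.C n →+ K'.C m) (hZ : ∀ x ∈ K.cocycles n, φ x ∈ K'.cocycles m)
    (hB : ∀ x ∈ K.coboundaries n, φ x ∈ K'.coboundaries m) : K.H n →+ K'.H m :=
  QuotientAddGroup.map _ _
    ((φ.comp (K.cocycles n).subtype).codRestrict (K'.cocycles m) fun x => hZ x x.2)
    (fun x hx => hB x hx)

/-- Morphisms of complexes of measurable cochains. -/
structure Hom (K : MeasComplex.{w}) (K' : MeasComplex.{v}) where
  /-- the map in degree `n` -/
  f : ∀ n, K.C n →+ K'.C n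
  comm : ∀ n x, f (n + 1) (K.d n x) = K'.d n (f n x)
  map_meas : ∀ n, ∀ x ∈ K.meas n, f n x ∈ K'.meas n
  map_null : ∀ n, ∀ x ∈ K.null n, f n x ∈ K'.null n

namespace Hom

variable (φ : Hom K K')

theorem map_cocycles (n : ℕ) (x : K.C n) (hx : x ∈ K.cocycles n) : φ.f n x ∈ K'.cocycles n := by
  refine ⟨φ.map_meas n x hx.1, ?_⟩
  have h := φ.map_null (n + 1) _ hx.2
  rw [φ.comm] at h
  exact h

theorem map_coboundaries (n : ℕ) (x : K.C n) (hx : x ∈ K.coboundaries n) :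
    φ.f n x ∈ K'.coboundaries n := by
  cases n with
  | zero => exact φ.map_null 0 x hx
  | succ n =>
    obtain ⟨y, hy, z, ⟨t, ht, rfl⟩, rfl⟩ := AddSubgroup.mem_sup.1 hx
    rw [map_add, φ.comm]
    exact AddSubgroup.mem_sup.2
      ⟨_, φ.map_null _ y hy, _, ⟨_, φ.map_meas n t ht, rfl⟩, rfl⟩

/-- The homomorphism induced on cohomology. -/
def H (n : ℕ) : K.H n →+ K'.H n := mapH (φ.f n) (φ.map_cocycles n) (φ.map_coboundaries n)

end Hom

end MeasComplex

/-! ### Spaces of functions -/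

section Functions

variable {X : Type u} [MeasurableSpace X] (ν : Measure X) (A : Type v) [AddCommGroup A]

/-- Functions that are almost everywhere equal to a (strongly) measurable one. -/
def measFun [TopologicalSpace A] [IsTopologicalAddGroup A] : AddSubgroup (X → A) where
  carrier := {F | AEStronglyMeasurable F ν}
  zero_mem' := aestronglyMeasurable_const
  add_mem' hF hG := hF.add hG
  neg_mem' hF := hF.neg

/-- Functions vanishing almost everywhere. -/
def nullFun : AddSubgroup (X → A) where
  carrier := {F | ∀ᵐ x ∂ν, F x = 0}
  zero_mem' := by simp
  add_mem' {F F'} hF hG := by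
    simp only [Set.mem_ofPred_eq] at *
    filter_upwards [hF, hG] with x h1 h2
    simp [h1, h2]
  neg_mem' {F} hF := by
    simp only [Set.mem_ofPred_eq] at *
    filter_upwards [hF] with x h1
    simp [h1]

end Functions

/-! ### Measurable group cohomology -/

section GroupCohomology

variable (G : Type u) [Group G]

/-- The coboundary
`(d F)(g₀, …, gₙ) = g₀ • F(g₁, …, gₙ) + ∑_{i=1}^{n} (-1)^i F(…, gᵢ₋₁ gᵢ, …)
  + (-1)^{n+1} F(g₀, …, gₙ₋₁)`;
the last term is the summand `j = n` below. -/
def groupD (A : Type v) [AddCommGroup A] [DistribMulAction G A] (n : ℕ) :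
    ((Fin n → G) → A) →+ ((Fin (n + 1) → G) → A) where
  toFun F g := g 0 • F (fun i => g i.succ) +
    ∑ j : Fin (n + 1), (-1 : ℤ) ^ ((j : ℕ) + 1) • F (Fin.contractNth j (· * ·) g)
  map_zero' := by ext g; simp
  map_add' F F' := by
    ext g
    simp only [Pi.add_apply, smul_add, Finset.sum_add_distrib]
    abel

variable [TopologicalSpace G] [IsTopologicalGroup G] [LocallyCompactSpace G]
  [MeasurableSpace G] [BorelSpace G]

/-- The complex `(L(Gⁿ, A))ₙ`, where `Gⁿ` carries the class of the Haar measure; its cohomology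
`(groupComplex G A).H n` is the measurable cohomology `Hⁿ(G, A)`. -/
def groupComplex (A : Type v) [AddCommGroup A] [TopologicalSpace A] [IsTopologicalAddGroup A]
    [DistribMulAction G A] : MeasComplex where
  C n := (Fin n → G) → A
  meas n := measFun (Measure.pi fun _ : Fin n => (haar : Measure G)) A
  null n := nullFun (Measure.pi fun _ : Fin n => (haar : Measure G)) A
  d n := groupD G A n

variable {A : Type v} [AddCommGroup A] [TopologicalSpace A] [IsTopologicalAddGroup A]
    [DistribMulAction G A] {B : Type w} [AddCommGroup B] [TopologicalSpace B]
    [IsTopologicalAddGroup B] [DistribMulAction G B]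

/-- A continuous equivariant homomorphism of coefficient modules induces a map of complexes. -/
def coeffHom (φ : A →+ B) (hc : Continuous φ) (he : ∀ (g : G) (a : A), φ (g • a) = g • φ a) :
    (groupComplex G A).Hom (groupComplex G B) where
  f n := φ.compLeft (Fin n → G)
  comm n F := by
    funext g
    change φ (g 0 • (F : (Fin n → G) → A) (fun i => g i.succ) + ∑ j : Fin (n + 1),
        (-1 : ℤ) ^ ((j : ℕ) + 1) • (F : (Fin n → G) → A) (Fin.contractNth j (· * ·) g)) =
      g 0 • φ ((F : (Fin n → G) → A) (fun i => g i.succ)) + ∑ j : Fin (n + 1),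
        (-1 : ℤ) ^ ((j : ℕ) + 1) • φ ((F : (Fin n → G) → A) (Fin.contractNth j (· * ·) g))
    rw [map_add, he, _root_.map_sum]
    simp only [map_zsmul]
  map_meas n F hF := hc.comp_aestronglyMeasurable hF
  map_null n F hF := by
    change ∀ᵐ x ∂_, φ (F x) = 0
    have hF' : ∀ᵐ x ∂_, F x = 0 := hF
    filter_upwards [hF'] with x hx
    rw [hx, map_zero]

/-- `δ` is the connecting homomorphism `Hⁿ(G, C) → Hⁿ⁺¹(G, A)` of the short exact sequence
`0 → A → B → C → 0` given by `ι` and `π`: `δ x = y` iff `x` is the class of a cocycle `c`, and `y`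
the class of a cocycle `e`, such that some measurable `F : Gⁿ → B` satisfies `π ∘ F = c` and
`d F = ι ∘ e` almost everywhere. -/
def IsConnectingHom {C : Type*} [AddCommGroup C] [TopologicalSpace C] [IsTopologicalAddGroup C]
    [DistribMulAction G C] (ι : A →+ B) (π : B →+ C) (n : ℕ)
    (δ : (groupComplex G C).H n →+ (groupComplex G A).H (n + 1)) : Prop :=
  ∀ x y, δ x = y ↔
    ∃ (F : (Fin n → G) → B) (c : (groupComplex G C).cocycles n)
      (e : (groupComplex G A).cocycles (n + 1)),
        AEStronglyMeasurable F (Measure.pi fun _ => haar) ∧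
        (∀ᵐ g ∂(Measure.pi fun _ => haar), π (F g) = (c.1 : (Fin n → G) → C) g) ∧
        (∀ᵐ g ∂(Measure.pi fun _ => haar),
          groupD G B n F g = ι ((e.1 : (Fin (n + 1) → G) → A) g)) ∧
        (groupComplex G C).cls c = x ∧ (groupComplex G A).cls e = y

end GroupCohomology

/-! ### The Polish modules `L(X, A)` and `L(X, A) / A` -/

/-- `L(X, A)`: classes of measurable functions `X → A` modulo equality almost everywhere.
(A synonym of Mathlib's type, as it carries a different group action.) -/
def LSp (X : Type u) [MeasurableSpace X] (ν : Measure X) (A : Type v) [TopologicalSpace A] :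
    Type (max u v) := X →ₘ[ν] A

/-- The measure class of `ν` is invariant under the action of `G` on `X`. -/
class QuasiInvariant (G : Type w) {X : Type u} [Group G] [MulAction G X] [MeasurableSpace X]
    (ν : Measure X) : Prop where
  qmp : ∀ g : G, QuasiMeasurePreserving (fun x : X => g • x) ν ν

namespace LSp

variable {X : Type u} [MeasurableSpace X] {ν : Measure X} {A : Type v} [AddCommGroup A]
  [TopologicalSpace A] [IsTopologicalAddGroup A]

instance : AddCommGroup (LSp X ν A) := inferInstanceAs (AddCommGroup (X →ₘ[ν] A))

/-- The basic neighbourhood of `0` given by `U` and `ε`: all `F` with `ν {x | F x ∉ U} < ε`. -/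
def basicNhd (ν : Measure X) (U : Set A) (ε : ℝ≥0∞) : Set (LSp X ν A) :=
  {F : X →ₘ[ν] A | ν {x | F x ∉ U} < ε}

/-- The group topology on `L(X, A)` of convergence in measure, for a finite measure `ν`. -/
@[reducible] def filterBasis : AddGroupFilterBasis (LSp X ν A) :=
  addGroupFilterBasisOfComm
    {S | ∃ U ∈ 𝓝 (0 : A), ∃ ε : ℝ≥0∞, 0 < ε ∧ S = basicNhd ν U ε}
    ⟨_, Set.univ, Filter.univ_mem, 1, one_pos, rfl⟩
    (by
      rintro _ _ ⟨U, hU, ε, hε, rfl⟩ ⟨V, hV, η, hη, rfl⟩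
      refine ⟨_, ⟨U ∩ V, Filter.inter_mem hU hV, min ε η, lt_min hε hη, rfl⟩, fun F hF => ⟨?_, ?_⟩⟩
      · exact (measure_mono (Set.ofPred_subset_ofPred.2 fun x hx h => hx h.1)).trans_lt (lt_of_lt_of_le hF (min_le_left _ _))
      · exact (measure_mono (Set.ofPred_subset_ofPred.2 fun x hx h => hx h.2)).trans_lt (lt_of_lt_of_le hF (min_le_right _ _)))
    (by
      rintro _ ⟨U, hU, ε, hε, rfl⟩
      have h0 : ν {x | (0 : X →ₘ[ν] A) x ∉ U} = 0 := by
        have : ∀ᵐ x ∂ν, (0 : X →ₘ[ν] A) x ∈ U := by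
          filter_upwards [AEEqFun.coeFn_zero (α := X) (μ := ν) (β := A)] with x hx
          rw [hx]
          exact mem_of_mem_nhds hU
        exact this
      change ν {x | (0 : X →ₘ[ν] A) x ∉ U} < ε
      rwa [h0])
    (by
      rintro _ ⟨U, hU, ε, hε, rfl⟩
      obtain ⟨V, hV, hVU⟩ := exists_nhds_zero_half hU
      refine ⟨_, ⟨V, hV, ε / 2, ENNReal.half_pos hε.ne', rfl⟩, ?_⟩
      rintro _ ⟨F, hF, F', hF', rfl⟩
      have key : ν {x | ((show X →ₘ[ν] A from F) + (show X →ₘ[ν] A from F') : X →ₘ[ν] A) x ∉ U} ≤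
          ν ({x | (show X →ₘ[ν] A from F) x ∉ V} ∪ {x | (show X →ₘ[ν] A from F') x ∉ V}) := by
        refine measure_mono_ae ?_
        filter_upwards [AEEqFun.coeFn_add (show X →ₘ[ν] A from F) (show X →ₘ[ν] A from F')]
          with x hx h
        change x ∈ ({x | (show X →ₘ[ν] A from F) x ∉ V} ∪ {x | (show X →ₘ[ν] A from F') x ∉ V} :
          Set X)
        by_contra hc
        simp only [Set.mem_union, Set.mem_ofPred_eq, not_or, not_not] at hc
        apply h
        rw [hx]
        exact hVU _ hc.1 _ hc.2
      calc _ ≤ _ := key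
        _ ≤ _ := measure_union_le _ _
        _ < ε / 2 + ε / 2 := ENNReal.add_lt_add hF hF'
        _ = ε := ENNReal.add_halves ε)
    (by
      rintro _ ⟨U, hU, ε, hε, rfl⟩
      refine ⟨_, ⟨-U, neg_mem_nhds_zero A hU, ε, hε, rfl⟩, fun F hF => ?_⟩
      have key : ν {x | (-(show X →ₘ[ν] A from F) : X →ₘ[ν] A) x ∉ U} ≤
          ν {x | (show X →ₘ[ν] A from F) x ∉ -U} := by
        refine measure_mono_ae ?_
        filter_upwards [AEEqFun.coeFn_neg (show X →ₘ[ν] A from F)] with x hx h hc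
        apply h
        rw [hx]
        exact hc
      exact key.trans_lt hF)

instance : TopologicalSpace (LSp X ν A) := filterBasis.topology

instance : IsTopologicalAddGroup (LSp X ν A) := filterBasis.isTopologicalAddGroup

/-- Elements of `A` as constant functions. -/
def const (X : Type u) [MeasurableSpace X] (ν : Measure X) (A : Type v) [AddCommGroup A]
    [TopologicalSpace A] [IsTopologicalAddGroup A] : A →+ LSp X ν A where
  toFun a := (AEEqFun.const X a : X →ₘ[ν] A)
  map_zero' := rfl
  map_add' _ _ := rfl

theorem continuous_const : Continuous (const X ν A) := by
  refine continuous_of_continuousAt_zero _ ?_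
  rw [ContinuousAt, map_zero]
  refine (filterBasis.nhds_zero_hasBasis).tendsto_right_iff.2 ?_
  rintro _ ⟨U, hU, ε, hε, rfl⟩
  filter_upwards [hU] with a ha
  have h0 : ν {x | (AEEqFun.const X a : X →ₘ[ν] A) x ∉ U} = 0 := by
    have : ∀ᵐ x ∂ν, (AEEqFun.const X a : X →ₘ[ν] A) x ∈ U := by
      filter_upwards [AEEqFun.coeFn_const (α := X) (μ := ν) a] with x hx
      rw [hx]
      exact ha
    exact this
  change ν {x | (AEEqFun.const X a : X →ₘ[ν] A) x ∉ U} < ε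
  rwa [h0]

variable {G : Type w} [Group G] [MulAction G X] [QuasiInvariant G ν] [DistribMulAction G A]
  [ContinuousConstSMul G A]

/-- The action `(g • F)(x) = g • F(g⁻¹ • x)` of `G` on `L(X, A)`. -/
def act (g : G) (F : LSp X ν A) : LSp X ν A :=
  AEEqFun.comp (fun a : A => g • a) (continuous_const_smul g)
    (AEEqFun.compQuasiMeasurePreserving (show X →ₘ[ν] A from F) (fun x => g⁻¹ • x)
      (QuasiInvariant.qmp g⁻¹))

set_option linter.unusedSectionVars false in
theorem act_mk (g : G) (f : X → A) (hf : AEStronglyMeasurable f ν) :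
    act g (AEEqFun.mk f hf : X →ₘ[ν] A) = (AEEqFun.mk (fun x => g • f (g⁻¹ • x))
      ((continuous_const_smul g).comp_aestronglyMeasurable
        (hf.comp_quasiMeasurePreserving (QuasiInvariant.qmp g⁻¹))) : X →ₘ[ν] A) := rfl

instance : DistribMulAction G (LSp X ν A) where
  smul := act
  one_smul F := by
    induction F using AEEqFun.induction_on with
    | H f hf =>
      change act 1 _ = _
      rw [act_mk]
      simp only [inv_one, one_smul]
      rfl
  mul_smul g h F := by
    induction F using AEEqFun.induction_on with
    | H f hf =>
      change act _ _ = act _ (act _ _)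
      rw [act_mk, act_mk, act_mk]
      simp only [mul_inv_rev, mul_smul]
      rfl
  smul_zero g := by
    change act g (AEEqFun.mk (fun _ => 0) aestronglyMeasurable_const : X →ₘ[ν] A) = _
    rw [act_mk]
    simp only [smul_zero]
    rfl
  smul_add g F F' := by
    induction F, F' using AEEqFun.induction_on₂ with
    | H f hf f' hf' =>
      change act _ (AEEqFun.mk (f + f') (hf.add hf') : X →ₘ[ν] A) = act _ _ + act _ _
      rw [act_mk, act_mk, act_mk]
      simp only [Pi.add_apply, smul_add]
      rfl

theorem const_smul (g : G) (a : A) : const X ν A (g • a) = g • const X ν A a := rfl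

end LSp

/-- The quotient `L(X, A) / A` of `L(X, A)` by the constant functions. -/
def LModConst (X : Type u) [MeasurableSpace X] (ν : Measure X) (A : Type v) [AddCommGroup A]
    [TopologicalSpace A] [IsTopologicalAddGroup A] : Type (max u v) :=
  LSp X ν A ⧸ (LSp.const X ν A).range

namespace LModConst

variable {X : Type u} [MeasurableSpace X] {ν : Measure X} {A : Type v} [AddCommGroup A]
  [TopologicalSpace A] [IsTopologicalAddGroup A]

instance : AddCommGroup (LModConst X ν A) :=
  inferInstanceAs (AddCommGroup (LSp X ν A ⧸ (LSp.const X ν A).range))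

instance : TopologicalSpace (LModConst X ν A) :=
  inferInstanceAs (TopologicalSpace (LSp X ν A ⧸ (LSp.const X ν A).range))

instance : IsTopologicalAddGroup (LModConst X ν A) :=
  inferInstanceAs (IsTopologicalAddGroup (LSp X ν A ⧸ (LSp.const X ν A).range))

/-- The quotient map. -/
def proj (X : Type u) [MeasurableSpace X] (ν : Measure X) (A : Type v) [AddCommGroup A]
    [TopologicalSpace A] [IsTopologicalAddGroup A] : LSp X ν A →+ LModConst X ν A :=
  QuotientAddGroup.mk' _

theorem continuous_proj : Continuous (proj X ν A) := QuotientAddGroup.continuous_mk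

variable {G : Type w} [Group G] [MulAction G X] [QuasiInvariant G ν] [DistribMulAction G A]
  [ContinuousConstSMul G A]

/-- The action of `G` on `L(X, A) / A` induced by the action on `L(X, A)`. -/
def act (g : G) : LModConst X ν A →+ LModConst X ν A :=
  QuotientAddGroup.map _ _ (DistribSMul.toAddMonoidHom (LSp X ν A) g) (by
    rintro _ ⟨a, rfl⟩
    exact ⟨g • a, LSp.const_smul g a⟩)

instance : DistribMulAction G (LModConst X ν A) where
  smul g F := act g F
  one_smul F := by
    induction F using QuotientAddGroup.induction_on with
    | H F => exact congrArg (proj X ν A) (one_smul G F)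
  mul_smul g h F := by
    induction F using QuotientAddGroup.induction_on with
    | H F => exact congrArg (proj X ν A) (mul_smul g h F)
  smul_zero g := map_zero (act g)
  smul_add g F F' := map_add (act g) F F'

theorem proj_smul (g : G) (F : LSp X ν A) : proj X ν A (g • F) = g • proj X ν A F := rfl

end LModConst

/-! ### Matched pairs and double complexes -/

theorem measurable_mk {G : Type u} [Group G] [MeasurableSpace G] (H : Subgroup G) :
    Measurable (QuotientGroup.mk : G → G ⧸ H) :=
  measurable_quotient_mk''

section MatchedPairs

variable (G : Type u) [Group G] [TopologicalSpace G] [IsTopologicalGroup G]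
  [LocallyCompactSpace G] [MeasurableSpace G] [BorelSpace G]

/-- A matched pair of closed subgroups `G₁, G₂` of the locally compact group `G`. -/
structure MatchedPair where
  G₁ : Subgroup G
  G₂ : Subgroup G
  isClosed₁ : IsClosed (G₁ : Set G)
  isClosed₂ : IsClosed (G₂ : Set G)
  inf_eq_bot : G₁ ⊓ G₂ = ⊥
  conull : (haar : Measure G) ((G₁ : Set G) * (G₂ : Set G))ᶜ = 0

variable {G}

/-- The measure class on `G / H`: a set is null iff its preimage in `G` is Haar null. -/
def quotMeasure [SecondCountableTopology G] (H : Subgroup G) : Measure (G ⧸ H) :=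
  (haar : Measure G).toFinite.map (QuotientGroup.mk : G → G ⧸ H)

instance [SecondCountableTopology G] (H : Subgroup G) : IsFiniteMeasure (quotMeasure H) :=
  inferInstanceAs (IsFiniteMeasure (Measure.map _ _))

instance [SecondCountableTopology G] (H : Subgroup G) : QuasiInvariant G (quotMeasure H) where
  qmp g := by
    have h1 : QuasiMeasurePreserving (fun x : G => g * x) (haar : Measure G).toFinite
        (haar : Measure G).toFinite :=
      (measurePreserving_mul_left haar g).quasiMeasurePreserving.mono
        (toFinite_absolutelyContinuous _) (absolutelyContinuous_toFinite _)
    have hm : Measurable fun x : G ⧸ H => g • x :=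
      measurable_from_quotient.2 ((measurable_mk H).comp h1.measurable)
    refine ⟨hm, AbsolutelyContinuous.mk fun E hE h0 => ?_⟩
    rw [quotMeasure, map_apply (measurable_mk H) hE] at h0
    rw [map_apply hm hE, quotMeasure, map_apply (measurable_mk H) (hm hE)]
    exact h1.preimage_null h0

namespace MatchedPair

variable (P : MatchedPair G)

instance : LocallyCompactSpace P.G₁ := P.isClosed₁.locallyCompactSpace

instance : LocallyCompactSpace P.G₂ := P.isClosed₂.locallyCompactSpace

instance [SecondCountableTopology G] : SecondCountableTopology P.G₁ :=
  TopologicalSpace.Subtype.secondCountableTopology _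

instance [SecondCountableTopology G] : SecondCountableTopology P.G₂ :=
  TopologicalSpace.Subtype.secondCountableTopology _

/-- The disjoint union `G / G₁ ⊔ G / G₂`. -/
abbrev Quot : Type u := (G ⧸ P.G₁) ⊕ (G ⧸ P.G₂)

/-- The measure class of `G / G₁ ⊔ G / G₂`, given by a finite measure. -/
def quotMeasure [SecondCountableTopology G] : Measure P.Quot :=
  (KacCohomology.quotMeasure P.G₁).map Sum.inl + (KacCohomology.quotMeasure P.G₂).map Sum.inr

instance [SecondCountableTopology G] : IsFiniteMeasure P.quotMeasure :=
  inferInstanceAs (IsFiniteMeasure (Measure.map _ _ + Measure.map _ _))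

instance [SecondCountableTopology G] : QuasiInvariant G P.quotMeasure where
  qmp g := by
    have h1 := QuasiInvariant.qmp (ν := KacCohomology.quotMeasure P.G₁) g
    have h2 := QuasiInvariant.qmp (ν := KacCohomology.quotMeasure P.G₂) g
    have hm : Measurable fun x : P.Quot => g • x :=
      measurable_fun_sum (measurable_inl.comp h1.measurable) (measurable_inr.comp h2.measurable)
    refine ⟨hm, AbsolutelyContinuous.mk fun E hE h0 => ?_⟩
    rw [quotMeasure, add_apply, map_apply measurable_inl hE, map_apply measurable_inr hE,
      add_eq_zero] at h0
    rw [map_apply hm hE, quotMeasure, add_apply, map_apply measurable_inl (hm hE),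
      map_apply measurable_inr (hm hE), add_eq_zero]
    exact ⟨h1.preimage_null h0.1, h2.preimage_null h0.2⟩

/-- The space `Γ_{pq}` of grids with `p` rows and `q` columns of squares.  The first component is
the matrix of the vertical edges `g i j ∈ G₁` (`p` rows, `q + 1` columns), the second one the matrix
of the horizontal edges `s i j ∈ G₂` (`p + 1` rows, `q` columns), and for every square the product
(top edge) * (right edge) equals the product (left edge) * (bottom edge). -/
def Grid (p q : ℕ) : Type u :=
  {X : (Fin p → Fin (q + 1) → P.G₁) × (Fin (p + 1) → Fin q → P.G₂) //
    ∀ (i : Fin p) (j : Fin q), (X.2 i.castSucc j : G) * (X.1 i j.succ : G) =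
      (X.1 i j.castSucc : G) * (X.2 i.succ j : G)}

instance (p q : ℕ) : MeasurableSpace (P.Grid p q) := inferInstanceAs (MeasurableSpace (Subtype _))

variable {P}

namespace Grid

variable {p q : ℕ}

/-- Vertical edges. -/
def g (X : P.Grid p q) : Fin p → Fin (q + 1) → P.G₁ := X.1.1

/-- Horizontal edges. -/
def s (X : P.Grid p q) : Fin (p + 1) → Fin q → P.G₂ := X.1.2

/-- The first column and the first row. -/
def corner (X : P.Grid p q) : (Fin p → P.G₁) × (Fin q → P.G₂) :=
  (fun i => X.g i 0, fun j => X.s 0 j)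

/-- The measure class on `Γ_{pq}` obtained from `G₁ᵖ × G₂^q` through the injective map picking out
the first column and the first row. -/
def measure (P : MatchedPair G) (p q : ℕ) : Measure (P.Grid p q) :=
  Measure.comap corner
    ((Measure.pi fun _ : Fin p => (haar : Measure P.G₁)).prod
      (Measure.pi fun _ : Fin q => (haar : Measure P.G₂)))

/-- The horizontal face `∂ʰ₀`: drop the first column. -/
def faceH0 (X : P.Grid p (q + 1)) : P.Grid p q :=
  ⟨(fun i j => X.g i j.succ, fun i j => X.s i j.succ), fun i j => X.2 i j.succ⟩

/-- The vertical face `∂ᵛ₀`: drop the first row. -/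
def faceV0 (X : P.Grid (p + 1) q) : P.Grid p q :=
  ⟨(fun i j => X.g i.succ j, fun i j => X.s i.succ j), fun i j => X.2 i.succ j⟩

/-- The horizontal faces `∂ʰ_{k+1}`, `0 ≤ k ≤ q`: remove the vertical edges of column `k + 1` and
multiply the adjacent horizontal edges (for `k = q`: drop the last column). -/
def faceH (k : Fin (q + 1)) (X : P.Grid p (q + 1)) : P.Grid p q :=
  ⟨(fun i j => X.g i (k.succ.succAbove j), fun i => Fin.contractNth k (· * ·) (X.s i)), by
    intro i j
    have h1 := X.2 i j.castSucc
    have h2 := X.2 i j.succ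
    change ((Fin.contractNth k (· * ·) (X.s i.castSucc) j : P.G₂) : G) *
        (X.g i (k.succ.succAbove j.succ) : G)
      = (X.g i (k.succ.succAbove j.castSucc) : G) *
        ((Fin.contractNth k (· * ·) (X.s i.succ) j : P.G₂) : G)
    rcases lt_trichotomy (j : ℕ) k with h | h | h
    · rw [Fin.contractNth_apply_of_lt _ _ _ _ h, Fin.contractNth_apply_of_lt _ _ _ _ h,
        Fin.succAbove_of_castSucc_lt _ _ (by simp [Fin.lt_def]; omega),
        Fin.succAbove_of_castSucc_lt _ _ (by simp [Fin.lt_def]; omega)]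
      exact h1
    · rw [Fin.contractNth_apply_of_eq _ _ _ _ h, Fin.contractNth_apply_of_eq _ _ _ _ h,
        Fin.succAbove_of_le_castSucc _ _ (by simp [Fin.le_def]; omega),
        Fin.succAbove_of_castSucc_lt _ _ (by simp [Fin.lt_def]; omega)]
      change (X.s i.castSucc j.castSucc : G) * (X.s i.castSucc j.succ : G) * (X.g i j.succ.succ : G)
        = (X.g i j.castSucc.castSucc : G) *
          ((X.s i.succ j.castSucc : G) * (X.s i.succ j.succ : G))
      have h1' : (X.s i.castSucc j.castSucc : G) * (X.g i j.castSucc.succ : G) =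
        (X.g i j.castSucc.castSucc : G) * (X.s i.succ j.castSucc : G) := h1
      have h2' : (X.s i.castSucc j.succ : G) * (X.g i j.succ.succ : G) =
        (X.g i j.castSucc.succ : G) * (X.s i.succ j.succ : G) := h2
      rw [mul_assoc, h2', ← mul_assoc, h1', mul_assoc]
    · rw [Fin.contractNth_apply_of_gt _ _ _ _ h, Fin.contractNth_apply_of_gt _ _ _ _ h,
        Fin.succAbove_of_le_castSucc _ _ (by simp [Fin.le_def]; omega),
        Fin.succAbove_of_le_castSucc _ _ (by simp [Fin.le_def]; omega)]
      exact h2⟩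

/-- The vertical faces `∂ᵛ_{k+1}`, `0 ≤ k ≤ p`: remove the horizontal edges of row `k + 1` and
multiply the adjacent vertical edges (for `k = p`: drop the last row). -/
def faceV (k : Fin (p + 1)) (X : P.Grid (p + 1) q) : P.Grid p q :=
  ⟨(fun i j => Fin.contractNth k (· * ·) (fun i' => X.g i' j) i,
    fun i j => X.s (k.succ.succAbove i) j), by
    intro i j
    have h1 := X.2 i.castSucc j
    have h2 := X.2 i.succ j
    change (X.s (k.succ.succAbove i.castSucc) j : G) *
        ((Fin.contractNth k (· * ·) (fun i' => X.g i' j.succ) i : P.G₁) : G)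
      = ((Fin.contractNth k (· * ·) (fun i' => X.g i' j.castSucc) i : P.G₁) : G) *
        (X.s (k.succ.succAbove i.succ) j : G)
    rcases lt_trichotomy (i : ℕ) k with h | h | h
    · rw [Fin.contractNth_apply_of_lt _ _ _ _ h, Fin.contractNth_apply_of_lt _ _ _ _ h,
        Fin.succAbove_of_castSucc_lt _ _ (by simp [Fin.lt_def]; omega),
        Fin.succAbove_of_castSucc_lt _ _ (by simp [Fin.lt_def]; omega)]
      exact h1
    · rw [Fin.contractNth_apply_of_eq _ _ _ _ h, Fin.contractNth_apply_of_eq _ _ _ _ h,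
        Fin.succAbove_of_castSucc_lt _ _ (by simp [Fin.lt_def]; omega),
        Fin.succAbove_of_le_castSucc _ _ (by simp [Fin.le_def]; omega)]
      change (X.s i.castSucc.castSucc j : G) *
          ((X.g i.castSucc j.succ : G) * (X.g i.succ j.succ : G))
        = (X.g i.castSucc j.castSucc : G) * (X.g i.succ j.castSucc : G) * (X.s i.succ.succ j : G)
      have h1' : (X.s i.castSucc.castSucc j : G) * (X.g i.castSucc j.succ : G) =
        (X.g i.castSucc j.castSucc : G) * (X.s i.castSucc.succ j : G) := h1
      have h2' : (X.s i.castSucc.succ j : G) * (X.g i.succ j.succ : G) =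
        (X.g i.succ j.castSucc : G) * (X.s i.succ.succ j : G) := h2
      rw [← mul_assoc, h1', mul_assoc, h2', mul_assoc]
    · rw [Fin.contractNth_apply_of_gt _ _ _ _ h, Fin.contractNth_apply_of_gt _ _ _ _ h,
        Fin.succAbove_of_le_castSucc _ _ (by simp [Fin.le_def]; omega),
        Fin.succAbove_of_le_castSucc _ _ (by simp [Fin.le_def]; omega)]
      exact h2⟩

/-- `G₁ⁿ = Γ_{n0}`. -/
def ofG₁ {n : ℕ} (x : Fin n → P.G₁) : P.Grid n 0 :=
  ⟨(fun i _ => x i, fun _ j => j.elim0), fun _ j => j.elim0⟩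

/-- `G₂ⁿ = Γ_{0n}`. -/
def ofG₂ {n : ℕ} (x : Fin n → P.G₂) : P.Grid 0 n :=
  ⟨(fun i _ => i.elim0, fun _ j => x j), fun i _ => i.elim0⟩

theorem quasiMeasurePreserving_ofG₁ [SecondCountableTopology G] (n : ℕ) :
    QuasiMeasurePreserving (ofG₁ : (Fin n → P.G₁) → P.Grid n 0)
      (Measure.pi fun _ => haar) (measure P n 0) := by
  have hc : Measurable (corner : P.Grid n 0 → _) := by
    refine Measurable.prodMk ?_ ?_
    · exact measurable_pi_lambda _ fun i => (measurable_pi_apply 0).comp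
        ((measurable_pi_apply i).comp (measurable_fst.comp measurable_subtype_coe))
    · exact measurable_pi_lambda _ fun j => j.elim0
  have ho : Measurable (ofG₁ : (Fin n → P.G₁) → P.Grid n 0) := by
    refine Measurable.subtype_mk (Measurable.prodMk ?_ ?_)
    · exact measurable_pi_lambda _ fun i => measurable_pi_lambda _ fun _ => measurable_pi_apply i
    · exact measurable_pi_lambda _ fun _ => measurable_pi_lambda _ fun j => j.elim0
  let e : P.Grid n 0 ≃ᵐ (Fin n → P.G₁) × (Fin 0 → P.G₂) :=
    { toFun := corner
      invFun := fun x => ofG₁ x.1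
      left_inv := fun X => by
        refine Subtype.ext (Prod.ext ?_ ?_)
        · funext i j
          exact congrArg (X.1.1 i) (Subsingleton.elim (α := Fin 1) _ _)
        · funext i j
          exact j.elim0
      right_inv := fun x => Prod.ext rfl (Subsingleton.elim _ _)
      measurable_toFun := hc
      measurable_invFun := ho.comp measurable_fst }
  have hm : measure P n 0 = (Measure.pi fun _ : Fin n => (haar : Measure P.G₁)).map ofG₁ := by
    change Measure.comap e _ = _
    rw [← MeasurableEquiv.map_symm, pi_of_empty (fun _ : Fin 0 => (haar : Measure P.G₂)), prod_dirac,
      map_map e.symm.measurable (measurable_prodMk_right)]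
    rfl
  rw [hm]
  exact ⟨ho, AbsolutelyContinuous.rfl⟩

theorem quasiMeasurePreserving_ofG₂ [SecondCountableTopology G] (n : ℕ) :
    QuasiMeasurePreserving (ofG₂ : (Fin n → P.G₂) → P.Grid 0 n)
      (Measure.pi fun _ => haar) (measure P 0 n) := by
  have hc : Measurable (corner : P.Grid 0 n → _) := by
    refine Measurable.prodMk ?_ ?_
    · exact measurable_pi_lambda _ fun j => j.elim0
    · exact measurable_pi_lambda _ fun i => (measurable_pi_apply i).comp
        ((measurable_pi_apply 0).comp (measurable_snd.comp measurable_subtype_coe))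
  have ho : Measurable (ofG₂ : (Fin n → P.G₂) → P.Grid 0 n) := by
    refine Measurable.subtype_mk (Measurable.prodMk ?_ ?_)
    · exact measurable_pi_lambda _ fun j => j.elim0
    · exact measurable_pi_lambda _ fun _ => measurable_pi_lambda _ fun i => measurable_pi_apply i
  let e : P.Grid 0 n ≃ᵐ (Fin 0 → P.G₁) × (Fin n → P.G₂) :=
    { toFun := corner
      invFun := fun x => ofG₂ x.2
      left_inv := fun X => by
        refine Subtype.ext (Prod.ext ?_ ?_)
        · funext i j
          exact i.elim0
        · funext i j
          exact congrArg (fun i => X.1.2 i j) (Subsingleton.elim (α := Fin 1) _ _)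
      right_inv := fun x => Prod.ext (Subsingleton.elim _ _) rfl
      measurable_toFun := hc
      measurable_invFun := ho.comp measurable_snd }
  have hm : measure P 0 n = (Measure.pi fun _ : Fin n => (haar : Measure P.G₂)).map ofG₂ := by
    change Measure.comap e _ = _
    rw [← MeasurableEquiv.map_symm, pi_of_empty (fun _ : Fin 0 => (haar : Measure P.G₁)), dirac_prod,
      map_map e.symm.measurable (measurable_prodMk_left)]
    rfl
  rw [hm]
  exact ⟨ho, AbsolutelyContinuous.rfl⟩

end Grid

/-! ### The Kac double complex -/

section Coboundaries

variable {A : Type v} [AddCommGroup A] [DistribMulAction G A] {p q : ℕ}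

/-- `dʰ F (X) = s₀₁ • F (∂ʰ₀ X) + ∑_{i=1}^{q+1} (-1)^i F (∂ʰᵢ X)`. -/
def dH (F : P.Grid p q → A) (X : P.Grid p (q + 1)) : A :=
  (X.s 0 0 : G) • F X.faceH0 + ∑ k : Fin (q + 1), (-1 : ℤ) ^ ((k : ℕ) + 1) • F (X.faceH k)

/-- `dᵛ F (X) = g₁₀ • F (∂ᵛ₀ X) + ∑_{j=1}^{p+1} (-1)^j F (∂ᵛⱼ X)`. -/
def dV (F : P.Grid p q → A) (X : P.Grid (p + 1) q) : A :=
  (X.g 0 0 : G) • F X.faceV0 + ∑ k : Fin (p + 1), (-1 : ℤ) ^ ((k : ℕ) + 1) • F (X.faceV k)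

theorem dH_add (F F' : P.Grid p q → A) (X : P.Grid p (q + 1)) :
    dH (F + F') X = dH F X + dH F' X := by
  simp only [dH, Pi.add_apply, smul_add, Finset.sum_add_distrib]
  abel

theorem dV_add (F F' : P.Grid p q → A) (X : P.Grid (p + 1) q) :
    dV (F + F') X = dV F X + dV F' X := by
  simp only [dV, Pi.add_apply, smul_add, Finset.sum_add_distrib]
  abel

variable (P A) in
/-- Cochains of total degree `n`: families of functions on the `Γ_{pq}`, `p + q = n`. -/
abbrev DC (n : ℕ) : Type (max u v) :=
  (a : {a : ℕ × ℕ // a.1 + a.2 = n}) → P.Grid a.1.1 a.1.2 → A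

/-- The component of `dʰ F` in bidegree `(p, q)`. -/
def totH {n : ℕ} (F : DC P A n) : (p q : ℕ) → p + q = n + 1 → P.Grid p q → A
  | _, 0, _ => 0
  | p, q + 1, h => dH (F ⟨(p, q), Nat.succ.inj h⟩)

/-- The component of `dᵛ F` in bidegree `(p, q)`. -/
def totV {n : ℕ} (F : DC P A n) : (p q : ℕ) → p + q = n + 1 → P.Grid p q → A
  | 0, _, _ => 0
  | p + 1, q, h => dV (F ⟨(p, q), by simp only; omega⟩)

variable (P A) in
/-- The total coboundary `d = dʰ + ε dᵛ`, where `ε = (-1)^q` in bidegree `(p, q)`. -/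
def totD (n : ℕ) : DC P A n →+ DC P A (n + 1) :=
  AddMonoidHom.mk'
    (fun F a => totH F a.1.1 a.1.2 a.2 + (-1 : ℤ) ^ a.1.2 • totV F a.1.1 a.1.2 a.2) (by
      rintro F F'
      funext ⟨⟨p, q⟩, h⟩ X
      have e1 : totH (F + F') p q h X = totH F p q h X + totH F' p q h X := by
        cases q with
        | zero => exact (add_zero (0 : A)).symm
        | succ q => exact dH_add _ _ X
      have e2 : totV (F + F') p q h X = totV F p q h X + totV F' p q h X := by
        cases p with
        | zero => exact (add_zero (0 : A)).symm
        | succ p => exact dV_add _ _ X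
      change totH (F + F') p q h X + (-1 : ℤ) ^ q • totV (F + F') p q h X =
        (totH F p q h X + (-1 : ℤ) ^ q • totV F p q h X) +
        (totH F' p q h X + (-1 : ℤ) ^ q • totV F' p q h X)
      rw [e1, e2, smul_add]
      abel)

variable (P A) in
/-- Restriction of a cochain to the first column, `Γ_{n0} = G₁ⁿ`. -/
def col (n : ℕ) : DC P A n →+ ((Fin n → P.G₁) → A) :=
  AddMonoidHom.mk' (fun F x => F ⟨(n, 0), rfl⟩ (Grid.ofG₁ x)) fun _ _ => rfl

variable (P A) in
/-- Restriction of a cochain to the first row, `Γ_{0n} = G₂ⁿ`. -/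
def row (n : ℕ) : DC P A n →+ ((Fin n → P.G₂) → A) :=
  AddMonoidHom.mk' (fun F x => F ⟨(0, n), zero_add n⟩ (Grid.ofG₂ x)) fun _ _ => rfl

end Coboundaries

variable (P) (A : Type v) [AddCommGroup A] [TopologicalSpace A] [IsTopologicalAddGroup A]
  [DistribMulAction G A]

/-- The total complex `Dⁿ(A) = ⨁_{p+q=n} L(Γ_{pq}, A)` of the double complex with all
`p, q ≥ 0`. -/
def totalComplex : MeasComplex where
  C n := DC P A n
  meas _ := AddSubgroup.pi Set.univ fun a => measFun (Grid.measure P a.1.1 a.1.2) A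
  null _ := AddSubgroup.pi Set.univ fun a => nullFun (Grid.measure P a.1.1 a.1.2) A
  d n := totD P A n

/-- The projection of `D(A)` to its first column `(L(G₁ⁿ, A))ₙ`. -/
def J₁ [SecondCountableTopology G] : (P.totalComplex A).Hom (groupComplex P.G₁ A) where
  f n := col P A n
  comm n F := by
    funext x
    change (0 : A) + (-1 : ℤ) ^ 0 • _ = _
    rw [zero_add, pow_zero, one_smul]
    rfl
  map_meas n F hF := (hF ⟨(n, 0), rfl⟩ trivial).comp_quasiMeasurePreserving
    (Grid.quasiMeasurePreserving_ofG₁ n)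
  map_null n F hF := (Grid.quasiMeasurePreserving_ofG₁ n).ae (hF ⟨(n, 0), rfl⟩ trivial)

/-- The projection of `D(A)` to its first row `(L(G₂ⁿ, A))ₙ`. -/
def J₂ [SecondCountableTopology G] : (P.totalComplex A).Hom (groupComplex P.G₂ A) where
  f n := row P A n
  comm n F := by
    funext x
    change _ + (-1 : ℤ) ^ _ • (0 : A) = _
    rw [smul_zero, add_zero]
    rfl
  map_meas n F hF := (hF ⟨(0, n), zero_add n⟩ trivial).comp_quasiMeasurePreserving
    (Grid.quasiMeasurePreserving_ofG₂ n)
  map_null n F hF := (Grid.quasiMeasurePreserving_ofG₂ n).ae (hF ⟨(0, n), zero_add n⟩ trivial)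

/-! ### Kac cohomology: the mapping cone of `J = (J₁, J₂)` -/

section Cone

variable [SecondCountableTopology G]

/-- The mapping cone `Mⁿ = Dⁿ⁺¹(A) ⊕ L(G₁ⁿ, A) ⊕ L(G₂ⁿ, A)`, `n ≥ -1`, with the index shifted by
one: this is `M^{m-1}`. -/
def ConeC : ℕ → Type (max u v)
  | 0 => DC P A 0
  | n + 1 => DC P A (n + 1) × ((Fin n → P.G₁) → A) × ((Fin n → P.G₂) → A)

instance coneGroup : (m : ℕ) → AddCommGroup (ConeC P A m)
  | 0 => inferInstanceAs (AddCommGroup (DC P A 0))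
  | n + 1 => inferInstanceAs
      (AddCommGroup (DC P A (n + 1) × ((Fin n → P.G₁) → A) × ((Fin n → P.G₂) → A)))

/-- The coboundary `d (F, K) = (d F, -d K + J F)` of the mapping cone. -/
def coneD : (m : ℕ) → ConeC P A m →+ ConeC P A (m + 1)
  | 0 => (totD P A 0).prod ((col P A 0).prod (row P A 0))
  | n + 1 =>
    let prD : DC P A (n + 1) × ((Fin n → P.G₁) → A) × ((Fin n → P.G₂) → A) →+ DC P A (n + 1) :=
      AddMonoidHom.fst _ _
    let pr₁ : DC P A (n + 1) × ((Fin n → P.G₁) → A) × ((Fin n → P.G₂) → A) →+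
        ((Fin n → P.G₁) → A) := (AddMonoidHom.fst _ _).comp (AddMonoidHom.snd _ _)
    let pr₂ : DC P A (n + 1) × ((Fin n → P.G₁) → A) × ((Fin n → P.G₂) → A) →+
        ((Fin n → P.G₂) → A) := (AddMonoidHom.snd _ _).comp (AddMonoidHom.snd _ _)
    ((totD P A (n + 1)).comp prD).prod
      ((-(groupD P.G₁ A n).comp pr₁ + (col P A (n + 1)).comp prD).prod
        (-(groupD P.G₂ A n).comp pr₂ + (row P A (n + 1)).comp prD))

/-- The mapping cone as a complex of measurable cochains (index shifted by one). -/
def cone : MeasComplex where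
  C m := ConeC P A m
  meas
    | 0 => (P.totalComplex A).meas 0
    | n + 1 => ((P.totalComplex A).meas (n + 1)).prod
        (((groupComplex P.G₁ A).meas n).prod ((groupComplex P.G₂ A).meas n))
  null
    | 0 => (P.totalComplex A).null 0
    | n + 1 => ((P.totalComplex A).null (n + 1)).prod
        (((groupComplex P.G₁ A).null n).prod ((groupComplex P.G₂ A).null n))
  d m := coneD P A m

/-- The Kac cohomology `Hⁿ(m.p., A)` of the matched pair, `n ≥ 0`. -/
abbrev KacH (n : ℕ) : Type (max u v) := (P.cone A).H (n + 1)

/-- `Hⁿ(D(A)) → Hⁿ(G₁, A) ⊕ Hⁿ(G₂, A)`, induced by `J`. -/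
def kacRes (n : ℕ) :
    (P.totalComplex A).H n →+ (groupComplex P.G₁ A).H n × (groupComplex P.G₂ A).H n :=
  ((P.J₁ A).H n).prod ((P.J₂ A).H n)

/-- `Hⁿ(G₁, A) → Hⁿ(m.p., A)`, induced by `K ↦ (0, K, 0)`. -/
def kacIncl₁ (n : ℕ) : (groupComplex P.G₁ A).H n →+ P.KacH A n :=
  MeasComplex.mapH
    (show (groupComplex P.G₁ A).C n →+ (P.cone A).C (n + 1) from
      AddMonoidHom.mk' (fun K => ((0, K, 0) :
        DC P A (n + 1) × ((Fin n → P.G₁) → A) × ((Fin n → P.G₂) → A)))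
        (fun K K' => Prod.ext (add_zero _).symm (Prod.ext rfl (add_zero _).symm)))
    (by
      intro K hK
      refine ⟨⟨zero_mem _, hK.1, zero_mem _⟩, ?_, ?_, ?_⟩
      · change totD P A (n + 1) 0 ∈ _
        rw [map_zero]
        exact zero_mem _
      · change -groupD P.G₁ A n K + col P A (n + 1) 0 ∈ _
        rw [map_zero, add_zero]
        exact ((groupComplex P.G₁ A).null (n + 1)).neg_mem hK.2
      · change -groupD P.G₂ A n 0 + row P A (n + 1) 0 ∈ _
        rw [map_zero, map_zero, neg_zero, add_zero]
        exact zero_mem _)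
    (by
      intro K hK
      cases n with
      | zero =>
        exact AddSubgroup.mem_sup_left ⟨zero_mem _, hK, zero_mem _⟩
      | succ n =>
        obtain ⟨N, hN, _, ⟨T, hT, rfl⟩, rfl⟩ := AddSubgroup.mem_sup.1 hK
        refine AddSubgroup.mem_sup.2 ⟨((0, N, 0) : DC P A (n + 1 + 1) ×
          ((Fin (n + 1) → P.G₁) → A) × ((Fin (n + 1) → P.G₂) → A)),
          ⟨zero_mem _, hN, zero_mem _⟩, _, ⟨((0, -T, 0) : DC P A (n + 1) ×
          ((Fin n → P.G₁) → A) × ((Fin n → P.G₂) → A)),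
          ⟨zero_mem _, ((groupComplex P.G₁ A).meas n).neg_mem hT, zero_mem _⟩, rfl⟩, ?_⟩
        refine Prod.ext ?_ (Prod.ext ?_ ?_)
        · change 0 + totD P A (n + 1) 0 = 0
          rw [map_zero, add_zero]
        · let N' : (Fin (n + 1) → P.G₁) → A := N
          let T' : (Fin n → P.G₁) → A := T
          change N' + (-groupD P.G₁ A n (-T') + col P A (n + 1) 0) =
            N' + groupD P.G₁ A n T'
          rw [map_zero, map_neg, neg_neg, add_zero]
        · change 0 + (-groupD P.G₂ A n 0 + row P A (n + 1) 0) = 0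
          rw [map_zero, map_zero, neg_zero, add_zero, add_zero])

/-- `Hⁿ(G₂, A) → Hⁿ(m.p., A)`, induced by `K ↦ (0, 0, K)`. -/
def kacIncl₂ (n : ℕ) : (groupComplex P.G₂ A).H n →+ P.KacH A n :=
  MeasComplex.mapH
    (show (groupComplex P.G₂ A).C n →+ (P.cone A).C (n + 1) from
      AddMonoidHom.mk' (fun K => ((0, 0, K) :
        DC P A (n + 1) × ((Fin n → P.G₁) → A) × ((Fin n → P.G₂) → A)))
        (fun K K' => Prod.ext (add_zero _).symm (Prod.ext (add_zero _).symm rfl)))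
    (by
      intro K hK
      refine ⟨⟨zero_mem _, zero_mem _, hK.1⟩, ?_, ?_, ?_⟩
      · change totD P A (n + 1) 0 ∈ _
        rw [map_zero]
        exact zero_mem _
      · change -groupD P.G₁ A n 0 + col P A (n + 1) 0 ∈ _
        rw [map_zero, map_zero, neg_zero, add_zero]
        exact zero_mem _
      · change -groupD P.G₂ A n K + row P A (n + 1) 0 ∈ _
        rw [map_zero, add_zero]
        exact ((groupComplex P.G₂ A).null (n + 1)).neg_mem hK.2)
    (by
      intro K hK
      cases n with
      | zero =>
        exact AddSubgroup.mem_sup_left ⟨zero_mem _, zero_mem _, hK⟩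
      | succ n =>
        obtain ⟨N, hN, _, ⟨T, hT, rfl⟩, rfl⟩ := AddSubgroup.mem_sup.1 hK
        refine AddSubgroup.mem_sup.2 ⟨((0, 0, N) : DC P A (n + 1 + 1) ×
          ((Fin (n + 1) → P.G₁) → A) × ((Fin (n + 1) → P.G₂) → A)),
          ⟨zero_mem _, zero_mem _, hN⟩, _, ⟨((0, 0, -T) : DC P A (n + 1) ×
          ((Fin n → P.G₁) → A) × ((Fin n → P.G₂) → A)),
          ⟨zero_mem _, zero_mem _, ((groupComplex P.G₂ A).meas n).neg_mem hT⟩, rfl⟩, ?_⟩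
        refine Prod.ext ?_ (Prod.ext ?_ ?_)
        · change 0 + totD P A (n + 1) 0 = 0
          rw [map_zero, add_zero]
        · change 0 + (-groupD P.G₁ A n 0 + col P A (n + 1) 0) = 0
          rw [map_zero, map_zero, neg_zero, add_zero, add_zero]
        · let N' : (Fin (n + 1) → P.G₂) → A := N
          let T' : (Fin n → P.G₂) → A := T
          change N' + (-groupD P.G₂ A n (-T') + row P A (n + 1) 0) =
            N' + groupD P.G₂ A n T'
          rw [map_zero, map_neg, neg_neg, add_zero])

/-- `Hⁿ(G₁, A) ⊕ Hⁿ(G₂, A) → Hⁿ(m.p., A)`, induced by `K ↦ (0, K)`. -/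
def kacIncl (n : ℕ) :
    (groupComplex P.G₁ A).H n × (groupComplex P.G₂ A).H n →+ P.KacH A n :=
  (P.kacIncl₁ A n).coprod (P.kacIncl₂ A n)

/-- `Hⁿ(m.p., A) → Hⁿ⁺¹(D(A))`, induced by `(F, K) ↦ F`. -/
def kacProj (n : ℕ) : P.KacH A n →+ (P.totalComplex A).H (n + 1) :=
  MeasComplex.mapH
    (show (P.cone A).C (n + 1) →+ (P.totalComplex A).C (n + 1) from
      AddMonoidHom.fst (DC P A (n + 1)) (((Fin n → P.G₁) → A) × ((Fin n → P.G₂) → A)))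
    (fun _ hx => ⟨hx.1.1, hx.2.1⟩)
    (by
      intro x hx
      obtain ⟨N, hN, _, ⟨T, hT, rfl⟩, rfl⟩ := AddSubgroup.mem_sup.1 hx
      cases n with
      | zero => exact AddSubgroup.mem_sup.2 ⟨_, hN.1, _, ⟨T, hT, rfl⟩, rfl⟩
      | succ n => exact AddSubgroup.mem_sup.2 ⟨_, hN.1, _, ⟨Prod.fst T, hT.1, rfl⟩, rfl⟩)

end Cone

/-! ### The coefficient module of the matched pair -/

section Coefficients

variable [SecondCountableTopology G]

/-- The `G`-module `L(G / G₁ ⊔ G / G₂, A)`. -/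
abbrev LQuot : Type (max u v) := LSp P.Quot P.quotMeasure A

/-- The `G`-module `L(G / G₁ ⊔ G / G₂, A) / A`. -/
abbrev KacModule : Type (max u v) := LModConst P.Quot P.quotMeasure A

variable [ContinuousConstSMul G A]

/-- `Hⁿ(G, A) → Hⁿ(G, L(G / G₁ ⊔ G / G₂, A))`. -/
def constH (n : ℕ) : (groupComplex G A).H n →+ (groupComplex G (P.LQuot A)).H n :=
  (coeffHom G (LSp.const P.Quot P.quotMeasure A) LSp.continuous_const LSp.const_smul).H n

/-- `Hⁿ(G, L(G / G₁ ⊔ G / G₂, A)) → Hⁿ(G, L(G / G₁ ⊔ G / G₂, A) / A)`. -/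
def projH (n : ℕ) : (groupComplex G (P.LQuot A)).H n →+ (groupComplex G (P.KacModule A)).H n :=
  (coeffHom G (LModConst.proj P.Quot P.quotMeasure A) LModConst.continuous_proj
    LModConst.proj_smul).H n

end Coefficients

end MatchedPair

end MatchedPairs

end KacCohomology

end

set_option linter.unusedSectionVars false

noncomputable section

namespace KacCohomology

namespace MeasComplex

universe w₁ w₂ w₃ w₄

variable {K : MeasComplex.{w₁}} {K' : MeasComplex.{w₂}} {K'' : MeasComplex.{w₃}}

/-! ### Weak morphisms -/

/-! Write Z₁ = G/G₁ and Z₂ = G/G₂. Everything is compared inside one triple complex: G-equivariant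
measurable functions on Gⁿ × Z₁^q × Z₂^p with values in A, with the homogeneous coboundary in each
of the three kinds of variables (`Fam`, `famD`, `Rel`). Since G₁ ∩ G₂ is trivial and G₁G₂ is conull,
almost every coset of G₁ meets almost every coset of G₂ in exactly one point, and x ↦ (xG₁, xG₂)
identifies the measure class of G with that of Z₁ × Z₂. A grid with p rows and q columns is
therefore, up to translation by G and null sets, a choice of q + 1 cosets of G₁ (the columns of
vertices) and p + 1 cosets of G₂ (the rows of vertices), and the vertices are the intersection
points. So D(A) is the part n = 0 with q, p ≥ 1, its first column and first row are the parts with a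
single coset of G₁ or of G₂, the cochains of G are the part q = p = 0, and the cochains of G with
values in L(Zᵢ, A) are the part with a single coset of Gᵢ and no other coset. Equivariance is
required at every point and not only almost everywhere; this makes it possible to pass to slices
such as g₀ = 1, which may be null sets (`aestronglyMeasurable_of_smul`).

The augmented complex in one kind of variables is exact as soon as an equivariant point of that kind
can be inserted: g₀z in Zᵢ if there is a variable g₀ in G, and pt(a₀, b₀)h in G if there are cosets
a₀, b₀ of both kinds, `pt` being their intersection. Base points z and h are chosen generically by
Fubini (`exists_primitive0`, `exists_primitive1`, `exists_primitive2`). Exactness of the augmented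
complex says that the connecting morphism `famIns` from the part without the variable to the part
with it is a quasi-isomorphism (`relIns_bijective`).

Hence the complex T of the degrees n, q, p ≥ 1 receives quasi-isomorphisms from D(A), by adding
variables in G, and from the cochains of G, by adding cosets of both kinds. This gives Hⁿ(D(A)) ≅
Hⁿ(G, A). The same argument with at most one coset of G₁, or of G₂, gives complexes T₁ and T₂ that
compare Hⁿ(Gᵢ, A) with Hⁿ(G, L(Zᵢ, A)), a form of Shapiro's lemma. The restriction T → T₁ × T₂
corresponds to J on the side of the grids and to the inclusion of the constants A → B on the side of
G, up to null functions (`pairTriple_J`, `functionTriple_constMap`). By the five lemma the mapping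
cones have the same cohomology, compatibly with the long exact sequences (`coneMap_bijective`).

It remains to see that the cone of A → B computes Hⁿ(G, B/A) (`ShortExact.coneH_bijective`). This
needs short exact sequences of measurable cochain groups (`shortExact_const`), which rest on a
measurable lifting L(X, A)/A → L(X, A) (`LModConst.exists_lift`) and on the exponential law L(Ω,
L(X, A)) = L(Ω × X, A) (`LSp.aestronglyMeasurable_of_prod`,
`LSp.exists_prod_of_aestronglyMeasurable`). The topological assertions come from convergence in
measure, the completeness of Polish abelian groups, and the automatic continuity of measurable
actions (`continuousSMul_of_stronglyMeasurable`). -/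

/-- Morphisms of complexes of measurable cochains that commute with the coboundaries up to null
functions. -/
structure WHom (K : MeasComplex.{w₁}) (K' : MeasComplex.{w₂}) where
  /-- the map in degree `n` -/
  f : ∀ n, K.C n →+ K'.C n
  comm : ∀ n, ∀ x ∈ K.meas n, f (n + 1) (K.d n x) - K'.d n (f n x) ∈ K'.null (n + 1)
  map_meas : ∀ n, ∀ x ∈ K.meas n, f n x ∈ K'.meas n
  map_null : ∀ n, ∀ x ∈ K.null n, f n x ∈ K'.null n

/-- The coboundary maps measurable to measurable functions, null functions to null functions, and
has square zero. -/
structure Good (K : MeasComplex.{w₁}) : Prop where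
  d_meas : ∀ n, ∀ x ∈ K.meas n, K.d n x ∈ K.meas (n + 1)
  d_null : ∀ n, ∀ x ∈ K.null n, K.d n x ∈ K.null (n + 1)
  d_d : ∀ n, ∀ x ∈ K.meas n, K.d (n + 1) (K.d n x) ∈ K.null (n + 2)

theorem mem_coboundaries_succ {n : ℕ} {x : K.C (n + 1)} :
    x ∈ K.coboundaries (n + 1) ↔ ∃ y ∈ K.meas n, x - K.d n y ∈ K.null (n + 1) := by
  constructor
  · intro h
    obtain ⟨z, hz, _, ⟨y, hy, rfl⟩, rfl⟩ := AddSubgroup.mem_sup.1 h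
    exact ⟨y, hy, by simpa using hz⟩
  · rintro ⟨y, hy, h⟩
    exact AddSubgroup.mem_sup.2 ⟨_, h, _, ⟨y, hy, rfl⟩, by simp⟩

theorem null_le_coboundaries (n : ℕ) : K.null n ≤ K.coboundaries n := by
  cases n with
  | zero => exact le_rfl
  | succ n => exact le_sup_left

theorem cls_eq_iff {n : ℕ} {c c' : K.cocycles n} :
    K.cls c = K.cls c' ↔ (c'.1 - c.1) ∈ K.coboundaries n := by
  refine QuotientAddGroup.eq.trans ?_
  rw [AddSubgroup.mem_addSubgroupOf]
  simp [neg_add_eq_sub]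

theorem cls_eq_zero_iff {n : ℕ} {c : K.cocycles n} :
    K.cls c = 0 ↔ c.1 ∈ K.coboundaries n := by
  refine (QuotientAddGroup.eq_zero_iff _).trans ?_
  rw [AddSubgroup.mem_addSubgroupOf]

theorem cls_surjective (n : ℕ) : Function.Surjective (K.cls (n := n)) :=
  QuotientAddGroup.mk_surjective

namespace WHom

variable (φ : WHom K K')

theorem map_cocycles (n : ℕ) (x : K.C n) (hx : x ∈ K.cocycles n) : φ.f n x ∈ K'.cocycles n := by
  refine ⟨φ.map_meas n x hx.1, ?_⟩
  have h := φ.map_null (n + 1) _ hx.2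
  have h2 := (K'.null (n + 1)).sub_mem h (φ.comm n x hx.1)
  rwa [sub_sub_cancel] at h2

theorem map_coboundaries (n : ℕ) (x : K.C n) (hx : x ∈ K.coboundaries n) :
    φ.f n x ∈ K'.coboundaries n := by
  cases n with
  | zero => exact φ.map_null 0 x hx
  | succ n =>
    obtain ⟨y, hy, h⟩ := mem_coboundaries_succ.1 hx
    refine mem_coboundaries_succ.2 ⟨_, φ.map_meas n y hy, ?_⟩
    have h1 := (K'.null (n + 1)).add_mem (φ.map_null _ _ h) (φ.comm n y hy)
    rw [map_sub] at h1
    simpa using h1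

/-- The homomorphism induced on cohomology. -/
def H (n : ℕ) : K.H n →+ K'.H n := mapH (φ.f n) (φ.map_cocycles n) (φ.map_coboundaries n)

theorem H_cls {n : ℕ} (c : K.cocycles n) :
    φ.H n (K.cls c) = K'.cls ⟨φ.f n c.1, φ.map_cocycles n _ c.2⟩ := rfl

/-- Composition of weak morphisms. -/
def comp (ψ : WHom K' K'') (φ : WHom K K') : WHom K K'' where
  f n := (ψ.f n).comp (φ.f n)
  comm n x hx := by
    have h1 := ψ.map_null _ _ (φ.comm n x hx)
    have h2 := ψ.comm n _ (φ.map_meas n x hx)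
    rw [map_sub] at h1
    simpa using (K''.null (n + 1)).add_mem h1 h2
  map_meas n x hx := ψ.map_meas n _ (φ.map_meas n x hx)
  map_null n x hx := ψ.map_null n _ (φ.map_null n x hx)

theorem comp_H (ψ : WHom K' K'') (φ : WHom K K') (n : ℕ) (x : K.H n) :
    (ψ.comp φ).H n x = ψ.H n (φ.H n x) := by
  obtain ⟨c, rfl⟩ := cls_surjective n x
  rfl

theorem comp_bijective {ψ : WHom K' K''} {φ : WHom K K'} {n : ℕ}
    (hψ : Function.Bijective (ψ.H n)) (hφ : Function.Bijective (φ.H n)) :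
    Function.Bijective ((ψ.comp φ).H n) := by
  have : ⇑((ψ.comp φ).H n) = ψ.H n ∘ φ.H n := funext fun x => comp_H ψ φ n x
  rw [this]
  exact hψ.comp hφ

/-- Morphisms that agree up to null functions agree on cohomology. -/
theorem H_congr {φ ψ : WHom K K'} {n : ℕ} (h : ∀ x ∈ K.meas n, φ.f n x - ψ.f n x ∈ K'.null n)
    (x : K.H n) : φ.H n x = ψ.H n x := by
  obtain ⟨c, rfl⟩ := cls_surjective n x
  rw [H_cls, H_cls, cls_eq_iff]
  have := (K'.null n).neg_mem (h c.1 c.2.1)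
  rw [neg_sub] at this
  exact null_le_coboundaries n this

theorem H_bijective_of {φ : WHom K K'} {n : ℕ}
    (hinj : ∀ x ∈ K.cocycles n, φ.f n x ∈ K'.coboundaries n → x ∈ K.coboundaries n)
    (hsurj : ∀ y ∈ K'.cocycles n, ∃ x ∈ K.cocycles n, y - φ.f n x ∈ K'.coboundaries n) :
    Function.Bijective (φ.H n) := by
  constructor
  · refine (injective_iff_map_eq_zero _).2 fun x hx => ?_
    obtain ⟨c, rfl⟩ := cls_surjective n x
    rw [H_cls, cls_eq_zero_iff] at hx
    exact cls_eq_zero_iff.2 (hinj c.1 c.2 hx)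
  · intro y
    obtain ⟨c, rfl⟩ := cls_surjective n y
    obtain ⟨x, hx, h⟩ := hsurj c.1 c.2
    exact ⟨K.cls ⟨x, hx⟩, cls_eq_iff.2 h⟩

/-- A morphism that is bijective up to null functions induces isomorphisms on cohomology. -/
theorem H_bijective_of_equiv_on (φ : WHom K K') (hK' : K'.Good) (S : ∀ n, AddSubgroup (K.C n))
    (hS : ∀ n, K.meas n ≤ S n) (hd : ∀ n, ∀ x ∈ K.meas n, K.d n x ∈ S (n + 1))
    (hinj : ∀ n, ∀ x ∈ S n, φ.f n x ∈ K'.null n → x ∈ K.null n)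
    (hsurj : ∀ n, ∀ y ∈ K'.meas n, ∃ x ∈ K.meas n, y - φ.f n x ∈ K'.null n) (n : ℕ) :
    Function.Bijective (φ.H n) := by
  refine H_bijective_of ?_ ?_
  · intro x hx h
    cases n with
    | zero => exact hinj 0 x (hS 0 hx.1) h
    | succ n =>
      obtain ⟨y, hy, h⟩ := mem_coboundaries_succ.1 h
      -- The primitive is given in `K'`; pulling it back to `K` changes it by a null function, whose
      -- coboundary is null because `K'` is good.
      obtain ⟨z, hz, hyz⟩ := hsurj n y hy
      refine mem_coboundaries_succ.2 ⟨z, hz, hinj _ _ (sub_mem (hS _ hx.1) (hd n z hz)) ?_⟩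
      have h1 := hK'.d_null _ _ hyz
      have h2 := φ.comm n z hz
      rw [map_sub] at h1 ⊢
      have := (K'.null (n + 1)).sub_mem ((K'.null (n + 1)).add_mem h h1) h2
      convert this using 1
      abel
  · intro y hy
    obtain ⟨x, hx, h⟩ := hsurj n y hy.1
    refine ⟨x, ⟨hx, hinj _ _ (hd n x hx) ?_⟩, null_le_coboundaries n h⟩
    have h1 := hK'.d_null _ _ h
    have h2 := φ.comm n x hx
    have h3 : K'.d n y ∈ K'.null (n + 1) := hy.2
    rw [map_sub] at h1
    have := (K'.null (n + 1)).add_mem ((K'.null (n + 1)).sub_mem h3 h1) h2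
    convert this using 1
    abel

/-- Here injectivity modulo null functions is available for all functions, measurable or not. The
subgroup `S` of the general version is needed where this depends on measurability, as for currying.
-/
theorem H_bijective_of_equiv (φ : WHom K K') (hK' : K'.Good)
    (hinj : ∀ n x, φ.f n x ∈ K'.null n → x ∈ K.null n)
    (hsurj : ∀ n, ∀ y ∈ K'.meas n, ∃ x ∈ K.meas n, y - φ.f n x ∈ K'.null n) (n : ℕ) :
    Function.Bijective (φ.H n) :=
  φ.H_bijective_of_equiv_on hK' (fun _ => ⊤) (fun _ => le_top) (fun _ _ _ => trivial)
    (fun n x _ => hinj n x) hsurj n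

end WHom

/-- A morphism as a weak morphism. -/
def Hom.toWHom (φ : Hom K K') : WHom K K' where
  f := φ.f
  comm n x _ := by
    rw [φ.comm, sub_self]
    exact zero_mem _
  map_meas := φ.map_meas
  map_null := φ.map_null

/-! ### Products -/

/-- The product of two complexes. -/
def prod (K : MeasComplex.{w₁}) (K' : MeasComplex.{w₂}) : MeasComplex.{max w₁ w₂} where
  C n := K.C n × K'.C n
  meas n := (K.meas n).prod (K'.meas n)
  null n := (K.null n).prod (K'.null n)
  d n := (K.d n).prodMap (K'.d n)

theorem prod_coboundaries {n : ℕ} {x : (K.prod K').C n} :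
    x ∈ (K.prod K').coboundaries n ↔
      Prod.fst x ∈ K.coboundaries n ∧ Prod.snd x ∈ K'.coboundaries n := by
  cases n with
  | zero => exact Iff.rfl
  | succ n =>
    rw [mem_coboundaries_succ, mem_coboundaries_succ, mem_coboundaries_succ]
    constructor
    · rintro ⟨y, hy, h⟩
      exact ⟨⟨y.1, hy.1, h.1⟩, ⟨y.2, hy.2, h.2⟩⟩
    · rintro ⟨⟨y, hy, h⟩, ⟨y', hy', h'⟩⟩
      exact ⟨(y, y'), ⟨hy, hy'⟩, ⟨h, h'⟩⟩

theorem prod_cocycles {n : ℕ} {x : (K.prod K').C n} :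
    x ∈ (K.prod K').cocycles n ↔ Prod.fst x ∈ K.cocycles n ∧ Prod.snd x ∈ K'.cocycles n :=
  ⟨fun h => ⟨⟨h.1.1, h.2.1⟩, ⟨h.1.2, h.2.2⟩⟩, fun h => ⟨⟨h.1.1, h.2.1⟩, ⟨h.1.2, h.2.2⟩⟩⟩

/-- The inclusion `Hⁿ(K) → Hⁿ(K × K')`. -/
def inlH (K : MeasComplex.{w₁}) (K' : MeasComplex.{w₂}) (n : ℕ) : K.H n →+ (K.prod K').H n :=
  mapH (show K.C n →+ (K.prod K').C n from AddMonoidHom.inl (K.C n) (K'.C n))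
    (fun _ hx => prod_cocycles.2 ⟨hx, zero_mem _⟩)
    (fun _ hx => prod_coboundaries.2 ⟨hx, zero_mem _⟩)

/-- The inclusion `Hⁿ(K') → Hⁿ(K × K')`. -/
def inrH (K : MeasComplex.{w₁}) (K' : MeasComplex.{w₂}) (n : ℕ) : K'.H n →+ (K.prod K').H n :=
  mapH (show K'.C n →+ (K.prod K').C n from AddMonoidHom.inr (K.C n) (K'.C n))
    (fun _ hx => prod_cocycles.2 ⟨zero_mem _, hx⟩)
    (fun _ hx => prod_coboundaries.2 ⟨zero_mem _, hx⟩)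

theorem coprod_cls {n : ℕ} (c : K.cocycles n) (c' : K'.cocycles n) :
    (inlH K K' n).coprod (inrH K K' n) (K.cls c, K'.cls c') =
      (K.prod K').cls ⟨(c.1, c'.1), prod_cocycles.2 ⟨c.2, c'.2⟩⟩ := by
  rw [AddMonoidHom.coprod_apply]
  refine congrArg (K.prod K').cls (Subtype.ext ?_)
  exact Prod.ext (add_zero c.1) (zero_add c'.1)

theorem coprod_bijective (n : ℕ) :
    Function.Bijective ((inlH K K' n).coprod (inrH K K' n)) := by
  constructor
  · refine (injective_iff_map_eq_zero _).2 ?_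
    rintro ⟨x, x'⟩ hx
    obtain ⟨c, rfl⟩ := cls_surjective n x
    obtain ⟨c', rfl⟩ := cls_surjective n x'
    rw [coprod_cls, cls_eq_zero_iff, prod_coboundaries] at hx
    exact Prod.ext (cls_eq_zero_iff.2 hx.1) (cls_eq_zero_iff.2 hx.2)
  · intro y
    obtain ⟨c, rfl⟩ := cls_surjective n y
    have h := prod_cocycles.1 c.2
    exact ⟨(K.cls ⟨_, h.1⟩, K'.cls ⟨_, h.2⟩), coprod_cls _ _⟩

/-- `Hⁿ(K) × Hⁿ(K') ≃ Hⁿ(K × K')`. -/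
def prodEquiv (K : MeasComplex.{w₁}) (K' : MeasComplex.{w₂}) (n : ℕ) :
    K.H n × K'.H n ≃+ (K.prod K').H n :=
  AddEquiv.ofBijective _ (coprod_bijective n)

/-- The morphism to a product given by its two components. -/
def WHom.pair (φ : WHom K K') (ψ : WHom K K'') : WHom K (K'.prod K'') where
  f n := (φ.f n).prod (ψ.f n)
  comm n x hx := ⟨φ.comm n x hx, ψ.comm n x hx⟩
  map_meas n x hx := ⟨φ.map_meas n x hx, ψ.map_meas n x hx⟩
  map_null n x hx := ⟨φ.map_null n x hx, ψ.map_null n x hx⟩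

theorem prodEquiv_cls {n : ℕ} (c : K.cocycles n) (c' : K'.cocycles n) :
    prodEquiv K K' n (K.cls c, K'.cls c') =
      (K.prod K').cls ⟨(c.1, c'.1), prod_cocycles.2 ⟨c.2, c'.2⟩⟩ := coprod_cls c c'

theorem WHom.pair_H (φ : WHom K K') (ψ : WHom K K'') (n : ℕ) (x : K.H n) :
    (φ.pair ψ).H n x = prodEquiv K' K'' n (φ.H n x, ψ.H n x) := by
  obtain ⟨c, rfl⟩ := cls_surjective n x
  rw [WHom.H_cls, WHom.H_cls, WHom.H_cls, prodEquiv_cls]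
  rfl

/-- The product of two morphisms. -/
def WHom.prodMap {L : MeasComplex.{w₃}} {L' : MeasComplex.{w₄}} (φ : WHom K K') (ψ : WHom L L') :
    WHom (K.prod L) (K'.prod L') where
  f n := (φ.f n).prodMap (ψ.f n)
  comm n _ hx := ⟨φ.comm n _ hx.1, ψ.comm n _ hx.2⟩
  map_meas n _ hx := ⟨φ.map_meas n _ hx.1, ψ.map_meas n _ hx.2⟩
  map_null n _ hx := ⟨φ.map_null n _ hx.1, ψ.map_null n _ hx.2⟩

theorem WHom.prodMap_bijective {L : MeasComplex.{w₃}} {L' : MeasComplex.{w₄}} {φ : WHom K K'}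
    {ψ : WHom L L'} {n : ℕ} (hφ : Function.Bijective (φ.H n)) (hψ : Function.Bijective (ψ.H n)) :
    Function.Bijective ((φ.prodMap ψ).H n) := by
  have h : ∀ x, (φ.prodMap ψ).H n (prodEquiv K L n x) =
      prodEquiv K' L' n (Prod.map (φ.H n) (ψ.H n) x) := by
    rintro ⟨x, y⟩
    obtain ⟨c, rfl⟩ := cls_surjective n x
    obtain ⟨c', rfl⟩ := cls_surjective n y
    rw [Prod.map_apply, WHom.H_cls, WHom.H_cls, prodEquiv_cls, prodEquiv_cls]
    rfl
  have h2 : ⇑((φ.prodMap ψ).H n) =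
      prodEquiv K' L' n ∘ Prod.map (φ.H n) (ψ.H n) ∘ (prodEquiv K L n).symm := by
    funext x
    simpa using h ((prodEquiv K L n).symm x)
  rw [h2]
  exact (prodEquiv K' L' n).bijective.comp
    ((hφ.prodMap hψ).comp (prodEquiv K L n).symm.bijective)

theorem Good.prod (hK : K.Good) (hK' : K'.Good) : (K.prod K').Good where
  d_meas n _ hx := ⟨hK.d_meas n _ hx.1, hK'.d_meas n _ hx.2⟩
  d_null n _ hx := ⟨hK.d_null n _ hx.1, hK'.d_null n _ hx.2⟩
  d_d n _ hx := ⟨hK.d_d n _ hx.1, hK'.d_d n _ hx.2⟩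

/-! ### Mapping cones -/

section Cone

variable {X : MeasComplex.{w₁}} {Y : MeasComplex.{w₂}} (r : WHom X Y)

/-- Cocycles of the mapping cone. -/
def coneZ (n : ℕ) : AddSubgroup (X.C (n + 1) × Y.C n) where
  carrier := {c | c.1 ∈ X.cocycles (n + 1) ∧ c.2 ∈ Y.meas n ∧
    r.f (n + 1) c.1 - Y.d n c.2 ∈ Y.null (n + 1)}
  zero_mem' := ⟨zero_mem _, zero_mem _, by simp⟩
  add_mem' {a b} ha hb := ⟨add_mem ha.1 hb.1, add_mem ha.2.1 hb.2.1, by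
    have := add_mem ha.2.2 hb.2.2
    simp only [Prod.fst_add, Prod.snd_add, map_add]
    convert this using 1
    abel⟩
  neg_mem' {a} ha := ⟨neg_mem ha.1, neg_mem ha.2.1, by
    have := neg_mem ha.2.2
    simp only [Prod.fst_neg, Prod.snd_neg, map_neg]
    convert this using 1
    abel⟩

/-- Coboundaries of the mapping cone. -/
def coneB (n : ℕ) : AddSubgroup (X.C (n + 1) × Y.C n) where
  carrier := {c | ∃ x ∈ X.meas n, c.1 - X.d n x ∈ X.null (n + 1) ∧
    c.2 - r.f n x ∈ Y.coboundaries n}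
  zero_mem' := ⟨0, zero_mem _, by simp, by simp⟩
  add_mem' := by
    rintro a b ⟨x, hx, h1, h2⟩ ⟨y, hy, h3, h4⟩
    refine ⟨x + y, add_mem hx hy, ?_, ?_⟩
    · have := add_mem h1 h3
      simp only [Prod.fst_add, map_add]
      convert this using 1
      abel
    · have := add_mem h2 h4
      simp only [Prod.snd_add, map_add]
      convert this using 1
      abel
  neg_mem' := by
    rintro a ⟨x, hx, h1, h2⟩
    refine ⟨-x, neg_mem hx, ?_, ?_⟩
    · have := neg_mem h1
      simp only [Prod.fst_neg, map_neg]
      convert this using 1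
      abel
    · have := neg_mem h2
      simp only [Prod.snd_neg, map_neg]
      convert this using 1
      abel

/-- The cohomology of the mapping cone. -/
abbrev ConeH (n : ℕ) : Type (max w₁ w₂) := coneZ r n ⧸ (coneB r n).addSubgroupOf (coneZ r n)

/-- The class of a cocycle of the mapping cone. -/
def coneCls {n : ℕ} (c : coneZ r n) : ConeH r n := QuotientAddGroup.mk c

variable {r}

theorem coneCls_surjective (n : ℕ) : Function.Surjective (coneCls r (n := n)) :=
  QuotientAddGroup.mk_surjective

theorem coneCls_eq_iff {n : ℕ} {c c' : coneZ r n} :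
    coneCls r c = coneCls r c' ↔ (c'.1 - c.1) ∈ coneB r n := by
  refine QuotientAddGroup.eq.trans ?_
  rw [AddSubgroup.mem_addSubgroupOf]
  simp [neg_add_eq_sub]

theorem coneCls_eq_zero_iff {n : ℕ} {c : coneZ r n} : coneCls r c = 0 ↔ c.1 ∈ coneB r n := by
  refine (QuotientAddGroup.eq_zero_iff _).trans ?_
  rw [AddSubgroup.mem_addSubgroupOf]

variable (r)

/-- `K ↦ (0, K)`. -/
def coneIncl (n : ℕ) : Y.H n →+ ConeH r n :=
  QuotientAddGroup.map _ _
    (((AddMonoidHom.inr (X.C (n + 1)) (Y.C n)).comp (Y.cocycles n).subtype).codRestrict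
      (coneZ r n) fun x => ⟨zero_mem _, x.2.1, by
        have : Y.d n x.1 ∈ Y.null (n + 1) := x.2.2
        simpa using this⟩)
    (fun x hx => ⟨0, zero_mem _, by
        change (0 : X.C (n + 1)) - _ ∈ _
        simp, by
        have : x.1 ∈ Y.coboundaries n := hx
        change x.1 - _ ∈ _
        simpa using this⟩)

/-- `(F, K) ↦ F`. -/
def coneProj (n : ℕ) : ConeH r n →+ X.H (n + 1) :=
  QuotientAddGroup.map _ _
    (((AddMonoidHom.fst (X.C (n + 1)) (Y.C n)).comp (coneZ r n).subtype).codRestrict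
      (X.cocycles (n + 1)) fun x => x.2.1)
    (fun x hx => by
      obtain ⟨y, hy, h, -⟩ : x.1 ∈ coneB r n := hx
      exact mem_coboundaries_succ.2 ⟨y, hy, h⟩)

theorem coneProj_cls {n : ℕ} (c : coneZ r n) : coneProj r n (coneCls r c) = X.cls ⟨c.1.1, c.2.1⟩ :=
  rfl

/-- The pair (0, K) bounds in the cone iff K - r x is a coboundary for some x with dx null, that is,
iff the class of K is the image of the class of x. -/
theorem exact_H_coneIncl (n : ℕ) : Function.Exact (r.H n) (coneIncl r n) := by
  intro y
  obtain ⟨c, rfl⟩ := cls_surjective n y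
  refine coneCls_eq_zero_iff.trans ?_
  constructor
  · rintro ⟨x, hx, h1, h2⟩
    refine ⟨X.cls ⟨x, hx, ?_⟩, ?_⟩
    · have h1 : 0 - X.d n x ∈ X.null (n + 1) := h1
      rwa [zero_sub, neg_mem_iff] at h1
    · rw [WHom.H_cls, cls_eq_iff]
      exact h2
  · rintro ⟨x, hx⟩
    obtain ⟨x, rfl⟩ := cls_surjective n x
    rw [WHom.H_cls, cls_eq_iff] at hx
    refine ⟨x.1, x.2.1, ?_, hx⟩
    have : X.d n x.1 ∈ X.null (n + 1) := x.2.2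
    change 0 - X.d n x.1 ∈ _
    rwa [zero_sub, neg_mem_iff]

/-- If F = dx, subtracting the coboundary (dx, r x) moves the cocycle (F, K) to (0, K - r x). -/
theorem exact_coneIncl_coneProj (n : ℕ) : Function.Exact (coneIncl r n) (coneProj r n) := by
  intro y
  obtain ⟨c, rfl⟩ := coneCls_surjective n y
  rw [coneProj_cls, cls_eq_zero_iff, mem_coboundaries_succ]
  constructor
  · rintro ⟨x, hx, h⟩
    have hz : c.1.2 - r.f n x ∈ Y.cocycles n := by
      refine ⟨(Y.meas n).sub_mem c.2.2.1 (r.map_meas n x hx), ?_⟩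
      change Y.d n (c.1.2 - r.f n x) ∈ Y.null (n + 1)
      have h1 := r.map_null _ _ h
      have h2 := r.comm n x hx
      have h3 := c.2.2.2
      rw [map_sub] at h1 ⊢
      have := add_mem (sub_mem h1 h3) h2
      convert this using 1
      abel
    refine ⟨Y.cls ⟨_, hz⟩, coneCls_eq_iff.2 ⟨x, hx, ?_, ?_⟩⟩
    · change c.1.1 - 0 - X.d n x ∈ _
      simpa using h
    · change c.1.2 - (c.1.2 - r.f n x) - r.f n x ∈ _
      simp
  · rintro ⟨x, hx⟩
    obtain ⟨x, rfl⟩ := cls_surjective n x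
    obtain ⟨z, hz, h1, -⟩ := coneCls_eq_iff.1 hx
    refine ⟨z, hz, ?_⟩
    have h1 : c.1.1 - 0 - X.d n z ∈ _ := h1
    simpa using h1

/-- A cocycle F extends to a cone cocycle (F, K) exactly if r F = dK has a solution K. A change of F
by dz is compensated by adding r z to K. -/
theorem exact_coneProj_H (n : ℕ) : Function.Exact (coneProj r n) (r.H (n + 1)) := by
  intro y
  obtain ⟨c, rfl⟩ := cls_surjective (n + 1) y
  rw [WHom.H_cls, cls_eq_zero_iff, mem_coboundaries_succ]
  constructor
  · rintro ⟨k, hk, h⟩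
    exact ⟨coneCls r ⟨(c.1, k), c.2, hk, h⟩, rfl⟩
  · rintro ⟨x, hx⟩
    obtain ⟨x, rfl⟩ := coneCls_surjective n x
    rw [coneProj_cls, cls_eq_iff, mem_coboundaries_succ] at hx
    obtain ⟨z, hz, h⟩ := hx
    refine ⟨x.1.2 + r.f n z, add_mem x.2.2.1 (r.map_meas n z hz), ?_⟩
    have h1 := r.map_null _ _ h
    have h2 := r.comm n z hz
    have h3 := x.2.2.2
    simp only [map_sub, map_add] at h1 ⊢
    have := add_mem (add_mem h1 h2) h3
    convert this using 1
    abel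

variable {X' : MeasComplex.{w₃}} {Y' : MeasComplex.{w₄}} (r' : WHom X' Y') (f : WHom X X')
  (g : WHom Y Y')

/-- The map of mapping cones induced by a square that commutes up to null functions. -/
def coneMap (h : ∀ n, ∀ x ∈ X.meas n, g.f n (r.f n x) - r'.f n (f.f n x) ∈ Y'.null n) (n : ℕ) :
    ConeH r n →+ ConeH r' n :=
  QuotientAddGroup.map _ _
    ((((f.f (n + 1)).prodMap (g.f n)).comp (coneZ r n).subtype).codRestrict
      (coneZ r' n) fun x => ⟨f.map_cocycles _ _ x.2.1, g.map_meas _ _ x.2.2.1, by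
        change r'.f (n + 1) (f.f (n + 1) x.1.1) - Y'.d n (g.f n x.1.2) ∈ _
        have h1 := g.map_null _ _ x.2.2.2
        have h2 := h _ _ x.2.1.1
        have h3 := g.comm _ _ x.2.2.1
        rw [map_sub] at h1
        have := add_mem (sub_mem h1 h2) h3
        convert this using 1
        abel⟩)
    (fun x hx => by
      obtain ⟨y, hy, h1, h2⟩ : x.1 ∈ coneB r n := hx
      refine ⟨f.f n y, f.map_meas _ _ hy, ?_, ?_⟩
      · change f.f (n + 1) x.1.1 - X'.d n (f.f n y) ∈ _
        have h3 := add_mem (f.map_null _ _ h1) (f.comm n y hy)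
        rw [map_sub] at h3
        simpa using h3
      · change g.f n x.1.2 - r'.f n (f.f n y) ∈ _
        have h3 := add_mem (g.map_coboundaries _ _ h2) (null_le_coboundaries _ (h n y hy))
        rw [map_sub] at h3
        simpa using h3)

variable (h : ∀ n, ∀ x ∈ X.meas n, g.f n (r.f n x) - r'.f n (f.f n x) ∈ Y'.null n)

theorem coneMap_coneIncl (n : ℕ) (y : Y.H n) :
    coneMap r r' f g h n (coneIncl r n y) = coneIncl r' n (g.H n y) := by
  obtain ⟨c, rfl⟩ := cls_surjective n y
  refine congrArg (coneCls r') (Subtype.ext (Prod.ext ?_ rfl))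
  exact map_zero (f.f (n + 1))

theorem coneProj_coneMap (n : ℕ) (y : ConeH r n) :
    coneProj r' n (coneMap r r' f g h n y) = f.H (n + 1) (coneProj r n y) := by
  obtain ⟨c, rfl⟩ := coneCls_surjective n y
  rfl

theorem H_square (h : ∀ n, ∀ x ∈ X.meas n, g.f n (r.f n x) - r'.f n (f.f n x) ∈ Y'.null n)
    (n : ℕ) (x : X.H n) : g.H n (r.H n x) = r'.H n (f.H n x) := by
  rw [← WHom.comp_H, ← WHom.comp_H]
  exact WHom.H_congr (h n) x

/-- The five lemma for the long exact sequences of the two cones. -/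
theorem coneMap_bijective (hf : ∀ n, Function.Bijective (f.H n))
    (hg : ∀ n, Function.Bijective (g.H n)) (n : ℕ) :
    Function.Bijective (coneMap r r' f g h n) :=
  AddMonoidHom.bijective_of_surjective_of_bijective_of_bijective_of_injective
    (r.H n) (coneIncl r n) (coneProj r n) (r.H (n + 1))
    (r'.H n) (coneIncl r' n) (coneProj r' n) (r'.H (n + 1))
    (f.H n) (g.H n) (coneMap r r' f g h n) (f.H (n + 1)) (g.H (n + 1))
    (AddMonoidHom.ext fun x => (H_square r r' f g h n x).symm)
    (AddMonoidHom.ext fun x => (coneMap_coneIncl r r' f g h n x).symm)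
    (AddMonoidHom.ext fun x => coneProj_coneMap r r' f g h n x)
    (AddMonoidHom.ext fun x => (H_square r r' f g h (n + 1) x).symm)
    (exact_H_coneIncl r n) (exact_coneIncl_coneProj r n) (exact_coneProj_H r n)
    (exact_H_coneIncl r' n) (exact_coneIncl_coneProj r' n) (exact_coneProj_H r' n)
    (hf n).2 (hg n) (hf (n + 1)) (hg (n + 1)).1

end Cone

end MeasComplex

end KacCohomology

end

/-! ### Kac cohomology as the cohomology of the cone of J -/

noncomputable section

namespace KacCohomology

namespace MatchedPair

open MeasComplex

variable {G : Type u} [Group G] [TopologicalSpace G] [IsTopologicalGroup G]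
  [LocallyCompactSpace G] [MeasurableSpace G] [BorelSpace G] [SecondCountableTopology G]
  (P : MatchedPair G) (A : Type v) [AddCommGroup A] [TopologicalSpace A] [IsTopologicalAddGroup A]
  [DistribMulAction G A]

/-- The pair `L(G₁ⁿ, A) ⊕ L(G₂ⁿ, A)`. -/
abbrev pairComplex : MeasComplex := (groupComplex P.G₁ A).prod (groupComplex P.G₂ A)

/-- The morphism `J`. -/
def J : WHom (P.totalComplex A) (P.pairComplex A) := (P.J₁ A).toWHom.pair (P.J₂ A).toWHom

theorem J_H (n : ℕ) (x : (P.totalComplex A).H n) :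
    (P.J A).H n x = prodEquiv _ _ n (P.kacRes A n x) := WHom.pair_H _ _ _ _

theorem cone_cocycles_iff {n : ℕ} {F : (P.totalComplex A).C (n + 1)}
    {K : (P.pairComplex A).C n} :
    (show (P.cone A).C (n + 1) from (F, K)) ∈ (P.cone A).cocycles (n + 1) ↔
      (F, K) ∈ coneZ (P.J A) n := by
  have e1 : -groupD P.G₁ A n (Prod.fst K) + col P A (n + 1) F =
      col P A (n + 1) F - groupD P.G₁ A n (Prod.fst K) := by abel
  have e2 : -groupD P.G₂ A n (Prod.snd K) + row P A (n + 1) F =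
      row P A (n + 1) F - groupD P.G₂ A n (Prod.snd K) := by abel
  constructor
  · rintro ⟨h1, h2, h3, h4⟩
    refine ⟨⟨h1.1, h2⟩, h1.2, ?_, ?_⟩
    · exact (congrArg (· ∈ (groupComplex P.G₁ A).null (n + 1)) e1).mp h3
    · exact (congrArg (· ∈ (groupComplex P.G₂ A).null (n + 1)) e2).mp h4
  · rintro ⟨⟨h1, h2⟩, h3, h4, h5⟩
    refine ⟨⟨h1, h3⟩, h2, ?_, ?_⟩
    · exact (congrArg (· ∈ (groupComplex P.G₁ A).null (n + 1)) e1).mpr h4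
    · exact (congrArg (· ∈ (groupComplex P.G₂ A).null (n + 1)) e2).mpr h5

/-- The coboundary of the cone contains -dK, while `coneB` asks for an arbitrary coboundary in the
second component; K ↦ -K passes from one to the other. In the lowest degree there is no K, which
agrees with the convention that coboundaries of degree 0 are the null functions. -/
theorem cone_coboundaries_iff {n : ℕ} {F : (P.totalComplex A).C (n + 1)}
    {K : (P.pairComplex A).C n} :
    (show (P.cone A).C (n + 1) from (F, K)) ∈ (P.cone A).coboundaries (n + 1) ↔
      (F, K) ∈ coneB (P.J A) n := by
  rw [mem_coboundaries_succ]
  cases n with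
  | zero =>
    constructor
    · rintro ⟨y, hy, h1, h2⟩
      exact ⟨y, hy, h1, h2⟩
    · rintro ⟨y, hy, h1, h2⟩
      exact ⟨y, hy, h1, h2⟩
  | succ n =>
    have e1 : ∀ (f : (Fin (n + 1) → P.G₁) → A) (k : (Fin n → P.G₁) → A) (x : DC P A (n + 1)),
        f - col P A (n + 1) x - groupD P.G₁ A n (-k) =
        f - (-groupD P.G₁ A n k + col P A (n + 1) x) := fun f k x => by
      rw [map_neg]; abel
    have e2 : ∀ (f : (Fin (n + 1) → P.G₂) → A) (k : (Fin n → P.G₂) → A) (x : DC P A (n + 1)),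
        f - row P A (n + 1) x - groupD P.G₂ A n (-k) =
        f - (-groupD P.G₂ A n k + row P A (n + 1) x) := fun f k x => by
      rw [map_neg]; abel
    have e1' : ∀ (f : (Fin (n + 1) → P.G₁) → A) (k : (Fin n → P.G₁) → A) (x : DC P A (n + 1)),
        f - col P A (n + 1) x - groupD P.G₁ A n k =
        f - (-groupD P.G₁ A n (-k) + col P A (n + 1) x) := fun f k x => by
      rw [map_neg]; abel
    have e2' : ∀ (f : (Fin (n + 1) → P.G₂) → A) (k : (Fin n → P.G₂) → A) (x : DC P A (n + 1)),
        f - row P A (n + 1) x - groupD P.G₂ A n k =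
        f - (-groupD P.G₂ A n (-k) + row P A (n + 1) x) := fun f k x => by
      rw [map_neg]; abel
    constructor
    · rintro ⟨y, hy, h1, h2, h3⟩
      refine ⟨Prod.fst y, hy.1, h1, mem_coboundaries_succ.2 ⟨-Prod.snd y,
        ((P.pairComplex A).meas n).neg_mem hy.2, ?_, ?_⟩⟩
      · exact (congrArg (· ∈ (groupComplex P.G₁ A).null (n + 1)) (e1 _ _ _)).mpr h2
      · exact (congrArg (· ∈ (groupComplex P.G₂ A).null (n + 1)) (e2 _ _ _)).mpr h3
    · rintro ⟨x, hx, h1, h2⟩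
      obtain ⟨k, hk, h2, h3⟩ := mem_coboundaries_succ.1 h2
      refine ⟨(x, -k), ⟨hx, ((P.pairComplex A).meas n).neg_mem hk⟩, h1, ?_, ?_⟩
      · exact (congrArg (· ∈ (groupComplex P.G₁ A).null (n + 1)) (e1' _ _ _)).mp h2
      · exact (congrArg (· ∈ (groupComplex P.G₂ A).null (n + 1)) (e2' _ _ _)).mp h3

/-- Kac cohomology as the cohomology of the mapping cone of `J`. -/
def kacEquiv (n : ℕ) : P.KacH A n ≃+ ConeH (P.J A) n :=
  QuotientAddGroup.congr _ _
    { toFun := fun x => ⟨x.1, (P.cone_cocycles_iff A).1 x.2⟩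
      invFun := fun x => ⟨x.1, (P.cone_cocycles_iff A).2 x.2⟩
      left_inv := fun _ => rfl
      right_inv := fun _ => rfl
      map_add' := fun _ _ => rfl }
    (by
      ext x
      constructor
      · rintro ⟨y, hy, rfl⟩
        exact (P.cone_coboundaries_iff A).1 hy
      · intro hx
        exact ⟨⟨x.1, (P.cone_cocycles_iff A).2 x.2⟩, (P.cone_coboundaries_iff A).2 hx, rfl⟩)

theorem kacEquiv_kacIncl (n : ℕ)
    (y : (groupComplex P.G₁ A).H n × (groupComplex P.G₂ A).H n) :
    P.kacEquiv A n (P.kacIncl A n y) = coneIncl (P.J A) n (prodEquiv _ _ n y) := by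
  obtain ⟨x, y⟩ := y
  obtain ⟨c, rfl⟩ := cls_surjective n x
  obtain ⟨c', rfl⟩ := cls_surjective n y
  rw [prodEquiv_cls]
  refine congrArg (coneCls (P.J A)) (Subtype.ext (Prod.ext ?_ (Prod.ext ?_ ?_)))
  · exact add_zero (0 : DC P A (n + 1))
  · exact add_zero (M := (groupComplex P.G₁ A).C n) c.1
  · exact zero_add (M := (groupComplex P.G₂ A).C n) c'.1

theorem coneProj_kacEquiv (n : ℕ) (y : P.KacH A n) :
    coneProj (P.J A) n (P.kacEquiv A n y) = P.kacProj A n y := by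
  obtain ⟨c, rfl⟩ := cls_surjective (n + 1) y
  rfl

theorem exact_kacRes_kacIncl (n : ℕ) : Function.Exact (P.kacRes A n) (P.kacIncl A n) := by
  intro y
  rw [← (P.kacEquiv A n).map_eq_zero_iff, kacEquiv_kacIncl, exact_H_coneIncl (P.J A) n]
  simp only [Set.mem_range, J_H, EmbeddingLike.apply_eq_iff_eq]

theorem exact_kacIncl_kacProj (n : ℕ) : Function.Exact (P.kacIncl A n) (P.kacProj A n) := by
  intro y
  rw [← coneProj_kacEquiv, exact_coneIncl_coneProj (P.J A) n]
  constructor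
  · rintro ⟨x, hx⟩
    refine ⟨(prodEquiv _ _ n).symm x, (P.kacEquiv A n).injective ?_⟩
    rw [kacEquiv_kacIncl, AddEquiv.apply_symm_apply, hx]
  · rintro ⟨x, rfl⟩
    exact ⟨_, (P.kacEquiv_kacIncl A n x).symm⟩

theorem exact_kacProj_kacRes (n : ℕ) : Function.Exact (P.kacProj A n) (P.kacRes A (n + 1)) := by
  intro y
  rw [← (prodEquiv _ _ (n + 1)).map_eq_zero_iff, ← J_H, exact_coneProj_H (P.J A) n]
  constructor
  · rintro ⟨x, hx⟩
    refine ⟨(P.kacEquiv A n).symm x, ?_⟩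
    rw [← coneProj_kacEquiv, AddEquiv.apply_symm_apply, hx]
  · rintro ⟨x, rfl⟩
    exact ⟨_, P.coneProj_kacEquiv A n x⟩

end MatchedPair

end KacCohomology

end

noncomputable section

namespace KacCohomology

/-! ### Quasi measure preserving maps -/

section QuasiMeasurePreserving

variable {α β γ δ : Type*} [MeasurableSpace α] [MeasurableSpace β] [MeasurableSpace γ]
  [MeasurableSpace δ] {μa : Measure α} {μb : Measure β} {μc : Measure γ} {μd : Measure δ}

/-- Fubini: the slice over `a` of a preimage is the preimage under `τ a` of the slice over `a`. -/
theorem qmp_skew [SFinite μb] [SFinite μc] {τ : α → β → γ}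
    (hm : Measurable fun x : α × β => τ x.1 x.2)
    (h : ∀ᵐ a ∂μa, QuasiMeasurePreserving (τ a) μb μc) :
    QuasiMeasurePreserving (fun x : α × β => (x.1, τ x.1 x.2)) (μa.prod μb) (μa.prod μc) := by
  have hm' : Measurable fun x : α × β => (x.1, τ x.1 x.2) := measurable_fst.prodMk hm
  refine ⟨hm', AbsolutelyContinuous.mk fun E hE h0 => ?_⟩
  rw [map_apply hm' hE, measure_prod_null (hm' hE)]
  rw [measure_prod_null hE] at h0
  filter_upwards [h0, h] with a ha hτ
  exact hτ.preimage_null ha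

theorem qmp_swap [SFinite μa] [SFinite μb] :
    QuasiMeasurePreserving (Prod.swap : α × β → β × α) (μa.prod μb) (μb.prod μa) :=
  measurePreserving_swap.quasiMeasurePreserving

theorem qmp_prodMap [SFinite μa] [SFinite μb] [SFinite μc] [SFinite μd] {f : α → β} {g : γ → δ}
    (hf : QuasiMeasurePreserving f μa μb) (hg : QuasiMeasurePreserving g μc μd) :
    QuasiMeasurePreserving (fun x : α × γ => (f x.1, g x.2)) (μa.prod μc) (μb.prod μd) := by
  have h1 : QuasiMeasurePreserving (fun x : α × γ => (x.1, g x.2)) (μa.prod μc) (μa.prod μd) :=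
    qmp_skew (τ := fun _ => g) (hg.measurable.comp measurable_snd) (Filter.Eventually.of_forall
      fun _ => hg)
  have h2 : QuasiMeasurePreserving (fun x : δ × α => (x.1, f x.2)) (μd.prod μa) (μd.prod μb) :=
    qmp_skew (τ := fun _ => f) (hf.measurable.comp measurable_snd) (Filter.Eventually.of_forall
      fun _ => hf)
  exact qmp_swap.comp (h2.comp (qmp_swap.comp h1))

theorem qmp_left_comm [SFinite μa] [SFinite μb] [SFinite μc] :
    QuasiMeasurePreserving (fun x : α × β × γ => (x.2.1, x.1, x.2.2)) (μa.prod (μb.prod μc))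
      (μb.prod (μa.prod μc)) := by
  have h1 : QuasiMeasurePreserving (MeasurableEquiv.prodAssoc : (α × β) × γ ≃ᵐ α × β × γ).symm
      (μa.prod (μb.prod μc)) ((μa.prod μb).prod μc) := by
    refine ⟨MeasurableEquiv.measurable _, ?_⟩
    rw [← Measure.prodAssoc_prod, MeasurableEquiv.map_symm_map]
  have h2 : QuasiMeasurePreserving (MeasurableEquiv.prodAssoc : (β × α) × γ ≃ᵐ β × α × γ)
      ((μb.prod μa).prod μc) (μb.prod (μa.prod μc)) := by
    refine ⟨MeasurableEquiv.measurable _, ?_⟩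
    rw [Measure.prodAssoc_prod]
  exact h2.comp ((qmp_prodMap qmp_swap (.id μc)).comp h1)

theorem qmp_skew_left [SFinite μa] [SFinite μb] [SFinite μc] {τ : α → β → γ}
    (hm : Measurable fun x : α × β => τ x.1 x.2)
    (h : ∀ᵐ a ∂μa, QuasiMeasurePreserving (τ a) μb μc) :
    QuasiMeasurePreserving (fun x : β × α => (τ x.2 x.1, x.2)) (μb.prod μa) (μc.prod μa) :=
  qmp_swap.comp ((qmp_skew hm h).comp qmp_swap)

theorem qmp_cons [SigmaFinite μa] (p : ℕ) :
    QuasiMeasurePreserving (fun x : α × (Fin p → α) => (Fin.cons x.1 x.2 : Fin (p + 1) → α))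
      (μa.prod (Measure.pi fun _ => μa)) (Measure.pi fun _ => μa) := by
  have h := (measurePreserving_piFinSuccAbove (fun _ : Fin (p + 1) => μa) 0).symm
    |>.quasiMeasurePreserving
  have e : (fun x : α × (Fin p → α) => (Fin.cons x.1 x.2 : Fin (p + 1) → α)) =
      (MeasurableEquiv.piFinSuccAbove (fun _ : Fin (p + 1) => α) 0).symm := by
    funext x
    exact (Fin.insertNth_zero' x.1 x.2).symm
  rw [e]
  exact h

theorem qmp_succAbove [SigmaFinite μa] {p : ℕ} (k : Fin (p + 1)) :
    QuasiMeasurePreserving (fun (x : Fin (p + 1) → α) i => x (k.succAbove i))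
      (Measure.pi fun _ => μa) (Measure.pi fun _ => μa) :=
  quasiMeasurePreserving_snd.comp
    (measurePreserving_piFinSuccAbove (fun _ : Fin (p + 1) => μa) k).quasiMeasurePreserving

end QuasiMeasurePreserving

/-! ### The homogeneous coboundary in one variable -/

section HomogeneousCoboundary

variable {Z : Type*} {Y : Type*} {A : Type*} [AddCommGroup A]

/-- The homogeneous coboundary. -/
def hd (h : ∀ p, (Fin p → Z) → A) : ∀ p, (Fin p → Z) → A
  | 0, _ => 0
  | p + 1, b => ∑ k : Fin (p + 1), (-1 : ℤ) ^ (k : ℕ) • h p fun i => b (k.succAbove i)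

theorem hd_succ (h : ∀ p, (Fin p → Z) → A) (p : ℕ) (b : Fin (p + 1) → Z) :
    hd h (p + 1) b =
      ∑ k : Fin (p + 1), (-1 : ℤ) ^ (k : ℕ) • h p fun i => b (k.succAbove i) := rfl

/-- Omitting the first point returns `b`; omitting any other point keeps `z` in front and shifts the
sign. This is the identity behind all contracting homotopies below: where `hd h` vanishes, `h` is
the coboundary of `h` with `z` prepended. -/
theorem hd_cons (h : ∀ p, (Fin p → Z) → A) (p : ℕ) (z : Z) (b : Fin p → Z) :
    hd h (p + 1) (Fin.cons z b : Fin (p + 1) → Z) =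
      h p b - hd (fun p b => h (p + 1) (Fin.cons z b : Fin (p + 1) → Z)) p b := by
  rw [hd_succ, Fin.sum_univ_succ, sub_eq_add_neg]
  have e0 : (fun i => (Fin.cons z b : Fin (p + 1) → Z) ((0 : Fin (p + 1)).succAbove i)) = b := by
    funext i
    simp
  rw [e0, Fin.val_zero, pow_zero, one_smul]
  congr 1
  cases p with
  | zero => simp [hd]
  | succ p =>
    rw [hd_succ, ← Finset.sum_neg_distrib]
    refine Finset.sum_congr rfl fun k _ => ?_
    have e : (fun i => (Fin.cons z b : Fin (p + 2) → Z) (k.succ.succAbove i)) =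
        Fin.cons z fun i => b (k.succAbove i) := by
      funext i
      refine Fin.cases ?_ (fun i => ?_) i
      · simp
      · simp
    rw [e, Fin.val_succ, pow_succ, mul_neg_one, neg_smul]

theorem hd_eq_zero {h : ∀ p, (Fin p → Z) → A} {p : ℕ} {b : Fin p → Z}
    (h0 : ∀ p', p' + 1 = p → ∀ b', h p' b' = 0) : hd h p b = 0 := by
  cases p with
  | zero => rfl
  | succ p => exact Finset.sum_eq_zero fun k _ => by rw [h0 p rfl, smul_zero]

theorem hd_congr {h h' : ∀ p, (Fin p → Z) → A} {p : ℕ} {b : Fin p → Z}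
    (e : ∀ p', p' + 1 = p → ∀ b', h p' b' = h' p' b') : hd h p b = hd h' p b := by
  cases p with
  | zero => rfl
  | succ p => exact Finset.sum_congr rfl fun k _ => by rw [e p rfl]

theorem hd_add (h h' : ∀ p, (Fin p → Z) → A) (p : ℕ) (b : Fin p → Z) :
    hd (fun p b => h p b + h' p b) p b = hd h p b + hd h' p b := by
  cases p with
  | zero => exact (add_zero 0).symm
  | succ p => simp only [hd, smul_add, Finset.sum_add_distrib]

theorem hd_zsmul (c : ℤ) (h : ∀ p, (Fin p → Z) → A) (p : ℕ) (b : Fin p → Z) :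
    hd (fun p b => c • h p b) p b = c • hd h p b := by
  cases p with
  | zero => exact (smul_zero c).symm
  | succ p => simp only [hd, Finset.smul_sum, smul_comm c]

/-- The coboundary changes the number of variables by one, so it anticommutes with the sign given by
that number. The offset `c` stands for the number of variables of the other kinds. -/
theorem hd_alternating (c : ℕ) (h : ∀ p, (Fin p → Z) → A) (p : ℕ) (b : Fin p → Z) :
    hd (fun p b => (-1 : ℤ) ^ (p + c) • h p b) p b = -((-1 : ℤ) ^ (p + c) • hd h p b) := by
  cases p with
  | zero => simp [hd]
  | succ p =>
    rw [hd, hd, Finset.smul_sum, ← Finset.sum_neg_distrib]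
    refine Finset.sum_congr rfl fun k _ => ?_
    rw [smul_comm, Nat.succ_add, pow_succ, mul_neg_one, neg_smul, neg_neg]

theorem hd_sub (h h' : ∀ p, (Fin p → Z) → A) (p : ℕ) (b : Fin p → Z) :
    hd (fun p b => h p b - h' p b) p b = hd h p b - hd h' p b := by
  have := hd_add h (fun p b => (-1 : ℤ) • h' p b) p b
  rw [hd_zsmul] at this
  simpa [sub_eq_add_neg] using this

/-- Split off the first point twice with `hd_cons`: the terms without it cancel, and what remains is
the same assertion for `h` with its first point fixed. -/
theorem hd_hd (h : ∀ p, (Fin p → Z) → A) (p : ℕ) (b : Fin p → Z) : hd (hd h) p b = 0 := by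
  induction p generalizing h with
  | zero => rfl
  | succ p ih =>
    rw [← Fin.cons_self_tail b, hd_cons]
    simp only [hd_cons]
    rw [hd_sub, ih, sub_zero, sub_self]

theorem hd_smul {S : Type*} [Monoid S] [DistribMulAction S A] [SMul S Z] {s : S}
    {h h' : ∀ p, (Fin p → Z) → A} (e : ∀ p b, h p (s • b) = s • h' p b) (p : ℕ) (b : Fin p → Z) :
    hd h p (s • b) = s • hd h' p b := by
  cases p with
  | zero => exact (smul_zero s).symm
  | succ p =>
    rw [hd_succ, hd_succ, Finset.smul_sum]
    refine Finset.sum_congr rfl fun k _ => ?_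
    rw [smul_comm s, ← e]
    rfl

theorem hd_comm (h : ∀ p q, (Fin p → Z) → (Fin q → Y) → A) (p q : ℕ) (b : Fin p → Z)
    (c : Fin q → Y) : hd (fun p b => hd (fun q c => h p q b c) q c) p b =
      hd (fun q c => hd (fun p b => h p q b c) p b) q c := by
  cases p with
  | zero =>
    symm
    exact hd_eq_zero fun _ _ _ => rfl
  | succ p =>
    cases q with
    | zero => exact hd_eq_zero fun _ _ _ => rfl
    | succ q =>
      simp only [hd, Finset.smul_sum]
      rw [Finset.sum_comm]
      exact Finset.sum_congr rfl fun _ _ => Finset.sum_congr rfl fun _ _ => smul_comm _ _ _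

end HomogeneousCoboundary

/-! ### Homogeneous cochains in three kinds of variables -/

section Families

variable (G X₁ X₂ : Type u) (A : Type v)

/-- Families of functions of `n + q + p` variables of three kinds. -/
abbrev Fam : Type (max u v) :=
  ∀ n q p : ℕ, (Fin n → G) × (Fin q → X₁) × (Fin p → X₂) → A

variable {G X₁ X₂ A} [AddCommGroup A]

/-- Coboundary in the variables of the first kind. -/
def D0 (f : Fam G X₁ X₂ A) : Fam G X₁ X₂ A := fun n q p x =>
  hd (fun n g => f n q p (g, x.2.1, x.2.2)) n x.1

/-- Coboundary in the variables of the second kind. -/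
def D1 (f : Fam G X₁ X₂ A) : Fam G X₁ X₂ A := fun n q p x =>
  hd (fun q a => f n q p (x.1, a, x.2.2)) q x.2.1

/-- Coboundary in the variables of the third kind. -/
def D2 (f : Fam G X₁ X₂ A) : Fam G X₁ X₂ A := fun n q p x =>
  hd (fun p b => f n q p (x.1, x.2.1, b)) p x.2.2

/-- The total coboundary. -/
def famD : Fam G X₁ X₂ A →+ Fam G X₁ X₂ A :=
  AddMonoidHom.mk'
    (fun f n q p x => D0 f n q p x + (-1 : ℤ) ^ n • D1 f n q p x +
      (-1 : ℤ) ^ (n + q) • D2 f n q p x)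
    (by
      intro f f'
      funext n q p x
      simp only [D0, D1, D2, Pi.add_apply, hd_add, smul_add]
      abel)

theorem famD_apply (f : Fam G X₁ X₂ A) (n q p : ℕ)
    (x : (Fin n → G) × (Fin q → X₁) × (Fin p → X₂)) :
    famD f n q p x = D0 f n q p x + (-1 : ℤ) ^ n • D1 f n q p x +
      (-1 : ℤ) ^ (n + q) • D2 f n q p x := rfl

/-- The three coboundaries have square zero and commute. The signs turn commuting into anticommuting
(`hd_alternating`), so the mixed terms cancel. -/
theorem famD_famD (f : Fam G X₁ X₂ A) : famD (famD f) = 0 := by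
  funext n q p x
  obtain ⟨g, a, b⟩ := x
  simp only [famD_apply, D0, D1, D2, hd_add, hd_zsmul, Pi.zero_apply, hd_hd, smul_zero, zero_add]
  have h1 := hd_alternating 0 (fun n g => hd (fun q a => f n q p (g, a, b)) q a) n g
  have h2 := hd_alternating q (fun n g => hd (fun p b => f n q p (g, a, b)) p b) n g
  have h3 := hd_alternating n (fun q a => hd (fun p b => f n q p (g, a, b)) p b) q a
  simp only [add_zero] at h1
  simp only [add_comm _ n] at h3
  rw [h1, h2, h3, hd_comm (fun q n a g => f n q p (g, a, b)),
    hd_comm (fun p n b g => f n q p (g, a, b)), hd_comm (fun p q b a => f n q p (g, a, b))]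
  simp only [smul_add, smul_neg, add_zero]
  rw [smul_comm ((-1 : ℤ) ^ (n + q)) ((-1 : ℤ) ^ n)]
  abel

variable [MeasurableSpace G] [MeasurableSpace X₁] [MeasurableSpace X₂]
  (μ₀ : Measure G) (μ₁ : Measure X₁) (μ₂ : Measure X₂)

/-- The product measure. -/
abbrev famMeasure (n q p : ℕ) : Measure ((Fin n → G) × (Fin q → X₁) × (Fin p → X₂)) :=
  (Measure.pi fun _ => μ₀).prod ((Measure.pi fun _ => μ₁).prod (Measure.pi fun _ => μ₂))

variable [SigmaFinite μ₀] [SigmaFinite μ₁] [SigmaFinite μ₂]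

theorem qmp_face0 {n q p : ℕ} (k : Fin (n + 1)) :
    QuasiMeasurePreserving (fun x : (Fin (n + 1) → G) × (Fin q → X₁) × (Fin p → X₂) =>
      ((fun i => x.1 (k.succAbove i)), x.2.1, x.2.2)) (famMeasure μ₀ μ₁ μ₂ (n + 1) q p)
      (famMeasure μ₀ μ₁ μ₂ n q p) :=
  qmp_prodMap (qmp_succAbove k) (.id _)

theorem qmp_face1 {n q p : ℕ} (k : Fin (q + 1)) :
    QuasiMeasurePreserving (fun x : (Fin n → G) × (Fin (q + 1) → X₁) × (Fin p → X₂) =>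
      (x.1, (fun i => x.2.1 (k.succAbove i)), x.2.2)) (famMeasure μ₀ μ₁ μ₂ n (q + 1) p)
      (famMeasure μ₀ μ₁ μ₂ n q p) :=
  qmp_prodMap (.id _) (qmp_prodMap (qmp_succAbove k) (.id _))

theorem qmp_face2 {n q p : ℕ} (k : Fin (p + 1)) :
    QuasiMeasurePreserving (fun x : (Fin n → G) × (Fin q → X₁) × (Fin (p + 1) → X₂) =>
      (x.1, x.2.1, fun i => x.2.2 (k.succAbove i))) (famMeasure μ₀ μ₁ μ₂ n q (p + 1))
      (famMeasure μ₀ μ₁ μ₂ n q p) :=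
  qmp_prodMap (.id _) (qmp_prodMap (.id _) (qmp_succAbove k))

section AEZero

variable {f : Fam G X₁ X₂ A} {n q p : ℕ}

theorem ae_D0 (h : ∀ m, m + 1 = n → ∀ᵐ x ∂famMeasure μ₀ μ₁ μ₂ m q p, f m q p x = 0) :
    ∀ᵐ x ∂famMeasure μ₀ μ₁ μ₂ n q p, D0 f n q p x = 0 := by
  cases n with
  | zero => exact Filter.Eventually.of_forall fun _ => rfl
  | succ n =>
    have := ae_all_iff.2 fun k => (qmp_face0 μ₀ μ₁ μ₂ k).ae (h n rfl)
    filter_upwards [this] with x hx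
    rw [D0, hd_succ]
    exact Finset.sum_eq_zero fun k _ => (congrArg _ (hx k)).trans (smul_zero _)

theorem ae_D1 (h : ∀ m, m + 1 = q → ∀ᵐ x ∂famMeasure μ₀ μ₁ μ₂ n m p, f n m p x = 0) :
    ∀ᵐ x ∂famMeasure μ₀ μ₁ μ₂ n q p, D1 f n q p x = 0 := by
  cases q with
  | zero => exact Filter.Eventually.of_forall fun _ => rfl
  | succ q =>
    have := ae_all_iff.2 fun k => (qmp_face1 μ₀ μ₁ μ₂ k).ae (h q rfl)
    filter_upwards [this] with x hx
    rw [D1, hd_succ]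
    exact Finset.sum_eq_zero fun k _ => (congrArg _ (hx k)).trans (smul_zero _)

theorem ae_D2 (h : ∀ m, m + 1 = p → ∀ᵐ x ∂famMeasure μ₀ μ₁ μ₂ n q m, f n q m x = 0) :
    ∀ᵐ x ∂famMeasure μ₀ μ₁ μ₂ n q p, D2 f n q p x = 0 := by
  cases p with
  | zero => exact Filter.Eventually.of_forall fun _ => rfl
  | succ p =>
    have := ae_all_iff.2 fun k => (qmp_face2 μ₀ μ₁ μ₂ k).ae (h p rfl)
    filter_upwards [this] with x hx
    rw [D2, hd_succ]
    exact Finset.sum_eq_zero fun k _ => (congrArg _ (hx k)).trans (smul_zero _)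

end AEZero

/-- Families that vanish almost everywhere in the degrees given by `V`. -/
def famNull (V : ℕ → ℕ → ℕ → Prop) : AddSubgroup (Fam G X₁ X₂ A) where
  carrier := {f | ∀ n q p, V n q p → ∀ᵐ x ∂famMeasure μ₀ μ₁ μ₂ n q p, f n q p x = 0}
  zero_mem' := fun _ _ _ _ => Filter.Eventually.of_forall fun _ => rfl
  add_mem' {f f'} hf hf' n q p h := by
    filter_upwards [hf n q p h, hf' n q p h] with x h1 h2
    simp [h1, h2]
  neg_mem' {f} hf n q p h := by
    filter_upwards [hf n q p h] with x h1
    simp [h1]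

/-- In a given degree the coboundary reads the family in degrees with one variable less, hence the
closure conditions on `V`. -/
theorem famD_mem_famNull {f : Fam G X₁ X₂ A} {V : ℕ → ℕ → ℕ → Prop}
    (h0 : ∀ n q p, V (n + 1) q p → V n q p)
    (h1 : ∀ n q p, V n (q + 1) p → V n q p) (h2 : ∀ n q p, V n q (p + 1) → V n q p)
    (hf : f ∈ famNull μ₀ μ₁ μ₂ V) : famD f ∈ famNull μ₀ μ₁ μ₂ V := by
  intro n q p hV
  have e0 : ∀ᵐ x ∂famMeasure μ₀ μ₁ μ₂ n q p, D0 f n q p x = 0 := ae_D0 μ₀ μ₁ μ₂ (by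
    rintro n rfl
    exact hf _ _ _ (h0 _ _ _ hV))
  have e1 : ∀ᵐ x ∂famMeasure μ₀ μ₁ μ₂ n q p, D1 f n q p x = 0 := ae_D1 μ₀ μ₁ μ₂ (by
    rintro n rfl
    exact hf _ _ _ (h1 _ _ _ hV))
  have e2 : ∀ᵐ x ∂famMeasure μ₀ μ₁ μ₂ n q p, D2 f n q p x = 0 := ae_D2 μ₀ μ₁ μ₂ (by
    rintro n rfl
    exact hf _ _ _ (h2 _ _ _ hV))
  filter_upwards [e0, e1, e2] with x h0 h1 h2
  simp [famD_apply, h0, h1, h2]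

variable [Group G] [MulAction G X₁] [MulAction G X₂] [TopologicalSpace A]
  [IsTopologicalAddGroup A] [DistribMulAction G A]

/-- Strictly equivariant measurable families that vanish in the degrees given by `L`. -/
def famMeas (L : ℕ → ℕ → ℕ → Prop) : AddSubgroup (Fam G X₁ X₂ A) where
  carrier := {f | (∀ n q p, AEStronglyMeasurable (f n q p) (famMeasure μ₀ μ₁ μ₂ n q p)) ∧
    (∀ n q p (s : G) x, f n q p (s • x) = s • f n q p x) ∧ ∀ n q p, L n q p → f n q p = 0}
  zero_mem' := ⟨fun _ _ _ => aestronglyMeasurable_const, fun _ _ _ s _ => (smul_zero s).symm,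
    fun _ _ _ _ => rfl⟩
  add_mem' {f f'} hf hf' := ⟨fun n q p => (hf.1 n q p).add (hf'.1 n q p),
    fun n q p s x => by simp only [Pi.add_apply, hf.2.1, hf'.2.1, smul_add],
    fun n q p h => by simp only [Pi.add_apply, hf.2.2 n q p h, hf'.2.2 n q p h, add_zero]⟩
  neg_mem' {f} hf := ⟨fun n q p => (hf.1 n q p).neg,
    fun n q p s x => by simp only [Pi.neg_apply, hf.2.1, smul_neg],
    fun n q p h => by simp only [Pi.neg_apply, hf.2.2 n q p h, neg_zero]⟩

section

variable {μ₀ μ₁ μ₂} {f : Fam G X₁ X₂ A} {L L' : ℕ → ℕ → ℕ → Prop}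

theorem aesm_D0 (hf : ∀ n q p, AEStronglyMeasurable (f n q p) (famMeasure μ₀ μ₁ μ₂ n q p))
    (n q p : ℕ) : AEStronglyMeasurable (D0 f n q p) (famMeasure μ₀ μ₁ μ₂ n q p) := by
  cases n with
  | zero => exact aestronglyMeasurable_const (b := (0 : A))
  | succ n =>
    exact Finset.aestronglyMeasurable_fun_sum
      (f := fun (k : Fin (n + 1)) (x : (Fin (n + 1) → G) × (Fin q → X₁) × (Fin p → X₂)) =>
        (-1 : ℤ) ^ (k : ℕ) • f n q p (fun i => x.1 (k.succAbove i), x.2.1, x.2.2))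
      Finset.univ fun k _ => ((hf n q p).comp_quasiMeasurePreserving
      (qmp_face0 μ₀ μ₁ μ₂ k)).const_smul ((-1 : ℤ) ^ (k : ℕ))

theorem aesm_D1 (hf : ∀ n q p, AEStronglyMeasurable (f n q p) (famMeasure μ₀ μ₁ μ₂ n q p))
    (n q p : ℕ) : AEStronglyMeasurable (D1 f n q p) (famMeasure μ₀ μ₁ μ₂ n q p) := by
  cases q with
  | zero => exact aestronglyMeasurable_const (b := (0 : A))
  | succ q =>
    exact Finset.aestronglyMeasurable_fun_sum
      (f := fun (k : Fin (q + 1)) (x : (Fin n → G) × (Fin (q + 1) → X₁) × (Fin p → X₂)) =>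
        (-1 : ℤ) ^ (k : ℕ) • f n q p (x.1, fun i => x.2.1 (k.succAbove i), x.2.2))
      Finset.univ fun k _ => ((hf n q p).comp_quasiMeasurePreserving
      (qmp_face1 μ₀ μ₁ μ₂ k)).const_smul ((-1 : ℤ) ^ (k : ℕ))

theorem aesm_D2 (hf : ∀ n q p, AEStronglyMeasurable (f n q p) (famMeasure μ₀ μ₁ μ₂ n q p))
    (n q p : ℕ) : AEStronglyMeasurable (D2 f n q p) (famMeasure μ₀ μ₁ μ₂ n q p) := by
  cases p with
  | zero => exact aestronglyMeasurable_const (b := (0 : A))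
  | succ p =>
    exact Finset.aestronglyMeasurable_fun_sum
      (f := fun (k : Fin (p + 1)) (x : (Fin n → G) × (Fin q → X₁) × (Fin (p + 1) → X₂)) =>
        (-1 : ℤ) ^ (k : ℕ) • f n q p (x.1, x.2.1, fun i => x.2.2 (k.succAbove i)))
      Finset.univ fun k _ => ((hf n q p).comp_quasiMeasurePreserving
      (qmp_face2 μ₀ μ₁ μ₂ k)).const_smul ((-1 : ℤ) ^ (k : ℕ))

/-- The total coboundary of a measurable family. -/
theorem famD_mem_famMeas (h0 : ∀ n q p, L' (n + 1) q p → L n q p)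
    (h1 : ∀ n q p, L' n (q + 1) p → L n q p) (h2 : ∀ n q p, L' n q (p + 1) → L n q p)
    (hf : f ∈ famMeas μ₀ μ₁ μ₂ L) : famD f ∈ famMeas μ₀ μ₁ μ₂ L' := by
  refine ⟨fun n q p => ?_, fun n q p s x => ?_, fun n q p hL => ?_⟩
  · exact ((aesm_D0 hf.1 n q p).add ((aesm_D1 hf.1 n q p).const_smul ((-1 : ℤ) ^ n))).add
      ((aesm_D2 hf.1 n q p).const_smul ((-1 : ℤ) ^ (n + q)))
  · obtain ⟨g, a, b⟩ := x
    have e0 : D0 f n q p (s • (g, a, b)) = s • D0 f n q p (g, a, b) :=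
      hd_smul (fun n g => hf.2.1 n q p s (g, a, b)) n g
    have e1 : D1 f n q p (s • (g, a, b)) = s • D1 f n q p (g, a, b) :=
      hd_smul (fun q a => hf.2.1 n q p s (g, a, b)) q a
    have e2 : D2 f n q p (s • (g, a, b)) = s • D2 f n q p (g, a, b) :=
      hd_smul (fun p b => hf.2.1 n q p s (g, a, b)) p b
    rw [famD_apply, famD_apply, e0, e1, e2, smul_add, smul_add, smul_comm s, smul_comm s]
  · funext x
    have e0 : D0 f n q p x = 0 := hd_eq_zero (by
      rintro n rfl g
      rw [hf.2.2 _ _ _ (h0 _ _ _ hL)]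
      rfl)
    have e1 : D1 f n q p x = 0 := hd_eq_zero (by
      rintro q rfl g
      rw [hf.2.2 _ _ _ (h1 _ _ _ hL)]
      rfl)
    have e2 : D2 f n q p x = 0 := hd_eq_zero (by
      rintro q rfl g
      rw [hf.2.2 _ _ _ (h2 _ _ _ hL)]
      rfl)
    rw [famD_apply, e0, e1, e2]
    simp

end

/-- Sets of degrees that are closed under removing variables. -/
structure Lower (V : ℕ → ℕ → ℕ → Prop) : Prop where
  lower0 : ∀ n q p, V (n + 1) q p → V n q p
  lower1 : ∀ n q p, V n (q + 1) p → V n q p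
  lower2 : ∀ n q p, V n q (p + 1) → V n q p

/-- Homogeneous cochains on the degrees in `V`, relative to the degrees in `L`; the degree `m` is the
number of variables minus `k`. -/
def Rel (A : Type v) [AddCommGroup A] [TopologicalSpace A] [IsTopologicalAddGroup A]
    [DistribMulAction G A] (V L : ℕ → ℕ → ℕ → Prop) (k : ℕ) : MeasComplex where
  C _ := Fam G X₁ X₂ A
  meas m := famMeas μ₀ μ₁ μ₂ fun n q p => L n q p ∨ n + q + p ≠ m + k
  null _ := famNull μ₀ μ₁ μ₂ V
  d _ := famD

theorem Rel_good {V L : ℕ → ℕ → ℕ → Prop} (hV : Lower V) (hL : Lower L) (k : ℕ) :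
    (Rel μ₀ μ₁ μ₂ A V L k).Good where
  d_meas m f hf := famD_mem_famMeas
    (fun n q p h => h.imp (hL.lower0 n q p) fun h => by omega)
    (fun n q p h => h.imp (hL.lower1 n q p) fun h => by omega)
    (fun n q p h => h.imp (hL.lower2 n q p) fun h => by omega) hf
  d_null m f hf := famD_mem_famNull μ₀ μ₁ μ₂ hV.lower0 hV.lower1 hV.lower2 hf
  d_d m f hf := by
    exact (congrArg (· ∈ famNull μ₀ μ₁ μ₂ V) (famD_famD (f : Fam G X₁ X₂ A))).mpr (zero_mem _)

end Families

end KacCohomology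

end

noncomputable section

namespace KacCohomology

/-! ### Exactness in one kind of variables -/

section Exactness

variable {G X₁ X₂ : Type u} {A : Type v} [AddCommGroup A]
  [MeasurableSpace G] [MeasurableSpace X₁] [MeasurableSpace X₂]
  {μ₀ : Measure G} {μ₁ : Measure X₁} {μ₂ : Measure X₂}
  [SigmaFinite μ₀] [SigmaFinite μ₁] [SigmaFinite μ₂]
  [Group G] [MulAction G X₁] [MulAction G X₂] [TopologicalSpace A]
  [IsTopologicalAddGroup A] [DistribMulAction G A]

/-- Exactness follows from exactness of the leading terms for a filtration by the number of some of
the variables. -/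
theorem exists_primitive_of_step {V L : ℕ → ℕ → ℕ → Prop} (hL : Lower L)
    (deg : ℕ → ℕ → ℕ → ℕ) (hdeg : ∀ n q p, deg n q p ≤ n + q + p) (N : ℕ)
    (step : ∀ i, ∀ f ∈ famMeas (A := A) μ₀ μ₁ μ₂ (fun n q p => L n q p ∨ n + q + p ≠ N),
      famD f ∈ famNull μ₀ μ₁ μ₂ V →
      (∀ n q p, V n q p → deg n q p < i → ∀ᵐ x ∂famMeasure μ₀ μ₁ μ₂ n q p, f n q p x = 0) →
      ∃ u ∈ famMeas (A := A) μ₀ μ₁ μ₂ (fun n q p => L n q p ∨ n + q + p + 1 ≠ N),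
        ∀ n q p, V n q p → deg n q p < i + 1 →
          ∀ᵐ x ∂famMeasure μ₀ μ₁ μ₂ n q p, f n q p x = famD u n q p x)
    (f : Fam G X₁ X₂ A) (hf : f ∈ famMeas μ₀ μ₁ μ₂ (fun n q p => L n q p ∨ n + q + p ≠ N))
    (hdf : famD f ∈ famNull μ₀ μ₁ μ₂ V) :
    ∃ u ∈ famMeas μ₀ μ₁ μ₂ (fun n q p => L n q p ∨ n + q + p + 1 ≠ N),
      f - famD u ∈ famNull μ₀ μ₁ μ₂ V := by
  have hd : ∀ u ∈ famMeas (A := A) μ₀ μ₁ μ₂ (fun n q p => L n q p ∨ n + q + p + 1 ≠ N),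
      famD u ∈ famMeas (A := A) μ₀ μ₁ μ₂ (fun n q p => L n q p ∨ n + q + p ≠ N) := fun u hu =>
    famD_mem_famMeas (fun n q p h => h.imp (hL.lower0 n q p) fun h => by omega)
      (fun n q p h => h.imp (hL.lower1 n q p) fun h => by omega)
      (fun n q p h => h.imp (hL.lower2 n q p) fun h => by omega) hu
  have key : ∀ i, ∃ u ∈ famMeas (A := A) μ₀ μ₁ μ₂ (fun n q p => L n q p ∨ n + q + p + 1 ≠ N),
      ∀ n q p, V n q p → deg n q p < i →
        ∀ᵐ x ∂famMeasure μ₀ μ₁ μ₂ n q p, (f - famD u) n q p x = 0 := by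
    intro i
    induction i with
    | zero => exact ⟨0, zero_mem _, fun n q p _ h => absurd h (Nat.not_lt_zero _)⟩
    | succ i ih =>
      obtain ⟨u, hu, h⟩ := ih
      obtain ⟨u', hu', h'⟩ := step i (f - famD u) (sub_mem hf (hd u hu)) (by
        rw [map_sub, famD_famD, sub_zero]
        exact hdf) h
      refine ⟨u + u', add_mem hu hu', fun n q p hV hd => ?_⟩
      filter_upwards [h' n q p hV hd] with x hx
      rw [map_add, ← sub_sub]
      simp only [Pi.sub_apply] at hx ⊢
      rw [hx, sub_self]
  -- A family of total degree `N` lives in filtration degrees at most `N`, so `N + 1` rounds exhaust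
  -- it.
  obtain ⟨u, hu, h⟩ := key (N + 1)
  refine ⟨u, hu, fun n q p hV => ?_⟩
  by_cases hN : n + q + p = N
  · exact h n q p hV (by have := hdeg n q p; omega)
  · refine Filter.Eventually.of_forall fun x => ?_
    rw [(sub_mem hf (hd u hu)).2.2 n q p (Or.inr hN)]
    rfl

section Third

variable [QuasiInvariant G μ₂] [MeasurableSMul₂ G X₂]

/-- For a fixed `z` the tuples containing the point g₀z may form a null set; only jointly in `z`
does the insertion respect null sets. It follows that almost every single `z` can be used for a
given null set. -/
theorem qmp_insert2 (n q p : ℕ) :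
    QuasiMeasurePreserving
      (fun y : X₂ × (Fin (n + 1) → G) × (Fin q → X₁) × (Fin p → X₂) =>
        (y.2.1, y.2.2.1, (Fin.cons (y.2.1 0 • y.1) y.2.2.2 : Fin (p + 1) → X₂)))
      (μ₂.prod (famMeasure μ₀ μ₁ μ₂ (n + 1) q p)) (famMeasure μ₀ μ₁ μ₂ (n + 1) q (p + 1)) :=
  (qmp_prodMap (.id _) ((qmp_prodMap (.id _) (qmp_cons p)).comp qmp_left_comm)).comp
    (qmp_left_comm.comp (qmp_skew_left
      (τ := fun (x : (Fin (n + 1) → G) × (Fin q → X₁) × (Fin p → X₂)) (z : X₂) => x.1 0 • z)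
      (((measurable_pi_apply 0).comp (measurable_fst.comp measurable_fst)).smul measurable_snd)
      (Filter.Eventually.of_forall fun x => QuasiInvariant.qmp (x.1 0))))

/-- Insertion of a point of the third kind. -/
def insert2 (i : ℕ) (f : Fam G X₁ X₂ A) (z : X₂) : Fam G X₁ X₂ A
  | 0, _, _ => 0
  | n + 1, q, p => fun x => if n + 1 + q = i then
      (-1 : ℤ) ^ i • f (n + 1) q (p + 1)
        (x.1, x.2.1, (Fin.cons (x.1 0 • z) x.2.2 : Fin (p + 1) → X₂)) else 0

/-- A point z of `X₂` yields the equivariant point g₀z, and its insertion contracts the complex in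
the variables of the third kind. Filtering by the number of the other variables leaves only `D2` in
the leading term. The sets `V` and `L` must not depend on p, and `L` contains the degrees n = 0, in
which there is no g₀. -/
theorem exists_primitive2 [NeZero μ₂] {V L : ℕ → ℕ → ℕ → Prop} (hV : Lower V) (hL : Lower L)
    (hV2 : ∀ n q p p', V n q p → V n q p') (hL2 : ∀ n q p p', L n q p → L n q p')
    (hL0 : ∀ q p, L 0 q p) (N : ℕ)
    (f : Fam G X₁ X₂ A) (hf : f ∈ famMeas μ₀ μ₁ μ₂ (fun n q p => L n q p ∨ n + q + p ≠ N))
    (hdf : famD f ∈ famNull μ₀ μ₁ μ₂ V) :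
    ∃ u ∈ famMeas μ₀ μ₁ μ₂ (fun n q p => L n q p ∨ n + q + p + 1 ≠ N),
      f - famD u ∈ famNull μ₀ μ₁ μ₂ V := by
  refine exists_primitive_of_step hL (fun n q _ => n + q) (fun n q p => by simp) N ?_ f hf hdf
  clear hf hdf f
  intro i f hf hdf h0
  -- In filtration degree `i` the other two coboundaries only see the family in filtration degree `i
  -- - 1`, where it vanishes. So the cocycle condition reduces to the vanishing of `D2 f`, up to a
  -- sign.
  have hD : ∀ n q p, V (n + 1) q p → n + 1 + q = i →
      ∀ᵐ x ∂famMeasure μ₀ μ₁ μ₂ (n + 1) q (p + 1), D2 f (n + 1) q (p + 1) x = 0 := by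
    intro n q p hv hi
    have hv := hV2 _ _ _ (p + 1) hv
    have e0 : ∀ᵐ x ∂famMeasure μ₀ μ₁ μ₂ (n + 1) q (p + 1), D0 f (n + 1) q (p + 1) x = 0 :=
      ae_D0 μ₀ μ₁ μ₂ (by
        intro m hm
        obtain rfl : m = n := by omega
        exact h0 _ _ _ (hV.lower0 _ _ _ hv) (by omega))
    have e1 : ∀ᵐ x ∂famMeasure μ₀ μ₁ μ₂ (n + 1) q (p + 1), D1 f (n + 1) q (p + 1) x = 0 :=
      ae_D1 μ₀ μ₁ μ₂ (by
        rintro m rfl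
        exact h0 _ _ _ (hV.lower1 _ _ _ hv) (by omega))
    filter_upwards [e0, e1, hdf _ _ _ hv] with x h1 h2 h3
    rw [famD_apply, h1, h2, smul_zero, add_zero, zero_add] at h3
    have := congrArg (fun y => (-1 : ℤ) ^ (n + 1 + q) • y) h3
    simpa only [smul_smul, ← pow_add, Even.neg_one_pow ⟨n + 1 + q, rfl⟩, one_smul, smul_zero]
      using this
  -- By Fubini almost every `z` serves for all of the countably many degrees, both for the cocycle
  -- identity and for the measurability of the slice.
  obtain ⟨z, hz1, hz2⟩ : ∃ z : X₂,
      (∀ n q p, V (n + 1) q p → n + 1 + q = i → ∀ᵐ x ∂famMeasure μ₀ μ₁ μ₂ (n + 1) q p,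
        D2 f (n + 1) q (p + 1)
          (x.1, x.2.1, (Fin.cons (x.1 0 • z) x.2.2 : Fin (p + 1) → X₂)) = 0) ∧
      (∀ n q p, AEStronglyMeasurable (fun x => f (n + 1) q (p + 1)
          (x.1, x.2.1, (Fin.cons (x.1 0 • z) x.2.2 : Fin (p + 1) → X₂)))
          (famMeasure μ₀ μ₁ μ₂ (n + 1) q p)) := by
    have a1 : ∀ᵐ z ∂μ₂, ∀ n q p, V (n + 1) q p → n + 1 + q = i →
        ∀ᵐ x ∂famMeasure μ₀ μ₁ μ₂ (n + 1) q p, D2 f (n + 1) q (p + 1)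
          (x.1, x.2.1, (Fin.cons (x.1 0 • z) x.2.2 : Fin (p + 1) → X₂)) = 0 := by
      simp only [ae_all_iff, Filter.eventually_imp_distrib_left]
      intro n q p hv hi
      exact ae_ae_of_ae_prod ((qmp_insert2 n q p).ae (hD n q p hv hi))
    have a2 : ∀ᵐ z ∂μ₂, ∀ n q p, AEStronglyMeasurable (fun x => f (n + 1) q (p + 1)
          (x.1, x.2.1, (Fin.cons (x.1 0 • z) x.2.2 : Fin (p + 1) → X₂)))
          (famMeasure μ₀ μ₁ μ₂ (n + 1) q p) := by
      simp only [ae_all_iff]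
      intro n q p
      exact ((hf.1 (n + 1) q (p + 1)).comp_quasiMeasurePreserving (qmp_insert2 n q p)).prodMk_left
    exact (a1.and a2).exists
  have hdegu : ∀ n q p x, n + q ≠ i → insert2 i f z n q p x = 0 := by
    intro n q p x h
    cases n with
    | zero => rfl
    | succ n => exact if_neg h
  refine ⟨insert2 i f z, ⟨?_, ?_, ?_⟩, ?_⟩
  · intro n q p
    cases n with
    | zero => exact aestronglyMeasurable_const (b := (0 : A))
    | succ n =>
      by_cases h : n + 1 + q = i
      · simp only [insert2, if_pos h]
        exact (hz2 n q p).const_smul ((-1 : ℤ) ^ i)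
      · simp only [insert2, if_neg h]
        exact aestronglyMeasurable_const
  · intro n q p s x
    cases n with
    | zero => exact (smul_zero s).symm
    | succ n =>
      by_cases h : n + 1 + q = i
      · simp only [insert2, if_pos h]
        rw [smul_comm s, ← hf.2.1]
        congr 2
        refine Prod.ext rfl (Prod.ext rfl ?_)
        funext j
        refine Fin.cases ?_ (fun j => ?_) j
        · exact mul_smul s (x.1 0) z
        · rfl
      · simp only [insert2, if_neg h, smul_zero]
  · intro n q p h
    cases n with
    | zero => rfl
    | succ n =>
      funext x
      have : f (n + 1) q (p + 1) = 0 :=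
        hf.2.2 _ _ _ (h.imp (hL2 _ _ _ _) fun h => by omega)
      simp [insert2, this]
  · intro n q p hv hi
    have e0 : ∀ x, D0 (insert2 i f z) n q p x = 0 := fun x => hd_eq_zero fun m hm g =>
      hdegu _ _ _ _ (by omega)
    have e1 : ∀ x, D1 (insert2 i f z) n q p x = 0 := fun x => hd_eq_zero fun m hm g =>
      hdegu _ _ _ _ (by omega)
    by_cases hi' : n + q = i
    · cases n with
      | zero =>
        rw [hf.2.2 _ _ _ (Or.inl (hL0 q p))]
        refine Filter.Eventually.of_forall fun x => ?_
        have e2 : D2 (insert2 i f z) 0 q p x = 0 := hd_eq_zero fun m hm g => rfl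
        rw [famD_apply, e0, e1, e2]
        simp
      | succ n =>
        filter_upwards [hz1 n q p hv hi'] with x hx
        rw [famD_apply, e0, e1, smul_zero, add_zero, zero_add]
        -- The cocycle identity at the tuple with g₀z in front expresses `f` as the coboundary of
        -- the inserted cochain. The factor (-1)^i of `insert2` cancels the sign of `D2` in `famD`.
        rw [D2, hd_cons, sub_eq_zero] at hx
        rw [hx, D2]
        simp only [insert2, if_pos hi']
        rw [hd_zsmul, hi', smul_smul, ← pow_add, Even.neg_one_pow ⟨i, rfl⟩, one_smul]
    · filter_upwards [h0 n q p hv (by omega)] with x hx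
      have e2 : D2 (insert2 i f z) n q p x = 0 := hd_eq_zero fun m hm g => hdegu _ _ _ _ hi'
      rw [hx, famD_apply, e0, e1, e2]
      simp

end Third

section Second

variable [QuasiInvariant G μ₁] [MeasurableSMul₂ G X₁]

theorem qmp_insert1 (n q p : ℕ) :
    QuasiMeasurePreserving
      (fun y : X₁ × (Fin (n + 1) → G) × (Fin q → X₁) × (Fin p → X₂) =>
        (y.2.1, (Fin.cons (y.2.1 0 • y.1) y.2.2.1 : Fin (q + 1) → X₁), y.2.2.2))
      (μ₁.prod (famMeasure μ₀ μ₁ μ₂ (n + 1) q p)) (famMeasure μ₀ μ₁ μ₂ (n + 1) (q + 1) p) := by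
  have h1 : QuasiMeasurePreserving
      (fun y : X₁ × (Fin (n + 1) → G) × (Fin q → X₁) × (Fin p → X₂) =>
        (y.2.1 0 • y.1, y.2)) (μ₁.prod (famMeasure μ₀ μ₁ μ₂ (n + 1) q p))
      (μ₁.prod (famMeasure μ₀ μ₁ μ₂ (n + 1) q p)) := qmp_skew_left
      (τ := fun (x : (Fin (n + 1) → G) × (Fin q → X₁) × (Fin p → X₂)) (z : X₁) => x.1 0 • z)
      (((measurable_pi_apply 0).comp (measurable_fst.comp measurable_fst)).smul measurable_snd)
      (Filter.Eventually.of_forall fun x => QuasiInvariant.qmp (x.1 0))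
  have h2 : QuasiMeasurePreserving
      (fun y : X₁ × (Fin q → X₁) × (Fin p → X₂) =>
        ((Fin.cons y.1 y.2.1 : Fin (q + 1) → X₁), y.2.2))
      (μ₁.prod ((Measure.pi fun _ => μ₁).prod (Measure.pi fun _ => μ₂)))
      ((Measure.pi fun _ => μ₁).prod (Measure.pi fun _ => μ₂)) := by
    have h3 : QuasiMeasurePreserving
        (MeasurableEquiv.prodAssoc : (X₁ × (Fin q → X₁)) × (Fin p → X₂) ≃ᵐ _).symm
        (μ₁.prod ((Measure.pi fun _ => μ₁).prod (Measure.pi fun _ => μ₂)))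
        ((μ₁.prod (Measure.pi fun _ => μ₁)).prod (Measure.pi fun _ => μ₂)) := by
      refine ⟨MeasurableEquiv.measurable _, ?_⟩
      rw [← Measure.prodAssoc_prod, MeasurableEquiv.map_symm_map]
    exact (qmp_prodMap (qmp_cons q) (.id _)).comp h3
  exact (qmp_prodMap (.id _) h2).comp (qmp_left_comm.comp h1)

/-- Insertion of a point of the second kind. -/
def insert1 (i : ℕ) (f : Fam G X₁ X₂ A) (z : X₁) : Fam G X₁ X₂ A
  | 0, _, _ => 0
  | n + 1, q, p => fun x => if n + 1 + p = i then
      (-1 : ℤ) ^ (n + 1) • f (n + 1) (q + 1) p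
        (x.1, (Fin.cons (x.1 0 • z) x.2.1 : Fin (q + 1) → X₁), x.2.2) else 0

/-- The contraction by g₀z for the variables of the second kind. The filtration is by n + p, and the
sign in `insert1` is that of `D1` in `famD`. -/
theorem exists_primitive1 [NeZero μ₁] {V L : ℕ → ℕ → ℕ → Prop} (hV : Lower V) (hL : Lower L)
    (hV1 : ∀ n q q' p, V n q p → V n q' p) (hL1 : ∀ n q q' p, L n q p → L n q' p)
    (hL0 : ∀ q p, L 0 q p) (N : ℕ)
    (f : Fam G X₁ X₂ A) (hf : f ∈ famMeas μ₀ μ₁ μ₂ (fun n q p => L n q p ∨ n + q + p ≠ N))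
    (hdf : famD f ∈ famNull μ₀ μ₁ μ₂ V) :
    ∃ u ∈ famMeas μ₀ μ₁ μ₂ (fun n q p => L n q p ∨ n + q + p + 1 ≠ N),
      f - famD u ∈ famNull μ₀ μ₁ μ₂ V := by
  refine exists_primitive_of_step hL (fun n _ p => n + p) (fun n q p => by omega) N ?_
    f hf hdf
  clear hf hdf f
  intro i f hf hdf h0
  have hD : ∀ n q p, V (n + 1) q p → n + 1 + p = i →
      ∀ᵐ x ∂famMeasure μ₀ μ₁ μ₂ (n + 1) (q + 1) p, D1 f (n + 1) (q + 1) p x = 0 := by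
    intro n q p hv hi
    have hv := hV1 _ _ (q + 1) _ hv
    have e0 : ∀ᵐ x ∂famMeasure μ₀ μ₁ μ₂ (n + 1) (q + 1) p, D0 f (n + 1) (q + 1) p x = 0 :=
      ae_D0 μ₀ μ₁ μ₂ (by
        intro m hm
        obtain rfl : m = n := by omega
        exact h0 _ _ _ (hV.lower0 _ _ _ hv) (by omega))
    have e2 : ∀ᵐ x ∂famMeasure μ₀ μ₁ μ₂ (n + 1) (q + 1) p, D2 f (n + 1) (q + 1) p x = 0 :=
      ae_D2 μ₀ μ₁ μ₂ (by
        rintro m rfl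
        exact h0 _ _ _ (hV.lower2 _ _ _ hv) (by omega))
    filter_upwards [e0, e2, hdf _ _ _ hv] with x h1 h2 h3
    rw [famD_apply, h1, h2, smul_zero, add_zero, zero_add] at h3
    have := congrArg (fun y => (-1 : ℤ) ^ (n + 1) • y) h3
    simpa only [smul_smul, ← pow_add, Even.neg_one_pow ⟨n + 1, rfl⟩, one_smul, smul_zero]
      using this
  obtain ⟨z, hz1, hz2⟩ : ∃ z : X₁,
      (∀ n q p, V (n + 1) q p → n + 1 + p = i → ∀ᵐ x ∂famMeasure μ₀ μ₁ μ₂ (n + 1) q p,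
        D1 f (n + 1) (q + 1) p
          (x.1, (Fin.cons (x.1 0 • z) x.2.1 : Fin (q + 1) → X₁), x.2.2) = 0) ∧
      (∀ n q p, AEStronglyMeasurable (fun x => f (n + 1) (q + 1) p
          (x.1, (Fin.cons (x.1 0 • z) x.2.1 : Fin (q + 1) → X₁), x.2.2))
          (famMeasure μ₀ μ₁ μ₂ (n + 1) q p)) := by
    have a1 : ∀ᵐ z ∂μ₁, ∀ n q p, V (n + 1) q p → n + 1 + p = i →
        ∀ᵐ x ∂famMeasure μ₀ μ₁ μ₂ (n + 1) q p, D1 f (n + 1) (q + 1) p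
          (x.1, (Fin.cons (x.1 0 • z) x.2.1 : Fin (q + 1) → X₁), x.2.2) = 0 := by
      simp only [ae_all_iff, Filter.eventually_imp_distrib_left]
      intro n q p hv hi
      exact ae_ae_of_ae_prod ((qmp_insert1 n q p).ae (hD n q p hv hi))
    have a2 : ∀ᵐ z ∂μ₁, ∀ n q p, AEStronglyMeasurable (fun x => f (n + 1) (q + 1) p
          (x.1, (Fin.cons (x.1 0 • z) x.2.1 : Fin (q + 1) → X₁), x.2.2))
          (famMeasure μ₀ μ₁ μ₂ (n + 1) q p) := by
      simp only [ae_all_iff]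
      intro n q p
      exact ((hf.1 (n + 1) (q + 1) p).comp_quasiMeasurePreserving (qmp_insert1 n q p)).prodMk_left
    exact (a1.and a2).exists
  have hdegu : ∀ n q p x, n + p ≠ i → insert1 i f z n q p x = 0 := by
    intro n q p x h
    cases n with
    | zero => rfl
    | succ n => exact if_neg h
  refine ⟨insert1 i f z, ⟨?_, ?_, ?_⟩, ?_⟩
  · intro n q p
    cases n with
    | zero => exact aestronglyMeasurable_const (b := (0 : A))
    | succ n =>
      by_cases h : n + 1 + p = i
      · simp only [insert1, if_pos h]
        exact (hz2 n q p).const_smul ((-1 : ℤ) ^ (n + 1))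
      · simp only [insert1, if_neg h]
        exact aestronglyMeasurable_const
  · intro n q p s x
    cases n with
    | zero => exact (smul_zero s).symm
    | succ n =>
      by_cases h : n + 1 + p = i
      · simp only [insert1, if_pos h]
        rw [smul_comm s, ← hf.2.1]
        congr 2
        refine Prod.ext rfl (Prod.ext ?_ rfl)
        funext j
        refine Fin.cases ?_ (fun j => ?_) j
        · exact mul_smul s (x.1 0) z
        · rfl
      · simp only [insert1, if_neg h, smul_zero]
  · intro n q p h
    cases n with
    | zero => rfl
    | succ n =>
      funext x
      have : f (n + 1) (q + 1) p = 0 :=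
        hf.2.2 _ _ _ (h.imp (hL1 _ _ _ _) fun h => by omega)
      simp [insert1, this]
  · intro n q p hv hi
    have e0 : ∀ x, D0 (insert1 i f z) n q p x = 0 := fun x => hd_eq_zero fun m hm g =>
      hdegu _ _ _ _ (by omega)
    have e2 : ∀ x, D2 (insert1 i f z) n q p x = 0 := fun x => hd_eq_zero fun m hm g =>
      hdegu _ _ _ _ (by omega)
    by_cases hi' : n + p = i
    · cases n with
      | zero =>
        rw [hf.2.2 _ _ _ (Or.inl (hL0 q p))]
        refine Filter.Eventually.of_forall fun x => ?_
        have e1 : D1 (insert1 i f z) 0 q p x = 0 := hd_eq_zero fun m hm g => rfl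
        rw [famD_apply, e0, e1, e2]
        simp
      | succ n =>
        filter_upwards [hz1 n q p hv hi'] with x hx
        rw [famD_apply, e0, e2, smul_zero, add_zero, zero_add]
        rw [D1, hd_cons, sub_eq_zero] at hx
        rw [hx, D1]
        simp only [insert1, if_pos hi']
        rw [hd_zsmul, smul_smul, ← pow_add, Even.neg_one_pow ⟨n + 1, rfl⟩, one_smul]
    · filter_upwards [h0 n q p hv (by omega)] with x hx
      have e1 : D1 (insert1 i f z) n q p x = 0 := hd_eq_zero fun m hm g => hdegu _ _ _ _ hi'
      rw [hx, famD_apply, e0, e1, e2]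
      simp

end Second

section First

variable [MeasurableMul₂ G] [μ₀.IsMulLeftInvariant]

/-- For fixed cosets the inserted element pt(a₀, b₀)h is a left translate of h, and left
translations preserve μ₀. -/
theorem qmp_insert0 {pt : X₁ × X₂ → G} (hpt : Measurable pt) (n q p : ℕ) :
    QuasiMeasurePreserving
      (fun y : G × (Fin n → G) × (Fin (q + 1) → X₁) × (Fin (p + 1) → X₂) =>
        ((Fin.cons (pt (y.2.2.1 0, y.2.2.2 0) * y.1) y.2.1 : Fin (n + 1) → G), y.2.2))
      (μ₀.prod (famMeasure μ₀ μ₁ μ₂ n (q + 1) (p + 1)))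
      (famMeasure μ₀ μ₁ μ₂ (n + 1) (q + 1) (p + 1)) := by
  have h1 : QuasiMeasurePreserving
      (fun y : G × (Fin n → G) × (Fin (q + 1) → X₁) × (Fin (p + 1) → X₂) =>
        (pt (y.2.2.1 0, y.2.2.2 0) * y.1, y.2))
      (μ₀.prod (famMeasure μ₀ μ₁ μ₂ n (q + 1) (p + 1)))
      (μ₀.prod (famMeasure μ₀ μ₁ μ₂ n (q + 1) (p + 1))) := qmp_skew_left
      (τ := fun (x : (Fin n → G) × (Fin (q + 1) → X₁) × (Fin (p + 1) → X₂)) (h : G) =>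
        pt (x.2.1 0, x.2.2 0) * h) (by fun_prop)
      (Filter.Eventually.of_forall fun x => (measurePreserving_mul_left μ₀ _).quasiMeasurePreserving)
  have h3 : QuasiMeasurePreserving
        (MeasurableEquiv.prodAssoc :
          (G × (Fin n → G)) × (Fin (q + 1) → X₁) × (Fin (p + 1) → X₂) ≃ᵐ _).symm
        (μ₀.prod (famMeasure μ₀ μ₁ μ₂ n (q + 1) (p + 1)))
        ((μ₀.prod (Measure.pi fun _ => μ₀)).prod
          ((Measure.pi fun _ => μ₁).prod (Measure.pi fun _ => μ₂))) := by
    refine ⟨MeasurableEquiv.measurable _, ?_⟩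
    rw [← Measure.prodAssoc_prod, MeasurableEquiv.map_symm_map]
  exact ((qmp_prodMap (qmp_cons n) (.id _)).comp h3).comp h1

open Classical in
/-- Insertion of a point of the first kind. -/
def insert0 (pt : X₁ × X₂ → G) (R : Set (X₁ × X₂)) (i : ℕ) (f : Fam G X₁ X₂ A) (h : G) :
    Fam G X₁ X₂ A
  | _, 0, _ => 0
  | _, _, 0 => 0
  | n, q + 1, p + 1 => fun x => if q + 1 + (p + 1) = i ∧ (x.2.1 0, x.2.2 0) ∈ R then
      f (n + 1) (q + 1) (p + 1)
        ((Fin.cons (pt (x.2.1 0, x.2.2 0) * h) x.1 : Fin (n + 1) → G), x.2) else 0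

theorem insert0_eq_zero (pt : X₁ × X₂ → G) (R : Set (X₁ × X₂)) {i : ℕ} (f : Fam G X₁ X₂ A)
    (h : G) {n q p : ℕ} (hi : q = 0 ∨ p = 0 ∨ q + p ≠ i)
    (x : (Fin n → G) × (Fin q → X₁) × (Fin p → X₂)) : insert0 pt R i f h n q p x = 0 := by
  cases q with
  | zero => cases p <;> rfl
  | succ q =>
    cases p with
    | zero => rfl
    | succ p => exact if_neg fun h => by omega

/-- The equivariant point of `G` is manufactured from one variable of each of the other two kinds,
as pt(a₀, b₀)h. The map `pt` is equivariant only on the invariant conull set `R`; the inserted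
cochain is set to zero off `R`, which keeps equivariance strict. -/
theorem exists_primitive0 [NeZero μ₀] {pt : X₁ × X₂ → G} (hpt : Measurable pt)
    {R : Set (X₁ × X₂)} (hR : ∀ᵐ x ∂μ₁.prod μ₂, x ∈ R)
    (hinv : ∀ (s : G) x, s • x ∈ R ↔ x ∈ R) (heq : ∀ (s : G), ∀ x ∈ R, pt (s • x) = s * pt x)
    {V L : ℕ → ℕ → ℕ → Prop} (hV : Lower V) (hL : Lower L)
    (hV0 : ∀ n n' q p, V n q p → V n' q p) (hL0 : ∀ n n' q p, L n q p → L n' q p)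
    (hL1 : ∀ n p, L n 0 p) (hL2 : ∀ n q, L n q 0) (N : ℕ)
    (f : Fam G X₁ X₂ A) (hf : f ∈ famMeas μ₀ μ₁ μ₂ (fun n q p => L n q p ∨ n + q + p ≠ N))
    (hdf : famD f ∈ famNull μ₀ μ₁ μ₂ V) :
    ∃ u ∈ famMeas μ₀ μ₁ μ₂ (fun n q p => L n q p ∨ n + q + p + 1 ≠ N),
      f - famD u ∈ famNull μ₀ μ₁ μ₂ V := by
  classical
  refine exists_primitive_of_step hL (fun _ q p => q + p) (fun n q p => by omega) N ?_
    f hf hdf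
  clear hf hdf f
  intro i f hf hdf h0
  have hD : ∀ n q p, V n q p → q + p = i →
      ∀ᵐ x ∂famMeasure μ₀ μ₁ μ₂ (n + 1) q p, D0 f (n + 1) q p x = 0 := by
    intro n q p hv hi
    have hv := hV0 _ (n + 1) _ _ hv
    have e1 : ∀ᵐ x ∂famMeasure μ₀ μ₁ μ₂ (n + 1) q p, D1 f (n + 1) q p x = 0 :=
      ae_D1 μ₀ μ₁ μ₂ (by
        rintro m rfl
        exact h0 _ _ _ (hV.lower1 _ _ _ hv) (by omega))
    have e2 : ∀ᵐ x ∂famMeasure μ₀ μ₁ μ₂ (n + 1) q p, D2 f (n + 1) q p x = 0 :=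
      ae_D2 μ₀ μ₁ μ₂ (by
        rintro m rfl
        exact h0 _ _ _ (hV.lower2 _ _ _ hv) (by omega))
    -- The coboundary `D0` carries no sign in `famD`, and accordingly `insert0` has none.
    filter_upwards [e1, e2, hdf _ _ _ hv] with x h1 h2 h3
    rwa [famD_apply, h1, h2, smul_zero, add_zero, smul_zero, add_zero] at h3
  have hRp : ∀ n q p, ∀ᵐ x ∂famMeasure μ₀ μ₁ μ₂ n (q + 1) (p + 1), (x.2.1 0, x.2.2 0) ∈ R :=
    fun n q p => ((qmp_prodMap (Measure.quasiMeasurePreserving_eval (fun _ => μ₁) 0)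
      (Measure.quasiMeasurePreserving_eval (fun _ => μ₂) 0)).comp quasiMeasurePreserving_snd).ae hR
  obtain ⟨z, hz1, hz2⟩ : ∃ z : G,
      (∀ n q p, V n (q + 1) (p + 1) → q + 1 + (p + 1) = i →
        ∀ᵐ x ∂famMeasure μ₀ μ₁ μ₂ n (q + 1) (p + 1),
          D0 f (n + 1) (q + 1) (p + 1)
          ((Fin.cons (pt (x.2.1 0, x.2.2 0) * z) x.1 : Fin (n + 1) → G), x.2) = 0) ∧
      (∀ n q p, AEStronglyMeasurable (fun x => f (n + 1) (q + 1) (p + 1)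
          ((Fin.cons (pt (x.2.1 0, x.2.2 0) * z) x.1 : Fin (n + 1) → G), x.2))
          (famMeasure μ₀ μ₁ μ₂ n (q + 1) (p + 1))) := by
    have a1 : ∀ᵐ z ∂μ₀, ∀ n q p, V n (q + 1) (p + 1) → q + 1 + (p + 1) = i →
        ∀ᵐ x ∂famMeasure μ₀ μ₁ μ₂ n (q + 1) (p + 1), D0 f (n + 1) (q + 1) (p + 1)
          ((Fin.cons (pt (x.2.1 0, x.2.2 0) * z) x.1 : Fin (n + 1) → G), x.2) = 0 := by
      simp only [ae_all_iff, Filter.eventually_imp_distrib_left]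
      intro n q p hv hi
      exact ae_ae_of_ae_prod ((qmp_insert0 hpt n q p).ae (hD n _ _ hv hi))
    have a2 : ∀ᵐ z ∂μ₀, ∀ n q p, AEStronglyMeasurable (fun x => f (n + 1) (q + 1) (p + 1)
          ((Fin.cons (pt (x.2.1 0, x.2.2 0) * z) x.1 : Fin (n + 1) → G), x.2))
          (famMeasure μ₀ μ₁ μ₂ n (q + 1) (p + 1)) := by
      simp only [ae_all_iff]
      intro n q p
      exact ((hf.1 (n + 1) _ _).comp_quasiMeasurePreserving (qmp_insert0 hpt n q p)).prodMk_left
    exact (a1.and a2).exists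
  refine ⟨insert0 pt R i f z, ⟨?_, ?_, ?_⟩, ?_⟩
  · intro n q p
    by_cases h : q = 0 ∨ p = 0 ∨ q + p ≠ i
    · exact (aestronglyMeasurable_const (b := (0 : A))).congr
        (Filter.Eventually.of_forall fun x => (insert0_eq_zero pt R f z h x).symm)
    · obtain ⟨q, rfl⟩ := Nat.exists_eq_succ_of_ne_zero (n := q) (by omega)
      obtain ⟨p, rfl⟩ := Nat.exists_eq_succ_of_ne_zero (n := p) (by omega)
      refine (hz2 n q p).congr ?_
      filter_upwards [hRp n q p] with x hx
      exact (if_pos ⟨by omega, hx⟩).symm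
  · intro n q p s x
    by_cases h : q = 0 ∨ p = 0 ∨ q + p ≠ i
    · rw [insert0_eq_zero pt R f z h, insert0_eq_zero pt R f z h, smul_zero]
    · obtain ⟨q, rfl⟩ := Nat.exists_eq_succ_of_ne_zero (n := q) (by omega)
      obtain ⟨p, rfl⟩ := Nat.exists_eq_succ_of_ne_zero (n := p) (by omega)
      have hr : ((s • x).2.1 0, (s • x).2.2 0) = s • (x.2.1 0, x.2.2 0) := rfl
      by_cases hx : (x.2.1 0, x.2.2 0) ∈ R
      · have hx' : ((s • x).2.1 0, (s • x).2.2 0) ∈ R := by rwa [hr, hinv]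
        have hi : q + 1 + (p + 1) = i := by omega
        simp only [insert0, if_pos (And.intro hi hx), if_pos (And.intro hi hx')]
        rw [hr, heq s _ hx, ← hf.2.1]
        congr 1
        refine Prod.ext ?_ rfl
        funext j
        refine Fin.cases ?_ (fun j => ?_) j
        · exact mul_assoc _ _ _
        · rfl
      · have hx' : ((s • x).2.1 0, (s • x).2.2 0) ∉ R := by rwa [hr, hinv]
        simp only [insert0, hx, hx', and_false, if_false, smul_zero]
  · intro n q p h
    funext x
    cases q with
    | zero => exact insert0_eq_zero pt R f z (Or.inl rfl) x
    | succ q =>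
      cases p with
      | zero => exact insert0_eq_zero pt R f z (Or.inr (Or.inl rfl)) x
      | succ p =>
        have : f (n + 1) (q + 1) (p + 1) = 0 :=
          hf.2.2 _ _ _ (h.imp (hL0 _ _ _ _) fun h => by omega)
        simp [insert0, this]
  · intro n q p hv hi
    have e1 : ∀ x, D1 (insert0 pt R i f z) n q p x = 0 := fun x => hd_eq_zero fun m hm g =>
      insert0_eq_zero _ _ _ _ (by omega) _
    have e2 : ∀ x, D2 (insert0 pt R i f z) n q p x = 0 := fun x => hd_eq_zero fun m hm g =>
      insert0_eq_zero _ _ _ _ (by omega) _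
    by_cases hi' : q = 0 ∨ p = 0 ∨ q + p ≠ i
    · have e0 : ∀ x, D0 (insert0 pt R i f z) n q p x = 0 := fun x => hd_eq_zero fun m hm g =>
        insert0_eq_zero _ _ _ _ hi' _
      have hz : ∀ᵐ x ∂famMeasure μ₀ μ₁ μ₂ n q p, f n q p x = 0 := by
        rcases hi' with rfl | rfl | hi'
        · rw [hf.2.2 _ _ _ (Or.inl (hL1 n p))]
          exact Filter.Eventually.of_forall fun _ => rfl
        · rw [hf.2.2 _ _ _ (Or.inl (hL2 n q))]
          exact Filter.Eventually.of_forall fun _ => rfl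
        · exact h0 n q p hv (by omega)
      filter_upwards [hz] with x hx
      rw [hx, famD_apply, e0, e1, e2]
      simp
    · obtain ⟨q, rfl⟩ := Nat.exists_eq_succ_of_ne_zero (n := q) (by omega)
      obtain ⟨p, rfl⟩ := Nat.exists_eq_succ_of_ne_zero (n := p) (by omega)
      filter_upwards [hz1 n q p hv (by omega), hRp n q p] with x hx hxR
      rw [famD_apply, e1, e2, smul_zero, smul_zero, add_zero, add_zero]
      rw [D0, hd_cons, sub_eq_zero] at hx
      refine hx.trans (hd_congr fun m _ g => ?_)
      exact (if_pos ⟨by omega, hxR⟩).symm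

end First

end Exactness

end KacCohomology

end

noncomputable section

namespace KacCohomology

/-! ### The connecting morphism of a set of degrees -/

section Insertion

variable {G X₁ X₂ : Type u} {A : Type v} [AddCommGroup A]

open Classical in
/-- The part of a family in the degrees given by `c`. -/
def famPart (c : ℕ → ℕ → ℕ → Prop) : Fam G X₁ X₂ A →+ Fam G X₁ X₂ A :=
  AddMonoidHom.mk' (fun f n q p => if c n q p then f n q p else 0) (by
    intro f f'
    funext n q p
    by_cases h : c n q p
    · simp only [Pi.add_apply, if_pos h]
    · simp only [Pi.add_apply, if_neg h, add_zero])

theorem famPart_pos {c : ℕ → ℕ → ℕ → Prop} (f : Fam G X₁ X₂ A) {n q p : ℕ} (h : c n q p) :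
    famPart c f n q p = f n q p := if_pos h

theorem famPart_neg {c : ℕ → ℕ → ℕ → Prop} (f : Fam G X₁ X₂ A) {n q p : ℕ} (h : ¬c n q p) :
    famPart c f n q p = 0 := if_neg h

theorem famD_congr {c : ℕ → ℕ → ℕ → Prop} (hc : Lower c) {f f' : Fam G X₁ X₂ A}
    (h : ∀ n q p, c n q p → f n q p = f' n q p) {n q p : ℕ} (hn : c n q p) :
    famD f n q p = famD f' n q p := by
  funext x
  have e0 : D0 f n q p x = D0 f' n q p x := hd_congr (by
    rintro m rfl g
    rw [h _ _ _ (hc.lower0 _ _ _ hn)])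
  have e1 : D1 f n q p x = D1 f' n q p x := hd_congr (by
    rintro m rfl g
    rw [h _ _ _ (hc.lower1 _ _ _ hn)])
  have e2 : D2 f n q p x = D2 f' n q p x := hd_congr (by
    rintro m rfl g
    rw [h _ _ _ (hc.lower2 _ _ _ hn)])
  rw [famD_apply, famD_apply, e0, e1, e2]

/-- The sign `(-1)^m` in total degree `m`. -/
def famAlt : Fam G X₁ X₂ A →+ Fam G X₁ X₂ A :=
  AddMonoidHom.mk' (fun f n q p x => (-1 : ℤ) ^ (n + q + p) • f n q p x) (by
    intro f f'
    funext n q p x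
    exact smul_add _ _ _)

theorem famAlt_apply (f : Fam G X₁ X₂ A) (n q p : ℕ)
    (x : (Fin n → G) × (Fin q → X₁) × (Fin p → X₂)) :
    famAlt f n q p x = (-1 : ℤ) ^ (n + q + p) • f n q p x := rfl

theorem famAlt_famAlt (f : Fam G X₁ X₂ A) : famAlt (famAlt f) = f := by
  funext n q p x
  rw [famAlt_apply, famAlt_apply, smul_smul, ← pow_add, Even.neg_one_pow ⟨_, rfl⟩, one_smul]

theorem famD_famAlt (f : Fam G X₁ X₂ A) : famD (famAlt f) = -famAlt (famD f) := by
  funext n q p x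
  have e0 : D0 (famAlt f) n q p x = -((-1 : ℤ) ^ (n + q + p) • D0 f n q p x) := by
    have := hd_alternating (q + p) (fun n g => f n q p (g, x.2.1, x.2.2)) n x.1
    simp only [← add_assoc] at this
    exact this
  have e1 : D1 (famAlt f) n q p x = -((-1 : ℤ) ^ (n + q + p) • D1 f n q p x) := by
    have := hd_alternating (n + p) (fun q a => f n q p (x.1, a, x.2.2)) q x.2.1
    have e : ∀ q, q + (n + p) = n + q + p := fun q => by omega
    simp only [e] at this
    exact this
  have e2 : D2 (famAlt f) n q p x = -((-1 : ℤ) ^ (n + q + p) • D2 f n q p x) := by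
    have := hd_alternating (n + q) (fun p b => f n q p (x.1, x.2.1, b)) p x.2.2
    simp only [add_comm _ (n + q)] at this
    exact this
  rw [famD_apply, e0, e1, e2]
  simp only [Pi.neg_apply, famAlt_apply, famD_apply, smul_add, smul_neg, neg_add,
    smul_comm ((-1 : ℤ) ^ (n + q + p))]

/-- The connecting morphism: the commutator of the coboundary and the restriction to the degrees
in `c`, up to sign. -/
def famIns (c : ℕ → ℕ → ℕ → Prop) : Fam G X₁ X₂ A →+ Fam G X₁ X₂ A :=
  -famAlt.comp (famD.comp (famPart c) - (famPart c).comp famD)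

theorem famIns_apply (c : ℕ → ℕ → ℕ → Prop) (f : Fam G X₁ X₂ A) :
    famIns c f = -famAlt (famD (famPart c f) - famPart c (famD f)) := rfl

theorem famD_famPart (c : ℕ → ℕ → ℕ → Prop) (f : Fam G X₁ X₂ A) :
    famD (famPart c f) = famPart c (famD f) - famAlt (famIns c f) := by
  rw [famIns_apply, map_neg, famAlt_famAlt]
  abel

/-- As `famD` has square zero, its commutator with a restriction anticommutes with `famD`. So does
`famAlt`, and composing with it gives a map that commutes. -/
theorem famD_famIns (c : ℕ → ℕ → ℕ → Prop) (f : Fam G X₁ X₂ A) :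
    famD (famIns c f) = famIns c (famD f) := by
  rw [famIns_apply, famIns_apply, map_neg, famD_famAlt, map_sub, famD_famD, famD_famD, map_zero,
    neg_neg, zero_sub, sub_zero, map_neg]

/-- In a degree of `c` the coboundary only reads degrees of `c`, so restriction and coboundary
commute there. This is why the connecting morphism lands in cochains relative to `c`. -/
theorem famIns_of_pos {c : ℕ → ℕ → ℕ → Prop} (hc : Lower c) (f : Fam G X₁ X₂ A) {n q p : ℕ}
    (h : c n q p) : famIns c f n q p = 0 := by
  funext x
  have : famD (famPart c f) n q p = famD f n q p :=
    famD_congr hc (fun _ _ _ h => famPart_pos f h) h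
  rw [famIns_apply]
  simp only [Pi.neg_apply, famAlt_apply, Pi.sub_apply, famPart_pos (famD f) h, this, sub_self,
    smul_zero, neg_zero, Pi.zero_apply]

theorem famIns_of_neg {c : ℕ → ℕ → ℕ → Prop} (f : Fam G X₁ X₂ A) {n q p : ℕ}
    (h : ¬c n q p) (x : (Fin n → G) × (Fin q → X₁) × (Fin p → X₂)) :
    famIns c f n q p x = -((-1 : ℤ) ^ (n + q + p) • famD (famPart c f) n q p x) := by
  rw [famIns_apply]
  simp only [Pi.neg_apply, famAlt_apply, Pi.sub_apply, famPart_neg (famD f) h, Pi.zero_apply,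
    sub_zero]

variable [MeasurableSpace G] [MeasurableSpace X₁] [MeasurableSpace X₂]
  {μ₀ : Measure G} {μ₁ : Measure X₁} {μ₂ : Measure X₂}

theorem famPart_mem_famNull {V V' c : ℕ → ℕ → ℕ → Prop} {f : Fam G X₁ X₂ A}
    (h : ∀ n q p, V' n q p → c n q p → V n q p) (hf : f ∈ famNull μ₀ μ₁ μ₂ V) :
    famPart c f ∈ famNull μ₀ μ₁ μ₂ V' := by
  intro n q p hV
  by_cases hc : c n q p
  · rw [famPart_pos f hc]
    exact hf n q p (h n q p hV hc)
  · rw [famPart_neg f hc]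
    exact Filter.Eventually.of_forall fun _ => rfl

theorem famAlt_mem_famNull {V : ℕ → ℕ → ℕ → Prop} {f : Fam G X₁ X₂ A}
    (hf : f ∈ famNull μ₀ μ₁ μ₂ V) : famAlt f ∈ famNull μ₀ μ₁ μ₂ V := by
  intro n q p hV
  filter_upwards [hf n q p hV] with x hx
  rw [famAlt_apply, hx, smul_zero]

variable [SigmaFinite μ₀] [SigmaFinite μ₁] [SigmaFinite μ₂]
  [Group G] [MulAction G X₁] [MulAction G X₂] [TopologicalSpace A]
  [IsTopologicalAddGroup A] [DistribMulAction G A]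

theorem famPart_mem_famMeas {L L' c : ℕ → ℕ → ℕ → Prop} {f : Fam G X₁ X₂ A}
    (h : ∀ n q p, L' n q p → c n q p → L n q p) (hf : f ∈ famMeas μ₀ μ₁ μ₂ L) :
    famPart c f ∈ famMeas μ₀ μ₁ μ₂ L' := by
  refine ⟨fun n q p => ?_, fun n q p s x => ?_, fun n q p hL => ?_⟩
  all_goals by_cases hc : c n q p
  · rw [famPart_pos f hc]
    exact hf.1 n q p
  · rw [famPart_neg f hc]
    exact aestronglyMeasurable_const (b := (0 : A))
  · rw [famPart_pos f hc]
    exact hf.2.1 n q p s x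
  · rw [famPart_neg f hc]
    exact (smul_zero s).symm
  · rw [famPart_pos f hc]
    exact hf.2.2 n q p (h n q p hL hc)
  · rw [famPart_neg f hc]

theorem famAlt_mem_famMeas {L : ℕ → ℕ → ℕ → Prop} {f : Fam G X₁ X₂ A}
    (hf : f ∈ famMeas μ₀ μ₁ μ₂ L) : famAlt f ∈ famMeas μ₀ μ₁ μ₂ L := by
  refine ⟨fun n q p => (hf.1 n q p).const_smul ((-1 : ℤ) ^ (n + q + p)), fun n q p s x => ?_,
    fun n q p hL => ?_⟩
  · rw [famAlt_apply, famAlt_apply, hf.2.1, smul_comm]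
  · funext x
    rw [famAlt_apply, hf.2.2 n q p hL]
    exact smul_zero _

theorem famIns_mem_famMeas {L L' c : ℕ → ℕ → ℕ → Prop} (hc : Lower c) {f : Fam G X₁ X₂ A}
    (hf : f ∈ famMeas μ₀ μ₁ μ₂ L) (h0 : ∀ n q p, L' (n + 1) q p → L n q p ∨ c (n + 1) q p)
    (h1 : ∀ n q p, L' n (q + 1) p → L n q p ∨ c n (q + 1) p)
    (h2 : ∀ n q p, L' n q (p + 1) → L n q p ∨ c n q (p + 1)) :
    famIns c f ∈ famMeas μ₀ μ₁ μ₂ L' := by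
  have hP : famPart c f ∈ famMeas μ₀ μ₁ μ₂ L := famPart_mem_famMeas (fun _ _ _ h _ => h) hf
  have key : ∀ {g : Fam G X₁ X₂ A}, g ∈ famMeas μ₀ μ₁ μ₂ L →
      famD g ∈ famMeas μ₀ μ₁ μ₂ fun n q p => L' n q p ∧ ¬c n q p := fun hg =>
    famD_mem_famMeas (fun n q p h => (h0 _ _ _ h.1).resolve_right h.2)
      (fun n q p h => (h1 _ _ _ h.1).resolve_right h.2)
      (fun n q p h => (h2 _ _ _ h.1).resolve_right h.2) hg
  have hI : famIns c f ∈ famMeas μ₀ μ₁ μ₂ fun n q p => L' n q p ∧ ¬c n q p :=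
    neg_mem (famAlt_mem_famMeas (sub_mem (key hP)
      (famPart_mem_famMeas (fun _ _ _ h _ => h) (key hf))))
  refine ⟨hI.1, hI.2.1, fun n q p h => ?_⟩
  by_cases hcn : c n q p
  · exact famIns_of_pos hc f hcn
  · exact hI.2.2 n q p ⟨h, hcn⟩

theorem famIns_mem_famNull {V V' c : ℕ → ℕ → ℕ → Prop} (hV : Lower V) (hc : Lower c)
    (hV' : ∀ n q p, V' n q p ↔ V n q p ∧ c n q p) {f : Fam G X₁ X₂ A}
    (hf : f ∈ famNull μ₀ μ₁ μ₂ V') : famIns c f ∈ famNull μ₀ μ₁ μ₂ V := by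
  have h1 : famD (famPart c f) ∈ famNull μ₀ μ₁ μ₂ V :=
    famD_mem_famNull μ₀ μ₁ μ₂ hV.lower0 hV.lower1 hV.lower2
      (famPart_mem_famNull (fun n q p h h' => (hV' n q p).2 ⟨h, h'⟩) hf)
  have h2 : famD f ∈ famNull μ₀ μ₁ μ₂ V' :=
    famD_mem_famNull μ₀ μ₁ μ₂
      (fun n q p h => (hV' _ _ _).2 (((hV' _ _ _).1 h).imp (hV.lower0 _ _ _) (hc.lower0 _ _ _)))
      (fun n q p h => (hV' _ _ _).2 (((hV' _ _ _).1 h).imp (hV.lower1 _ _ _) (hc.lower1 _ _ _)))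
      (fun n q p h => (hV' _ _ _).2 (((hV' _ _ _).1 h).imp (hV.lower2 _ _ _) (hc.lower2 _ _ _)))
      hf
  exact neg_mem (famAlt_mem_famNull (sub_mem h1
    (famPart_mem_famNull (fun n q p h h' => (hV' n q p).2 ⟨h, h'⟩) h2)))

theorem famAlt_of_degree {L : ℕ → ℕ → ℕ → Prop} {N : ℕ} {f : Fam G X₁ X₂ A}
    (hf : f ∈ famMeas μ₀ μ₁ μ₂ fun n q p => L n q p ∨ n + q + p ≠ N) :
    famAlt f = (-1 : ℤ) ^ N • f := by
  funext n q p x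
  by_cases h : n + q + p = N
  · rw [famAlt_apply, h]
    rfl
  · have : f n q p = 0 := hf.2.2 n q p (Or.inr h)
    rw [famAlt_apply, this]
    simp [this]

/-- Surjectivity of the connecting morphism. A cocycle t relative to `c` has a primitive u in the
exact complex; in the degrees of `c` this u is a cocycle, as t vanishes there, and t is its image up
to a sign and up to the coboundary of u minus its restriction to `c`. -/
theorem exists_famIns_preimage {V L c : ℕ → ℕ → ℕ → Prop}
    (hc : Lower c) {N : ℕ}
    (prim : ∀ f ∈ famMeas (A := A) μ₀ μ₁ μ₂ (fun n q p => L n q p ∨ n + q + p ≠ N + 1),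
      famD f ∈ famNull μ₀ μ₁ μ₂ V →
      ∃ u ∈ famMeas (A := A) μ₀ μ₁ μ₂ (fun n q p => L n q p ∨ n + q + p + 1 ≠ N + 1),
        f - famD u ∈ famNull μ₀ μ₁ μ₂ V) (hL : Lower L) {t : Fam G X₁ X₂ A}
    (ht : t ∈ famMeas μ₀ μ₁ μ₂ fun n q p => (L n q p ∨ c n q p) ∨ n + q + p ≠ N + 1)
    (hdt : famD t ∈ famNull μ₀ μ₁ μ₂ V) :
    ∃ x ∈ famMeas (A := A) μ₀ μ₁ μ₂ (fun n q p => L n q p ∨ n + q + p ≠ N),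
      famD x ∈ famNull μ₀ μ₁ μ₂ (fun n q p => V n q p ∧ c n q p) ∧
      ∃ h ∈ famMeas (A := A) μ₀ μ₁ μ₂ (fun n q p => (L n q p ∨ c n q p) ∨ n + q + p ≠ N),
        t - famIns c x - famD h ∈ famNull μ₀ μ₁ μ₂ V := by
  obtain ⟨u, hu, htu⟩ := prim t ⟨ht.1, ht.2.1, fun n q p h => ht.2.2 n q p (h.imp Or.inl id)⟩ hdt
  have hu : u ∈ famMeas μ₀ μ₁ μ₂ fun n q p => L n q p ∨ n + q + p ≠ N :=
    ⟨hu.1, hu.2.1, fun n q p h => hu.2.2 n q p (h.imp id fun h => by omega)⟩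
  have hI : famIns c u ∈ famMeas μ₀ μ₁ μ₂ fun n q p => L n q p ∨ n + q + p ≠ N + 1 :=
    famIns_mem_famMeas hc hu
      (fun n q p h => Or.inl (h.imp (hL.lower0 _ _ _) fun h => by omega))
      (fun n q p h => Or.inl (h.imp (hL.lower1 _ _ _) fun h => by omega))
      (fun n q p h => Or.inl (h.imp (hL.lower2 _ _ _) fun h => by omega))
  have hP : famPart c (famD u) ∈ famNull μ₀ μ₁ μ₂ V := by
    intro n q p hV
    by_cases hn : c n q p
    · have h0 := ht.2.2 n q p (Or.inl (Or.inr hn))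
      filter_upwards [htu n q p hV] with x hx
      rw [famPart_pos _ hn]
      simp only [Pi.sub_apply, h0, Pi.zero_apply, zero_sub, neg_eq_zero] at hx
      exact hx
    · rw [famPart_neg _ hn]
      exact Filter.Eventually.of_forall fun _ => rfl
  -- The sign undoes the `famAlt` in `famD_famPart`, which is (-1)^(N + 1) on the image of `u`.
  refine ⟨(-1 : ℤ) ^ N • u, zsmul_mem hu _, ?_, u - famPart c u, ⟨?_, ?_, ?_⟩, ?_⟩
  · rw [map_zsmul]
    refine zsmul_mem ?_ _
    intro n q p hV
    filter_upwards [hP n q p hV.1] with x hx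
    rwa [famPart_pos _ hV.2] at hx
  · exact (sub_mem hu (famPart_mem_famMeas (fun _ _ _ h _ => h) hu)).1
  · exact (sub_mem hu (famPart_mem_famMeas (fun _ _ _ h _ => h) hu)).2.1
  · rintro n q p ((h | h) | h)
    · exact (sub_mem hu (famPart_mem_famMeas (fun _ _ _ h _ => h) hu)).2.2 n q p (Or.inl h)
    · change u n q p - famPart c u n q p = 0
      rw [famPart_pos _ h, sub_self]
    · exact (sub_mem hu (famPart_mem_famMeas (fun _ _ _ h _ => h) hu)).2.2 n q p (Or.inr h)
  · have e : t - famIns c ((-1 : ℤ) ^ N • u) - famD (u - famPart c u) =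
        (t - famD u) + famPart c (famD u) := by
      rw [map_sub, famD_famPart, famAlt_of_degree hI, map_zsmul, pow_succ, mul_neg_one, neg_smul]
      abel
    rw [e]
    exact add_mem htu hP

/-- Injectivity of the connecting morphism. If the image of x is dh with h relative to `c`, then the
extension of x by zero, corrected by h up to sign, is a cocycle of the exact complex. Its primitive
restricts to one of x because h vanishes in the degrees of `c`. -/
theorem exists_primitive_of_famIns {V L c : ℕ → ℕ → ℕ → Prop}
    (hc : Lower c) {N : ℕ}
    (prim : ∀ f ∈ famMeas (A := A) μ₀ μ₁ μ₂ (fun n q p => L n q p ∨ n + q + p ≠ N),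
      famD f ∈ famNull μ₀ μ₁ μ₂ V →
      ∃ u ∈ famMeas (A := A) μ₀ μ₁ μ₂ (fun n q p => L n q p ∨ n + q + p + 1 ≠ N),
        f - famD u ∈ famNull μ₀ μ₁ μ₂ V) (hL : Lower L) {x h : Fam G X₁ X₂ A}
    (hx : x ∈ famMeas μ₀ μ₁ μ₂ fun n q p => L n q p ∨ n + q + p ≠ N)
    (hdx : famD x ∈ famNull μ₀ μ₁ μ₂ fun n q p => V n q p ∧ c n q p)
    (hh : h ∈ famMeas μ₀ μ₁ μ₂ fun n q p => (L n q p ∨ c n q p) ∨ n + q + p ≠ N)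
    (hxh : famIns c x - famD h ∈ famNull μ₀ μ₁ μ₂ V) :
    ∃ u ∈ famMeas (A := A) μ₀ μ₁ μ₂ (fun n q p => L n q p ∨ n + q + p + 1 ≠ N),
      x - famD u ∈ famNull μ₀ μ₁ μ₂ fun n q p => V n q p ∧ c n q p := by
  have hI : famIns c x ∈ famMeas μ₀ μ₁ μ₂ fun n q p => L n q p ∨ n + q + p ≠ N + 1 :=
    famIns_mem_famMeas hc hx
      (fun n q p h => Or.inl (h.imp (hL.lower0 _ _ _) fun h => by omega))
      (fun n q p h => Or.inl (h.imp (hL.lower1 _ _ _) fun h => by omega))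
      (fun n q p h => Or.inl (h.imp (hL.lower2 _ _ _) fun h => by omega))
  have hh' : h ∈ famMeas μ₀ μ₁ μ₂ fun n q p => L n q p ∨ n + q + p ≠ N :=
    ⟨hh.1, hh.2.1, fun n q p h => hh.2.2 n q p (h.imp Or.inl id)⟩
  obtain ⟨u, hu, hwu⟩ := prim (famPart c x - (-1 : ℤ) ^ N • h)
    (sub_mem (famPart_mem_famMeas (fun _ _ _ h _ => h) hx)
      (zsmul_mem hh' _)) (by
    have e : famD (famPart c x - (-1 : ℤ) ^ N • h) =
        famPart c (famD x) + (-1 : ℤ) ^ N • (famIns c x - famD h) := by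
      rw [map_sub, famD_famPart, famAlt_of_degree hI, map_zsmul, pow_succ, mul_neg_one, neg_smul,
        smul_sub]
      abel
    rw [e]
    exact add_mem (famPart_mem_famNull (V := fun n q p => V n q p ∧ c n q p)
      (fun _ _ _ h h' => ⟨h, h'⟩) hdx) (zsmul_mem hxh _))
  refine ⟨u, hu, fun n q p hV => ?_⟩
  have h0 := hh.2.2 n q p (Or.inl (Or.inr hV.2))
  filter_upwards [hwu n q p hV.1] with y hy
  have e : (famPart c x - (-1 : ℤ) ^ N • h - famD u) n q p y =
      famPart c x n q p y - (-1 : ℤ) ^ N • h n q p y - famD u n q p y := rfl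
  rw [e, h0, famPart_pos _ hV.2, Pi.zero_apply, smul_zero, sub_zero] at hy
  exact hy

variable (A) (μ₀) (μ₁) (μ₂)

/-- The connecting morphism of the complexes of homogeneous cochains. -/
def relIns {V V' L L' c : ℕ → ℕ → ℕ → Prop} (hV : Lower V) (hL : Lower L) (hc : Lower c)
    (hV' : ∀ n q p, V' n q p ↔ V n q p ∧ c n q p)
    (hL' : ∀ n q p, L' n q p ↔ L n q p ∨ c n q p) (k : ℕ) :
    (Rel μ₀ μ₁ μ₂ A V' L k).WHom (Rel μ₀ μ₁ μ₂ A V L' (k + 1)) where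
  f _ := famIns c
  comm m x hx := by
    have e : ∀ x : Fam G X₁ X₂ A, famIns c (famD x) - famD (famIns c x) ∈ famNull μ₀ μ₁ μ₂ V :=
      fun x => by
        rw [famD_famIns, sub_self]
        exact zero_mem _
    exact e x
  map_meas m x hx := famIns_mem_famMeas hc hx
    (fun n q p h => by
      rcases h with h | h
      · exact ((hL' _ _ _).1 h).imp (fun h => Or.inl (hL.lower0 _ _ _ h)) id
      · exact Or.inl (Or.inr (by omega)))
    (fun n q p h => by
      rcases h with h | h
      · exact ((hL' _ _ _).1 h).imp (fun h => Or.inl (hL.lower1 _ _ _ h)) id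
      · exact Or.inl (Or.inr (by omega)))
    (fun n q p h => by
      rcases h with h | h
      · exact ((hL' _ _ _).1 h).imp (fun h => Or.inl (hL.lower2 _ _ _ h)) id
      · exact Or.inl (Or.inr (by omega)))
  map_null m x hx := famIns_mem_famNull hV hc hV' hx

/-- The connecting morphism is a quasi-isomorphism if the middle term is exact. -/
theorem relIns_bijective {V V' L L' c : ℕ → ℕ → ℕ → Prop} (hV : Lower V) (hL : Lower L)
    (hc : Lower c) (hV' : ∀ n q p, V' n q p ↔ V n q p ∧ c n q p)
    (hL' : ∀ n q p, L' n q p ↔ L n q p ∨ c n q p) (k : ℕ)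
    (hk : ∀ n q p, n + q + p = k → L' n q p) (hk' : ∀ n q p, n + q + p + 1 = k → L n q p)
    (prim : ∀ N, ∀ f ∈ famMeas (A := A) μ₀ μ₁ μ₂ (fun n q p => L n q p ∨ n + q + p ≠ N),
      famD f ∈ famNull μ₀ μ₁ μ₂ V →
      ∃ u ∈ famMeas (A := A) μ₀ μ₁ μ₂ (fun n q p => L n q p ∨ n + q + p + 1 ≠ N),
        f - famD u ∈ famNull μ₀ μ₁ μ₂ V) (m : ℕ) :
    Function.Bijective ((relIns A μ₀ μ₁ μ₂ hV hL hc hV' hL' k).H m) := by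
  obtain rfl : V' = fun n q p => V n q p ∧ c n q p := by
    funext n q p
    exact propext (hV' n q p)
  obtain rfl : L' = fun n q p => L n q p ∨ c n q p := by
    funext n q p
    exact propext (hL' n q p)
  refine MeasComplex.WHom.H_bijective_of ?_ ?_
  · intro x hx hxB
    obtain ⟨h, hh, hxh⟩ : ∃ h ∈ famMeas (A := A) μ₀ μ₁ μ₂
        (fun n q p => (L n q p ∨ c n q p) ∨ n + q + p ≠ m + k),
        famIns c x - famD h ∈ famNull μ₀ μ₁ μ₂ V := by
      cases m with
      | zero =>
        refine ⟨0, zero_mem _, ?_⟩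
        rw [map_zero, sub_zero]
        exact hxB
      | succ m =>
        obtain ⟨h, hh, hxh⟩ := MeasComplex.mem_coboundaries_succ.1 hxB
        exact ⟨h, ⟨hh.1, hh.2.1, fun n q p h => hh.2.2 n q p (h.imp id fun h => by omega)⟩, hxh⟩
    obtain ⟨u, hu, hxu⟩ := exists_primitive_of_famIns hc (prim (m + k)) hL hx.1 hx.2 hh hxh
    cases m with
    | zero =>
      -- In degree 0 coboundaries are null functions. By `hk'` there are no cochains of total degree
      -- `k - 1`, so the primitive is zero, as required.
      have h0 : u = 0 := by
        funext n q p
        refine hu.2.2 n q p ?_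
        by_cases h : n + q + p + 1 = k
        · exact Or.inl (hk' _ _ _ h)
        · exact Or.inr (by omega)
      have e : ∀ y : Fam G X₁ X₂ A, y - famD u ∈ famNull μ₀ μ₁ μ₂ (fun n q p => V n q p ∧ c n q p) →
          y ∈ famNull μ₀ μ₁ μ₂ fun n q p => V n q p ∧ c n q p := fun y hy => by
        rwa [h0, map_zero, sub_zero] at hy
      exact e x hxu
    | succ m =>
      exact MeasComplex.mem_coboundaries_succ.2 ⟨u, ⟨hu.1, hu.2.1,
        fun n q p h => hu.2.2 n q p (h.imp id fun h => by omega)⟩, hxu⟩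
  · intro t ht
    obtain ⟨x, hx, hdx, h, hh, hth⟩ := exists_famIns_preimage hc (prim (m + k + 1)) hL ht.1 ht.2
    refine ⟨x, ⟨hx, hdx⟩, ?_⟩
    cases m with
    | zero =>
      -- Similarly, `hk` leaves no cochains relative to `L'` in total degree `k`.
      have h0 : h = 0 := by
        funext n q p
        refine hh.2.2 n q p ?_
        by_cases h : n + q + p = k
        · exact Or.inl (hk _ _ _ h)
        · exact Or.inr (by omega)
      rw [h0, map_zero, sub_zero] at hth
      exact hth
    | succ m =>
      exact MeasComplex.mem_coboundaries_succ.2 ⟨h, ⟨hh.1, hh.2.1,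
        fun n q p h => hh.2.2 n q p (h.imp id fun h => by omega)⟩, hth⟩

end Insertion

end KacCohomology

end

noncomputable section

namespace KacCohomology

/-! ### Maps that preserve and reflect null sets -/

section ClassPreserving

variable {α β γ δ : Type*} [MeasurableSpace α] [MeasurableSpace β] [MeasurableSpace γ]
  [MeasurableSpace δ] {μa : Measure α} {μb : Measure β} {μc : Measure γ} {μd : Measure δ}

/-- A measurable map that preserves the measure class: a set is null iff its preimage is. -/
structure ClassPreserving (f : α → β) (μa : Measure α) (μb : Measure β) : Prop where
  measurable : Measurable f
  null_iff : ∀ E, MeasurableSet E → (μa (f ⁻¹' E) = 0 ↔ μb E = 0)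

namespace ClassPreserving

theorem qmp {f : α → β} (h : ClassPreserving f μa μb) : QuasiMeasurePreserving f μa μb :=
  ⟨h.measurable, AbsolutelyContinuous.mk fun E hE h0 => by
    rw [map_apply h.measurable hE]
    exact (h.null_iff E hE).2 h0⟩

theorem of_measurePreserving {f : α → β} (h : MeasurePreserving f μa μb) :
    ClassPreserving f μa μb :=
  ⟨h.measurable, fun E hE => by rw [h.measure_preimage hE.nullMeasurableSet]⟩

theorem comp {f : α → β} {g : β → γ} (hg : ClassPreserving g μb μc)
    (hf : ClassPreserving f μa μb) : ClassPreserving (g ∘ f) μa μc :=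
  ⟨hg.measurable.comp hf.measurable, fun E hE => by
    rw [Set.preimage_comp, hf.null_iff _ (hg.measurable hE), hg.null_iff E hE]⟩

/-- Null sets are tested on the source of `f`. The measure classes of coset spaces and their
products are determined below by precomposing with maps from products of groups. -/
theorem of_comp {f : α → β} {g : β → γ} (hg : Measurable g) (hf : ClassPreserving f μa μb)
    (h : ClassPreserving (g ∘ f) μa μc) : ClassPreserving g μb μc :=
  ⟨hg, fun E hE => by rw [← hf.null_iff _ (hg hE), ← Set.preimage_comp, h.null_iff E hE]⟩

theorem id : ClassPreserving (id : α → α) μa μa := ⟨measurable_id, fun _ _ => Iff.rfl⟩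

theorem skew [SFinite μb] [SFinite μc] {τ : α → β → γ}
    (hm : Measurable fun x : α × β => τ x.1 x.2)
    (h : ∀ᵐ a ∂μa, ClassPreserving (τ a) μb μc) :
    ClassPreserving (fun x : α × β => (x.1, τ x.1 x.2)) (μa.prod μb) (μa.prod μc) := by
  have hm' : Measurable fun x : α × β => (x.1, τ x.1 x.2) := measurable_fst.prodMk hm
  refine ⟨hm', fun E hE => ?_⟩
  rw [measure_prod_null (hm' hE), measure_prod_null hE]
  refine Filter.eventually_congr ?_
  filter_upwards [h] with a ha
  exact ha.null_iff _ (measurable_prodMk_left hE)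

theorem swap [SFinite μa] [SFinite μb] :
    ClassPreserving (Prod.swap : α × β → β × α) (μa.prod μb) (μb.prod μa) :=
  of_measurePreserving measurePreserving_swap

theorem prodMap [SFinite μa] [SFinite μb] [SFinite μc] [SFinite μd] {f : α → β} {g : γ → δ}
    (hf : ClassPreserving f μa μb) (hg : ClassPreserving g μc μd) :
    ClassPreserving (fun x : α × γ => (f x.1, g x.2)) (μa.prod μc) (μb.prod μd) := by
  have h1 : ClassPreserving (fun x : α × γ => (x.1, g x.2)) (μa.prod μc) (μa.prod μd) :=
    skew (τ := fun _ => g) (hg.measurable.comp measurable_snd) (Filter.Eventually.of_forall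
      fun _ => hg)
  have h2 : ClassPreserving (fun x : δ × α => (x.1, f x.2)) (μd.prod μa) (μd.prod μb) :=
    skew (τ := fun _ => f) (hf.measurable.comp measurable_snd) (Filter.Eventually.of_forall
      fun _ => hf)
  exact swap.comp (h2.comp (swap.comp h1))

theorem fst [SFinite μb] [NeZero μb] :
    ClassPreserving (Prod.fst : α × β → α) (μa.prod μb) μa :=
  ⟨measurable_fst, fun E _ => by
    rw [← Set.prod_univ, prod_prod, mul_eq_zero]
    exact or_iff_left (NeZero.ne (μb Set.univ))⟩

theorem prodAssoc [SFinite μa] [SFinite μb] [SFinite μc] :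
    ClassPreserving (fun x : (α × β) × γ => (x.1.1, x.1.2, x.2)) ((μa.prod μb).prod μc)
      (μa.prod (μb.prod μc)) :=
  of_measurePreserving (measurePreserving_prodAssoc μa μb μc)

theorem prodAssoc_symm [SFinite μa] [SFinite μb] [SFinite μc] :
    ClassPreserving (fun x : α × β × γ => ((x.1, x.2.1), x.2.2)) (μa.prod (μb.prod μc))
      ((μa.prod μb).prod μc) :=
  of_measurePreserving (measurePreserving_prodAssoc μa μb μc).symm

theorem prod_left_comm [SFinite μa] [SFinite μb] [SFinite μc] :
    ClassPreserving (fun x : α × β × γ => (x.2.1, x.1, x.2.2)) (μa.prod (μb.prod μc))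
      (μb.prod (μa.prod μc)) :=
  prodAssoc.comp ((prodMap swap id).comp prodAssoc_symm)

theorem prod_prod_comm [SFinite μa] [SFinite μb] [SFinite μc] [SFinite μd] :
    ClassPreserving (fun x : (α × β) × γ × δ => ((x.1.1, x.2.1), x.1.2, x.2.2))
      ((μa.prod μb).prod (μc.prod μd)) ((μa.prod μc).prod (μb.prod μd)) :=
  prodAssoc_symm.comp ((prodMap id prod_left_comm).comp prodAssoc)

theorem of_measurableEquiv {e : α ≃ᵐ β} (h : MeasurePreserving e μa μb) :
    ClassPreserving e.symm μb μa := of_measurePreserving h.symm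

theorem cons [SigmaFinite μa] (p : ℕ) :
    ClassPreserving (fun x : α × (Fin p → α) => (Fin.cons x.1 x.2 : Fin (p + 1) → α))
      (μa.prod (Measure.pi fun _ => μa)) (Measure.pi fun _ => μa) := by
  have e : (fun x : α × (Fin p → α) => (Fin.cons x.1 x.2 : Fin (p + 1) → α)) =
      (MeasurableEquiv.piFinSuccAbove (fun _ : Fin (p + 1) => α) 0).symm := by
    funext x
    exact (Fin.insertNth_zero' x.1 x.2).symm
  rw [e]
  exact of_measurableEquiv (measurePreserving_piFinSuccAbove (fun _ : Fin (p + 1) => μa) 0)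

theorem uncons [SigmaFinite μa] (p : ℕ) :
    ClassPreserving (fun x : Fin (p + 1) → α => (x 0, Fin.tail x))
      (Measure.pi fun _ => μa) (μa.prod (Measure.pi fun _ => μa)) := 
  of_measurePreserving (measurePreserving_piFinSuccAbove (fun _ : Fin (p + 1) => μa) 0)

theorem pi [SigmaFinite μa] [SigmaFinite μb] {f : α → β} (h : ClassPreserving f μa μb) (p : ℕ) :
    ClassPreserving (fun (x : Fin p → α) i => f (x i)) (Measure.pi fun _ => μa)
      (Measure.pi fun _ => μb) := by
  induction p with
  | zero =>
    have hf : Measurable fun (x : Fin 0 → α) (i : Fin 0) => f (x i) :=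
      measurable_pi_lambda _ fun i => i.elim0
    refine of_measurePreserving ⟨hf, ?_⟩
    rw [Measure.pi_of_empty (fun _ : Fin 0 => μa), Measure.pi_of_empty (fun _ : Fin 0 => μb),
      map_dirac' hf]
    exact congrArg dirac (Subsingleton.elim _ _)
  | succ p ih =>
    have := (cons p).comp ((h.prodMap ih).comp (uncons (μa := μa) p))
    convert this using 1
    funext x i
    refine Fin.cases ?_ (fun i => ?_) i <;> rfl

end ClassPreserving

end ClassPreserving

/-! ### Locally compact groups and their coset spaces -/

section CosetSpaces

variable (G : Type u) [Group G] [TopologicalSpace G] [IsTopologicalGroup G]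
  [T2Space G] [LocallyCompactSpace G] [SecondCountableTopology G]

/-- A locally compact group is complete for its right uniformity, and second countability makes this
uniformity countably generated. -/
instance polishSpace_of_locallyCompact : PolishSpace G := by
  let _ : UniformSpace G := IsTopologicalGroup.rightUniformSpace G
  have : IsRightUniformGroup G := { uniformity_eq := rfl }
  have : CompleteSpace G := IsRightUniformGroup.completeSpace_of_weaklyLocallyCompactSpace
  have : (uniformity G).IsCountablyGenerated := Filter.comap.isCountablyGenerated _ _
  infer_instance

variable {G} [MeasurableSpace G] [BorelSpace G]

theorem classPreserving_mul_left (g : G) : ClassPreserving (fun x => g * x) (haar : Measure G) haar :=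
  .of_measurePreserving (measurePreserving_mul_left haar g)

/-- Haar measure need not be right invariant, but its class is. -/
theorem classPreserving_mul_right (g : G) :
    ClassPreserving (fun x => x * g) (haar : Measure G) haar :=
  ⟨measurable_mul_const g, fun _ _ => measure_mul_right_null haar g⟩

variable (H K : Subgroup G)

theorem neZero_prod {α β : Type*} [MeasurableSpace α] [MeasurableSpace β] {μ : Measure α}
    {ν : Measure β} [SFinite ν] [NeZero μ] [NeZero ν] : NeZero (μ.prod ν) :=
  ⟨fun h => by
    have h' : μ.prod ν Set.univ = 0 := by simp [h]
    rw [← Set.univ_prod_univ, prod_prod, mul_eq_zero] at h'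
    exact h'.elim (NeZero.ne _) (NeZero.ne _)⟩

theorem classPreserving_mk :
    ClassPreserving (QuotientGroup.mk : G → G ⧸ H) haar (quotMeasure H) :=
  ⟨measurable_mk H, fun E hE => by
    rw [quotMeasure, map_apply (measurable_mk H) hE]
    exact ⟨fun h => toFinite_absolutelyContinuous _ h, fun h => absolutelyContinuous_toFinite _ h⟩⟩

instance : NeZero (quotMeasure H) := ⟨fun h => by
  have := (classPreserving_mk H).null_iff Set.univ MeasurableSet.univ
  rw [h, Set.preimage_univ] at this
  exact NeZero.ne (haar (Set.univ : Set G)) (this.2 rfl)⟩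

theorem classPreserving_smul (g : G) :
    ClassPreserving (fun x : G ⧸ H => g • x) (quotMeasure H) (quotMeasure H) :=
  .of_comp (QuasiInvariant.qmp (ν := quotMeasure H) g).measurable (classPreserving_mk H)
    ((classPreserving_mk H).comp (classPreserving_mul_left g))

variable [hH : IsClosed (H : Set G)] [hK : IsClosed (K : Set G)]
  [LocallyCompactSpace H] [LocallyCompactSpace K] [SecondCountableTopology H]
  [SecondCountableTopology K]

instance measurableSMul₂_quotient : MeasurableSMul₂ G (G ⧸ H) := by
  have : T2Space (G ⧸ H) := inferInstance
  have : BorelSpace (G ⧸ H) := CosetSpace.borelSpace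
  infer_instance

/-- If `H K` is conull, then the multiplication `H × K → G` preserves the measure class. -/
theorem classPreserving_mul (h : (haar : Measure G) ((H : Set G) * (K : Set G))ᶜ = 0) :
    ClassPreserving (fun x : H × K => (x.1 : G) * x.2) (haar.prod haar) haar := by
  have hm : Measurable fun x : H × K => (x.1 : G) * x.2 := by fun_prop
  refine ⟨hm, fun E hE => ?_⟩
  -- The set of (h, k, x) with hxk ∈ E is measured in two ways. The slices over (h, k) are two-sided
  -- translates of E.
  have hW : MeasurableSet {y : (H × K) × G | (y.1.1 : G) * y.2 * y.1.2 ∈ E} :=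
    (show Measurable fun y : (H × K) × G => (y.1.1 : G) * y.2 * y.1.2 by fun_prop) hE
  have h1 : (((haar : Measure H).prod (haar : Measure K)).prod (haar : Measure G))
      {y | (y.1.1 : G) * y.2 * y.1.2 ∈ E} = 0 ↔ (haar : Measure G) E = 0 := by
    rw [measure_prod_null hW]
    have : ∀ a : H × K, (haar : Measure G) (Prod.mk a ⁻¹'
        {y : (H × K) × G | (y.1.1 : G) * y.2 * y.1.2 ∈ E}) = 0 ↔ (haar : Measure G) E = 0 :=
      fun a => ((classPreserving_mul_right (a.2 : G)).comp
        (classPreserving_mul_left (a.1 : G))).null_iff E hE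
    refine (Filter.eventually_congr (Filter.Eventually.of_forall this)).trans ?_
    have : NeZero ((haar : Measure H).prod (haar : Measure K)) := neZero_prod
    exact Filter.eventually_const
  -- For almost every x one has x = yz with y ∈ H and z ∈ K. The slice over such an x is the
  -- preimage of E under multiplication H × K → G, translated by y on the right in H and by z on the
  -- left in K.
  have h2 : (((haar : Measure H).prod (haar : Measure K)).prod (haar : Measure G))
      {y | (y.1.1 : G) * y.2 * y.1.2 ∈ E} = 0 ↔
      ((haar : Measure H).prod (haar : Measure K)) {x | (x.1 : G) * x.2 ∈ E} = 0 := by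
    have hW' := (measurable_swap hW : MeasurableSet (Prod.swap ⁻¹' _))
    rw [← (ClassPreserving.swap (μa := (haar : Measure G))
      (μb := (haar : Measure H).prod (haar : Measure K))).null_iff _ hW, measure_prod_null hW']
    refine (Filter.eventually_congr (q := fun _ => ((haar : Measure H).prod (haar : Measure K))
      {x | (x.1 : G) * x.2 ∈ E} = 0) ?_).trans Filter.eventually_const
    have h' : ∀ᵐ x ∂(haar : Measure G), x ∈ (H : Set G) * (K : Set G) := h
    filter_upwards [h'] with x hx
    obtain ⟨y, hy, z, hz, rfl⟩ := hx
    refine Iff.trans (Eq.congr (congrArg _ ?_) rfl)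
      (((classPreserving_mul_right (⟨y, hy⟩ : H)).prodMap
      (classPreserving_mul_left (⟨z, hz⟩ : K))).null_iff _ (hm hE))
    ext a
    simp [mul_assoc]
  exact h2.symm.trans h1

/-- If `K H` is conull, then `K → G / H` preserves the measure class. -/
theorem classPreserving_coset (h : (haar : Measure G) ((K : Set G) * (H : Set G))ᶜ = 0) :
    ClassPreserving (fun x : K => (QuotientGroup.mk (x : G) : G ⧸ H)) haar (quotMeasure H) := by
  -- The composite K × H → G → G/H factors through the projection to K.
  refine .of_comp (f := Prod.fst) (μa := (haar : Measure K).prod (haar : Measure H))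
    ((measurable_mk H).comp measurable_subtype_coe) .fst ?_
  convert (classPreserving_mk H).comp (classPreserving_mul K H h) using 1
  funext x
  simp

/-- If `H K` is conull, then `G → G / H × G / K` preserves the measure class. -/
theorem classPreserving_pair (h : (haar : Measure G) ((H : Set G) * (K : Set G))ᶜ = 0) :
    ClassPreserving (fun x : G => ((QuotientGroup.mk x : G ⧸ H), (QuotientGroup.mk x : G ⧸ K))) haar
      ((quotMeasure H).prod (quotMeasure K)) := by
  -- Precompose with (x, h, k) ↦ xh. The pair (xhH, xhK) equals (xH, xhkK), so it only depends on
  -- (x, xhk), and this element of G × G is distributed according to the product class.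
  have h1 : ClassPreserving (fun x : G × H × K => x.1 * (x.2.1 : G))
      ((haar : Measure G).prod ((haar : Measure H).prod (haar : Measure K))) haar := by
    have h2 : ClassPreserving (fun x : G × H => (x.1 * (x.2 : G), x.2))
        ((haar : Measure G).prod (haar : Measure H)) (haar.prod haar) :=
      ClassPreserving.swap.comp ((ClassPreserving.skew (τ := fun (y : H) (x : G) => x * (y : G))
        (by fun_prop) (Filter.Eventually.of_forall fun y => classPreserving_mul_right (y : G))).comp
        ClassPreserving.swap)
    exact (ClassPreserving.fst.comp h2).comp (ClassPreserving.fst.comp .prodAssoc_symm)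
  refine .of_comp (f := fun x : G × H × K => x.1 * (x.2.1 : G))
    ((measurable_mk H).prodMk (measurable_mk K)) h1 ?_
  have h3 : ClassPreserving (fun x : G × H × K => (x.1, x.1 * ((x.2.1 : G) * x.2.2)))
      ((haar : Measure G).prod ((haar : Measure H).prod (haar : Measure K)))
      ((haar : Measure G).prod (haar : Measure G)) :=
    (ClassPreserving.skew (τ := fun (y x : G) => y * x) (by fun_prop)
      (Filter.Eventually.of_forall fun y => classPreserving_mul_left y)).comp
      (.prodMap .id (classPreserving_mul H K h))
  convert (ClassPreserving.prodMap (classPreserving_mk H) (classPreserving_mk K)).comp h3 using 1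
  funext x
  simp only [Function.comp_apply, ← mul_assoc, QuotientGroup.mk_mul_of_mem _ x.2.1.2,
    QuotientGroup.mk_mul_of_mem _ x.2.2.2]

end CosetSpaces

end KacCohomology

end

/-! ### Intersections of cosets, and grids as tuples of cosets -/

noncomputable section

namespace KacCohomology

namespace ClassPreserving

theorem snd {α β : Type*} [MeasurableSpace α] [MeasurableSpace β] {μa : Measure α} {μb : Measure β}
    [SFinite μa] [SFinite μb] [NeZero μa] :
    ClassPreserving (Prod.snd : α × β → β) (μa.prod μb) μb := fst.comp swap

end ClassPreserving

section

variable {H : Type*} [Group H] [TopologicalSpace H] [IsTopologicalGroup H]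
  [T2Space H] [LocallyCompactSpace H] [SecondCountableTopology H] [MeasurableSpace H] [BorelSpace H]

theorem measurable_partialProd {n : ℕ} (i : Fin (n + 1)) :
    Measurable fun g : Fin n → H => Fin.partialProd g i := by
  refine Fin.induction ?_ (fun i ih => ?_) i
  · simp only [Fin.partialProd_zero]
    exact measurable_const
  · simp only [Fin.partialProd_succ]
    exact ih.mul (measurable_pi_apply i)

/-- The change of variables to partial products preserves the measure class. -/
theorem classPreserving_partialProd (n : ℕ) :
    ClassPreserving (fun (g : Fin n → H) (i : Fin n) => Fin.partialProd g i.succ)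
      (Measure.pi fun _ => haar) (Measure.pi fun _ => haar) := by
  induction n with
  | zero =>
    convert ClassPreserving.id (μa := Measure.pi fun _ : Fin 0 => (haar : Measure H)) using 1
  | succ n ih =>
    have h1 : ClassPreserving (fun x : H × (Fin n → H) => (x.1, fun i => x.1 * x.2 i))
        (haar.prod (Measure.pi fun _ => haar)) (haar.prod (Measure.pi fun _ => haar)) :=
      ClassPreserving.skew (τ := fun (y : H) (x : Fin n → H) i => y * x i) (by fun_prop)
        (Filter.Eventually.of_forall fun y => (classPreserving_mul_left y).pi n)
    convert (ClassPreserving.cons n).comp (h1.comp ((ClassPreserving.id.prodMap ih).comp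
      (ClassPreserving.uncons n))) using 1
    funext g i
    refine Fin.cases ?_ (fun i => ?_) i
    · exact (Fin.partialProd_succ g 0).trans (by simp)
    · exact Fin.partialProd_succ' g i.succ

end

namespace MatchedPair

variable {G : Type u} [Group G] [TopologicalSpace G] [IsTopologicalGroup G]
  [T2Space G] [LocallyCompactSpace G] [SecondCountableTopology G]
  [MeasurableSpace G] [BorelSpace G] (P : MatchedPair G)

instance isClosed_coe₁ : IsClosed (P.G₁ : Set G) := P.isClosed₁

instance isClosed_coe₂ : IsClosed (P.G₂ : Set G) := P.isClosed₂

/-- Inversion exchanges G₁G₂ and G₂G₁ and preserves the Haar class. -/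
theorem conull_swap : (haar : Measure G) ((P.G₂ : Set G) * (P.G₁ : Set G))ᶜ = 0 := by
  rw [← measure_inv_null, Set.compl_inv, mul_inv_rev, inv_coe_set, inv_coe_set]
  exact P.conull

instance borelSpace₁ : BorelSpace (G ⧸ P.G₁) := by
  have : T2Space (G ⧸ P.G₁) := inferInstance
  exact CosetSpace.borelSpace

instance borelSpace₂ : BorelSpace (G ⧸ P.G₂) := by
  have : T2Space (G ⧸ P.G₂) := inferInstance
  exact CosetSpace.borelSpace

/-- The two cosets of an element. -/
def toPair (x : G) : (G ⧸ P.G₁) × (G ⧸ P.G₂) := (x, x)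

/-- Two elements with the same cosets differ by an element of G₁ ∩ G₂, so the map is injective, and
an injective Borel map on a standard Borel space is an embedding (Lusin–Souslin). This makes the
intersection point a Borel function of the two cosets. -/
theorem measurableEmbedding_toPair : MeasurableEmbedding P.toPair := by
  have : T2Space (G ⧸ P.G₁) := inferInstance
  have : T2Space (G ⧸ P.G₂) := inferInstance
  have : MeasurableSpace.CountablySeparated ((G ⧸ P.G₁) × (G ⧸ P.G₂)) :=
    inferInstance
  refine Measurable.measurableEmbedding ((measurable_mk P.G₁).prodMk (measurable_mk P.G₂)) ?_
  intro x y h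
  have h1 : x⁻¹ * y ∈ P.G₁ := QuotientGroup.eq.1 (Prod.ext_iff.1 h).1
  have h2 : x⁻¹ * y ∈ P.G₂ := QuotientGroup.eq.1 (Prod.ext_iff.1 h).2
  have h3 : x⁻¹ * y ∈ P.G₁ ⊓ P.G₂ := ⟨h1, h2⟩
  rw [P.inf_eq_bot, Subgroup.mem_bot, inv_mul_eq_one] at h3
  exact h3

/-- The pairs of cosets that intersect. -/
def good : Set ((G ⧸ P.G₁) × (G ⧸ P.G₂)) := Set.range P.toPair

/-- The point of intersection of two cosets. -/
def pt : (G ⧸ P.G₁) × (G ⧸ P.G₂) → G := P.measurableEmbedding_toPair.invFun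

theorem measurable_pt : Measurable P.pt := P.measurableEmbedding_toPair.measurable_invFun

theorem pt_toPair (x : G) : P.pt (x, x) = x := P.measurableEmbedding_toPair.leftInverse_invFun x

theorem toPair_pt {x : (G ⧸ P.G₁) × (G ⧸ P.G₂)} (h : x ∈ P.good) :
    ((P.pt x : G ⧸ P.G₁), (P.pt x : G ⧸ P.G₂)) = x := by
  obtain ⟨y, rfl⟩ := h
  rw [toPair, pt_toPair]

theorem measurableSet_good : MeasurableSet P.good :=
  P.measurableEmbedding_toPair.measurableSet_range

theorem smul_mem_good (g : G) (x : (G ⧸ P.G₁) × (G ⧸ P.G₂)) : g • x ∈ P.good ↔ x ∈ P.good := by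
  have key : ∀ (g : G) x, x ∈ P.good → g • x ∈ P.good := by
    rintro g _ ⟨y, rfl⟩
    exact ⟨g * y, rfl⟩
  exact ⟨fun h => by simpa using key g⁻¹ _ h, key g x⟩

theorem pt_smul (g : G) (x : (G ⧸ P.G₁) × (G ⧸ P.G₂)) (hx : x ∈ P.good) :
    P.pt (g • x) = g * P.pt x := by
  obtain ⟨y, rfl⟩ := hx
  exact (P.pt_toPair (g * y)).trans (by rw [toPair, pt_toPair])

theorem classPreserving_toPair : ClassPreserving P.toPair haar
    ((KacCohomology.quotMeasure P.G₁).prod (KacCohomology.quotMeasure P.G₂)) :=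
  classPreserving_pair P.G₁ P.G₂ P.conull

/-- Pairs of cosets that do not meet have empty preimage under `toPair`, which preserves the measure
class. -/
theorem ae_good : ∀ᵐ x ∂(KacCohomology.quotMeasure P.G₁).prod (KacCohomology.quotMeasure P.G₂),
    x ∈ P.good := by
  refine (P.classPreserving_toPair.null_iff _ P.measurableSet_good.compl).1 ?_
  have : P.toPair ⁻¹' P.goodᶜ = ∅ := by
    ext x
    simp [good]
  rw [this, measure_empty]

theorem classPreserving_coset₁ : ClassPreserving (fun x : P.G₂ => ((x : G) : G ⧸ P.G₁)) haar
    (KacCohomology.quotMeasure P.G₁) :=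
  classPreserving_coset P.G₁ P.G₂ P.conull_swap

theorem classPreserving_coset₂ : ClassPreserving (fun x : P.G₁ => ((x : G) : G ⧸ P.G₂)) haar
    (KacCohomology.quotMeasure P.G₂) :=
  classPreserving_coset P.G₂ P.G₁ P.conull

/-- The cosets of the vertices of the first row and of the first column of a grid. -/
def theta (p q : ℕ) (x : G × (Fin p → P.G₁) × (Fin q → P.G₂)) :
    (Fin (q + 1) → G ⧸ P.G₁) × (Fin (p + 1) → G ⧸ P.G₂) :=
  (fun j => ((x.1 * (Fin.partialProd x.2.2 j : P.G₂) : G) : G ⧸ P.G₁),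
    fun i => ((x.1 * (Fin.partialProd x.2.1 i : P.G₁) : G) : G ⧸ P.G₂))

/-- The corner x contributes the pair (xG₁, xG₂), whose class is that of Z₁ × Z₂. For fixed x the
other vertices of the first row have the form xs with s ∈ G₂, and s ↦ sG₁ preserves the class; the
first column is treated in the same way with the roles exchanged. -/
theorem classPreserving_theta (p q : ℕ) : ClassPreserving (P.theta p q)
    ((haar : Measure G).prod ((Measure.pi fun _ => haar).prod (Measure.pi fun _ => haar)))
    ((Measure.pi fun _ => KacCohomology.quotMeasure P.G₁).prod
      (Measure.pi fun _ => KacCohomology.quotMeasure P.G₂)) := by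
  have h1 : ClassPreserving (fun x : G × (Fin p → P.G₁) × (Fin q → P.G₂) => (x.1,
      (fun j => x.1 • (((Fin.partialProd x.2.2 j.succ : P.G₂) : G) : G ⧸ P.G₁) : Fin q → _),
      (fun i => x.1 • (((Fin.partialProd x.2.1 i.succ : P.G₁) : G) : G ⧸ P.G₂) : Fin p → _)))
      ((haar : Measure G).prod ((Measure.pi fun _ => haar).prod (Measure.pi fun _ => haar)))
      ((haar : Measure G).prod ((Measure.pi fun _ => KacCohomology.quotMeasure P.G₁).prod
        (Measure.pi fun _ => KacCohomology.quotMeasure P.G₂))) := by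
    refine ClassPreserving.skew (τ := fun (y : G) (x : (Fin p → P.G₁) × (Fin q → P.G₂)) =>
      ((fun j => y • (((Fin.partialProd x.2 j.succ : P.G₂) : G) : G ⧸ P.G₁) : Fin q → _),
      (fun i => y • (((Fin.partialProd x.1 i.succ : P.G₁) : G) : G ⧸ P.G₂) : Fin p → _))) ?_
      (Filter.Eventually.of_forall fun y => ?_)
    · refine Measurable.prodMk (measurable_pi_lambda _ fun j => Measurable.comp
        (g := fun z : G × (G ⧸ P.G₁) => z.1 • z.2) measurable_smul (measurable_fst.prodMk ?_))
        (measurable_pi_lambda _ fun j => Measurable.comp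
        (g := fun z : G × (G ⧸ P.G₂) => z.1 • z.2) measurable_smul (measurable_fst.prodMk ?_))
      · exact (measurable_mk P.G₁).comp (measurable_subtype_coe.comp
          ((measurable_partialProd j.succ).comp (measurable_snd.comp measurable_snd)))
      · exact (measurable_mk P.G₂).comp (measurable_subtype_coe.comp
          ((measurable_partialProd j.succ).comp (measurable_fst.comp measurable_snd)))
    · exact ((((classPreserving_smul P.G₁ y).comp P.classPreserving_coset₁).pi q).comp
        (classPreserving_partialProd q)).prodMap
        ((((classPreserving_smul P.G₂ y).comp P.classPreserving_coset₂).pi p).comp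
        (classPreserving_partialProd p)) |>.comp .swap
  convert ((ClassPreserving.cons q).prodMap (ClassPreserving.cons p)).comp
    (ClassPreserving.prod_prod_comm.comp
      ((P.classPreserving_toPair.prodMap ClassPreserving.id).comp h1)) using 1
  funext x
  refine Prod.ext ?_ ?_
  · funext j
    refine Fin.cases ?_ (fun j => ?_) j
    · simp [theta, toPair]
    · rfl
  · funext j
    refine Fin.cases ?_ (fun j => ?_) j
    · simp [theta, toPair]
    · rfl

open Classical in
/-- A retraction to a subgroup. -/
def retract (H : Subgroup G) (x : G) : H := if h : x ∈ H then ⟨x, h⟩ else 1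

theorem coe_retract {H : Subgroup G} {x : G} (h : x ∈ H) : (retract H x : G) = x := by
  rw [retract, dif_pos h]

theorem retract_eq {H : Subgroup G} {x : G} {y : H} (h : x = y) : retract H x = y := by
  subst h
  exact Subtype.ext (coe_retract y.2)

theorem measurable_retract {H : Subgroup G} (hH : IsClosed (H : Set G)) :
    Measurable (retract H) :=
  open scoped Classical in
  Measurable.dite (s := (H : Set G)) measurable_id measurable_const hH.measurableSet

/-- The vertical edges given by cosets. -/
def vEdge {q p : ℕ} (x : (Fin (q + 1) → G ⧸ P.G₁) × (Fin (p + 1) → G ⧸ P.G₂)) (i : Fin p)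
    (j : Fin (q + 1)) : P.G₁ :=
  retract P.G₁ ((P.pt (x.1 j, x.2 i.castSucc))⁻¹ * P.pt (x.1 j, x.2 i.succ))

/-- The horizontal edges given by cosets. -/
def hEdge {q p : ℕ} (x : (Fin (q + 1) → G ⧸ P.G₁) × (Fin (p + 1) → G ⧸ P.G₂)) (i : Fin (p + 1))
    (j : Fin q) : P.G₂ :=
  retract P.G₂ ((P.pt (x.1 j.castSucc, x.2 i))⁻¹ * P.pt (x.1 j.succ, x.2 i))

theorem measurable_vEdge {q p : ℕ} (i : Fin p) (j : Fin (q + 1)) :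
    Measurable fun x : (Fin (q + 1) → G ⧸ P.G₁) × (Fin (p + 1) → G ⧸ P.G₂) => P.vEdge x i j :=
  (measurable_retract P.isClosed₁).comp
    (((P.measurable_pt.comp (by fun_prop)).inv).mul (P.measurable_pt.comp (by fun_prop)))

theorem measurable_hEdge {q p : ℕ} (i : Fin (p + 1)) (j : Fin q) :
    Measurable fun x : (Fin (q + 1) → G ⧸ P.G₁) × (Fin (p + 1) → G ⧸ P.G₂) => P.hEdge x i j :=
  (measurable_retract P.isClosed₂).comp
    (((P.measurable_pt.comp (by fun_prop)).inv).mul (P.measurable_pt.comp (by fun_prop)))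

/-- All pairs of cosets intersect. -/
def AllGood {q p : ℕ} (x : (Fin (q + 1) → G ⧸ P.G₁) × (Fin (p + 1) → G ⧸ P.G₂)) : Prop :=
  ∀ i j, (x.1 j, x.2 i) ∈ P.good

theorem measurableSet_allGood (q p : ℕ) : MeasurableSet
    {x : (Fin (q + 1) → G ⧸ P.G₁) × (Fin (p + 1) → G ⧸ P.G₂) | P.AllGood x} := by
  have : {x : (Fin (q + 1) → G ⧸ P.G₁) × (Fin (p + 1) → G ⧸ P.G₂) | P.AllGood x} =
      ⋂ (i : Fin (p + 1)) (j : Fin (q + 1)), (fun x => (x.1 j, x.2 i)) ⁻¹' P.good := by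
    ext x
    simp [AllGood]
  rw [this]
  exact MeasurableSet.iInter fun i => MeasurableSet.iInter fun j =>
    (by fun_prop : Measurable _) P.measurableSet_good

theorem ae_allGood (q p : ℕ) : ∀ᵐ x ∂(Measure.pi fun _ : Fin (q + 1) =>
    KacCohomology.quotMeasure P.G₁).prod (Measure.pi fun _ : Fin (p + 1) =>
    KacCohomology.quotMeasure P.G₂), P.AllGood x := by
  simp only [AllGood, ae_all_iff]
  exact fun i j => (qmp_prodMap (Measure.quasiMeasurePreserving_eval _ j)
    (Measure.quasiMeasurePreserving_eval _ i)).ae P.ae_good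

variable {P}

theorem AllGood.smul {q p : ℕ} {x : (Fin (q + 1) → G ⧸ P.G₁) × (Fin (p + 1) → G ⧸ P.G₂)} {g : G} :
    P.AllGood (g • x) ↔ P.AllGood x :=
  forall_congr' fun _ => forall_congr' fun _ => P.smul_mem_good g (x.1 _, x.2 _)

/-- Both intersection points lie in the coset `x.1 j` of G₁, so their quotient is in G₁ and
`retract` leaves it alone. -/
theorem coe_vEdge {q p : ℕ} {x : (Fin (q + 1) → G ⧸ P.G₁) × (Fin (p + 1) → G ⧸ P.G₂)}
    (hx : P.AllGood x) (i : Fin p) (j : Fin (q + 1)) :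
    (P.vEdge x i j : G) = (P.pt (x.1 j, x.2 i.castSucc))⁻¹ * P.pt (x.1 j, x.2 i.succ) := by
  refine coe_retract (QuotientGroup.eq.1 ?_)
  exact (Prod.ext_iff.1 (P.toPair_pt (hx i.castSucc j))).1.trans
    (Prod.ext_iff.1 (P.toPair_pt (hx i.succ j))).1.symm

theorem coe_hEdge {q p : ℕ} {x : (Fin (q + 1) → G ⧸ P.G₁) × (Fin (p + 1) → G ⧸ P.G₂)}
    (hx : P.AllGood x) (i : Fin (p + 1)) (j : Fin q) :
    (P.hEdge x i j : G) = (P.pt (x.1 j.castSucc, x.2 i))⁻¹ * P.pt (x.1 j.succ, x.2 i) := by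
  refine coe_retract (QuotientGroup.eq.1 ?_)
  exact (Prod.ext_iff.1 (P.toPair_pt (hx i j.castSucc))).2.trans
    (Prod.ext_iff.1 (P.toPair_pt (hx i j.succ))).2.symm

variable (P)

open Classical in
/-- The grid given by cosets. -/
def gridOf {q p : ℕ} (x : (Fin (q + 1) → G ⧸ P.G₁) × (Fin (p + 1) → G ⧸ P.G₂)) : P.Grid p q :=
  if h : P.AllGood x then ⟨(P.vEdge x, P.hEdge x), fun i j => by
    simp only [coe_vEdge h, coe_hEdge h]
    group⟩
  -- An arbitrary constant grid on the null set of tuples in which some pair of cosets does not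
  -- meet.
  else ⟨(fun _ _ => 1, fun _ _ => 1), fun _ _ => rfl⟩

theorem measurable_gridOf (q p : ℕ) : Measurable (P.gridOf : _ → P.Grid p q) := by
  classical
  refine measurable_comap_iff.2 ?_
  have e : (Subtype.val ∘ (P.gridOf : _ → P.Grid p q)) = fun x =>
      if P.AllGood x then (P.vEdge x, P.hEdge x) else (fun _ _ => 1, fun _ _ => 1) := by
    funext x
    by_cases h : P.AllGood x
    · rw [if_pos h]
      exact congrArg Subtype.val (dif_pos h)
    · rw [if_neg h]
      exact congrArg Subtype.val (dif_neg h)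
  change Measurable (Subtype.val ∘ (P.gridOf : _ → P.Grid p q))
  rw [e]
  refine Measurable.ite (P.measurableSet_allGood q p) (Measurable.prodMk ?_ ?_) measurable_const
  · exact measurable_pi_lambda _ fun i => measurable_pi_lambda _ fun j => P.measurable_vEdge i j
  · exact measurable_pi_lambda _ fun i => measurable_pi_lambda _ fun j => P.measurable_hEdge i j

variable {P}

theorem gridOf_g {q p : ℕ} {x : (Fin (q + 1) → G ⧸ P.G₁) × (Fin (p + 1) → G ⧸ P.G₂)}
    (hx : P.AllGood x) : (P.gridOf x).g = P.vEdge x :=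
  congrArg (fun X : P.Grid p q => X.1.1) (dif_pos hx)

theorem gridOf_s {q p : ℕ} {x : (Fin (q + 1) → G ⧸ P.G₁) × (Fin (p + 1) → G ⧸ P.G₂)}
    (hx : P.AllGood x) : (P.gridOf x).s = P.hEdge x :=
  congrArg (fun X : P.Grid p q => X.1.2) (dif_pos hx)

theorem Grid.ext {p q : ℕ} {X Y : P.Grid p q} (hg : ∀ i j, (X.g i j : G) = Y.g i j)
    (hs : ∀ i j, (X.s i j : G) = Y.s i j) : X = Y :=
  Subtype.ext (Prod.ext (funext fun i => funext fun j => Subtype.ext (hg i j))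
    (funext fun i => funext fun j => Subtype.ext (hs i j)))

namespace Grid

variable {p q : ℕ} (X : P.Grid p q)

/-- The position of a vertex relative to the corner. -/
def vertex (i : Fin (p + 1)) (j : Fin (q + 1)) : G :=
  (Fin.partialProd (fun i => X.g i 0) i : P.G₁) * (Fin.partialProd (X.s i) j : P.G₂)

theorem vertex_hsucc (i : Fin (p + 1)) (j : Fin q) :
    X.vertex i j.succ = X.vertex i j.castSucc * X.s i j := by
  rw [vertex, vertex, Fin.partialProd_succ, Subgroup.coe_mul, mul_assoc]

/-- The position of a vertex is defined along one path, down the first column and then along a row.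
Commutativity of the squares moves a vertical step from the first column to column j. -/
theorem vertex_vsucc (i : Fin p) (j : Fin (q + 1)) :
    X.vertex i.succ j = X.vertex i.castSucc j * X.g i j := by
  refine Fin.induction ?_ (fun j ih => ?_) j
  · simp only [vertex, Fin.partialProd_zero, Fin.partialProd_succ, Subgroup.coe_mul,
      Subgroup.coe_one, mul_one]
  · rw [vertex_hsucc, vertex_hsucc, ih, mul_assoc, mul_assoc]
    exact congrArg _ (X.2 i j).symm

/-- Vertical edges lie in G₁, so all vertices of a column lie in the coset of G₁ of its top vertex.
-/
theorem mk_vertex₁ (h : G) (i : Fin (p + 1)) (j : Fin (q + 1)) :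
    ((h * X.vertex i j : G) : G ⧸ P.G₁) = (P.theta p q (h, X.corner)).1 j := by
  refine Fin.induction ?_ (fun i ih => ?_) i
  · simp [vertex, theta, corner]
  · rw [vertex_vsucc, ← mul_assoc, QuotientGroup.mk_mul_of_mem _ (X.g i j).2, ih]

theorem mk_vertex₂ (h : G) (i : Fin (p + 1)) (j : Fin (q + 1)) :
    ((h * X.vertex i j : G) : G ⧸ P.G₂) = (P.theta p q (h, X.corner)).2 i := by
  rw [vertex, ← mul_assoc, QuotientGroup.mk_mul_of_mem _ (Subtype.mem _)]
  rfl

theorem theta_corner (h : G) (i : Fin (p + 1)) (j : Fin (q + 1)) :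
    ((P.theta p q (h, X.corner)).1 j, (P.theta p q (h, X.corner)).2 i) =
      P.toPair (h * X.vertex i j) :=
  Prod.ext (X.mk_vertex₁ h i j).symm (X.mk_vertex₂ h i j).symm

theorem allGood_theta (h : G) : P.AllGood (P.theta p q (h, X.corner)) := fun i j => by
  rw [theta_corner]
  exact ⟨_, rfl⟩

theorem pt_theta (h : G) (i : Fin (p + 1)) (j : Fin (q + 1)) :
    P.pt ((P.theta p q (h, X.corner)).1 j, (P.theta p q (h, X.corner)).2 i) =
      h * X.vertex i j := by
  rw [theta_corner]
  exact P.pt_toPair _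

/-- The intersection points are the vertices translated by `h`, and edges are quotients of adjacent
vertices, so `h` drops out. -/
theorem gridOf_theta (h : G) : P.gridOf (P.theta p q (h, X.corner)) = X := by
  refine Grid.ext (fun i j => ?_) (fun i j => ?_)
  · rw [gridOf_g (X.allGood_theta h), coe_vEdge (X.allGood_theta h), pt_theta, pt_theta,
      vertex_vsucc]
    group
  · rw [gridOf_s (X.allGood_theta h), coe_hEdge (X.allGood_theta h), pt_theta, pt_theta,
      vertex_hsucc]
    group

theorem corner_injective : Function.Injective (corner : P.Grid p q → _) := fun X Y h => by
  rw [← X.gridOf_theta 1, h, Y.gridOf_theta]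

theorem measurable_corner : Measurable (corner : P.Grid p q → _) :=
  (measurable_pi_lambda _ fun i => (measurable_pi_apply 0).comp
    ((measurable_pi_apply i).comp (measurable_fst.comp measurable_subtype_coe))).prodMk
  (measurable_pi_lambda _ fun j => (measurable_pi_apply j).comp
    ((measurable_pi_apply 0).comp (measurable_snd.comp measurable_subtype_coe)))

instance : StandardBorelSpace (P.Grid p q) := by
  refine MeasurableSet.standardBorel (s := {X : (Fin p → Fin (q + 1) → P.G₁) ×
    (Fin (p + 1) → Fin q → P.G₂) | ∀ (i : Fin p) (j : Fin q),
    (X.2 i.castSucc j : G) * (X.1 i j.succ : G) = (X.1 i j.castSucc : G) * (X.2 i.succ j : G)}) ?_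
  simp only [Set.ofPred_forall]
  exact MeasurableSet.iInter fun i => MeasurableSet.iInter fun j =>
    measurableSet_eq_fun (by fun_prop) (by fun_prop)

/-- Lusin–Souslin on the standard Borel space of grids; a grid is determined by its corner because
it can be recovered through cosets. This gives `Measure.comap` in `Grid.measure` its intended value,
the measure of the image under `corner`. -/
theorem measurableEmbedding_corner : MeasurableEmbedding (corner : P.Grid p q → _) :=
  measurable_corner.measurableEmbedding corner_injective

variable (P p q)

theorem qmp_corner : QuasiMeasurePreserving (corner : P.Grid p q → _) (measure P p q)
    ((Measure.pi fun _ => haar).prod (Measure.pi fun _ => haar)) := by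
  refine ⟨measurable_corner, AbsolutelyContinuous.mk fun E hE h0 => ?_⟩
  rw [map_apply measurable_corner hE, measure, measurableEmbedding_corner.comap_apply]
  exact measure_mono_null (Set.image_preimage_subset _ _) h0

instance : SigmaFinite (measure P p q) :=
  ⟨⟨{ set := fun n => corner ⁻¹' spanningSets _ n
      set_mem := fun _ => trivial
      finite := fun n => by
        rw [measure, measurableEmbedding_corner.comap_apply]
        exact (measure_mono (Set.image_preimage_subset _ _)).trans_lt (measure_spanningSets_lt_top _ n)
      spanning := by rw [← Set.preimage_iUnion, iUnion_spanningSets, Set.preimage_univ] }⟩⟩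

theorem qmp_theta : QuasiMeasurePreserving
    (fun x : G × P.Grid p q => P.theta p q (x.1, x.2.corner)) (haar.prod (measure P p q))
    ((Measure.pi fun _ => KacCohomology.quotMeasure P.G₁).prod
      (Measure.pi fun _ => KacCohomology.quotMeasure P.G₂)) :=
  (P.classPreserving_theta p q).qmp.comp (qmp_prodMap (.id _) (qmp_corner P p q))

/-- Reading the first column and the first row off the cosets undoes `theta`, except that the base
point is forgotten. Hence it preserves the class, by `ClassPreserving.of_comp`, and on tuples in
which all cosets meet it is the corner of `gridOf`. -/
theorem qmp_gridOf : QuasiMeasurePreserving (P.gridOf : _ → P.Grid p q)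
    ((Measure.pi fun _ => KacCohomology.quotMeasure P.G₁).prod
      (Measure.pi fun _ => KacCohomology.quotMeasure P.G₂)) (measure P p q) := by
  refine ⟨P.measurable_gridOf q p, AbsolutelyContinuous.mk fun E hE h0 => ?_⟩
  have hc : ClassPreserving (fun x : (Fin (q + 1) → G ⧸ P.G₁) × (Fin (p + 1) → G ⧸ P.G₂) =>
      ((fun i => P.vEdge x i 0, fun j => P.hEdge x 0 j) : (Fin p → P.G₁) × (Fin q → P.G₂)))
      ((Measure.pi fun _ => KacCohomology.quotMeasure P.G₁).prod
        (Measure.pi fun _ => KacCohomology.quotMeasure P.G₂))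
      ((Measure.pi fun _ => haar).prod (Measure.pi fun _ => haar)) := by
    refine .of_comp ((measurable_pi_lambda _ fun i => P.measurable_vEdge i 0).prodMk
      (measurable_pi_lambda _ fun j => P.measurable_hEdge 0 j)) (P.classPreserving_theta p q) ?_
    convert ClassPreserving.snd (μa := (haar : Measure G)) (μb := (Measure.pi fun _ : Fin p =>
      (haar : Measure P.G₁)).prod (Measure.pi fun _ : Fin q => (haar : Measure P.G₂))) using 1
    funext x
    refine Prod.ext (funext fun i => ?_) (funext fun j => ?_)
    · refine retract_eq ?_
      have e : ∀ i : Fin (p + 1), P.pt ((P.theta p q x).1 0, (P.theta p q x).2 i) =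
          x.1 * (Fin.partialProd x.2.1 i : P.G₁) := fun i => by
        have h : ((P.theta p q x).1 0, (P.theta p q x).2 i) =
            P.toPair (x.1 * (Fin.partialProd x.2.1 i : P.G₁)) :=
          Prod.ext (by simp [theta, toPair]) rfl
        exact (congrArg P.pt h).trans (P.pt_toPair _)
      rw [e, e, Fin.partialProd_succ, Subgroup.coe_mul]
      group
    · refine retract_eq ?_
      have e : ∀ j : Fin (q + 1), P.pt ((P.theta p q x).1 j, (P.theta p q x).2 0) =
          x.1 * (Fin.partialProd x.2.2 j : P.G₂) := fun j => by
        have h : ((P.theta p q x).1 j, (P.theta p q x).2 0) =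
            P.toPair (x.1 * (Fin.partialProd x.2.2 j : P.G₂)) :=
          Prod.ext rfl (by simp [theta, toPair])
        exact (congrArg P.pt h).trans (P.pt_toPair _)
      rw [e, e, Fin.partialProd_succ, Subgroup.coe_mul]
      group
  rw [measure, measurableEmbedding_corner.comap_apply] at h0
  have h1 := hc.qmp.preimage_null h0
  rw [map_apply (P.measurable_gridOf q p) hE]
  refine measure_mono_null_ae ?_ h1
  filter_upwards [P.ae_allGood q p] with x hx hxE
  refine ⟨P.gridOf x, hxE, ?_⟩
  rw [corner, gridOf_g hx, gridOf_s hx]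

end Grid

end MatchedPair

end KacCohomology

end

noncomputable section

namespace KacCohomology

/-! ### Homogeneous and inhomogeneous cochains -/

section Homogenization

variable {G : Type*} [Group G]

/-- Differences of successive elements. -/
def edges {n : ℕ} (x : Fin (n + 1) → G) (i : Fin n) : G := (x i.castSucc)⁻¹ * x i.succ

theorem edges_smul {n : ℕ} (g : G) (x : Fin (n + 1) → G) : edges (g • x) = edges x := by
  funext i
  simp only [edges, Pi.smul_apply, smul_eq_mul]
  group

theorem edges_partialProd {n : ℕ} (h : G) (g : Fin n → G) :
    edges (h • Fin.partialProd g) = g := by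
  rw [edges_smul]
  funext i
  exact Fin.partialProd_right_inv g i

theorem smul_partialProd_edges {n : ℕ} (x : Fin (n + 1) → G) :
    x 0 • Fin.partialProd (edges x) = x := Fin.partialProd_left_inv x

/-- Up to its first vertex a tuple is the sequence of partial products of its edges, and multiplying
two adjacent edges omits one partial product. -/
theorem edges_succAbove {n : ℕ} (x : Fin (n + 2) → G) (k : Fin (n + 1)) :
    edges (fun i => x (k.succ.succAbove i)) = Fin.contractNth k (· * ·) (edges x) := by
  have h : (fun i => x (k.succ.succAbove i)) =
      x 0 • Fin.partialProd (Fin.contractNth k (· * ·) (edges x)) := by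
    rw [Fin.partialProd_contractNth]
    conv_lhs => rw [← smul_partialProd_edges x]
    rfl
  rw [h, edges_partialProd]

variable {M : Type*} [AddCommGroup M] [DistribMulAction G M]

/-- The homogeneous cochain of an inhomogeneous cochain. -/
def homog {m : ℕ} (F : (Fin m → G) → M) : ∀ n, (Fin n → G) → M
  | 0, _ => 0
  | n + 1, x => if h : n = m then x 0 • F (fun i => edges x (Fin.cast h.symm i)) else 0

theorem homog_self {m : ℕ} (F : (Fin m → G) → M) (x : Fin (m + 1) → G) :
    homog F (m + 1) x = x 0 • F (edges x) := dif_pos rfl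

theorem homog_of_ne {m : ℕ} (F : (Fin m → G) → M) {n : ℕ} (h : n ≠ m + 1) (x : Fin n → G) :
    homog F n x = 0 := by
  cases n with
  | zero => rfl
  | succ n => exact dif_neg fun h' => h (by rw [h'])

theorem homog_add {m : ℕ} (F F' : (Fin m → G) → M) (n : ℕ) (x : Fin n → G) :
    homog (F + F') n x = homog F n x + homog F' n x := by
  by_cases h : n = m + 1
  · subst h
    simp only [homog_self, Pi.add_apply, smul_add]
  · simp only [homog_of_ne _ h, add_zero]

theorem homog_smul {m : ℕ} (F : (Fin m → G) → M) (n : ℕ) (g : G) (x : Fin n → G) :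
    homog F n (g • x) = g • homog F n x := by
  by_cases h : n = m + 1
  · subst h
    rw [homog_self, homog_self, edges_smul, ← mul_smul]
    rfl
  · rw [homog_of_ne _ h, homog_of_ne _ h, smul_zero]

/-- Omitting the first vertex replaces x₀ by x₁ = x₀e₀, where e₀ is the first edge, and produces the
term with the action. Omitting any other vertex contracts the sequence of edges. -/
theorem hd_homog {m : ℕ} (F : (Fin m → G) → M) (n : ℕ) (x : Fin n → G) :
    hd (homog F) n x = homog (groupD G M m F) n x := by
  by_cases h : n = m + 1 + 1
  · subst h
    rw [homog_self, hd_succ, Fin.sum_univ_succ]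
    simp only [homog_self]
    change _ = x 0 • (edges x 0 • F (fun i => edges x i.succ) + ∑ j : Fin (m + 1),
      (-1 : ℤ) ^ ((j : ℕ) + 1) • F (Fin.contractNth j (· * ·) (edges x)))
    rw [smul_add, Finset.smul_sum]
    congr 1
    · rw [Fin.val_zero, pow_zero, one_smul, ← mul_smul]
      congr 2
      simp [edges]
    · refine Finset.sum_congr rfl fun k _ => ?_
      rw [edges_succAbove, smul_comm (x 0)]
      rfl
  · rw [homog_of_ne _ h]
    exact hd_eq_zero fun k hk b => homog_of_ne _ (by omega) b

/-- The coboundary of inhomogeneous cochains squares to zero. -/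
theorem groupD_groupD {m : ℕ} (F : (Fin m → G) → M) : groupD G M (m + 1) (groupD G M m F) = 0 := by
  funext g
  have h := hd_hd (homog F) (m + 1 + 1 + 1) (Fin.partialProd g)
  have e : hd (homog F) = homog (groupD G M m F) := by
    funext n x
    exact hd_homog F n x
  rw [e, hd_homog, homog_self, ← one_smul G (Fin.partialProd g), edges_partialProd] at h
  have h1 : (1 : G) • Fin.partialProd g 0 = 1 := by rw [Fin.partialProd_zero, smul_eq_mul, mul_one]
  rw [Pi.smul_apply, h1, one_smul] at h
  exact h

end Homogenization

section GroupComplex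

variable {G : Type u} [Group G] [TopologicalSpace G] [IsTopologicalGroup G]
  [T2Space G] [LocallyCompactSpace G] [SecondCountableTopology G] [MeasurableSpace G] [BorelSpace G]

theorem classPreserving_smul_partialProd (n : ℕ) :
    ClassPreserving (fun x : G × (Fin n → G) => x.1 • Fin.partialProd x.2)
      (haar.prod (Measure.pi fun _ => haar)) (Measure.pi fun _ => haar) := by
  have h1 : ClassPreserving (fun x : G × (Fin n → G) => (x.1, fun i => x.1 * x.2 i))
      (haar.prod (Measure.pi fun _ => haar)) (haar.prod (Measure.pi fun _ => haar)) :=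
    ClassPreserving.skew (τ := fun (y : G) (x : Fin n → G) i => y * x i) (by fun_prop)
      (Filter.Eventually.of_forall fun y => (classPreserving_mul_left y).pi n)
  convert (ClassPreserving.cons n).comp (h1.comp (ClassPreserving.id.prodMap
    (classPreserving_partialProd n))) using 1
  funext g i
  refine Fin.cases ?_ (fun i => ?_) i
  · simp
  · rfl

theorem measurable_edges {n : ℕ} : Measurable (edges : (Fin (n + 1) → G) → Fin n → G) :=
  measurable_pi_lambda _ fun i => (measurable_pi_apply _).inv.mul (measurable_pi_apply _)

theorem classPreserving_edges (n : ℕ) :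
    ClassPreserving (edges : (Fin (n + 1) → G) → Fin n → G)
      (Measure.pi fun _ => haar) (Measure.pi fun _ => haar) := by
  refine .of_comp measurable_edges (classPreserving_smul_partialProd n) ?_
  convert ClassPreserving.snd (μa := (haar : Measure G))
    (μb := Measure.pi fun _ : Fin n => (haar : Measure G)) using 1
  funext x
  exact edges_partialProd x.1 x.2

/-- Null sets are tested on vertices, as `edges` preserves the class; there the contraction becomes
the omission of a vertex. -/
theorem qmp_contractNth {n : ℕ} (k : Fin (n + 1)) :
    QuasiMeasurePreserving (fun g : Fin (n + 1) → G => (Fin.contractNth k (· * ·) g : Fin n → G))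
      (Measure.pi fun _ => haar) (Measure.pi fun _ => haar) := by
  have hm : Measurable fun g : Fin (n + 1) → G => (Fin.contractNth k (· * ·) g : Fin n → G) := by
    refine measurable_pi_lambda _ fun i => ?_
    unfold Fin.contractNth
    split_ifs <;> fun_prop
  refine ⟨hm, AbsolutelyContinuous.mk fun E hE h0 => ?_⟩
  rw [map_apply hm hE, ← (classPreserving_edges (n + 1)).null_iff _ (hm hE)]
  have h := ((classPreserving_edges (G := G) n).qmp.comp
    (qmp_succAbove (μa := (haar : Measure G)) k.succ)).preimage_null h0
  convert h using 2
  ext x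
  exact Eq.to_iff (congrArg (· ∈ E) (edges_succAbove x k).symm)

variable {A : Type v} [AddCommGroup A] [TopologicalSpace A] [IsTopologicalAddGroup A]
  [DistribMulAction G A]

variable (G A) in
theorem groupComplex_good [ContinuousSMul G A] : (groupComplex G A).Good where
  d_meas n F hF := by
    refine AEStronglyMeasurable.add ?_ ?_
    · exact (measurable_pi_apply 0).aestronglyMeasurable.smul
        (AEStronglyMeasurable.comp_quasiMeasurePreserving hF
          (qmp_succAbove (μa := (haar : Measure G)) (0 : Fin (n + 1))))
    · exact Finset.aestronglyMeasurable_fun_sum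
        (f := fun (k : Fin (n + 1)) (g : Fin (n + 1) → G) =>
          (-1 : ℤ) ^ ((k : ℕ) + 1) • (F : (Fin n → G) → A) (Fin.contractNth k (· * ·) g))
        Finset.univ fun k _ => (AEStronglyMeasurable.comp_quasiMeasurePreserving hF
          (qmp_contractNth k)).const_smul ((-1 : ℤ) ^ ((k : ℕ) + 1))
  d_null n F hF := by
    have h1 := (qmp_succAbove (μa := (haar : Measure G)) (0 : Fin (n + 1))).ae hF
    have h2 := ae_all_iff.2 fun k => (qmp_contractNth (G := G) (n := n) k).ae hF
    filter_upwards [h1, h2] with g h1 h2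
    change g 0 • (F : (Fin n → G) → A) (fun i => g i.succ) + ∑ j : Fin (n + 1),
      (-1 : ℤ) ^ ((j : ℕ) + 1) • (F : (Fin n → G) → A) (Fin.contractNth j (· * ·) g) = 0
    have h1' : (F : (Fin n → G) → A) (fun i => g i.succ) = 0 := by simpa using h1
    rw [h1', smul_zero, zero_add]
    exact Finset.sum_eq_zero fun k _ => (congrArg _ (h2 k)).trans (smul_zero _)
  d_d n F hF := by
    have : ∀ F : (Fin n → G) → A, groupD G A (n + 1) (groupD G A n F) ∈
        nullFun (Measure.pi fun _ : Fin (n + 2) => (haar : Measure G)) A := fun F => by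
      rw [groupD_groupD]
      exact zero_mem _
    exact this F

end GroupComplex

end KacCohomology

end

/-! ### Strict equivariance: measurability and null sets on slices -/

noncomputable section

namespace KacCohomology

theorem ae_of_ae_fst {α β : Type*} [MeasurableSpace α] [MeasurableSpace β] {μ : Measure α}
    {ν : Measure β} [SFinite ν] [NeZero ν] {p : α → Prop} (h : ∀ᵐ z ∂μ.prod ν, p z.1) :
    ∀ᵐ x ∂μ, p x := by
  filter_upwards [ae_ae_of_ae_prod h] with x hx
  exact Filter.eventually_const.1 hx

theorem ae_of_ae_snd {α β : Type*} [MeasurableSpace α] [MeasurableSpace β] {μ : Measure α}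
    {ν : Measure β} [SFinite μ] [SFinite ν] [NeZero μ] {p : β → Prop}
    (h : ∀ᵐ z ∂μ.prod ν, p z.2) : ∀ᵐ x ∂ν, p x :=
  ae_of_ae_fst (μ := ν) (ν := μ) (qmp_swap.ae h)

instance neZero_pi_empty {X : Type*} [MeasurableSpace X] (μ : Measure X) [SigmaFinite μ] :
    NeZero (Measure.pi fun _ : Fin 0 => μ) := by
  rw [Measure.pi_of_empty (fun _ : Fin 0 => μ)]
  infer_instance

section Translates

variable {G : Type*} [Group G] [TopologicalSpace G] [IsTopologicalGroup G]
  [T2Space G] [LocallyCompactSpace G] [SecondCountableTopology G] [MeasurableSpace G] [BorelSpace G]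
  {A : Type*} [AddCommGroup A] [TopologicalSpace A]
  [DistribMulAction G A] [ContinuousSMul G A] {Y W : Type*} [MeasurableSpace Y] [MeasurableSpace W]
  {μY : Measure Y} {μW : Measure W} [SFinite μY] {T : G × Y → W}

/-- `F` may be the restriction of `y` to a null set, where measurability of `y` almost everywhere
says nothing. By equivariance `F` is a translate of the restriction to a generic slice T(g, ·),
which is measurable by Fubini. -/
theorem aestronglyMeasurable_of_smul (hT : QuasiMeasurePreserving T (haar.prod μY) μW) {y : W → A}
    (hy : AEStronglyMeasurable y μW) {F : Y → A} (h : ∀ g x, y (T (g, x)) = g • F x) :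
    AEStronglyMeasurable F μY := by
  obtain ⟨g, hg⟩ := (hy.comp_quasiMeasurePreserving hT).prodMk_left.exists
  have : F = fun x => g⁻¹ • y (T (g, x)) := by
    funext x
    rw [h, inv_smul_smul]
  rw [this]
  exact (continuous_const_smul g⁻¹).comp_aestronglyMeasurable hg

theorem ae_eq_zero_of_smul (hT : QuasiMeasurePreserving T (haar.prod μY) μW) {y : W → A}
    (hy : ∀ᵐ w ∂μW, y w = 0) {F : Y → A} (h : ∀ g x, y (T (g, x)) = g • F x) :
    ∀ᵐ x ∂μY, F x = 0 := by
  obtain ⟨g, hg⟩ := (ae_ae_of_ae_prod (hT.ae hy)).exists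
  filter_upwards [hg] with x hx
  rwa [h, smul_eq_zero_iff_eq] at hx

end Translates

/-! ### Comparison of the group complex with homogeneous cochains -/

section HomogMap

variable {G : Type u} [Group G] [TopologicalSpace G] [IsTopologicalGroup G]
  [T2Space G] [LocallyCompactSpace G] [SecondCountableTopology G] [MeasurableSpace G] [BorelSpace G]
  {X₁ X₂ : Type u} [MeasurableSpace X₁] [MeasurableSpace X₂] [MulAction G X₁] [MulAction G X₂]
  (μ₁ : Measure X₁) (μ₂ : Measure X₂) [SigmaFinite μ₁] [SigmaFinite μ₂]
  (A : Type v) [AddCommGroup A] [TopologicalSpace A] [IsTopologicalAddGroup A]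
  [DistribMulAction G A] [ContinuousSMul G A]

variable {A} in
/-- Homogeneous cochains as families. -/
def homogFam {m : ℕ} (F : (Fin m → G) → A) : Fam G X₁ X₂ A
  | n, 0, 0 => fun x => homog F n x.1
  | _, _, _ => 0

variable {A} in
theorem homogFam_eq_zero {m : ℕ} (F : (Fin m → G) → A) {n q p : ℕ}
    (h : ¬(q = 0 ∧ p = 0) ∨ n ≠ m + 1) : homogFam (X₁ := X₁) (X₂ := X₂) F n q p = 0 := by
  rcases q with _ | q
  · rcases p with _ | p
    · funext x
      exact homog_of_ne F (h.resolve_left fun h => h ⟨rfl, rfl⟩) x.1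
    · rfl
  · rfl

variable {A} in
theorem aestronglyMeasurable_homog {m : ℕ} {F : (Fin m → G) → A}
    (hF : AEStronglyMeasurable F (Measure.pi fun _ => haar)) :
    AEStronglyMeasurable (homog F (m + 1)) (Measure.pi fun _ => haar) := by
  have : homog F (m + 1) = fun x => x 0 • F (edges x) := funext fun x => homog_self F x
  rw [this]
  exact (measurable_pi_apply 0).aestronglyMeasurable.smul
    (hF.comp_quasiMeasurePreserving (classPreserving_edges m).qmp)

variable {A} in
theorem ae_homog_eq_zero_iff {m : ℕ} {F : (Fin m → G) → A} :
    (∀ᵐ x ∂(Measure.pi fun _ => haar), homog F (m + 1) x = 0) ↔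
      ∀ᵐ g ∂(Measure.pi fun _ => haar), F g = 0 := by
  simp only [homog_self, smul_eq_zero_iff_eq]
  refine ⟨fun h => ?_, fun h => (classPreserving_edges m).qmp.ae h⟩
  obtain ⟨g, hg⟩ := (ae_ae_of_ae_prod
    ((classPreserving_smul_partialProd (G := G) m).qmp.ae h)).exists
  simpa only [edges_partialProd] using hg

/-- The passage to homogeneous cochains. -/
def homogMap : (groupComplex G A).WHom
    (Rel (haar : Measure G) μ₁ μ₂ A (fun _ q p => q = 0 ∧ p = 0) (fun n _ _ => n = 0) 1) where
  f m := AddMonoidHom.mk' (fun F => homogFam F) (by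
    intro F F'
    funext n q p x
    rcases q with _ | q
    · rcases p with _ | p
      · exact homog_add F F' n x.1
      · exact (add_zero (0 : A)).symm
    · exact (add_zero (0 : A)).symm)
  comm m F hF := by
    have key : ∀ F : (Fin m → G) → A, homogFam (groupD G A m F) -
        famD (homogFam F) ∈ famNull (X₁ := X₁) (X₂ := X₂) haar μ₁ μ₂
          (fun _ q p => q = 0 ∧ p = 0) := by
      rintro F n _ _ ⟨rfl, rfl⟩
      refine Filter.Eventually.of_forall fun x => ?_
      have e1 : D1 (homogFam F) n 0 0 x = 0 := rfl
      have e2 : D2 (homogFam F) n 0 0 x = 0 := rfl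
      have e0 : D0 (homogFam F) n 0 0 x = homog (groupD G A m F) n x.1 := hd_homog F n x.1
      change homog (groupD G A m F) n x.1 - famD (homogFam F) n 0 0 x = 0
      rw [famD_apply, e0, e1, e2, smul_zero, smul_zero, add_zero, add_zero, sub_self]
    exact key F
  map_meas m F hF := by
    refine ⟨fun n q p => ?_, fun n q p s x => ?_, fun n q p h => ?_⟩
    · by_cases h : ¬(q = 0 ∧ p = 0) ∨ n ≠ m + 1
      · exact (aestronglyMeasurable_const (b := (0 : A))).congr (Filter.Eventually.of_forall
          fun x => (congrFun (homogFam_eq_zero (F : (Fin m → G) → A) h) x).symm)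
      · obtain ⟨⟨rfl, rfl⟩, rfl⟩ : (q = 0 ∧ p = 0) ∧ n = m + 1 := by
          simpa only [not_or, not_not] using h
        exact (aestronglyMeasurable_homog hF).comp_quasiMeasurePreserving quasiMeasurePreserving_fst
    · rcases q with _ | q
      · rcases p with _ | p
        · exact homog_smul _ n s x.1
        · exact (smul_zero s).symm
      · exact (smul_zero s).symm
    · by_cases h' : ¬(q = 0 ∧ p = 0) ∨ n ≠ m + 1
      · exact homogFam_eq_zero _ h'
      · simp only [not_or, not_not] at h'
        obtain ⟨⟨rfl, rfl⟩, rfl⟩ := h'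
        omega
  map_null m F hF := by
    rintro n _ _ ⟨rfl, rfl⟩
    by_cases h : n = m + 1
    · subst h
      exact quasiMeasurePreserving_fst.ae (ae_homog_eq_zero_iff.2 hF)
    · exact Filter.Eventually.of_forall fun x => homog_of_ne _ h x.1

/-- The inverse evaluates at tuples of partial products, whose first entry is 1. Strict equivariance
makes this legitimate even if these tuples form a null set. -/
theorem homogMap_bijective [NeZero μ₁] [NeZero μ₂] (m : ℕ) :
    Function.Bijective ((homogMap (G := G) μ₁ μ₂ A).H m) := by
  have hz : NeZero ((Measure.pi fun _ : Fin 0 => μ₁).prod (Measure.pi fun _ : Fin 0 => μ₂)) :=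
    neZero_prod
  have hs : ∀ n, QuasiMeasurePreserving (fun x : Fin n → G => (x, (default : Fin 0 → X₁),
      (default : Fin 0 → X₂))) (Measure.pi fun _ => haar) (famMeasure haar μ₁ μ₂ n 0 0) := fun n =>
    (ClassPreserving.of_comp (f := Prod.fst) (by fun_prop) .fst (by
      convert ClassPreserving.id (μa := famMeasure (haar : Measure G) μ₁ μ₂ n 0 0) using 1
      funext x
      exact Prod.ext rfl (Subsingleton.elim _ _))).qmp
  refine MeasComplex.WHom.H_bijective_of_equiv _ (Rel_good _ _ _ ?_ ?_ 1) ?_ ?_ m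
  · exact ⟨fun _ _ _ h => h, fun _ _ _ h => by omega, fun _ _ _ h => by omega⟩
  · exact ⟨fun _ _ _ h => by omega, fun _ _ _ h => h, fun _ _ _ h => h⟩
  · intro m F hF
    have h0 : ∀ᵐ x ∂famMeasure haar μ₁ μ₂ (m + 1) 0 0, homog (F : (Fin m → G) → A) (m + 1) x.1 = 0 :=
      hF (m + 1) 0 0 ⟨rfl, rfl⟩
    exact ae_homog_eq_zero_iff.1 (ae_of_ae_fst h0)
  · intro m y hy
    have hT := (hs (m + 1)).comp (classPreserving_smul_partialProd (G := G) m).qmp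
    have he : ∀ (g : G) (x : Fin m → G), (y : Fam G X₁ X₂ A) (m + 1) 0 0
        (g • Fin.partialProd x, default, default) =
        g • (y : Fam G X₁ X₂ A) (m + 1) 0 0 (Fin.partialProd x, default, default) := fun g x => by
      rw [← hy.2.1]
      exact congrArg _ (Prod.ext rfl (Subsingleton.elim _ _))
    refine ⟨fun g => (y : Fam G X₁ X₂ A) (m + 1) 0 0 (Fin.partialProd g, default, default),
      aestronglyMeasurable_of_smul hT (hy.1 (m + 1) 0 0) he, ?_⟩
    rintro n _ _ ⟨rfl, rfl⟩
    refine Filter.Eventually.of_forall fun x => ?_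
    change (y : Fam G X₁ X₂ A) n 0 0 x - homog (fun g : Fin m → G => (y : Fam G X₁ X₂ A) (m + 1) 0 0
      (Fin.partialProd g, default, default)) n x.1 = 0
    by_cases h : n = m + 1
    · subst h
      rw [homog_self, ← he, smul_partialProd_edges, sub_eq_zero]
      exact congrArg _ (Prod.ext rfl (Subsingleton.elim _ _))
    · rw [homog_of_ne _ h, sub_zero]
      have := hy.2.2 n 0 0 (Or.inr (by omega))
      exact congrFun this x

end HomogMap

end KacCohomology

end

/-! ### Functions on grids as equivariant functions of cosets -/

noncomputable section

namespace KacCohomology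

namespace MatchedPair

variable {G : Type u} [Group G] [TopologicalSpace G] [IsTopologicalGroup G]
  [T2Space G] [LocallyCompactSpace G] [SecondCountableTopology G] [MeasurableSpace G] [BorelSpace G]
  {P : MatchedPair G}

section GridFaces

variable {q p : ℕ}

theorem AllGood.comp {q' p' : ℕ} {x : (Fin (q + 1) → G ⧸ P.G₁) × (Fin (p + 1) → G ⧸ P.G₂)}
    (hx : P.AllGood x) (a : Fin (q' + 1) → Fin (q + 1)) (b : Fin (p' + 1) → Fin (p + 1)) :
    P.AllGood (fun j => x.1 (a j), fun i => x.2 (b i)) := fun i j => hx (b i) (a j)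

theorem faceH0_gridOf {x : (Fin (q + 2) → G ⧸ P.G₁) × (Fin (p + 1) → G ⧸ P.G₂)} (hx : P.AllGood x) :
    (P.gridOf x).faceH0 = P.gridOf (fun j => x.1 j.succ, x.2) := by
  have hy : P.AllGood ((fun j => x.1 j.succ, x.2) : (Fin (q + 1) → G ⧸ P.G₁) ×
    (Fin (p + 1) → G ⧸ P.G₂)) := hx.comp Fin.succ id
  refine Grid.ext (fun i j => ?_) (fun i j => ?_)
  · change ((P.gridOf x).g i j.succ : G) = _
    rw [gridOf_g hx, gridOf_g hy]
    rfl
  · change ((P.gridOf x).s i j.succ : G) = _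
    rw [gridOf_s hx, gridOf_s hy]
    rfl

theorem faceV0_gridOf {x : (Fin (q + 1) → G ⧸ P.G₁) × (Fin (p + 2) → G ⧸ P.G₂)} (hx : P.AllGood x) :
    (P.gridOf x).faceV0 = P.gridOf (x.1, fun i => x.2 i.succ) := by
  have hy : P.AllGood ((x.1, fun i => x.2 i.succ) : (Fin (q + 1) → G ⧸ P.G₁) ×
    (Fin (p + 1) → G ⧸ P.G₂)) := hx.comp id Fin.succ
  refine Grid.ext (fun i j => ?_) (fun i j => ?_)
  · change ((P.gridOf x).g i.succ j : G) = _
    rw [gridOf_g hx, gridOf_g hy]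
    rfl
  · change ((P.gridOf x).s i.succ j : G) = _
    rw [gridOf_s hx, gridOf_s hy]
    rfl

theorem coe_contractNth {H : Subgroup G} {n : ℕ} (k : Fin (n + 1)) (f : Fin (n + 1) → H) (j : Fin n) :
    ((Fin.contractNth k (· * ·) f j : H) : G) = Fin.contractNth k (· * ·) (fun i => (f i : G)) j := by
  unfold Fin.contractNth
  split_ifs <;> rfl

/-- Along each row the horizontal edges are the `edges` of the sequence of intersection points.
Omitting a coset of G₁ omits one of these points in every row, and `edges_succAbove` applies. -/
theorem faceH_gridOf {x : (Fin (q + 2) → G ⧸ P.G₁) × (Fin (p + 1) → G ⧸ P.G₂)} (hx : P.AllGood x)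
    (k : Fin (q + 1)) :
    (P.gridOf x).faceH k = P.gridOf (fun j => x.1 (k.succ.succAbove j), x.2) := by
  have hy : P.AllGood ((fun j => x.1 (k.succ.succAbove j), x.2) : (Fin (q + 1) → G ⧸ P.G₁) ×
    (Fin (p + 1) → G ⧸ P.G₂)) := hx.comp k.succ.succAbove id
  refine Grid.ext (fun i j => ?_) (fun i j => ?_)
  · change ((P.gridOf x).g i (k.succ.succAbove j) : G) = _
    rw [gridOf_g hx, gridOf_g hy]
    rfl
  · change ((Fin.contractNth k (· * ·) ((P.gridOf x).s i) j : P.G₂) : G) = _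
    rw [gridOf_s hx, gridOf_s hy, coe_contractNth, coe_hEdge hy]
    have e : (fun j => (P.hEdge x i j : G)) = edges (fun j => P.pt (x.1 j, x.2 i)) :=
      funext fun j => coe_hEdge hx i j
    rw [e, ← edges_succAbove]
    rfl

theorem faceV_gridOf {x : (Fin (q + 1) → G ⧸ P.G₁) × (Fin (p + 2) → G ⧸ P.G₂)} (hx : P.AllGood x)
    (k : Fin (p + 1)) :
    (P.gridOf x).faceV k = P.gridOf (x.1, fun i => x.2 (k.succ.succAbove i)) := by
  have hy : P.AllGood ((x.1, fun i => x.2 (k.succ.succAbove i)) : (Fin (q + 1) → G ⧸ P.G₁) ×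
    (Fin (p + 1) → G ⧸ P.G₂)) := hx.comp id k.succ.succAbove
  refine Grid.ext (fun i j => ?_) (fun i j => ?_)
  · change ((Fin.contractNth k (· * ·) (fun i' => (P.gridOf x).g i' j) i : P.G₁) : G) = _
    rw [gridOf_g hx, gridOf_g hy, coe_contractNth, coe_vEdge hy]
    have e : (fun i => (P.vEdge x i j : G)) = edges (fun i => P.pt (x.1 j, x.2 i)) :=
      funext fun i => coe_vEdge hx i j
    rw [e, ← edges_succAbove]
    rfl
  · change ((P.gridOf x).s (k.succ.succAbove i) j : G) = _
    rw [gridOf_s hx, gridOf_s hy]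
    rfl

theorem pt_mul_vertex {x : (Fin (q + 1) → G ⧸ P.G₁) × (Fin (p + 1) → G ⧸ P.G₂)} (hx : P.AllGood x)
    (i : Fin (p + 1)) (j : Fin (q + 1)) :
    P.pt (x.1 0, x.2 0) * (P.gridOf x).vertex i j = P.pt (x.1 j, x.2 i) := by
  refine Fin.induction ?_ (fun j ih => ?_) j
  · refine Fin.induction ?_ (fun i ih => ?_) i
    · simp [Grid.vertex]
    · rw [Grid.vertex_vsucc, ← mul_assoc, ih, gridOf_g hx, coe_vEdge hx, mul_inv_cancel_left]
  · rw [Grid.vertex_hsucc, ← mul_assoc, ih, gridOf_s hx, coe_hEdge hx, mul_inv_cancel_left]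

/-- With `Grid.gridOf_theta` and `Grid.pt_theta` this gives a bijection between tuples of cosets
that all meet and pairs of a base point and a grid. -/
theorem theta_gridOf {x : (Fin (q + 1) → G ⧸ P.G₁) × (Fin (p + 1) → G ⧸ P.G₂)} (hx : P.AllGood x) :
    P.theta p q (P.pt (x.1 0, x.2 0), (P.gridOf x).corner) = x := by
  have h := fun i j => ((P.gridOf x).theta_corner (P.pt (x.1 0, x.2 0)) i j).trans
    ((congrArg P.toPair (pt_mul_vertex hx i j)).trans (P.toPair_pt (hx i j)))
  exact Prod.ext (funext fun j => congrArg Prod.fst (h 0 j)) (funext fun i => congrArg Prod.snd (h i 0))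

theorem theta_eq_smul (g : G) (c : (Fin p → P.G₁) × (Fin q → P.G₂)) :
    P.theta p q (g, c) = g • P.theta p q (1, c) := by
  refine Prod.ext (funext fun j => ?_) (funext fun i => ?_)
  · change ((g * _ : G) : G ⧸ P.G₁) = g • ((1 * _ : G) : G ⧸ P.G₁)
    rw [one_mul]
    rfl
  · change ((g * _ : G) : G ⧸ P.G₂) = g • ((1 * _ : G) : G ⧸ P.G₂)
    rw [one_mul]
    rfl

end GridFaces

section GridCochains

variable {A : Type v} [AddCommGroup A] [DistribMulAction G A] {q p : ℕ}

open Classical in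
/-- The homogeneous cochain of a function of grids. -/
def gridCochain (f : P.Grid p q → A)
    (x : (Fin (q + 1) → G ⧸ P.G₁) × (Fin (p + 1) → G ⧸ P.G₂)) : A :=
  if P.AllGood x then P.pt (x.1 0, x.2 0) • f (P.gridOf x) else 0

theorem gridCochain_of_allGood (f : P.Grid p q → A)
    {x : (Fin (q + 1) → G ⧸ P.G₁) × (Fin (p + 1) → G ⧸ P.G₂)} (hx : P.AllGood x) :
    gridCochain f x = P.pt (x.1 0, x.2 0) • f (P.gridOf x) := if_pos hx

theorem gridCochain_add (f f' : P.Grid p q → A)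
    (x : (Fin (q + 1) → G ⧸ P.G₁) × (Fin (p + 1) → G ⧸ P.G₂)) :
    gridCochain (f + f') x = gridCochain f x + gridCochain f' x := by
  by_cases hx : P.AllGood x
  · simp only [gridCochain_of_allGood _ hx, Pi.add_apply, smul_add]
  · simp [gridCochain, hx]

/-- The grid is invariant under translation and its base point is equivariant. The tuples with an
empty intersection form an invariant set on which both sides vanish, so nothing is lost to null
sets. -/
theorem gridCochain_smul (f : P.Grid p q → A) (g : G)
    (x : (Fin (q + 1) → G ⧸ P.G₁) × (Fin (p + 1) → G ⧸ P.G₂)) :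
    gridCochain f (g • x) = g • gridCochain f x := by
  by_cases hx : P.AllGood x
  · have hx' : P.AllGood (g • x) := AllGood.smul.2 hx
    have e : ∀ i j, P.pt ((g • x).1 j, (g • x).2 i) = g * P.pt (x.1 j, x.2 i) := fun i j =>
      P.pt_smul g (x.1 j, x.2 i) (hx i j)
    have e' : P.gridOf (g • x) = P.gridOf x := by
      refine Grid.ext (fun i j => ?_) (fun i j => ?_)
      · rw [gridOf_g hx, gridOf_g hx', coe_vEdge hx, coe_vEdge hx', e, e]
        group
      · rw [gridOf_s hx, gridOf_s hx', coe_hEdge hx, coe_hEdge hx', e, e]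
        group
    rw [gridCochain_of_allGood _ hx, gridCochain_of_allGood _ hx', e, e', mul_smul]
  · have hx' : ¬P.AllGood (g • x) := fun h => hx (AllGood.smul.1 h)
    simp [gridCochain, hx, hx']

/-- Omitting the first coset of G₁ moves the base point along the edge s₀₁, to pt(x₀, y₀)s₀₁; this
is the origin of the action in `dH`. -/
theorem gridCochain_dH (f : P.Grid p q → A)
    {x : (Fin (q + 2) → G ⧸ P.G₁) × (Fin (p + 1) → G ⧸ P.G₂)} (hx : P.AllGood x) :
    ∑ k : Fin (q + 2), (-1 : ℤ) ^ (k : ℕ) • gridCochain f (fun j => x.1 (k.succAbove j), x.2) =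
      gridCochain (dH f) x := by
  have hk : ∀ k : Fin (q + 2), P.AllGood ((fun j => x.1 (k.succAbove j), x.2) :
    (Fin (q + 1) → G ⧸ P.G₁) × (Fin (p + 1) → G ⧸ P.G₂)) := fun k => hx.comp k.succAbove id
  rw [Fin.sum_univ_succ, gridCochain_of_allGood _ hx, dH, smul_add, Finset.smul_sum]
  congr 1
  · rw [gridCochain_of_allGood _ (hk 0), Fin.val_zero, pow_zero, one_smul, ← mul_smul,
      faceH0_gridOf hx, gridOf_s hx, coe_hEdge hx]
    simp
  · refine Finset.sum_congr rfl fun k _ => ?_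
    rw [gridCochain_of_allGood _ (hk k.succ), faceH_gridOf hx, smul_comm (P.pt _)]
    rfl

theorem gridCochain_dV (f : P.Grid p q → A)
    {x : (Fin (q + 1) → G ⧸ P.G₁) × (Fin (p + 2) → G ⧸ P.G₂)} (hx : P.AllGood x) :
    ∑ k : Fin (p + 2), (-1 : ℤ) ^ (k : ℕ) • gridCochain f (x.1, fun j => x.2 (k.succAbove j)) =
      gridCochain (dV f) x := by
  have hk : ∀ k : Fin (p + 2), P.AllGood ((x.1, fun j => x.2 (k.succAbove j)) :
    (Fin (q + 1) → G ⧸ P.G₁) × (Fin (p + 1) → G ⧸ P.G₂)) := fun k => hx.comp id k.succAbove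
  rw [Fin.sum_univ_succ, gridCochain_of_allGood _ hx, dV, smul_add, Finset.smul_sum]
  congr 1
  · rw [gridCochain_of_allGood _ (hk 0), Fin.val_zero, pow_zero, one_smul, ← mul_smul,
      faceV0_gridOf hx, gridOf_g hx, coe_vEdge hx]
    simp
  · refine Finset.sum_congr rfl fun k _ => ?_
    rw [gridCochain_of_allGood _ (hk k.succ), faceV_gridOf hx, smul_comm (P.pt _)]
    rfl

/-- The homogeneous cochains of a cochain of the double complex, as families. -/
def gridFam {m : ℕ} (F : DC P A m) : Fam G (G ⧸ P.G₁) (G ⧸ P.G₂) A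
  | 0, q + 1, p + 1 => fun x =>
    if h : p + q = m then (-1 : ℤ) ^ p • gridCochain (F ⟨(p, q), h⟩) x.2 else 0
  | _, _, _ => 0

theorem gridFam_apply {m : ℕ} (F : DC P A m) (h : p + q = m)
    (x : (Fin 0 → G) × (Fin (q + 1) → G ⧸ P.G₁) × (Fin (p + 1) → G ⧸ P.G₂)) :
    gridFam F 0 (q + 1) (p + 1) x = (-1 : ℤ) ^ p • gridCochain (F ⟨(p, q), h⟩) x.2 := dif_pos h

theorem gridFam_eq_zero {m : ℕ} (F : DC P A m) {n q p : ℕ}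
    (h : n ≠ 0 ∨ (q = 0 ∨ p = 0) ∨ n + q + p ≠ m + 2) : gridFam F n q p = 0 := by
  rcases n with _ | n
  · rcases q with _ | q
    · rfl
    · rcases p with _ | p
      · rfl
      · funext x
        exact dif_neg (by omega)
  · rfl

theorem gridFam_add {m : ℕ} (F F' : DC P A m) : gridFam (F + F') = gridFam F + gridFam F' := by
  funext n q p
  by_cases h : n ≠ 0 ∨ (q = 0 ∨ p = 0) ∨ n + q + p ≠ m + 2
  · change gridFam (F + F') n q p = gridFam F n q p + gridFam F' n q p
    rw [gridFam_eq_zero _ h, gridFam_eq_zero _ h, gridFam_eq_zero _ h, add_zero]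
  · simp only [not_or, not_not] at h
    obtain ⟨rfl, ⟨hq, hp⟩, hm⟩ := h
    obtain ⟨q, rfl⟩ := Nat.exists_eq_succ_of_ne_zero hq
    obtain ⟨p, rfl⟩ := Nat.exists_eq_succ_of_ne_zero hp
    have e : p + q = m := by omega
    funext x
    change gridFam (F + F') 0 (q + 1) (p + 1) x = gridFam F 0 (q + 1) (p + 1) x +
      gridFam F' 0 (q + 1) (p + 1) x
    rw [gridFam_apply _ e, gridFam_apply _ e, gridFam_apply _ e, ← smul_add, ← gridCochain_add]
    rfl

/-- A grid with q columns of squares has q + 1 cosets of G₁, so `famD` gives the vertical coboundary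
the sign (-1)^(q + 1), whereas `totD` uses (-1)^q. The factor (-1)^p in `gridFam` compensates. -/
theorem gridFam_totD {m : ℕ} (F : DC P A m) (h : p + q = m + 1)
    {x : (Fin 0 → G) × (Fin (q + 1) → G ⧸ P.G₁) × (Fin (p + 1) → G ⧸ P.G₂)} (hx : P.AllGood x.2) :
    gridFam (totD P A m F) 0 (q + 1) (p + 1) x = famD (gridFam F) 0 (q + 1) (p + 1) x := by
  have e0 : D0 (gridFam F) 0 (q + 1) (p + 1) x = 0 := rfl
  have e1 : D1 (gridFam F) 0 (q + 1) (p + 1) x = (-1 : ℤ) ^ p • gridCochain (totH F p q h) x.2 := by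
    rcases q with _ | q
    -- With a single coset of G₁ its omission leads to q = 0, where `gridFam` vanishes; on the other
    -- side `totH` is zero for grids without columns of squares.
    · refine Eq.trans (b := (0 : A)) ?_ ?_
      · exact hd_eq_zero fun k hk b => by
          obtain rfl : k = 0 := by omega
          rfl
      · change _ = (-1 : ℤ) ^ p • gridCochain (fun _ => (0 : A)) x.2
        rw [gridCochain_of_allGood _ hx, smul_zero, smul_zero]
    · change hd (fun q a => gridFam F 0 q (p + 1) (x.1, a, x.2.2)) (q + 2) x.2.1 = _
      rw [hd_succ]
      simp only [gridFam_apply F (p := p) (q := q) (by omega)]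
      simp only [smul_comm _ ((-1 : ℤ) ^ p), ← Finset.smul_sum]
      exact congrArg _ (gridCochain_dH _ hx)
  have e2 : D2 (gridFam F) 0 (q + 1) (p + 1) x =
      -((-1 : ℤ) ^ p • gridCochain (totV F p q h) x.2) := by
    rcases p with _ | p
    · refine Eq.trans (b := (0 : A)) ?_ ?_
      · exact hd_eq_zero fun k hk b => by
          obtain rfl : k = 0 := by omega
          rfl
      · change _ = -((-1 : ℤ) ^ 0 • gridCochain (fun _ => (0 : A)) x.2)
        rw [gridCochain_of_allGood _ hx, smul_zero, smul_zero, neg_zero]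
    · change hd (fun p b => gridFam F 0 (q + 1) p (x.1, x.2.1, b)) (p + 2) x.2.2 = _
      rw [hd_succ]
      simp only [gridFam_apply F (p := p) (q := q) (by omega)]
      simp only [smul_comm _ ((-1 : ℤ) ^ p), ← Finset.smul_sum]
      rw [pow_succ, mul_neg_one, neg_smul, neg_neg]
      exact congrArg _ (gridCochain_dV _ hx)
  rw [gridFam_apply _ h, famD_apply, e0, e1, e2]
  have e3 : gridCochain (totD P A m F ⟨(p, q), h⟩) x.2 =
      gridCochain (totH F p q h) x.2 + (-1 : ℤ) ^ q • gridCochain (totV F p q h) x.2 := by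
    change gridCochain (totH F p q h + (-1 : ℤ) ^ q • totV F p q h) x.2 = _
    simp only [gridCochain_of_allGood _ hx, Pi.add_apply, Pi.smul_apply, smul_add,
      smul_comm (P.pt _)]
  rw [e3, zero_add, smul_add, pow_zero, one_smul, zero_add, pow_succ, mul_neg_one, neg_smul_neg,
    smul_comm]

end GridCochains

end MatchedPair

end KacCohomology

end

/-! ### D(A) and the cochains of G₁ and G₂ as homogeneous cochains on cosets -/

noncomputable section

namespace KacCohomology

/-- Adding empty tuples. -/
theorem qmp_default_left {α β : Type*} [MeasurableSpace α] [MeasurableSpace β]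
    (μ : Measure α) [SigmaFinite μ] (ν : Measure β) [SFinite ν] :
    QuasiMeasurePreserving (fun x : β => ((default : Fin 0 → α), x)) ν
      ((Measure.pi fun _ => μ).prod ν) :=
  (ClassPreserving.of_comp (f := Prod.snd) (by fun_prop) .snd (by
    convert ClassPreserving.id (μa := (Measure.pi fun _ : Fin 0 => μ).prod ν) using 1
    funext x
    exact Prod.ext (Subsingleton.elim _ _) rfl)).qmp

namespace MatchedPair

variable {G : Type u} [Group G] [TopologicalSpace G] [IsTopologicalGroup G]
  [T2Space G] [LocallyCompactSpace G] [SecondCountableTopology G] [MeasurableSpace G] [BorelSpace G]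
  (P : MatchedPair G) (A : Type v) [AddCommGroup A] [TopologicalSpace A] [IsTopologicalAddGroup A]
  [DistribMulAction G A] [ContinuousSMul G A]

/-- Homogeneous cochains on `Z₁^q × Z₂^p`, `Zᵢ = G / Gᵢ`. -/
abbrev cosetRel (V : ℕ → ℕ → ℕ → Prop) (L : ℕ → ℕ → ℕ → Prop) (k : ℕ) : MeasComplex :=
  Rel (haar : Measure G) (KacCohomology.quotMeasure P.G₁) (KacCohomology.quotMeasure P.G₂) A V L k

variable {P A}

/-- Along `theta` the homogeneous cochain is g • F(X) up to sign, so a generic g transfers its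
vanishing to F. -/
theorem gridFam_null_apply {m : ℕ} {F : DC P A m} {V : ℕ → ℕ → ℕ → Prop} (hF : gridFam F ∈
    famNull (haar : Measure G) (KacCohomology.quotMeasure P.G₁) (KacCohomology.quotMeasure P.G₂) V)
    (a : {a : ℕ × ℕ // a.1 + a.2 = m}) (ha : V 0 (a.1.2 + 1) (a.1.1 + 1)) :
    F a ∈ nullFun (Grid.measure P a.1.1 a.1.2) A := by
  obtain ⟨⟨p, q⟩, h⟩ := a
  have h1 := hF 0 (q + 1) (p + 1) ha
  have h2 : ∀ᵐ x ∂famMeasure (haar : Measure G) (KacCohomology.quotMeasure P.G₁)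
      (KacCohomology.quotMeasure P.G₂) 0 (q + 1) (p + 1),
      gridCochain (F ⟨(p, q), h⟩) x.2 = 0 := by
    filter_upwards [h1] with x hx
    rw [gridFam_apply F h] at hx
    rcases neg_one_pow_eq_or ℤ p with e | e <;> rw [e] at hx
    · simpa using hx
    · simpa using hx
  refine ae_eq_zero_of_smul (Grid.qmp_theta P p q) (ae_of_ae_snd h2) fun g X => ?_
  rw [gridCochain_of_allGood _ (X.allGood_theta g), Grid.gridOf_theta, Grid.pt_theta]
  simp [Grid.vertex]

theorem gridFam_mem_famNull {m : ℕ} {F : DC P A m} {V : ℕ → ℕ → ℕ → Prop}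
    (hF : ∀ a : {a : ℕ × ℕ // a.1 + a.2 = m}, V 0 (a.1.2 + 1) (a.1.1 + 1) →
      F a ∈ nullFun (Grid.measure P a.1.1 a.1.2) A) : gridFam F ∈
    famNull (haar : Measure G) (KacCohomology.quotMeasure P.G₁) (KacCohomology.quotMeasure P.G₂)
      V := by
  intro n q p hV
  by_cases h : n ≠ 0 ∨ (q = 0 ∨ p = 0) ∨ n + q + p ≠ m + 2
  · rw [gridFam_eq_zero F h]
    exact Filter.Eventually.of_forall fun _ => rfl
  · simp only [not_or, not_not] at h
    obtain ⟨rfl, ⟨hq, hp⟩, hm⟩ := h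
    obtain ⟨q, rfl⟩ : ∃ k, q = k + 1 := ⟨q - 1, by omega⟩
    obtain ⟨p, rfl⟩ : ∃ k, p = k + 1 := ⟨p - 1, by omega⟩
    have e : p + q = m := by omega
    have h1 : ∀ᵐ x ∂_, F ⟨(p, q), e⟩ (P.gridOf x) = 0 :=
      (Grid.qmp_gridOf P p q).ae (hF ⟨(p, q), e⟩ hV)
    filter_upwards [quasiMeasurePreserving_snd.ae h1,
      quasiMeasurePreserving_snd.ae (P.ae_allGood q p)] with x hx hx'
    rw [gridFam_apply F e, gridCochain_of_allGood _ hx', hx, smul_zero,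
      smul_zero]

theorem aestronglyMeasurable_gridCochain {q p : ℕ} {f : P.Grid p q → A}
    (hf : AEStronglyMeasurable f (Grid.measure P p q)) :
    AEStronglyMeasurable (gridCochain f) ((Measure.pi fun _ => KacCohomology.quotMeasure P.G₁).prod
      (Measure.pi fun _ => KacCohomology.quotMeasure P.G₂)) := by
  have h1 : AEStronglyMeasurable (fun x : (Fin (q + 1) → G ⧸ P.G₁) × (Fin (p + 1) → G ⧸ P.G₂) =>
      P.pt (x.1 0, x.2 0) • f (P.gridOf x)) _ :=
    (P.measurable_pt.comp (by fun_prop)).aestronglyMeasurable.smul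
      (hf.comp_quasiMeasurePreserving (Grid.qmp_gridOf P p q))
  refine h1.congr ?_
  filter_upwards [P.ae_allGood q p] with x hx
  rw [gridCochain_of_allGood _ hx]

theorem gridFam_mem_famMeas {m : ℕ} {F : DC P A m} (hF : ∀ a, AEStronglyMeasurable (F a)
    (Grid.measure P a.1.1 a.1.2)) : gridFam F ∈
    famMeas (haar : Measure G) (KacCohomology.quotMeasure P.G₁) (KacCohomology.quotMeasure P.G₂)
      fun n q p => (q = 0 ∨ p = 0) ∨ n + q + p ≠ m + 2 := by
  refine ⟨fun n q p => ?_, fun n q p s x => ?_, fun n q p h => gridFam_eq_zero F (Or.inr h)⟩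
  all_goals
    by_cases h : n ≠ 0 ∨ (q = 0 ∨ p = 0) ∨ n + q + p ≠ m + 2
  · rw [gridFam_eq_zero F h]
    exact aestronglyMeasurable_const
  · simp only [not_or, not_not] at h
    obtain ⟨rfl, ⟨hq, hp⟩, hm⟩ := h
    obtain ⟨q, rfl⟩ : ∃ k, q = k + 1 := ⟨q - 1, by omega⟩
    obtain ⟨p, rfl⟩ : ∃ k, p = k + 1 := ⟨p - 1, by omega⟩
    have e : p + q = m := by omega
    have h1 := (aestronglyMeasurable_gridCochain (hF ⟨(p, q), e⟩)).comp_quasiMeasurePreserving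
      (quasiMeasurePreserving_snd (μ := Measure.pi fun _ : Fin 0 => (haar : Measure G)))
    refine (h1.const_smul ((-1 : ℤ) ^ p)).congr (Filter.Eventually.of_forall fun x => ?_)
    exact (gridFam_apply F e x).symm
  · rw [gridFam_eq_zero F h]
    exact (smul_zero s).symm
  · simp only [not_or, not_not] at h
    obtain ⟨rfl, ⟨hq, hp⟩, hm⟩ := h
    obtain ⟨q, rfl⟩ : ∃ k, q = k + 1 := ⟨q - 1, by omega⟩
    obtain ⟨p, rfl⟩ : ∃ k, p = k + 1 := ⟨p - 1, by omega⟩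
    have e : p + q = m := by omega
    rw [gridFam_apply F e, gridFam_apply F e, smul_comm s]
    exact congrArg _ (gridCochain_smul _ s x.2)

theorem gridFam_comm {m : ℕ} (F : DC P A m) : gridFam (totD P A m F) - famD (gridFam F) ∈
    famNull (haar : Measure G) (KacCohomology.quotMeasure P.G₁) (KacCohomology.quotMeasure P.G₂)
      fun n _ _ => n = 0 := by
  rintro n q p rfl
  by_cases h : (q = 0 ∨ p = 0) ∨ 0 + q + p ≠ m + 1 + 2
  · refine Filter.Eventually.of_forall fun x => ?_
    have e0 : D0 (gridFam F) 0 q p x = 0 := rfl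
    have e1 : D1 (gridFam F) 0 q p x = 0 := hd_eq_zero fun k hk b => by
      rw [gridFam_eq_zero F (by omega)]
      rfl
    have e2 : D2 (gridFam F) 0 q p x = 0 := hd_eq_zero fun k hk b => by
      rw [gridFam_eq_zero F (by omega)]
      rfl
    change gridFam (totD P A m F) 0 q p x - famD (gridFam F) 0 q p x = 0
    rw [famD_apply, e0, e1, e2, gridFam_eq_zero _ (Or.inr h)]
    simp
  · simp only [not_or, not_not] at h
    obtain ⟨⟨hq, hp⟩, hm⟩ := h
    obtain ⟨q, rfl⟩ : ∃ k, q = k + 1 := ⟨q - 1, by omega⟩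
    obtain ⟨p, rfl⟩ : ∃ k, p = k + 1 := ⟨p - 1, by omega⟩
    filter_upwards [quasiMeasurePreserving_snd.ae (P.ae_allGood q p)] with x hx
    exact sub_eq_zero.2 (gridFam_totD F (by omega) hx)

/-- The inverse evaluates `y` at the cosets of the grid with base point 1. Equivariance recovers `y`
on all tuples of cosets that meet, hence almost everywhere. -/
theorem exists_gridFam {m : ℕ} {y : Fam G (G ⧸ P.G₁) (G ⧸ P.G₂) A} (hy : y ∈ famMeas
    (haar : Measure G) (KacCohomology.quotMeasure P.G₁) (KacCohomology.quotMeasure P.G₂)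
      fun n q p => (q = 0 ∨ p = 0) ∨ n + q + p ≠ m + 2) :
    ∃ F : DC P A m, (∀ a, AEStronglyMeasurable (F a) (Grid.measure P a.1.1 a.1.2)) ∧
      y - gridFam F ∈ famNull (haar : Measure G) (KacCohomology.quotMeasure P.G₁)
        (KacCohomology.quotMeasure P.G₂) fun n _ _ => n = 0 := by
  refine ⟨fun a X => (-1 : ℤ) ^ a.1.1 • y 0 (a.1.2 + 1) (a.1.1 + 1)
    (default, P.theta a.1.1 a.1.2 (1, X.corner)), fun a => ?_, ?_⟩
  · obtain ⟨⟨p, q⟩, h⟩ := a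
    have h1 := ((hy.1 0 (q + 1) (p + 1)).comp_quasiMeasurePreserving
      (qmp_default_left _ _)).const_smul ((-1 : ℤ) ^ p)
    refine aestronglyMeasurable_of_smul (Grid.qmp_theta P p q) h1 fun g X => ?_
    rw [smul_comm g, ← hy.2.1, theta_eq_smul]
    exact congrArg (fun z => (-1 : ℤ) ^ p • y 0 (q + 1) (p + 1) z)
      (Prod.ext (Subsingleton.elim _ _) rfl)
  · rintro n q p rfl
    by_cases h : (q = 0 ∨ p = 0) ∨ 0 + q + p ≠ m + 2
    · refine Filter.Eventually.of_forall fun x => ?_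
      change y 0 q p x - gridFam _ 0 q p x = 0
      rw [gridFam_eq_zero _ (Or.inr h), hy.2.2 _ _ _ h]
      exact sub_zero _
    · simp only [not_or, not_not] at h
      obtain ⟨⟨hq, hp⟩, hm⟩ := h
      obtain ⟨q, rfl⟩ : ∃ k, q = k + 1 := ⟨q - 1, by omega⟩
      obtain ⟨p, rfl⟩ : ∃ k, p = k + 1 := ⟨p - 1, by omega⟩
      have e : p + q = m := by omega
      filter_upwards [quasiMeasurePreserving_snd.ae (P.ae_allGood q p)] with x hx
      change y 0 (q + 1) (p + 1) x - gridFam _ 0 (q + 1) (p + 1) x = 0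
      rw [gridFam_apply _ e, gridCochain_of_allGood _ hx, smul_comm (P.pt _), smul_smul, ← pow_add,
        Even.neg_one_pow ⟨p, rfl⟩, one_smul, ← hy.2.1, sub_eq_zero]
      refine congrArg (y 0 (q + 1) (p + 1)) (Prod.ext (Subsingleton.elim _ _) ?_)
      exact ((theta_eq_smul _ _).symm.trans (theta_gridOf hx)).symm

variable (P A)

/-- The double complex of grids as homogeneous cochains. -/
def gridMap : (P.totalComplex A).WHom
    (P.cosetRel A (fun n _ _ => n = 0) (fun _ q p => q = 0 ∨ p = 0) 2) where
  f m := AddMonoidHom.mk' (fun F : DC P A m => gridFam F) fun F F' => gridFam_add F F'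
  comm _ F _ := gridFam_comm F
  map_meas _ _ hF := gridFam_mem_famMeas fun a => hF a trivial
  map_null _ _ hF := gridFam_mem_famNull fun a _ => hF a trivial

theorem gridMap_bijective (m : ℕ) : Function.Bijective ((P.gridMap A).H m) := by
  refine MeasComplex.WHom.H_bijective_of_equiv _ (Rel_good _ _ _ ?_ ?_ 2) ?_ ?_ m
  · exact ⟨fun _ _ _ h => by omega, fun _ _ _ h => h, fun _ _ _ h => h⟩
  · exact ⟨fun _ _ _ h => h, fun _ _ _ h => by omega, fun _ _ _ h => by omega⟩
  · exact fun m F hF a _ => gridFam_null_apply hF a rfl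
  · intro m y hy
    obtain ⟨F, hF, h⟩ := exists_gridFam hy
    exact ⟨F, fun a _ => hF a, h⟩

variable {P A}

/-- Functions on `G₁ᵐ` as functions on grids without squares. -/
def colExt {m : ℕ} (K : (Fin m → P.G₁) → A) : DC P A m := fun a X =>
  if h : a.1.2 = 0 then K fun i => X.g (Fin.cast (by have := a.2; omega) i) 0 else 0

/-- Functions on `G₂ᵐ` as functions on grids without squares. -/
def rowExt {m : ℕ} (K : (Fin m → P.G₂) → A) : DC P A m := fun a X =>
  if h : a.1.1 = 0 then K fun i => X.s 0 (Fin.cast (by have := a.2; omega) i) else 0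

theorem colExt_add {m : ℕ} (K K' : (Fin m → P.G₁) → A) :
    (colExt (K + K') : DC P A m) = colExt K + colExt K' := by
  funext a X
  by_cases h : a.1.2 = 0 <;> simp [colExt, h]

theorem rowExt_add {m : ℕ} (K K' : (Fin m → P.G₂) → A) :
    (rowExt (K + K') : DC P A m) = rowExt K + rowExt K' := by
  funext a X
  by_cases h : a.1.1 = 0 <;> simp [rowExt, h]

theorem col_colExt {m : ℕ} (K : (Fin m → P.G₁) → A) : col P A m (colExt K) = K := rfl

theorem row_rowExt {m : ℕ} (K : (Fin m → P.G₂) → A) : row P A m (rowExt K) = K := rfl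

theorem aestronglyMeasurable_colExt {m : ℕ} {K : (Fin m → P.G₁) → A}
    (hK : AEStronglyMeasurable K (Measure.pi fun _ => haar)) (a : {a : ℕ × ℕ // a.1 + a.2 = m}) :
    AEStronglyMeasurable (colExt K a) (Grid.measure P a.1.1 a.1.2) := by
  obtain ⟨⟨p, q⟩, h⟩ := a
  rcases q with _ | q
  · obtain rfl : p = m := h
    exact hK.comp_quasiMeasurePreserving (quasiMeasurePreserving_fst.comp (Grid.qmp_corner P p 0))
  · exact aestronglyMeasurable_const (b := (0 : A))

theorem aestronglyMeasurable_rowExt {m : ℕ} {K : (Fin m → P.G₂) → A}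
    (hK : AEStronglyMeasurable K (Measure.pi fun _ => haar)) (a : {a : ℕ × ℕ // a.1 + a.2 = m}) :
    AEStronglyMeasurable (rowExt K a) (Grid.measure P a.1.1 a.1.2) := by
  obtain ⟨⟨p, q⟩, h⟩ := a
  rcases p with _ | p
  · obtain rfl : q = m := (zero_add q).symm.trans h
    exact hK.comp_quasiMeasurePreserving (quasiMeasurePreserving_snd.comp (Grid.qmp_corner P 0 q))
  · exact aestronglyMeasurable_const (b := (0 : A))

theorem Grid.ofG₁_col {m : ℕ} (X : P.Grid m 0) : Grid.ofG₁ (fun i => X.g i 0) = X :=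
  Grid.ext (fun i _ => congrArg (fun j => (X.g i j : G)) (Subsingleton.elim (α := Fin 1) _ _))
    fun _ j => j.elim0

theorem Grid.ofG₂_row {m : ℕ} (X : P.Grid 0 m) : Grid.ofG₂ (fun i => X.s 0 i) = X :=
  Grid.ext (fun i => i.elim0)
    fun _ j => congrArg (fun i => (X.s i j : G)) (Subsingleton.elim (α := Fin 1) _ _)

/-- Only grids without columns of squares are seen in the degrees q ≤ 1, and these are given by
their first column. -/
theorem gridFam_mem_famNull_of_col {m : ℕ} {F : DC P A m}
    (hF : ∀ᵐ x ∂(Measure.pi fun _ => haar), col P A m F x = 0) : gridFam F ∈ famNull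
      (haar : Measure G) (KacCohomology.quotMeasure P.G₁) (KacCohomology.quotMeasure P.G₂)
      fun n q _ => n = 0 ∧ q ≤ 1 := by
  refine gridFam_mem_famNull fun ⟨⟨p, q⟩, h⟩ h' => ?_
  obtain rfl : q = 0 := by
    have h2 : q + 1 ≤ 1 := h'.2
    omega
  obtain rfl : p = m := h
  have h1 := (quasiMeasurePreserving_fst.comp (Grid.qmp_corner P p 0)).ae hF
  change ∀ᵐ x ∂_, F ⟨(p, 0), rfl⟩ x = 0
  filter_upwards [h1] with X hX
  rw [← Grid.ofG₁_col X]
  exact hX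

theorem gridFam_mem_famNull_of_row {m : ℕ} {F : DC P A m}
    (hF : ∀ᵐ x ∂(Measure.pi fun _ => haar), row P A m F x = 0) : gridFam F ∈ famNull
      (haar : Measure G) (KacCohomology.quotMeasure P.G₁) (KacCohomology.quotMeasure P.G₂)
      fun n _ p => n = 0 ∧ p ≤ 1 := by
  refine gridFam_mem_famNull fun ⟨⟨p, q⟩, h⟩ h' => ?_
  obtain rfl : p = 0 := by
    have h2 : p + 1 ≤ 1 := h'.2
    omega
  obtain rfl : q = m := (zero_add q).symm.trans h
  have h1 := (quasiMeasurePreserving_snd.comp (Grid.qmp_corner P 0 q)).ae hF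
  change ∀ᵐ x ∂_, F ⟨(0, q), zero_add q⟩ x = 0
  filter_upwards [h1] with X hX
  rw [← Grid.ofG₂_row X]
  exact hX

theorem gridFam_sub {m : ℕ} (F F' : DC P A m) : gridFam (F - F') = gridFam F - gridFam F' :=
  eq_sub_of_add_eq (by rw [← gridFam_add, sub_add_cancel])

variable (P A)

/-- The cochains of `G₁` as homogeneous cochains with one coset of `G₁`. -/
def colMap : (groupComplex P.G₁ A).WHom
    (P.cosetRel A (fun n q _ => n = 0 ∧ q ≤ 1) (fun _ q p => q = 0 ∨ p = 0) 2) where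
  f m := AddMonoidHom.mk' (fun K : (Fin m → P.G₁) → A => gridFam (colExt K)) fun K K' =>
    (congrArg gridFam (colExt_add K K')).trans (gridFam_add _ _)
  comm m K hK := by
    have key : ∀ K : (Fin m → P.G₁) → A, gridFam (colExt (groupD P.G₁ A m K)) -
        famD (gridFam (colExt K)) ∈ famNull (haar : Measure G) (KacCohomology.quotMeasure P.G₁)
        (KacCohomology.quotMeasure P.G₂) fun n q _ => n = 0 ∧ q ≤ 1 := fun K => by
      have h1 : gridFam (colExt (groupD P.G₁ A m K) - totD P A m (colExt K)) ∈ famNull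
          (haar : Measure G) (KacCohomology.quotMeasure P.G₁) (KacCohomology.quotMeasure P.G₂)
          fun n q _ => n = 0 ∧ q ≤ 1 := by
        refine gridFam_mem_famNull_of_col (Filter.Eventually.of_forall fun x => ?_)
        have h2 : col P A (m + 1) (totD P A m (colExt K)) = groupD P.G₁ A m K :=
          ((P.J₁ A).comm m (colExt K)).trans (congrArg _ (col_colExt K))
        rw [map_sub, h2, col_colExt, sub_self]
        rfl
      have h2 : gridFam (totD P A m (colExt K)) - famD (gridFam (colExt K)) ∈ famNull
          (haar : Measure G) (KacCohomology.quotMeasure P.G₁) (KacCohomology.quotMeasure P.G₂)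
          fun n q _ => n = 0 ∧ q ≤ 1 := fun n q p h => gridFam_comm (colExt K) n q p h.1
      rw [gridFam_sub] at h1
      simpa using add_mem h1 h2
    exact key K
  map_meas _ K hK := gridFam_mem_famMeas (aestronglyMeasurable_colExt hK)
  map_null _ K hK := gridFam_mem_famNull_of_col hK

/-- In terms of cosets, the projection of D(A) to its first column is the restriction to the degrees
q ≤ 1. -/
theorem colMap_J₁ (m : ℕ) (F : DC P A m) : gridFam (colExt (col P A m F)) - gridFam F ∈ famNull
    (haar : Measure G) (KacCohomology.quotMeasure P.G₁) (KacCohomology.quotMeasure P.G₂)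
    fun n q _ => n = 0 ∧ q ≤ 1 := by
  rw [← gridFam_sub]
  refine gridFam_mem_famNull_of_col (Filter.Eventually.of_forall fun x => ?_)
  rw [map_sub, col_colExt, sub_self]
  rfl

theorem exists_colExt {m : ℕ} {y : Fam G (G ⧸ P.G₁) (G ⧸ P.G₂) A} (hy : y ∈ famMeas
    (haar : Measure G) (KacCohomology.quotMeasure P.G₁) (KacCohomology.quotMeasure P.G₂)
      fun n q p => (q = 0 ∨ p = 0) ∨ n + q + p ≠ m + 2) :
    ∃ K ∈ (groupComplex P.G₁ A).meas m, y - gridFam (colExt K) ∈ famNull (haar : Measure G)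
      (KacCohomology.quotMeasure P.G₁) (KacCohomology.quotMeasure P.G₂) fun n q _ => n = 0 ∧ q ≤ 1 := by
  obtain ⟨F, hF, h⟩ := exists_gridFam hy
  refine ⟨(P.J₁ A).f m F, (P.J₁ A).map_meas m F fun a _ => hF a, ?_⟩
  have h2 : y - gridFam F ∈ famNull (haar : Measure G) (KacCohomology.quotMeasure P.G₁)
    (KacCohomology.quotMeasure P.G₂) fun n q _ => n = 0 ∧ q ≤ 1 := fun n q p hn => h n q p hn.1
  have h3 := sub_mem h2 (P.colMap_J₁ A m F)
  rw [sub_sub_sub_cancel_right] at h3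
  exact h3

theorem colMap_bijective (m : ℕ) : Function.Bijective ((P.colMap A).H m) := by
  refine MeasComplex.WHom.H_bijective_of_equiv _ (Rel_good _ _ _ ?_ ?_ 2) ?_ ?_ m
  · exact ⟨fun _ _ _ h => by omega, fun _ _ _ h => ⟨h.1, by omega⟩, fun _ _ _ h => h⟩
  · exact ⟨fun _ _ _ h => h, fun _ _ _ h => by omega, fun _ _ _ h => by omega⟩
  · exact fun m K hK => (Grid.quasiMeasurePreserving_ofG₁ m).ae
      (gridFam_null_apply (F := colExt (K : (Fin m → P.G₁) → A)) hK ⟨(m, 0), rfl⟩ ⟨rfl, le_rfl⟩)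
  · exact fun m y hy => P.exists_colExt A hy

/-- The cochains of `G₂` as homogeneous cochains with one coset of `G₂`. -/
def rowMap : (groupComplex P.G₂ A).WHom
    (P.cosetRel A (fun n _ p => n = 0 ∧ p ≤ 1) (fun _ q p => q = 0 ∨ p = 0) 2) where
  f m := AddMonoidHom.mk' (fun K : (Fin m → P.G₂) → A => gridFam (rowExt K)) fun K K' =>
    (congrArg gridFam (rowExt_add K K')).trans (gridFam_add _ _)
  comm m K hK := by
    have key : ∀ K : (Fin m → P.G₂) → A, gridFam (rowExt (groupD P.G₂ A m K)) -
        famD (gridFam (rowExt K)) ∈ famNull (haar : Measure G) (KacCohomology.quotMeasure P.G₁)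
        (KacCohomology.quotMeasure P.G₂) fun n _ p => n = 0 ∧ p ≤ 1 := fun K => by
      have h1 : gridFam (rowExt (groupD P.G₂ A m K) - totD P A m (rowExt K)) ∈ famNull
          (haar : Measure G) (KacCohomology.quotMeasure P.G₁) (KacCohomology.quotMeasure P.G₂)
          fun n _ p => n = 0 ∧ p ≤ 1 := by
        refine gridFam_mem_famNull_of_row (Filter.Eventually.of_forall fun x => ?_)
        have h2 : row P A (m + 1) (totD P A m (rowExt K)) = groupD P.G₂ A m K :=
          ((P.J₂ A).comm m (rowExt K)).trans (congrArg _ (row_rowExt K))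
        rw [map_sub, h2, row_rowExt, sub_self]
        rfl
      have h2 : gridFam (totD P A m (rowExt K)) - famD (gridFam (rowExt K)) ∈ famNull
          (haar : Measure G) (KacCohomology.quotMeasure P.G₁) (KacCohomology.quotMeasure P.G₂)
          fun n _ p => n = 0 ∧ p ≤ 1 := fun n q p h => gridFam_comm (rowExt K) n q p h.1
      rw [gridFam_sub] at h1
      simpa using add_mem h1 h2
    exact key K
  map_meas _ K hK := gridFam_mem_famMeas (aestronglyMeasurable_rowExt hK)
  map_null _ K hK := gridFam_mem_famNull_of_row hK

/-- Likewise, the projection to the first row is the restriction to the degrees p ≤ 1. -/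
theorem rowMap_J₂ (m : ℕ) (F : DC P A m) : gridFam (rowExt (row P A m F)) - gridFam F ∈ famNull
    (haar : Measure G) (KacCohomology.quotMeasure P.G₁) (KacCohomology.quotMeasure P.G₂)
    fun n _ p => n = 0 ∧ p ≤ 1 := by
  rw [← gridFam_sub]
  refine gridFam_mem_famNull_of_row (Filter.Eventually.of_forall fun x => ?_)
  rw [map_sub, row_rowExt, sub_self]
  rfl

theorem exists_rowExt {m : ℕ} {y : Fam G (G ⧸ P.G₁) (G ⧸ P.G₂) A} (hy : y ∈ famMeas
    (haar : Measure G) (KacCohomology.quotMeasure P.G₁) (KacCohomology.quotMeasure P.G₂)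
      fun n q p => (q = 0 ∨ p = 0) ∨ n + q + p ≠ m + 2) :
    ∃ K ∈ (groupComplex P.G₂ A).meas m, y - gridFam (rowExt K) ∈ famNull (haar : Measure G)
      (KacCohomology.quotMeasure P.G₁) (KacCohomology.quotMeasure P.G₂) fun n _ p => n = 0 ∧ p ≤ 1 := by
  obtain ⟨F, hF, h⟩ := exists_gridFam hy
  refine ⟨(P.J₂ A).f m F, (P.J₂ A).map_meas m F fun a _ => hF a, ?_⟩
  have h2 : y - gridFam F ∈ famNull (haar : Measure G) (KacCohomology.quotMeasure P.G₁)
    (KacCohomology.quotMeasure P.G₂) fun n _ p => n = 0 ∧ p ≤ 1 := fun n q p hn => h n q p hn.1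
  have h3 := sub_mem h2 (P.rowMap_J₂ A m F)
  rw [sub_sub_sub_cancel_right] at h3
  exact h3

theorem rowMap_bijective (m : ℕ) : Function.Bijective ((P.rowMap A).H m) := by
  refine MeasComplex.WHom.H_bijective_of_equiv _ (Rel_good _ _ _ ?_ ?_ 2) ?_ ?_ m
  · exact ⟨fun _ _ _ h => by omega, fun _ _ _ h => h, fun _ _ _ h => ⟨h.1, by omega⟩⟩
  · exact ⟨fun _ _ _ h => h, fun _ _ _ h => by omega, fun _ _ _ h => by omega⟩
  · exact fun m K hK => (Grid.quasiMeasurePreserving_ofG₂ m).ae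
      (gridFam_null_apply (F := rowExt (K : (Fin m → P.G₂) → A)) hK ⟨(0, m), zero_add m⟩
        ⟨rfl, le_rfl⟩)
  · exact fun m y hy => P.exists_rowExt A hy

end MatchedPair

end KacCohomology

end

noncomputable section

namespace KacCohomology

theorem hd_map {Z A B : Type*} [AddCommGroup A] [AddCommGroup B] (φ : A →+ B)
    (h : ∀ p, (Fin p → Z) → A) (p : ℕ) (b : Fin p → Z) :
    hd (fun p b => φ (h p b)) p b = φ (hd h p b) := by
  cases p with
  | zero => exact (map_zero φ).symm
  | succ p => simp only [hd_succ, _root_.map_sum, map_zsmul]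

/-! ### Cochains with values in measurable functions -/

section FunctionModule

variable (X : Type*) [MeasurableSpace X] (ν : Measure X) (A : Type*) [AddCommGroup A]
  [TopologicalSpace A] [IsTopologicalAddGroup A]

/-- The group of measurable functions, with the action `(g • F)(x) = g • F(g⁻¹ • x)`. -/
def MFun : Type _ := measFun ν A

instance : AddCommGroup (MFun X ν A) := inferInstanceAs (AddCommGroup (measFun ν A))

variable {X ν A}

namespace MFun

/-- Evaluation at a point. -/
def eval (x : X) : MFun X ν A →+ A := (Pi.evalAddMonoidHom (fun _ : X => A) x).comp (measFun ν A).subtype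

theorem ext {F F' : MFun X ν A} (h : ∀ x, F.eval x = F'.eval x) : F = F' :=
  Subtype.ext (funext h)

theorem aestronglyMeasurable (F : MFun X ν A) : AEStronglyMeasurable (fun x => F.eval x) ν := F.2

open Classical in
/-- The function itself, if it is measurable. -/
def of (f : X → A) : MFun X ν A := if h : AEStronglyMeasurable f ν then ⟨f, h⟩ else 0

theorem eval_of {f : X → A} (h : AEStronglyMeasurable f ν) (x : X) :
    (of f : MFun X ν A).eval x = f x := congrArg (eval x) (dif_pos h)

variable {G : Type*} [Group G] [MulAction G X] [QuasiInvariant G ν] [DistribMulAction G A]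
  [ContinuousConstSMul G A]

instance : DistribMulAction G (MFun X ν A) where
  smul g F := ⟨fun x => g • F.eval (g⁻¹ • x), (continuous_const_smul g).comp_aestronglyMeasurable
    (F.2.comp_quasiMeasurePreserving (QuasiInvariant.qmp g⁻¹))⟩
  one_smul F := ext fun x => by
    change (1 : G) • F.eval ((1 : G)⁻¹ • x) = _
    rw [inv_one, one_smul, one_smul]
  mul_smul g h F := ext fun x => by
    change (g * h) • F.eval ((g * h)⁻¹ • x) = g • h • F.eval (h⁻¹ • g⁻¹ • x)
    rw [mul_inv_rev, mul_smul, mul_smul]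
  smul_zero g := ext fun x => smul_zero g
  smul_add g F F' := ext fun x => smul_add g _ _

theorem eval_smul (g : G) (F : MFun X ν A) (x : X) : (g • F).eval x = g • F.eval (g⁻¹ • x) := rfl

end MFun

end FunctionModule

section FunctionComplex

variable (G : Type u) [Group G] [TopologicalSpace G] [IsTopologicalGroup G]
  [T2Space G] [LocallyCompactSpace G] [SecondCountableTopology G] [MeasurableSpace G] [BorelSpace G]
  (X : Type u) [MeasurableSpace X] (ν : Measure X) [SigmaFinite ν]
  [MulAction G X] [QuasiInvariant G ν]
  (A : Type v) [AddCommGroup A] [TopologicalSpace A] [IsTopologicalAddGroup A]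
  [DistribMulAction G A] [ContinuousSMul G A]

/-- The complex of measurable functions on `Gⁿ × X`. -/
def functionComplex : MeasComplex where
  C n := (Fin n → G) → MFun X ν A
  meas n := (measFun ((Measure.pi fun _ : Fin n => (haar : Measure G)).prod ν) A).comap
    (AddMonoidHom.mk' (fun F z => (F z.1).eval z.2) fun _ _ => rfl)
  null n := (nullFun ((Measure.pi fun _ : Fin n => (haar : Measure G)).prod ν) A).comap
    (AddMonoidHom.mk' (fun F z => (F z.1).eval z.2) fun _ _ => rfl)
  d n := groupD G (MFun X ν A) n

variable {G X ν A}

/-- Homogenization of functions on `Gᵐ × X`. -/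
def homogPair {m : ℕ} (f : (Fin m → G) × X → A) (z : (Fin (m + 1) → G) × X) : A :=
  z.1 0 • f (edges z.1, (z.1 0)⁻¹ • z.2)

theorem eval_homog {m : ℕ} (F : (Fin m → G) → MFun X ν A) (x : Fin (m + 1) → G) (a : X) :
    (homog F (m + 1) x).eval a = homogPair (fun z => (F z.1).eval z.2) (x, a) := by
  rw [homog_self]
  rfl

variable [MeasurableSMul₂ G X]

theorem qmp_homogPair (m : ℕ) : QuasiMeasurePreserving
    (fun z : (Fin (m + 1) → G) × X => (edges z.1, (z.1 0)⁻¹ • z.2))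
    ((Measure.pi fun _ => haar).prod ν) ((Measure.pi fun _ => haar).prod ν) :=
  (qmp_prodMap (classPreserving_edges m).qmp (.id ν)).comp
    (qmp_skew (τ := fun (x : Fin (m + 1) → G) (a : X) => (x 0)⁻¹ • a)
      (((measurable_pi_apply 0).comp measurable_fst).inv.smul measurable_snd)
      (Filter.Eventually.of_forall fun _ => QuasiInvariant.qmp _))

theorem qmp_dehomogPair (m : ℕ) : QuasiMeasurePreserving
    (fun z : G × (Fin m → G) × X => (z.1 • Fin.partialProd z.2.1, z.1 • z.2.2))
    ((haar : Measure G).prod ((Measure.pi fun _ => haar).prod ν))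
    ((Measure.pi fun _ => haar).prod ν) :=
  (qmp_prodMap (classPreserving_smul_partialProd m).qmp (.id ν)).comp
    ((qmp_skew (τ := fun (x : G × (Fin m → G)) (a : X) => x.1 • a)
      ((measurable_fst.comp measurable_fst).smul measurable_snd)
      (Filter.Eventually.of_forall fun _ => QuasiInvariant.qmp _)).comp
      ClassPreserving.prodAssoc_symm.qmp)

theorem aestronglyMeasurable_homogPair {m : ℕ} {f : (Fin m → G) × X → A}
    (hf : AEStronglyMeasurable f ((Measure.pi fun _ => haar).prod ν)) :
    AEStronglyMeasurable (homogPair f) ((Measure.pi fun _ => haar).prod ν) :=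
  ((measurable_pi_apply 0).comp measurable_fst).aestronglyMeasurable.smul
    (hf.comp_quasiMeasurePreserving (qmp_homogPair m))

theorem homogPair_dehomog {m : ℕ} (f : (Fin m → G) × X → A) (g : G) (z : (Fin m → G) × X) :
    homogPair f (g • Fin.partialProd z.1, g • z.2) = g • f z := by
  have h : (g • Fin.partialProd z.1 : Fin (m + 1) → G) 0 = g := by simp
  rw [homogPair]
  simp only [h, edges_partialProd, inv_smul_smul]

theorem ae_homogPair_eq_zero_iff {m : ℕ} {f : (Fin m → G) × X → A} :
    (∀ᵐ z ∂(Measure.pi fun _ => haar).prod ν, homogPair f z = 0) ↔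
      ∀ᵐ z ∂(Measure.pi fun _ => haar).prod ν, f z = 0 := by
  constructor
  · exact fun h => ae_eq_zero_of_smul (qmp_dehomogPair m) h fun g z => homogPair_dehomog f g z
  · intro h
    filter_upwards [(qmp_homogPair m).ae h] with z hz
    rw [homogPair, hz, smul_zero]

theorem exists_functionComplex_of_equivariant {m : ℕ} {y : (Fin (m + 1) → G) × X → A}
    (hy : AEStronglyMeasurable y ((Measure.pi fun _ => haar).prod ν))
    (he : ∀ (g : G) z, y (g • z) = g • y z) :
    ∃ F ∈ (functionComplex G X ν A).meas m, ∀ᵐ z ∂(Measure.pi fun _ => haar).prod ν,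
      y z = (homog (F : (Fin m → G) → MFun X ν A) (m + 1) z.1).eval z.2 := by
  have hf : AEStronglyMeasurable (fun z : (Fin m → G) × X => y (Fin.partialProd z.1, z.2))
      ((Measure.pi fun _ => haar).prod ν) :=
    aestronglyMeasurable_of_smul (qmp_dehomogPair m) hy fun g z => he g (Fin.partialProd z.1, z.2)
  -- For the null set of `h` with a non-measurable slice `MFun.of` returns 0.
  let F : (Fin m → G) → MFun X ν A := fun h => MFun.of fun a => y (Fin.partialProd h, a)
  have hF : ∀ᵐ z ∂(Measure.pi fun _ => haar).prod ν,
      (F z.1).eval z.2 = y (Fin.partialProd z.1, z.2) := by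
    filter_upwards [quasiMeasurePreserving_fst.ae hf.prodMk_left] with z hz
    exact MFun.eval_of hz z.2
  refine ⟨F, hf.congr (hF.mono fun z hz => hz.symm), ?_⟩
  filter_upwards [(qmp_homogPair m).ae hF] with z hz
  rw [eval_homog, homogPair, hz, ← he]
  refine congrArg y (Prod.ext ?_ ?_)
  · exact (smul_partialProd_edges z.1).symm
  · exact (smul_inv_smul (z.1 0) z.2).symm

end FunctionComplex

end KacCohomology

end

/-! ### Cochains with values in functions on G/G₁ ⊔ G/G₂ -/

noncomputable section

namespace KacCohomology

theorem qmp_singleton {α X : Type*} [MeasurableSpace α] [MeasurableSpace X] (μ : Measure α)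
    [SFinite μ] (ν : Measure X) [SigmaFinite ν] :
    QuasiMeasurePreserving (fun z : α × X => (z.1, fun _ : Fin 1 => z.2)) (μ.prod ν)
      (μ.prod (Measure.pi fun _ => ν)) :=
  qmp_prodMap (.id μ)
    (measurePreserving_funUnique ν (Fin 1)).symm.quasiMeasurePreserving

section QuotientMeasure

variable {G : Type u} [Group G] [TopologicalSpace G] [IsTopologicalGroup G]
  [T2Space G] [LocallyCompactSpace G] [SecondCountableTopology G] [MeasurableSpace G] [BorelSpace G]
  (P : MatchedPair G) {α : Type*} [MeasurableSpace α] {μ : Measure α} [SFinite μ]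

namespace MatchedPair

theorem prod_quotMeasure : μ.prod P.quotMeasure =
    (μ.prod (KacCohomology.quotMeasure P.G₁)).map (Prod.map id Sum.inl) +
    (μ.prod (KacCohomology.quotMeasure P.G₂)).map (Prod.map id Sum.inr) := by
  rw [quotMeasure, Measure.prod_add, ← map_prod_map _ _ measurable_id measurable_inl,
    ← map_prod_map _ _ measurable_id measurable_inr, Measure.map_id]

theorem measurableEmbedding_inl : MeasurableEmbedding (Prod.map id Sum.inl : α × (G ⧸ P.G₁) →
    α × P.Quot) := MeasurableEmbedding.id.prodMap ⟨Sum.inl_injective, measurable_inl, fun _ hs => hs.inl_image⟩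

theorem measurableEmbedding_inr : MeasurableEmbedding (Prod.map id Sum.inr : α × (G ⧸ P.G₂) →
    α × P.Quot) := MeasurableEmbedding.id.prodMap ⟨Sum.inr_injective, measurable_inr, fun _ hs => hs.inr_image⟩

theorem ae_prod_quotMeasure_iff {p : α × P.Quot → Prop} : (∀ᵐ z ∂μ.prod P.quotMeasure, p z) ↔
    (∀ᵐ z ∂μ.prod (KacCohomology.quotMeasure P.G₁), p (z.1, Sum.inl z.2)) ∧
      ∀ᵐ z ∂μ.prod (KacCohomology.quotMeasure P.G₂), p (z.1, Sum.inr z.2) := by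
  rw [prod_quotMeasure, ae_add_measure_iff, P.measurableEmbedding_inl.ae_map_iff,
    P.measurableEmbedding_inr.ae_map_iff]
  rfl

theorem aestronglyMeasurable_prod_quotMeasure_iff {A : Type*} [TopologicalSpace A]
    [TopologicalSpace.PseudoMetrizableSpace A] {f : α × P.Quot → A} :
    AEStronglyMeasurable f (μ.prod P.quotMeasure) ↔
    AEStronglyMeasurable (fun z => f (z.1, Sum.inl z.2)) (μ.prod (KacCohomology.quotMeasure P.G₁)) ∧
    AEStronglyMeasurable (fun z => f (z.1, Sum.inr z.2))
      (μ.prod (KacCohomology.quotMeasure P.G₂)) := by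
  rw [prod_quotMeasure, aestronglyMeasurable_add_measure_iff,
    P.measurableEmbedding_inl.aestronglyMeasurable_map_iff,
    P.measurableEmbedding_inr.aestronglyMeasurable_map_iff]
  rfl

instance measurableSMul₂_quot : MeasurableSMul₂ G P.Quot where
  measurable_smul := by
    have h1 : Measurable fun z : G × (G ⧸ P.G₁) => (Sum.inl (z.1 • z.2) : P.Quot) :=
      measurable_inl.comp (measurable_fst.smul measurable_snd)
    have h2 : Measurable fun z : G × (G ⧸ P.G₂) => (Sum.inr (z.1 • z.2) : P.Quot) :=
      measurable_inr.comp (measurable_fst.smul measurable_snd)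
    have : (fun z : G × P.Quot => z.1 • z.2) = Sum.elim (fun z : G × (G ⧸ P.G₁) =>
        (Sum.inl (z.1 • z.2) : P.Quot)) (fun z : G × (G ⧸ P.G₂) => (Sum.inr (z.1 • z.2) : P.Quot)) ∘
        MeasurableEquiv.prodSumDistrib _ _ _ := by
      funext z
      obtain ⟨g, z | z⟩ := z <;> rfl
    change Measurable fun z : G × P.Quot => z.1 • z.2
    rw [this]
    exact (measurable_fun_sum h1 h2).comp (MeasurableEquiv.measurable _)

end MatchedPair

end QuotientMeasure

namespace MatchedPair

variable {G : Type u} [Group G] [TopologicalSpace G] [IsTopologicalGroup G]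
  [T2Space G] [LocallyCompactSpace G] [SecondCountableTopology G] [MeasurableSpace G] [BorelSpace G]
  (P : MatchedPair G) (A : Type v) [AddCommGroup A] [TopologicalSpace A] [IsTopologicalAddGroup A]
  [TopologicalSpace.PseudoMetrizableSpace A] [DistribMulAction G A] [ContinuousSMul G A]

/-- Measurable functions on `G / G₁ ⊔ G / G₂`. -/
abbrev QFun : Type (max u v) := MFun P.Quot P.quotMeasure A

variable {P A}

/-- Cochains with values in functions on `G / G₁ ⊔ G / G₂` as functions of a coset of `G₁`. -/
def evalFam₁ {m : ℕ} (F : (Fin m → G) → P.QFun A) : Fam G (G ⧸ P.G₁) (G ⧸ P.G₂) A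
  | n, 1, 0 => fun x => (homog F n x.1).eval (Sum.inl (x.2.1 0))
  | _, _, _ => 0

/-- Cochains with values in functions on `G / G₁ ⊔ G / G₂` as functions of a coset of `G₂`. -/
def evalFam₂ {m : ℕ} (F : (Fin m → G) → P.QFun A) : Fam G (G ⧸ P.G₁) (G ⧸ P.G₂) A
  | n, 0, 1 => fun x => -(homog F n x.1).eval (Sum.inr (x.2.2 0))
  | _, _, _ => 0

theorem evalFam₁_eq_zero {m : ℕ} (F : (Fin m → G) → P.QFun A) {n q p : ℕ}
    (h : ¬(q = 1 ∧ p = 0) ∨ n ≠ m + 1) : evalFam₁ F n q p = 0 := by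
  match q, p with
  | 0, p => rfl
  | 1, p + 1 => rfl
  | q + 2, p => rfl
  | 1, 0 =>
    funext x
    change (homog F n x.1).eval _ = 0
    rw [homog_of_ne F (h.resolve_left fun h => h ⟨rfl, rfl⟩), map_zero]

theorem evalFam₂_eq_zero {m : ℕ} (F : (Fin m → G) → P.QFun A) {n q p : ℕ}
    (h : ¬(q = 0 ∧ p = 1) ∨ n ≠ m + 1) : evalFam₂ F n q p = 0 := by
  match q, p with
  | 0, 0 => rfl
  | 0, p + 2 => rfl
  | q + 1, p => rfl
  | 0, 1 =>
    funext x
    change -(homog F n x.1).eval _ = 0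
    rw [homog_of_ne F (h.resolve_left fun h => h ⟨rfl, rfl⟩), map_zero, neg_zero]

theorem evalFam₁_add {m : ℕ} (F F' : (Fin m → G) → P.QFun A) :
    evalFam₁ (F + F') = evalFam₁ F + evalFam₁ F' := by
  funext n q p x
  by_cases h : q = 1 ∧ p = 0
  · obtain ⟨rfl, rfl⟩ := h
    change (homog (F + F') n x.1).eval _ = (homog F n x.1).eval _ + (homog F' n x.1).eval _
    rw [homog_add, map_add]
  · rw [Pi.add_apply, Pi.add_apply, Pi.add_apply, evalFam₁_eq_zero _ (.inl h),
      evalFam₁_eq_zero _ (.inl h), evalFam₁_eq_zero _ (.inl h), add_zero]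

theorem evalFam₂_add {m : ℕ} (F F' : (Fin m → G) → P.QFun A) :
    evalFam₂ (F + F') = evalFam₂ F + evalFam₂ F' := by
  funext n q p x
  by_cases h : q = 0 ∧ p = 1
  · obtain ⟨rfl, rfl⟩ := h
    change -(homog (F + F') n x.1).eval _ = -(homog F n x.1).eval _ + -(homog F' n x.1).eval _
    rw [homog_add, map_add, neg_add]
  · rw [Pi.add_apply, Pi.add_apply, Pi.add_apply, evalFam₂_eq_zero _ (.inl h),
      evalFam₂_eq_zero _ (.inl h), evalFam₂_eq_zero _ (.inl h), add_zero]

/-- In these degrees removing the coset leads to q = 0, where the family vanishes, and there is no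
coset of G₂ to remove. Only the coboundary in the variables of G survives. -/
theorem evalFam₁_groupD {m : ℕ} (F : (Fin m → G) → P.QFun A) {n q p : ℕ} (h : p = 0 ∧ q ≤ 1)
    (x : (Fin n → G) × (Fin q → G ⧸ P.G₁) × (Fin p → G ⧸ P.G₂)) :
    evalFam₁ (groupD G _ m F) n q p x = famD (evalFam₁ F) n q p x := by
  obtain ⟨rfl, hq⟩ := h
  have e1 : D1 (evalFam₁ F) n q 0 x = 0 := hd_eq_zero fun k hk b => by
    obtain rfl : k = 0 := by omega
    rfl
  have e2 : D2 (evalFam₁ F) n q 0 x = 0 := rfl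
  rw [famD_apply, e1, e2, smul_zero, smul_zero, add_zero, add_zero]
  obtain rfl | rfl : q = 0 ∨ q = 1 := by omega
  · exact (hd_eq_zero fun _ _ _ => rfl).symm
  · change (homog (groupD G _ m F) n x.1).eval _ =
      hd (fun n g => (homog F n g).eval (Sum.inl (x.2.1 0))) n x.1
    rw [hd_map, hd_homog]

theorem evalFam₂_groupD {m : ℕ} (F : (Fin m → G) → P.QFun A) {n q p : ℕ} (h : q = 0 ∧ p ≤ 1)
    (x : (Fin n → G) × (Fin q → G ⧸ P.G₁) × (Fin p → G ⧸ P.G₂)) :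
    evalFam₂ (groupD G _ m F) n q p x = famD (evalFam₂ F) n q p x := by
  obtain ⟨rfl, hp⟩ := h
  have e2 : D2 (evalFam₂ F) n 0 p x = 0 := hd_eq_zero fun k hk b => by
    obtain rfl : k = 0 := by omega
    rfl
  have e1 : D1 (evalFam₂ F) n 0 p x = 0 := rfl
  rw [famD_apply, e1, e2, smul_zero, smul_zero, add_zero, add_zero]
  obtain rfl | rfl : p = 0 ∨ p = 1 := by omega
  · exact (hd_eq_zero fun _ _ _ => rfl).symm
  · change -(homog (groupD G _ m F) n x.1).eval _ =
      hd (fun n g => -(homog F n g).eval (Sum.inr (x.2.2 0))) n x.1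
    have := hd_map (-(MFun.eval (Sum.inr (x.2.2 0)) : P.QFun A →+ A)) (homog F) n x.1
    refine Eq.trans ?_ this.symm
    rw [hd_homog]
    rfl

theorem evalFam₁_smul {m : ℕ} (F : (Fin m → G) → P.QFun A) (n q p : ℕ) (s : G)
    (x : (Fin n → G) × (Fin q → G ⧸ P.G₁) × (Fin p → G ⧸ P.G₂)) :
    evalFam₁ F n q p (s • x) = s • evalFam₁ F n q p x := by
  by_cases h : q = 1 ∧ p = 0
  · obtain ⟨rfl, rfl⟩ := h
    change (homog F n (s • x.1)).eval (s • Sum.inl (x.2.1 0)) = s • (homog F n x.1).eval _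
    rw [homog_smul, MFun.eval_smul, inv_smul_smul]
  · rw [evalFam₁_eq_zero _ (.inl h)]
    exact (smul_zero s).symm

theorem evalFam₂_smul {m : ℕ} (F : (Fin m → G) → P.QFun A) (n q p : ℕ) (s : G)
    (x : (Fin n → G) × (Fin q → G ⧸ P.G₁) × (Fin p → G ⧸ P.G₂)) :
    evalFam₂ F n q p (s • x) = s • evalFam₂ F n q p x := by
  by_cases h : q = 0 ∧ p = 1
  · obtain ⟨rfl, rfl⟩ := h
    change -(homog F n (s • x.1)).eval (s • Sum.inr (x.2.2 0)) = s • -(homog F n x.1).eval _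
    rw [homog_smul, MFun.eval_smul, inv_smul_smul, smul_neg]
  · rw [evalFam₂_eq_zero _ (.inl h)]
    exact (smul_zero s).symm

/-- The map from variables with one coset of `G₁`. -/
theorem qmp_coset₁ (n : ℕ) : QuasiMeasurePreserving
    (fun x : (Fin n → G) × (Fin 1 → G ⧸ P.G₁) × (Fin 0 → G ⧸ P.G₂) => (x.1, x.2.1 0))
    (famMeasure haar (KacCohomology.quotMeasure P.G₁) (KacCohomology.quotMeasure P.G₂) n 1 0)
    ((Measure.pi fun _ => haar).prod (KacCohomology.quotMeasure P.G₁)) :=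
  qmp_prodMap (.id _) ((Measure.quasiMeasurePreserving_eval _ 0).comp quasiMeasurePreserving_fst)

theorem qmp_coset₂ (n : ℕ) : QuasiMeasurePreserving
    (fun x : (Fin n → G) × (Fin 0 → G ⧸ P.G₁) × (Fin 1 → G ⧸ P.G₂) => (x.1, x.2.2 0))
    (famMeasure haar (KacCohomology.quotMeasure P.G₁) (KacCohomology.quotMeasure P.G₂) n 0 1)
    ((Measure.pi fun _ => haar).prod (KacCohomology.quotMeasure P.G₂)) :=
  qmp_prodMap (.id _) ((Measure.quasiMeasurePreserving_eval _ 0).comp quasiMeasurePreserving_snd)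

theorem qmp_ofCoset₁ (n : ℕ) : QuasiMeasurePreserving
    (fun x : (Fin n → G) × (G ⧸ P.G₁) => (x.1, (fun _ : Fin 1 => x.2),
      (default : Fin 0 → G ⧸ P.G₂))) ((Measure.pi fun _ => haar).prod (KacCohomology.quotMeasure P.G₁))
    (famMeasure haar (KacCohomology.quotMeasure P.G₁) (KacCohomology.quotMeasure P.G₂) n 1 0) := by
  convert (qmp_prodMap (.id (Measure.pi fun _ : Fin n => (haar : Measure G))) (qmp_swap.comp
    (qmp_default_left (KacCohomology.quotMeasure P.G₂) (Measure.pi fun _ : Fin 1 =>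
      KacCohomology.quotMeasure P.G₁)))).comp (qmp_singleton _ (KacCohomology.quotMeasure P.G₁)) using 1
  funext x
  exact Prod.ext rfl (Prod.ext rfl (Subsingleton.elim _ _))

theorem qmp_ofCoset₂ (n : ℕ) : QuasiMeasurePreserving
    (fun x : (Fin n → G) × (G ⧸ P.G₂) => (x.1, (default : Fin 0 → G ⧸ P.G₁),
      fun _ : Fin 1 => x.2)) ((Measure.pi fun _ => haar).prod (KacCohomology.quotMeasure P.G₂))
    (famMeasure haar (KacCohomology.quotMeasure P.G₁) (KacCohomology.quotMeasure P.G₂) n 0 1) := by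
  convert (qmp_prodMap (.id (Measure.pi fun _ : Fin n => (haar : Measure G)))
    (qmp_default_left (KacCohomology.quotMeasure P.G₁) (Measure.pi fun _ : Fin 1 =>
      KacCohomology.quotMeasure P.G₂))).comp (qmp_singleton _ (KacCohomology.quotMeasure P.G₂)) using 1
  funext x
  exact Prod.ext rfl (Prod.ext (Subsingleton.elim _ _) rfl)

variable (P A)

theorem evalFam_null_iff {m : ℕ} (F : (Fin m → G) → P.QFun A) :
    F ∈ (functionComplex G P.Quot P.quotMeasure A).null m ↔
      evalFam₁ F ∈ famNull haar (KacCohomology.quotMeasure P.G₁) (KacCohomology.quotMeasure P.G₂)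
        (fun _ q p => p = 0 ∧ q ≤ 1) ∧
      evalFam₂ F ∈ famNull haar (KacCohomology.quotMeasure P.G₁) (KacCohomology.quotMeasure P.G₂)
        (fun _ q p => q = 0 ∧ p ≤ 1) := by
  have h0 : F ∈ (functionComplex G P.Quot P.quotMeasure A).null m ↔
      ∀ᵐ z ∂(Measure.pi fun _ : Fin m => (haar : Measure G)).prod P.quotMeasure,
        (F z.1).eval z.2 = 0 := Iff.rfl
  rw [h0, ← ae_homogPair_eq_zero_iff, ae_prod_quotMeasure_iff]
  refine and_congr ⟨fun h => ?_, fun h => ?_⟩ ⟨fun h => ?_, fun h => ?_⟩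
  · intro n q p hn
    by_cases hq : ¬(q = 1 ∧ p = 0) ∨ n ≠ m + 1
    · rw [evalFam₁_eq_zero F hq]
      exact Filter.Eventually.of_forall fun _ => rfl
    · simp only [not_or, not_not] at hq
      obtain ⟨⟨rfl, rfl⟩, rfl⟩ := hq
      filter_upwards [(qmp_coset₁ (m + 1)).ae h] with x hx
      exact (eval_homog F x.1 _).trans hx
  · filter_upwards [(qmp_ofCoset₁ (m + 1)).ae (h (m + 1) 1 0 ⟨rfl, le_rfl⟩)] with z hz
    exact (eval_homog F z.1 _).symm.trans hz
  · intro n q p hn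
    by_cases hq : ¬(q = 0 ∧ p = 1) ∨ n ≠ m + 1
    · rw [evalFam₂_eq_zero F hq]
      exact Filter.Eventually.of_forall fun _ => rfl
    · simp only [not_or, not_not] at hq
      obtain ⟨⟨rfl, rfl⟩, rfl⟩ := hq
      filter_upwards [(qmp_coset₂ (m + 1)).ae h] with x hx
      exact neg_eq_zero.2 ((eval_homog F x.1 _).trans hx)
  · filter_upwards [(qmp_ofCoset₂ (m + 1)).ae (h (m + 1) 0 1 ⟨rfl, le_rfl⟩)] with z hz
    exact (eval_homog F z.1 _).symm.trans (neg_eq_zero.1 hz)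

/-- Evaluation at the cosets of `G₁`. -/
def evalMap₁ : (functionComplex G P.Quot P.quotMeasure A).WHom
    (P.cosetRel A (fun _ q p => p = 0 ∧ q ≤ 1) (fun n q _ => n = 0 ∨ q = 0) 2) where
  f m := AddMonoidHom.mk' (fun F : (Fin m → G) → P.QFun A => evalFam₁ F) fun F F' => evalFam₁_add F F'
  comm m F _ n q p h := Filter.Eventually.of_forall fun x => sub_eq_zero.2 (evalFam₁_groupD F h x)
  map_meas m F hF := by
    refine ⟨fun n q p => ?_, fun n q p s x => evalFam₁_smul F n q p s x,
      fun n q p h => evalFam₁_eq_zero F (by omega)⟩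
    by_cases hq : ¬(q = 1 ∧ p = 0) ∨ n ≠ m + 1
    · refine (aestronglyMeasurable_const (b := (0 : A))).congr (Filter.Eventually.of_forall
        fun x => (congrFun (evalFam₁_eq_zero (F : (Fin m → G) → P.QFun A) hq) x).symm)
    · simp only [not_or, not_not] at hq
      obtain ⟨⟨rfl, rfl⟩, rfl⟩ := hq
      refine ((P.aestronglyMeasurable_prod_quotMeasure_iff.1
        (aestronglyMeasurable_homogPair hF)).1.comp_quasiMeasurePreserving
        (qmp_coset₁ (m + 1))).congr (Filter.Eventually.of_forall fun x => ?_)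
      exact (eval_homog F x.1 _).symm
  map_null m F hF := ((P.evalFam_null_iff A F).1 hF).1

/-- Evaluation at the cosets of `G₂`. -/
def evalMap₂ : (functionComplex G P.Quot P.quotMeasure A).WHom
    (P.cosetRel A (fun _ q p => q = 0 ∧ p ≤ 1) (fun n _ p => n = 0 ∨ p = 0) 2) where
  f m := AddMonoidHom.mk' (fun F : (Fin m → G) → P.QFun A => evalFam₂ F) fun F F' => evalFam₂_add F F'
  comm m F _ n q p h := Filter.Eventually.of_forall fun x => sub_eq_zero.2 (evalFam₂_groupD F h x)
  map_meas m F hF := by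
    refine ⟨fun n q p => ?_, fun n q p s x => evalFam₂_smul F n q p s x,
      fun n q p h => evalFam₂_eq_zero F (by omega)⟩
    by_cases hq : ¬(q = 0 ∧ p = 1) ∨ n ≠ m + 1
    · refine (aestronglyMeasurable_const (b := (0 : A))).congr (Filter.Eventually.of_forall
        fun x => (congrFun (evalFam₂_eq_zero (F : (Fin m → G) → P.QFun A) hq) x).symm)
    · simp only [not_or, not_not] at hq
      obtain ⟨⟨rfl, rfl⟩, rfl⟩ := hq
      refine ((P.aestronglyMeasurable_prod_quotMeasure_iff.1
        (aestronglyMeasurable_homogPair hF)).2.comp_quasiMeasurePreserving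
        (qmp_coset₂ (m + 1))).neg.congr (Filter.Eventually.of_forall fun x => ?_)
      exact congrArg Neg.neg (eval_homog F x.1 _).symm
  map_null m F hF := ((P.evalFam_null_iff A F).1 hF).2

/-- An equivariant function on the disjoint union is the same as a pair of equivariant functions on
its two parts. -/
theorem evalMap_bijective (m : ℕ) :
    Function.Bijective (((P.evalMap₁ A).pair (P.evalMap₂ A)).H m) := by
  refine MeasComplex.WHom.H_bijective_of_equiv _ ((Rel_good _ _ _ ?_ ?_ 2).prod
    (Rel_good _ _ _ ?_ ?_ 2)) ?_ ?_ m
  · exact ⟨fun _ _ _ h => h, fun _ _ _ h => ⟨h.1, by omega⟩, fun _ _ _ h => by omega⟩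
  · exact ⟨fun _ _ _ h => by omega, fun _ _ _ h => by omega, fun _ _ _ h => h⟩
  · exact ⟨fun _ _ _ h => h, fun _ _ _ h => by omega, fun _ _ _ h => ⟨h.1, by omega⟩⟩
  · exact ⟨fun _ _ _ h => by omega, fun _ _ _ h => h, fun _ _ _ h => by omega⟩
  · exact fun m F hF => (P.evalFam_null_iff A F).2 hF
  · rintro m ⟨y₁, y₂⟩ ⟨hy₁, hy₂⟩
    -- The minus sign undoes the one in `evalFam₂`.
    let y : (Fin (m + 1) → G) × P.Quot → A := fun z => Sum.elim
      (fun a => (y₁ : Fam G (G ⧸ P.G₁) (G ⧸ P.G₂) A) (m + 1) 1 0 (z.1, fun _ => a, default))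
      (fun b => -(y₂ : Fam G (G ⧸ P.G₁) (G ⧸ P.G₂) A) (m + 1) 0 1 (z.1, default, fun _ => b)) z.2
    have hy : AEStronglyMeasurable y ((Measure.pi fun _ => haar).prod P.quotMeasure) :=
      P.aestronglyMeasurable_prod_quotMeasure_iff.2
        ⟨(hy₁.1 (m + 1) 1 0).comp_quasiMeasurePreserving (qmp_ofCoset₁ (m + 1)),
        ((hy₂.1 (m + 1) 0 1).comp_quasiMeasurePreserving (qmp_ofCoset₂ (m + 1))).neg⟩
    have he : ∀ (g : G) z, y (g • z) = g • y z := by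
      rintro g ⟨x, a | b⟩
      · refine Eq.trans ?_ (hy₁.2.1 (m + 1) 1 0 g (x, fun _ => a, default))
        exact congrArg ((y₁ : Fam G (G ⧸ P.G₁) (G ⧸ P.G₂) A) (m + 1) 1 0)
          (Prod.ext rfl (Prod.ext rfl (Subsingleton.elim _ _)))
      · refine Eq.trans ?_ (smul_neg g _).symm
        refine Eq.trans ?_ (congrArg Neg.neg (hy₂.2.1 (m + 1) 0 1 g (x, default, fun _ => b)))
        exact congrArg (fun z => -(y₂ : Fam G (G ⧸ P.G₁) (G ⧸ P.G₂) A) (m + 1) 0 1 z)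
          (Prod.ext rfl (Prod.ext (Subsingleton.elim _ _) rfl))
    obtain ⟨F, hF, hyF⟩ := exists_functionComplex_of_equivariant hy he
    obtain ⟨h1, h2⟩ := P.ae_prod_quotMeasure_iff.1 hyF
    refine ⟨F, hF, fun n q p h => ?_, fun n q p h => ?_⟩
    · change ∀ᵐ x ∂_, (y₁ : Fam G (G ⧸ P.G₁) (G ⧸ P.G₂) A) n q p x -
        evalFam₁ (F : (Fin m → G) → P.QFun A) n q p x = 0
      by_cases hq : ¬(q = 1 ∧ p = 0) ∨ n ≠ m + 1
      · have hz : (y₁ : Fam G (G ⧸ P.G₁) (G ⧸ P.G₂) A) n q p = 0 := hy₁.2.2 n q p (by omega)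
        rw [evalFam₁_eq_zero F hq, hz]
        exact Filter.Eventually.of_forall fun _ => sub_zero _
      · simp only [not_or, not_not] at hq
        obtain ⟨⟨rfl, rfl⟩, rfl⟩ := hq
        filter_upwards [(qmp_coset₁ (m + 1)).ae h1] with x hx
        refine sub_eq_zero.2 (Eq.trans ?_ hx)
        exact congrArg ((y₁ : Fam G (G ⧸ P.G₁) (G ⧸ P.G₂) A) (m + 1) 1 0) (Prod.ext rfl
          (Prod.ext (funext fun i => congrArg x.2.1 (Subsingleton.elim _ _))
            (Subsingleton.elim _ _)))
    · change ∀ᵐ x ∂_, (y₂ : Fam G (G ⧸ P.G₁) (G ⧸ P.G₂) A) n q p x -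
        evalFam₂ (F : (Fin m → G) → P.QFun A) n q p x = 0
      by_cases hq : ¬(q = 0 ∧ p = 1) ∨ n ≠ m + 1
      · have hz : (y₂ : Fam G (G ⧸ P.G₁) (G ⧸ P.G₂) A) n q p = 0 := hy₂.2.2 n q p (by omega)
        rw [evalFam₂_eq_zero F hq, hz]
        exact Filter.Eventually.of_forall fun _ => sub_zero _
      · simp only [not_or, not_not] at hq
        obtain ⟨⟨rfl, rfl⟩, rfl⟩ := hq
        filter_upwards [(qmp_coset₂ (m + 1)).ae h2] with x hx
        refine sub_eq_zero.2 (Eq.trans ?_ (congrArg Neg.neg hx))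
        rw [← neg_neg ((y₂ : Fam G (G ⧸ P.G₁) (G ⧸ P.G₂) A) (m + 1) 0 1 x)]
        exact congrArg (fun z => - -(y₂ : Fam G (G ⧸ P.G₁) (G ⧸ P.G₂) A) (m + 1) 0 1 z) (Prod.ext rfl
          (Prod.ext (Subsingleton.elim _ _)
            (funext fun i => congrArg x.2.2 (Subsingleton.elim _ _))))

end MatchedPair

end KacCohomology

end

/-! ### The triple complex, its two restrictions, and the comparison squares -/

noncomputable section

namespace KacCohomology

section InsertionValues

variable {G X₁ X₂ : Type u} {A : Type v} [AddCommGroup A] {f : Fam G X₁ X₂ A}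

theorem lower_q (k : ℕ) : Lower fun _ q _ => q ≤ k :=
  ⟨fun _ _ _ h => h, fun _ _ _ h => by omega, fun _ _ _ h => h⟩

theorem lower_p (k : ℕ) : Lower fun _ _ p => p ≤ k :=
  ⟨fun _ _ _ h => h, fun _ _ _ h => h, fun _ _ _ h => by omega⟩

theorem lower_n0 : Lower fun n _ _ => n = 0 :=
  ⟨fun _ _ _ h => by omega, fun _ _ _ h => h, fun _ _ _ h => h⟩

theorem lower_q0 : Lower fun _ q _ => q = 0 :=
  ⟨fun _ _ _ h => h, fun _ _ _ h => by omega, fun _ _ _ h => h⟩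

theorem lower_p0 : Lower fun _ _ p => p = 0 :=
  ⟨fun _ _ _ h => h, fun _ _ _ h => h, fun _ _ _ h => by omega⟩

theorem lower_true : Lower fun _ _ _ => True := ⟨fun _ _ _ h => h, fun _ _ _ h => h, fun _ _ _ h => h⟩

theorem famPart_eq_self {c : ℕ → ℕ → ℕ → Prop} (hf : ∀ n q p, ¬c n q p → f n q p = 0) :
    famPart c f = f := by
  funext n q p
  by_cases h : c n q p
  · exact famPart_pos f h
  · rw [famPart_neg f h, hf n q p h]

/-- The added variable is ignored. The sign is the product of the factor (-1)^n of `D1` in `famD`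
and the factor -(-1)^(n + 1 + p) in `famIns`. For the variables of the third kind the corresponding
product is 1. -/
theorem famIns_q_one (hf : ∀ n q p, q ≠ 0 → f n q p = 0) (n p : ℕ)
    (x : (Fin n → G) × (Fin 1 → X₁) × (Fin p → X₂)) :
    famIns (fun _ q _ => q = 0) f n 1 p x = (-1 : ℤ) ^ p • f n 0 p (x.1, Fin.elim0, x.2.2) := by
  rw [famIns_of_neg f one_ne_zero, famPart_eq_self hf, famD_apply]
  have e0 : D0 f n 1 p x = 0 := hd_eq_zero fun k _ b => congrFun (hf _ _ _ one_ne_zero) _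
  have e2 : D2 f n 1 p x = 0 := hd_eq_zero fun k _ b => congrFun (hf _ _ _ one_ne_zero) _
  have e1 : D1 f n 1 p x = f n 0 p (x.1, Fin.elim0, x.2.2) := by
    refine (hd_succ _ 0 x.2.1).trans ?_
    rw [Fin.sum_univ_one, Fin.val_zero, pow_zero, one_smul]
    exact congrArg (f n 0 p) (Prod.ext rfl (Prod.ext (Subsingleton.elim _ _) rfl))
  rw [e0, e1, e2, smul_zero, zero_add, add_zero, smul_smul, ← neg_smul]
  congr 1
  have h : ((-1 : ℤ) ^ n) * (-1) ^ n = 1 := by rw [← pow_add, Even.neg_one_pow ⟨_, rfl⟩]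
  rw [pow_add, pow_add, pow_one]
  linear_combination ((-1 : ℤ) ^ p) * h

theorem famIns_q_of_ne (hf : ∀ n q p, q ≠ 0 → f n q p = 0) {q : ℕ} (hq : q ≠ 1) (n p : ℕ) :
    famIns (fun _ q _ => q = 0) f n q p = 0 := by
  by_cases h0 : q = 0
  · exact famIns_of_pos lower_q0 f h0
  funext x
  rw [famIns_of_neg f h0, famPart_eq_self hf, famD_apply]
  have e0 : D0 f n q p x = 0 := hd_eq_zero fun k _ b => congrFun (hf _ _ _ h0) _
  have e2 : D2 f n q p x = 0 := hd_eq_zero fun k _ b => congrFun (hf _ _ _ h0) _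
  have e1 : D1 f n q p x = 0 := hd_eq_zero fun k hk b => congrFun (hf _ _ _ (by omega)) _
  rw [e0, e1, e2]
  simp

theorem famIns_p_one (hf : ∀ n q p, p ≠ 0 → f n q p = 0) (n q : ℕ)
    (x : (Fin n → G) × (Fin q → X₁) × (Fin 1 → X₂)) :
    famIns (fun _ _ p => p = 0) f n q 1 x = f n q 0 (x.1, x.2.1, Fin.elim0) := by
  rw [famIns_of_neg f one_ne_zero, famPart_eq_self hf, famD_apply]
  have e0 : D0 f n q 1 x = 0 := hd_eq_zero fun k _ b => congrFun (hf _ _ _ one_ne_zero) _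
  have e1 : D1 f n q 1 x = 0 := hd_eq_zero fun k _ b => congrFun (hf _ _ _ one_ne_zero) _
  have e2 : D2 f n q 1 x = f n q 0 (x.1, x.2.1, Fin.elim0) := by
    refine (hd_succ _ 0 x.2.2).trans ?_
    rw [Fin.sum_univ_one, Fin.val_zero, pow_zero, one_smul]
    exact congrArg (f n q 0) (Prod.ext rfl (Prod.ext rfl (Subsingleton.elim _ _)))
  rw [e0, e1, e2, smul_zero, zero_add, zero_add, smul_smul, ← neg_smul, pow_succ, mul_neg_one,
    neg_mul, neg_neg, ← pow_add, Even.neg_one_pow ⟨_, rfl⟩, one_smul]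

theorem famIns_p_of_ne (hf : ∀ n q p, p ≠ 0 → f n q p = 0) {p : ℕ} (hp : p ≠ 1) (n q : ℕ) :
    famIns (fun _ _ p => p = 0) f n q p = 0 := by
  by_cases h0 : p = 0
  · exact famIns_of_pos lower_p0 f h0
  funext x
  rw [famIns_of_neg f h0, famPart_eq_self hf, famD_apply]
  have e0 : D0 f n q p x = 0 := hd_eq_zero fun k _ b => congrFun (hf _ _ _ h0) _
  have e1 : D1 f n q p x = 0 := hd_eq_zero fun k _ b => congrFun (hf _ _ _ h0) _
  have e2 : D2 f n q p x = 0 := hd_eq_zero fun k hk b => congrFun (hf _ _ _ (by omega)) _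
  rw [e0, e1, e2]
  simp

end InsertionValues

namespace MatchedPair

open MeasComplex

variable {G : Type u} [Group G] [TopologicalSpace G] [IsTopologicalGroup G]
  [T2Space G] [LocallyCompactSpace G] [SecondCountableTopology G] [MeasurableSpace G] [BorelSpace G]
  (P : MatchedPair G) (A : Type v) [AddCommGroup A] [TopologicalSpace A] [IsTopologicalAddGroup A]
  [TopologicalSpace.PseudoMetrizableSpace A] [DistribMulAction G A] [ContinuousSMul G A]

/-- Homogeneous cochains with variables of all three kinds. -/
abbrev triple : MeasComplex := P.cosetRel A (fun _ _ _ => True) (fun n q p => n = 0 ∨ q = 0 ∨ p = 0) 3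

/-- Homogeneous cochains with variables of all three kinds, one coset of `G₁`. -/
abbrev triple₁ : MeasComplex := P.cosetRel A (fun _ q _ => q ≤ 1) (fun n q p => n = 0 ∨ q = 0 ∨ p = 0) 3

/-- Homogeneous cochains with variables of all three kinds, one coset of `G₂`. -/
abbrev triple₂ : MeasComplex := P.cosetRel A (fun _ _ p => p ≤ 1) (fun n q p => n = 0 ∨ q = 0 ∨ p = 0) 3

/-- Adding variables in `G`. -/
def insG {V V' : ℕ → ℕ → ℕ → Prop} (hV : Lower V) (h : ∀ n q p, V' n q p ↔ V n q p ∧ n = 0) :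
    (P.cosetRel A V' (fun _ q p => q = 0 ∨ p = 0) 2).WHom
      (P.cosetRel A V (fun n q p => n = 0 ∨ q = 0 ∨ p = 0) 3) :=
  relIns A _ _ _ hV (L := fun _ q p => q = 0 ∨ p = 0) ⟨fun _ _ _ h => h, fun _ _ _ h => by omega,
    fun _ _ _ h => by omega⟩ lower_n0 h (fun _ _ _ => by tauto) 2

/-- The middle term has cosets of both kinds, whose intersection point provides the equivariant
point of G needed for exactness. -/
theorem insG_bijective {V V' : ℕ → ℕ → ℕ → Prop} (hV : Lower V)
    (h : ∀ n q p, V' n q p ↔ V n q p ∧ n = 0) (hV0 : ∀ n n' q p, V n q p → V n' q p) (m : ℕ) :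
    Function.Bijective ((P.insG A hV h).H m) :=
  relIns_bijective A _ _ _ hV _ lower_n0 h _ 2 (fun _ _ _ _ => by omega) (fun _ _ _ _ => by omega)
    (fun N f hf hdf => exists_primitive0 P.measurable_pt P.ae_good
      P.smul_mem_good P.pt_smul hV ⟨fun _ _ _ h => h, fun _ _ _ h => by omega,
      fun _ _ _ h => by omega⟩ hV0 (fun _ _ _ _ h => h) (fun _ _ => by omega) (fun _ _ => by omega)
      N f hf hdf) m

/-- Adding cosets of `G₂`. -/
def ins₂ {V V' : ℕ → ℕ → ℕ → Prop} (hV : Lower V) (h : ∀ n q p, V' n q p ↔ V n q p ∧ p = 0) :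
    (P.cosetRel A V' (fun n q _ => n = 0 ∨ q = 0) 2).WHom
      (P.cosetRel A V (fun n q p => n = 0 ∨ q = 0 ∨ p = 0) 3) :=
  relIns A _ _ _ hV (L := fun n q _ => n = 0 ∨ q = 0) ⟨fun _ _ _ h => by omega,
    fun _ _ _ h => by omega, fun _ _ _ h => h⟩ lower_p0 h (fun _ _ _ => by tauto) 2

/-- The middle term has a variable in G, and its translate of a fixed coset of G₂ can be inserted.
-/
theorem ins₂_bijective {V V' : ℕ → ℕ → ℕ → Prop} (hV : Lower V)
    (h : ∀ n q p, V' n q p ↔ V n q p ∧ p = 0) (hV0 : ∀ n q p p', V n q p → V n q p') (m : ℕ) :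
    Function.Bijective ((P.ins₂ A hV h).H m) :=
  relIns_bijective A _ _ _ hV _ lower_p0 h _ 2 (fun _ _ _ _ => by omega) (fun _ _ _ _ => by omega)
    (fun N f hf hdf => exists_primitive2 hV ⟨fun _ _ _ h => by omega, fun _ _ _ h => by omega,
      fun _ _ _ h => h⟩ hV0 (fun _ _ _ _ h => h) (fun _ _ => by omega) N f hf hdf) m

/-- Adding cosets of `G₁`. -/
def ins₁ {V V' : ℕ → ℕ → ℕ → Prop} (hV : Lower V) (h : ∀ n q p, V' n q p ↔ V n q p ∧ q = 0) :
    (P.cosetRel A V' (fun n _ p => n = 0 ∨ p = 0) 2).WHom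
      (P.cosetRel A V (fun n q p => n = 0 ∨ q = 0 ∨ p = 0) 3) :=
  relIns A _ _ _ hV (L := fun n _ p => n = 0 ∨ p = 0) ⟨fun _ _ _ h => by omega,
    fun _ _ _ h => h, fun _ _ _ h => by omega⟩ lower_q0 h (fun _ _ _ => by tauto) 2

theorem ins₁_bijective {V V' : ℕ → ℕ → ℕ → Prop} (hV : Lower V)
    (h : ∀ n q p, V' n q p ↔ V n q p ∧ q = 0) (hV0 : ∀ n q q' p, V n q p → V n q' p) (m : ℕ) :
    Function.Bijective ((P.ins₁ A hV h).H m) :=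
  relIns_bijective A _ _ _ hV _ lower_q0 h _ 2 (fun _ _ _ _ => by omega) (fun _ _ _ _ => by omega)
    (fun N f hf hdf => exists_primitive1 hV ⟨fun _ _ _ h => by omega, fun _ _ _ h => h,
      fun _ _ _ h => by omega⟩ hV0 (fun _ _ _ _ h => h) (fun _ _ => by omega) N f hf hdf) m

/-- Adding cosets of `G₁` to cochains on `G`. -/
def insGroup₁ : (P.cosetRel A (fun _ q p => q = 0 ∧ p = 0) (fun n _ _ => n = 0) 1).WHom
      (P.cosetRel A (fun _ _ p => p = 0) (fun n q _ => n = 0 ∨ q = 0) 2) :=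
  relIns A _ _ _ lower_p0 lower_n0 lower_q0 (fun _ _ _ => by tauto) (fun _ _ _ => by tauto) 1

theorem insGroup₁_bijective (m : ℕ) : Function.Bijective ((P.insGroup₁ A).H m) :=
  relIns_bijective A _ _ _ lower_p0 lower_n0 lower_q0 _ _ 1 (fun _ _ _ _ => by omega)
    (fun _ _ _ _ => by omega) (fun N f hf hdf => exists_primitive1 lower_p0 lower_n0
      (fun _ _ _ _ h => h) (fun _ _ _ _ h => h) (fun _ _ => rfl) N f hf hdf) m

/-- Cochains of the double complex in the triple complex. -/
def gridTriple : (P.totalComplex A).WHom (P.triple A) :=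
  (P.insG A lower_true fun _ _ _ => by tauto).comp (P.gridMap A)

theorem gridTriple_bijective (m : ℕ) : Function.Bijective ((P.gridTriple A).H m) :=
  WHom.comp_bijective (P.insG_bijective A _ _ (fun _ _ _ _ h => h) m) (P.gridMap_bijective A m)

/-- Cochains of `G` in the triple complex. -/
def groupTriple : (groupComplex G A).WHom (P.triple A) :=
  (P.ins₂ A lower_true fun _ _ _ => by tauto).comp ((P.insGroup₁ A).comp (homogMap _ _ A))

theorem groupTriple_bijective (m : ℕ) : Function.Bijective ((P.groupTriple A).H m) :=
  WHom.comp_bijective (P.ins₂_bijective A _ _ (fun _ _ _ _ h => h) m)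
    (WHom.comp_bijective (P.insGroup₁_bijective A m) (homogMap_bijective _ _ A m))

/-- Restriction to one coset of `G₁`, and to one coset of `G₂`. -/
def resTriple : (P.triple A).WHom ((P.triple₁ A).prod (P.triple₂ A)) :=
  WHom.pair
    { f := fun _ => AddMonoidHom.id (Fam G (G ⧸ P.G₁) (G ⧸ P.G₂) A)
      comm := fun _ _ _ _ _ _ _ => Filter.Eventually.of_forall fun _ => sub_self _
      map_meas := fun _ _ hx => hx
      map_null := fun _ _ hx n q p _ => hx n q p trivial }
    { f := fun _ => AddMonoidHom.id (Fam G (G ⧸ P.G₁) (G ⧸ P.G₂) A)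
      comm := fun _ _ _ _ _ _ _ => Filter.Eventually.of_forall fun _ => sub_self _
      map_meas := fun _ _ hx => hx
      map_null := fun _ _ hx n q p _ => hx n q p trivial }

/-- Cochains of `G₁` and `G₂` in the triple complexes. -/
def pairTriple : (P.pairComplex A).WHom ((P.triple₁ A).prod (P.triple₂ A)) :=
  ((P.insG A (lower_q 1) fun _ _ _ => by tauto).comp (P.colMap A)).prodMap
    ((P.insG A (lower_p 1) fun _ _ _ => by tauto).comp (P.rowMap A))

theorem pairTriple_bijective (m : ℕ) : Function.Bijective ((P.pairTriple A).H m) :=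
  WHom.prodMap_bijective
    (WHom.comp_bijective (P.insG_bijective A _ _ (fun _ _ _ _ h => h) m) (P.colMap_bijective A m))
    (WHom.comp_bijective (P.insG_bijective A _ _ (fun _ _ _ _ h => h) m) (P.rowMap_bijective A m))

/-- `J` is restriction to the degrees q ≤ 1 and p ≤ 1 by `colMap_J₁` and `rowMap_J₂`. On both sides
the same morphism adds the variables in G, and it maps null families to null families. -/
theorem pairTriple_J (m : ℕ) (F : (P.totalComplex A).C m) :
    (P.pairTriple A).f m ((P.J A).f m F) - (P.resTriple A).f m ((P.gridTriple A).f m F) ∈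
      ((P.triple₁ A).prod (P.triple₂ A)).null m := by
  have h1 := (P.insG A (lower_q 1) fun _ _ _ => by tauto).map_null m _ (P.colMap_J₁ A m F)
  have h2 := (P.insG A (lower_p 1) fun _ _ _ => by tauto).map_null m _ (P.rowMap_J₂ A m F)
  constructor
  · exact (congrArg (· ∈ (P.triple₁ A).null m) (map_sub (famIns fun n _ _ => n = 0)
      (gridFam (colExt (col P A m F))) (gridFam F))).mp h1
  · exact (congrArg (· ∈ (P.triple₂ A).null m) (map_sub (famIns fun n _ _ => n = 0)
      (gridFam (rowExt (row P A m F))) (gridFam F))).mp h2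

/-- Cochains with values in functions on cosets in the triple complexes. -/
def functionTriple : (functionComplex G P.Quot P.quotMeasure A).WHom
    ((P.triple₁ A).prod (P.triple₂ A)) :=
  ((P.ins₂ A (lower_q 1) fun _ _ _ => by tauto).prodMap
    (P.ins₁ A (lower_p 1) fun _ _ _ => by tauto)).comp ((P.evalMap₁ A).pair (P.evalMap₂ A))

/-- Together with `pairTriple_bijective` this is Shapiro's lemma: the cochains of Gᵢ and the
cochains of G with values in functions on G/Gᵢ are two edges of the same complex. -/
theorem functionTriple_bijective (m : ℕ) : Function.Bijective ((P.functionTriple A).H m) :=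
  WHom.comp_bijective (WHom.prodMap_bijective (P.ins₂_bijective A _ _ (fun _ _ _ _ h => h) m)
    (P.ins₁_bijective A _ _ (fun _ _ _ _ h => h) m)) (P.evalMap_bijective A m)

variable {A} in
/-- Constant functions. -/
def constFun : A →+ P.QFun A where
  toFun a := ⟨fun _ => a, aestronglyMeasurable_const⟩
  map_zero' := rfl
  map_add' _ _ := rfl

variable {P A} in
theorem groupD_constFun {m : ℕ} (F : (Fin m → G) → A) :
    (groupD G (P.QFun A) m fun g => P.constFun (F g)) = fun g => P.constFun (groupD G A m F g) := by
  funext g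
  change g 0 • P.constFun (F fun i => g i.succ) + ∑ j : Fin (m + 1), (-1 : ℤ) ^ ((j : ℕ) + 1) •
      P.constFun (F (Fin.contractNth j (· * ·) g)) =
    P.constFun (g 0 • F (fun i => g i.succ) + ∑ j : Fin (m + 1), (-1 : ℤ) ^ ((j : ℕ) + 1) •
      F (Fin.contractNth j (· * ·) g))
  rw [map_add, _root_.map_sum]
  simp only [map_zsmul]
  rfl

/-- The inclusion of the constant functions. -/
def constMap : (groupComplex G A).WHom (functionComplex G P.Quot P.quotMeasure A) where
  f m := AddMonoidHom.mk' (fun (F : (Fin m → G) → A) g => P.constFun (F g)) fun F F' =>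
    funext fun g => map_add P.constFun (F g) (F' g)
  comm m F _ := by
    have key : ∀ F : (Fin m → G) → A, (fun g => P.constFun (groupD G A m F g)) -
        groupD G (P.QFun A) m (fun g => P.constFun (F g)) = 0 := fun F => by
      rw [groupD_constFun, sub_self]
    exact (congrArg (· ∈ (functionComplex G P.Quot P.quotMeasure A).null (m + 1)) (key F)).mpr
      (zero_mem _)
  map_meas m F hF := by
    have h : AEStronglyMeasurable (F : (Fin m → G) → A) (Measure.pi fun _ => haar) := hF
    exact h.comp_quasiMeasurePreserving quasiMeasurePreserving_fst
  map_null m F hF := quasiMeasurePreserving_fst.ae hF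

variable {P A} in
theorem eval_homog_constFun {m : ℕ} (F : (Fin m → G) → A) (n : ℕ) (x : Fin n → G) (a : P.Quot) :
    (homog (fun g => P.constFun (F g)) n x).eval a = homog F n x := by
  by_cases h : n = m + 1
  · subst h
    rw [homog_self, homog_self]
    rfl
  · rw [homog_of_ne _ h, homog_of_ne _ h, map_zero]

variable {P A} in
theorem evalFam₁_constFun {m : ℕ} (F : (Fin m → G) → A) :
    evalFam₁ (fun g => P.constFun (F g)) = famIns (fun _ q _ => q = 0) (homogFam F) := by
  have hf : ∀ n q p, q ≠ 0 → homogFam (X₁ := G ⧸ P.G₁) (X₂ := G ⧸ P.G₂) F n q p = 0 :=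
    fun n q p h => homogFam_eq_zero F (by omega)
  funext n q p x
  by_cases hq : q = 1
  · subst hq
    rw [famIns_q_one hf]
    by_cases hp : p = 0
    · subst hp
      rw [pow_zero, one_smul]
      exact eval_homog_constFun F n x.1 _
    · rw [evalFam₁_eq_zero _ (by omega), homogFam_eq_zero F (by omega)]
      exact (smul_zero _).symm
  · rw [evalFam₁_eq_zero _ (by omega), famIns_q_of_ne hf hq]

variable {P A} in
-- Adding first a coset of G₂ and then one of G₁, instead of the other way round, changes the sign;
-- this is the reason for the minus sign in `evalFam₂`.
theorem famIns_evalFam_constFun {m : ℕ} (F : (Fin m → G) → A) :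
    famIns (fun _ q _ => q = 0) (evalFam₂ fun g => P.constFun (F g)) =
      famIns (fun _ _ p => p = 0) (evalFam₁ fun g => P.constFun (F g)) := by
  have h₁ : ∀ n q p, p ≠ 0 → evalFam₁ (fun g => P.constFun (F g)) n q p = 0 :=
    fun n q p h => evalFam₁_eq_zero _ (by omega)
  have h₂ : ∀ n q p, q ≠ 0 → evalFam₂ (fun g => P.constFun (F g)) n q p = 0 :=
    fun n q p h => evalFam₂_eq_zero _ (by omega)
  funext n q p x
  by_cases hq : q = 1
  · subst hq
    rw [famIns_q_one h₂]
    by_cases hp : p = 1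
    · subst hp
      rw [famIns_p_one h₁, pow_one, neg_one_smul]
      change - -(homog (fun g => P.constFun (F g)) n x.1).eval _ =
        (homog (fun g => P.constFun (F g)) n x.1).eval _
      rw [neg_neg, eval_homog_constFun, eval_homog_constFun]
    · rw [famIns_p_of_ne h₁ hp, evalFam₂_eq_zero _ (by omega)]
      exact smul_zero _
  · rw [famIns_q_of_ne h₂ hq]
    by_cases hp : p = 1
    · subst hp
      rw [famIns_p_one h₁, evalFam₁_eq_zero _ (by omega)]
      rfl
    · rw [famIns_p_of_ne h₁ hp]

/-- A cochain with constant values ignores its coset, so both paths add a coset of each kind to the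
homogeneous cochain. On the G₁ side they do so in the same order, on the G₂ side in opposite orders,
which `famIns_evalFam_constFun` reconciles. -/
theorem functionTriple_constMap (m : ℕ) (F : (groupComplex G A).C m) :
    (P.functionTriple A).f m ((P.constMap A).f m F) -
      (P.resTriple A).f m ((P.groupTriple A).f m F) ∈
      ((P.triple₁ A).prod (P.triple₂ A)).null m := by
  have h₁ : ∀ F : (Fin m → G) → A,
      famIns (fun _ _ p => p = 0) (evalFam₁ fun g => P.constFun (F g)) -
        famIns (fun _ _ p => p = 0) (famIns (fun _ q _ => q = 0) (homogFam F)) = 0 := fun F => by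
    rw [evalFam₁_constFun, sub_self]
  have h₂ : ∀ F : (Fin m → G) → A,
      famIns (fun _ q _ => q = 0) (evalFam₂ fun g => P.constFun (F g)) -
        famIns (fun _ _ p => p = 0) (famIns (fun _ q _ => q = 0) (homogFam F)) = 0 := fun F => by
    rw [famIns_evalFam_constFun, evalFam₁_constFun, sub_self]
  constructor
  · exact (congrArg (· ∈ (P.triple₁ A).null m) (h₁ F)).mpr (zero_mem _)
  · exact (congrArg (· ∈ (P.triple₂ A).null m) (h₂ F)).mpr (zero_mem _)

end MatchedPair

end KacCohomology

end

noncomputable section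

namespace KacCohomology

/-! ### Polish abelian groups are complete -/

/-- Open sets of the source are traces of open sets of the target, so preimages of dense open sets
are dense and open. -/
theorem tendsto_residual_of_isDenseInducing {α β : Type*} [TopologicalSpace α] [TopologicalSpace β]
    {f : α → β} (hf : IsDenseInducing f) : Filter.Tendsto f (residual α) (residual β) := by
  apply Filter.le_countableGenerate_iff_of_countableInterFilter.mpr
  rintro t ⟨ht, htd⟩
  refine residual_of_dense_open (ht.preimage hf.continuous) (dense_iff_inter_open.2 ?_)
  rintro _ hV ⟨x, hx⟩
  obtain ⟨W, hW, rfl⟩ := hf.isOpen_iff.1 hV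
  obtain ⟨_, ⟨h1, h2⟩, ⟨y, rfl⟩⟩ := hf.dense.inter_open_nonempty _ (hW.inter ht)
    (htd.inter_open_nonempty W hW ⟨_, hx⟩)
  exact ⟨y, h1, h2⟩

/-- A Borel subgroup of a Polish abelian group that is not meagre and dense is everything. -/
theorem eq_top_of_dense_of_not_isMeagre {B : Type*} [AddCommGroup B] [TopologicalSpace B]
    [IsTopologicalAddGroup B] [BaireSpace B] [MeasurableSpace B] [BorelSpace B]
    (S : AddSubgroup B) (hd : Dense (S : Set B)) (hm : ¬ IsMeagre (S : Set B))
    (hS : MeasurableSet (S : Set B)) : S = ⊤ := by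
  obtain ⟨U, hU, hSU⟩ := hS.residualEq_isOpen
  have hne : U.Nonempty := by
    by_contra h
    rw [Set.not_nonempty_iff_eq_empty] at h
    subst h
    refine hm ?_
    filter_upwards [Filter.eventuallyEq_set.1 hSU] with x hx
    simpa using hx
  refine (AddSubgroup.eq_top_iff' S).2 fun b => ?_
  obtain ⟨u, hu⟩ := hne
  have hV : IsOpen {a : B | u + (b - a) ∈ U} := hU.preimage (by fun_prop)
  -- For a ∈ S close to b, the open set U meets its translate by b - a. A generic x in the
  -- intersection has both x and x + (b - a) in S, as S agrees with U up to a meagre set; so b - a,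
  -- and with it b, lies in S (Pettis).
  obtain ⟨a, ha, haS⟩ := hd.inter_open_nonempty _ hV ⟨b, by simpa using hu⟩
  have ho : IsOpen (U ∩ {x | x + (b - a) ∈ U}) := hU.inter (hU.preimage (by fun_prop))
  have h1 := Filter.eventuallyEq_set.1 hSU
  have h2 := (tendsto_residual_of_isOpenMap (continuous_add_const (b - a))
    (isOpenMap_add_right (b - a))).eventually h1
  obtain ⟨x, ⟨hx1, hx2⟩, hx3, hx4⟩ := (dense_of_mem_residual (h1.and h2)).inter_open_nonempty _ ho
    ⟨u, hu, ha⟩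
  have : b = x + (b - a) - x + a := by abel
  rw [this]
  exact S.add_mem (S.sub_mem (hx4.2 hx2) (hx3.2 hx1)) haS

/-- In its completion the group is dense, Borel by Lusin–Souslin, and not meagre, because a Baire
space that is densely embedded is not meagre. By Pettis' argument it is the whole completion. -/
theorem completeSpace_of_polishSpace (A : Type*) [AddCommGroup A] [UniformSpace A]
    [IsUniformAddGroup A] [PolishSpace A] : CompleteSpace A := by
  have : (uniformity A).IsCountablyGenerated := IsUniformAddGroup.uniformity_countably_generated
  let _ : MetricSpace A := UniformSpace.metricSpace A
  let B := UniformSpace.Completion A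
  have : SecondCountableTopology B := UniformSpace.secondCountable_of_separable B
  have : (uniformity B).IsCountablyGenerated := inferInstance
  have : PolishSpace B := inferInstance
  borelize B
  have hr : Set.range ((↑) : A → B) = ((UniformSpace.Completion.toCompl : A →+ B).range : Set B) := rfl
  have h := eq_top_of_dense_of_not_isMeagre (UniformSpace.Completion.toCompl : A →+ B).range
    (UniformSpace.Completion.denseRange_coe (α := A)) (fun h => ?_)
    (measurableSet_range_of_continuous_injective (UniformSpace.Completion.continuous_coe A)
      (UniformSpace.Completion.coe_injective A))
  · have hc : IsClosed (Set.range ((↑) : A → B)) := by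
      rw [hr, h]
      exact isClosed_univ
    exact ((UniformSpace.Completion.isUniformEmbedding_coe A).isUniformInducing
      |>.completeSpace_congr fun b => by
        have : b ∈ (UniformSpace.Completion.toCompl : A →+ B).range := h ▸ AddSubgroup.mem_top b
        exact this).2 inferInstance
  · have h' := (tendsto_residual_of_isDenseInducing
      (UniformSpace.Completion.isDenseInducing_coe (α := A))).eventually h
    obtain ⟨x, hx⟩ := (dense_of_mem_residual h').nonempty
    exact hx ⟨x, rfl⟩

end KacCohomology

end

noncomputable section

namespace KacCohomology

/-! ### Convergence in measure -/

/-- A sequence whose increments are small off small sets converges almost everywhere. -/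
theorem ae_exists_tendsto_of_measure_sub_le {X A : Type*} [MeasurableSpace X] {ν : Measure X}
    [AddCommGroup A] [TopologicalSpace A] [IsTopologicalAddGroup A] [PolishSpace A]
    {U : ℕ → Set A} (hU : (𝓝 (0 : A)).HasAntitoneBasis U)
    (hadd : ∀ n, U (n + 1) + U (n + 1) ⊆ U n) {f : ℕ → X → A}
    (hf : ∀ k, ν {x | f (k + 1) x - f k x ∉ U k} ≤ (2⁻¹ : ℝ≥0∞) ^ k) :
    ∀ᵐ x ∂ν, ∃ l, Filter.Tendsto (fun k => f k x) Filter.atTop (𝓝 l) := by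
  let _ := IsTopologicalAddGroup.rightUniformSpace A
  have _ := isUniformAddGroup_of_addCommGroup (G := A)
  have _ := completeSpace_of_polishSpace A
  have hs : (∑' k, ν {x | f (k + 1) x - f k x ∉ U k}) ≠ ∞ := by
    refine ne_top_of_le_ne_top ?_ (ENNReal.tsum_le_tsum hf)
    rw [ENNReal.tsum_geometric, ENNReal.one_sub_inv_two, inv_inv]
    exact ENNReal.ofNat_ne_top
  -- Borel–Cantelli: almost every point lies in only finitely many of the exceptional sets.
  filter_upwards [ae_eventually_notMem hs] with x hx
  obtain ⟨K, hK⟩ := Filter.eventually_atTop.1 hx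
  simp only [not_not] at hK
  have h0 : ∀ k, (0 : A) ∈ U k := fun k => mem_of_mem_nhds (hU.1.mem_of_mem trivial)
  -- Since U (n + 1) + U (n + 1) ⊆ U n, increments from U (k + 1), U (k + 2), … add up to an element
  -- of U k.
  have key : ∀ j k, K ≤ k → f (k + 1 + j) x - f (k + 1) x ∈ U k := by
    intro j
    induction j with
    | zero => exact fun k _ => by simpa using h0 k
    | succ j ih =>
      intro k hk
      refine hadd k ⟨_, ih (k + 1) (by omega), _, hK (k + 1) (by omega), ?_⟩
      simp only
      rw [sub_add_sub_cancel, show k + 1 + 1 + j = k + 1 + (j + 1) by omega]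
  have hb : (uniformity A).HasBasis (fun _ : ℕ => True) fun i => {p | p.1 - p.2 ∈ U i} := by
    rw [uniformity_eq_comap_nhds_zero_swapped]
    exact hU.1.comap _
  refine cauchySeq_tendsto_of_complete ((hb.cauchySeq_iff' (u := fun k => f k x)).2 fun i _ => ?_)
  · refine ⟨max i K + 1, fun n hn => ?_⟩
    obtain ⟨j, rfl⟩ := Nat.exists_eq_add_of_le hn
    exact hU.2 (le_max_left i K) (key j _ (le_max_right i K))

namespace LSp

variable {X : Type u} [MeasurableSpace X] {ν : Measure X} {A : Type v} [AddCommGroup A]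
  [TopologicalSpace A] [IsTopologicalAddGroup A]

/-- The class of a measurable function. -/
def of (f : X → A) (hf : AEStronglyMeasurable f ν) : LSp X ν A := AEEqFun.mk f hf

/-- A representative. -/
def fn (F : LSp X ν A) : X → A := ((show X →ₘ[ν] A from F) : X → A)

theorem aestronglyMeasurable_fn (F : LSp X ν A) : AEStronglyMeasurable F.fn ν :=
  AEEqFun.aestronglyMeasurable _

theorem fn_of {f : X → A} (hf : AEStronglyMeasurable f ν) : (of f hf).fn =ᵐ[ν] f :=
  AEEqFun.coeFn_mk f hf

theorem of_fn (F : LSp X ν A) : of F.fn F.aestronglyMeasurable_fn = F := AEEqFun.mk_coeFn _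

theorem of_eq_of_iff {f g : X → A} {hf : AEStronglyMeasurable f ν} {hg : AEStronglyMeasurable g ν} :
    of f hf = of g hg ↔ f =ᵐ[ν] g := AEEqFun.mk_eq_mk

theorem of_sub {f g : X → A} (hf : AEStronglyMeasurable f ν) (hg : AEStronglyMeasurable g ν) :
    of f hf - of g hg = of (f - g) (hf.sub hg) := rfl

theorem of_add {f g : X → A} (hf : AEStronglyMeasurable f ν) (hg : AEStronglyMeasurable g ν) :
    of f hf + of g hg = of (f + g) (hf.add hg) := rfl

theorem of_zero : of (0 : X → A) aestronglyMeasurable_zero = (0 : LSp X ν A) := rfl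

theorem of_mem_basicNhd {f : X → A} {hf : AEStronglyMeasurable f ν} {U : Set A} {ε : ℝ≥0∞} :
    of f hf ∈ basicNhd ν U ε ↔ ν {x | f x ∉ U} < ε := by
  have : ν {x | (of f hf).fn x ∉ U} = ν {x | f x ∉ U} := measure_congr <| by
    filter_upwards [fn_of hf] with x hx
    change ((of f hf).fn x ∉ U) = (f x ∉ U)
    rw [hx]
  rw [← this]
  rfl

theorem sub_mem_basicNhd {F F' : LSp X ν A} {U : Set A} {ε : ℝ≥0∞} :
    F - F' ∈ basicNhd ν U ε ↔ ν {x | F.fn x - F'.fn x ∉ U} < ε := by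
  conv_lhs => rw [← of_fn F, ← of_fn F', of_sub, of_mem_basicNhd]
  rfl

theorem basicNhd_mem_nhds {U : Set A} (hU : U ∈ 𝓝 0) {ε : ℝ≥0∞} (hε : 0 < ε) :
    basicNhd ν U ε ∈ 𝓝 (0 : LSp X ν A) :=
  filterBasis.nhds_zero_hasBasis.mem_of_mem (i := basicNhd ν U ε) ⟨U, hU, ε, hε, rfl⟩

theorem exists_basicNhd_subset {S : Set (LSp X ν A)} (hS : S ∈ 𝓝 0) :
    ∃ U ∈ 𝓝 (0 : A), ∃ ε > 0, basicNhd ν U ε ⊆ S := by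
  obtain ⟨_, ⟨U, hU, ε, hε, rfl⟩, h⟩ := (filterBasis (ν := ν) (A := A)).nhds_zero_hasBasis.mem_iff.1 hS
  exact ⟨U, hU, ε, hε, h⟩

theorem basicNhd_mono {U V : Set A} (h : U ⊆ V) {ε η : ℝ≥0∞} (h' : ε ≤ η) :
    basicNhd ν U ε ⊆ basicNhd ν V η := fun F hF =>
  (measure_mono (fun x (hx : F.fn x ∉ V) => (fun hc => hx (h hc) : F.fn x ∉ U))).trans_lt
    (lt_of_lt_of_le hF h')

/-- A countable basis of neighbourhoods of `0`. -/
theorem hasAntitoneBasis_nhds_zero {U : ℕ → Set A} (hU : (𝓝 (0 : A)).HasAntitoneBasis U) :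
    (𝓝 (0 : LSp X ν A)).HasAntitoneBasis fun k => basicNhd ν (U k) ((2⁻¹ : ℝ≥0∞) ^ k) := by
  have hlt : (2⁻¹ : ℝ≥0∞) < 1 := by simp
  have hanti : Antitone fun k : ℕ => (2⁻¹ : ℝ≥0∞) ^ k := fun m n h => pow_le_pow_of_le_one zero_le
    hlt.le h
  have hm : Antitone fun k => basicNhd ν (U k) ((2⁻¹ : ℝ≥0∞) ^ k) :=
    fun m n h => basicNhd_mono (hU.2 h) (hanti h)
  refine ⟨Filter.hasBasis_iff.2 fun S => ⟨fun hS => ?_, ?_⟩, hm⟩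
  · obtain ⟨V, hV, ε, hε, h⟩ := exists_basicNhd_subset hS
    obtain ⟨i, -, hi⟩ := hU.1.mem_iff.1 hV
    obtain ⟨j, hj⟩ := (ENNReal.tendsto_pow_atTop_nhds_zero_of_lt_one hlt).eventually
      (gt_mem_nhds hε) |>.exists
    refine ⟨max i j, trivial, (basicNhd_mono ?_ ?_).trans h⟩
    · exact (hU.2 (le_max_left i j)).trans hi
    · exact (hanti (le_max_right i j)).trans hj.le
  · rintro ⟨k, -, hk⟩
    exact Filter.mem_of_superset (basicNhd_mem_nhds (hU.1.mem_of_mem trivial)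
      (ENNReal.pow_pos (by simp) k)) hk

section Polish

variable [PolishSpace A]

/-- Convergence almost everywhere implies convergence in measure. -/
theorem tendsto_of_tendsto_ae [IsFiniteMeasure ν] {f : ℕ → X → A} {g : X → A}
    (hf : ∀ k, AEStronglyMeasurable (f k) ν) (hg : AEStronglyMeasurable g ν)
    (h : ∀ᵐ x ∂ν, Filter.Tendsto (fun k => f k x) Filter.atTop (𝓝 (g x))) :
    Filter.Tendsto (fun k => of (f k) (hf k)) Filter.atTop (𝓝 (of g hg)) := by
  rw [← tendsto_sub_nhds_zero_iff]
  refine tendsto_nhds.2 fun S hS h0 => ?_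
  obtain ⟨V, hV, ε, hε, hVS⟩ := exists_basicNhd_subset (hS.mem_nhds h0)
  obtain ⟨U, hUV, hU, h0U⟩ := mem_nhds_iff.1 hV
  have hsub : ∀ k, AEStronglyMeasurable (f k - g) ν := fun k => (hf k).sub hg
  borelize A
  have hm : ∀ k, MeasurableSet {x | (hsub k).mk _ x ∉ U} := fun k =>
    (hsub k).stronglyMeasurable_mk.measurable hU.measurableSet.compl
  have hlim : Filter.Tendsto (fun k => ν {x | (hsub k).mk _ x ∉ U}) Filter.atTop (𝓝 (ν ∅)) := by
    refine tendsto_measure_of_ae_tendsto_indicator_of_isFiniteMeasure _ MeasurableSet.empty hm ?_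
    filter_upwards [h, ae_all_iff.2 fun k => (hsub k).ae_eq_mk] with x hx hx'
    have h1 : Filter.Tendsto (fun k => f k x - g x) Filter.atTop (𝓝 0) :=
      tendsto_sub_nhds_zero_iff.2 hx
    filter_upwards [h1 (hU.mem_nhds h0U)] with k hk
    have : (hsub k).mk _ x ∈ U := by rw [← hx' k]; exact hk
    simpa using this
  rw [measure_empty] at hlim
  filter_upwards [hlim.eventually (gt_mem_nhds hε)] with k hk
  refine hVS (basicNhd_mono hUV le_rfl (?_ : of _ (hf k) - of g hg ∈ basicNhd ν U ε))
  refine of_mem_basicNhd (f := f k - g) |>.2 ?_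
  refine lt_of_le_of_lt (le_of_eq (measure_congr ?_)) hk
  filter_upwards [(hsub k).ae_eq_mk] with x hx
  change ((f k - g) x ∉ U) = ((hsub k).mk _ x ∉ U)
  rw [← hx]

instance : T2Space (LSp X ν A) := by
  refine IsTopologicalAddGroup.t2Space_of_zero_sep fun F hF => ?_
  by_contra hc
  push Not at hc
  obtain ⟨U, hU⟩ := (𝓝 (0 : A)).exists_antitone_basis
  apply hF
  have h : ∀ k, ∀ᵐ x ∂ν, F.fn x ∈ U k := fun k => by
    change ν {x | F.fn x ∉ U k} = 0
    by_contra h0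
    -- The radius is the measure of the exceptional set itself.
    exact lt_irrefl (ν {x | F.fn x ∉ U k}) (hc _ (basicNhd_mem_nhds (hU.1.mem_of_mem trivial) (pos_iff_ne_zero.2 h0)))
  rw [← of_fn F, ← of_zero]
  refine of_eq_of_iff.2 ?_
  filter_upwards [ae_all_iff.2 h] with x hx
  by_contra hne
  obtain ⟨i, -, hi⟩ := hU.1.mem_iff.1 (isOpen_ne.mem_nhds (Ne.symm hne))
  exact hi (hx i) rfl

instance : (𝓝 (0 : LSp X ν A)).IsCountablyGenerated := by
  obtain ⟨U, hU⟩ := (𝓝 (0 : A)).exists_antitone_basis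
  exact (hasAntitoneBasis_nhds_zero hU).1.isCountablyGenerated

/-- The uniformity is countably generated, so rapidly Cauchy sequences suffice. Their
representatives converge almost everywhere, and hence in measure. -/
theorem completeSpace [IsFiniteMeasure ν] :
    @CompleteSpace (LSp X ν A) (IsTopologicalAddGroup.rightUniformSpace _) := by
  let _ := IsTopologicalAddGroup.rightUniformSpace (LSp X ν A)
  have _ := isUniformAddGroup_of_addCommGroup (G := LSp X ν A)
  have : (uniformity (LSp X ν A)).IsCountablyGenerated :=
    IsUniformAddGroup.uniformity_countably_generated
  obtain ⟨U, hU, hadd⟩ := IsTopologicalAddGroup.exists_antitone_basis_nhds_zero A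
  refine UniformSpace.complete_of_convergent_controlled_sequences
    (fun k => {p | p.2 - p.1 ∈ basicNhd ν (U k) ((2⁻¹ : ℝ≥0∞) ^ k)}) (fun k => ?_) fun u hu => ?_
  · rw [uniformity_eq_comap_nhds_zero]
    exact Filter.preimage_mem_comap ((hasAntitoneBasis_nhds_zero hU).1.mem_of_mem trivial)
  · have h := ae_exists_tendsto_of_measure_sub_le hU hadd (ν := ν) (f := fun k => (u k).fn) fun k =>
      (sub_mem_basicNhd.1 (hu k k (k + 1) le_rfl (Nat.le_succ k))).le
    obtain ⟨g, hg, hlim⟩ := exists_stronglyMeasurable_limit_of_tendsto_ae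
      (fun k => (u k).aestronglyMeasurable_fn) h
    refine ⟨of g hg.aestronglyMeasurable, ?_⟩
    simpa only [of_fn] using tendsto_of_tendsto_ae (fun k => (u k).aestronglyMeasurable_fn)
      hg.aestronglyMeasurable hlim

/-- The countable dense subset is the subgroup generated by indicator functions of a measure-dense
family of sets, with values in a dense sequence. Its closure contains all indicators, hence all
simple functions and their pointwise limits. -/
theorem separableSpace [IsFiniteMeasure ν] [MeasurableSpace.CountablyGenerated X] :
    TopologicalSpace.SeparableSpace (LSp X ν A) := by
  classical
  obtain ⟨𝒜, h𝒜c, h𝒜⟩ := exists_countable_measureDense ν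
  have hind : ∀ {E : Set X} (hE : MeasurableSet E) (a : A),
    AEStronglyMeasurable (E.indicator fun _ => a) ν := fun hE a =>
      aestronglyMeasurable_const.indicator hE
  have _ : Countable 𝒜 := h𝒜c
  let φ := Finsupp.liftAddHom (M := ℤ) (N := LSp X ν A) fun p : 𝒜 × ℕ => (zmultiplesHom _)
    (of _ (hind (h𝒜.measurable p.1 p.1.2) (TopologicalSpace.denseSeq A p.2)))
  let S : AddSubgroup (LSp X ν A) := φ.range
  have hS : (S : Set (LSp X ν A)).Countable := Set.countable_range φ
  have h1 : ∀ {E : Set X} (hE : MeasurableSet E) (a : A),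
      of _ (hind hE a) ∈ S.topologicalClosure := by
    intro E hE a
    refine mem_closure_iff_nhds_zero.2 fun T hT => ?_
    obtain ⟨U, hU, ε, hε, hUT⟩ := exists_basicNhd_subset hT
    obtain ⟨_, ⟨i, rfl⟩, hd⟩ := mem_closure_iff_nhds_zero.1
      ((TopologicalSpace.denseRange_denseSeq A) a) U hU
    obtain ⟨δ, hδ, hδε⟩ : ∃ δ : ℝ, 0 < δ ∧ ENNReal.ofReal δ ≤ ε := by
      obtain ⟨δ, -, h0, h⟩ := ENNReal.lt_iff_exists_real_btwn.1 hε
      exact ⟨δ, ENNReal.ofReal_pos.1 h0, h.le⟩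
    obtain ⟨t, ht, hEt⟩ := h𝒜.approx E hE (measure_ne_top _ _) δ hδ
    refine ⟨of _ (hind (h𝒜.measurable t ht) (TopologicalSpace.denseSeq A i)),
      ⟨Finsupp.single (⟨t, ht⟩, i) 1, by simp [φ]⟩, hUT ?_⟩
    rw [of_sub, of_mem_basicNhd]
    -- Off the symmetric difference of the two sets the functions differ by the difference of their
    -- values or by 0, and both lie in `U`.
    refine (measure_mono fun x hx => ?_).trans_lt (hEt.trans_le hδε)
    by_contra hc
    refine hx ?_
    rw [Set.mem_symmDiff] at hc
    rw [Pi.sub_apply]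
    by_cases hxE : x ∈ E
    · have hxt : x ∈ t := by tauto
      rwa [Set.indicator_of_mem hxE, Set.indicator_of_mem hxt]
    · have hxt : x ∉ t := by tauto
      rw [Set.indicator_of_notMem hxE, Set.indicator_of_notMem hxt, sub_zero]
      exact mem_of_mem_nhds hU
  have h2 : ∀ f : SimpleFunc X A, of f f.aestronglyMeasurable ∈ S.topologicalClosure := by
    intro f
    induction f using SimpleFunc.induction with
    | const c hs =>
      convert h1 hs c using 2
      ext x
      simp [Set.indicator_apply, Set.piecewise]
    | add hd hf hg => exact S.topologicalClosure.add_mem hf hg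
  refine ⟨⟨S, hS, fun F => ?_⟩⟩
  obtain ⟨f, hf, hFf⟩ := F.aestronglyMeasurable_fn
  rw [← of_fn F, of_eq_of_iff (hg := hf.aestronglyMeasurable) |>.2 hFf]
  exact S.isClosed_topologicalClosure.mem_of_tendsto (tendsto_of_tendsto_ae
    (fun k => (hf.approx k).aestronglyMeasurable) hf.aestronglyMeasurable
    (Filter.Eventually.of_forall fun x => hf.tendsto_approx x)) (Filter.Eventually.of_forall fun k => h2 _)

instance polishSpace [IsFiniteMeasure ν] [MeasurableSpace.CountablyGenerated X] :
    PolishSpace (LSp X ν A) := by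
  let _ := IsTopologicalAddGroup.rightUniformSpace (LSp X ν A)
  have _ := isUniformAddGroup_of_addCommGroup (G := LSp X ν A)
  have : (uniformity (LSp X ν A)).IsCountablyGenerated :=
    IsUniformAddGroup.uniformity_countably_generated
  have := separableSpace (X := X) (ν := ν) (A := A)
  have := completeSpace (X := X) (ν := ν) (A := A)
  have := UniformSpace.secondCountable_of_separable (LSp X ν A)
  infer_instance

end Polish

end LSp

end KacCohomology

end

noncomputable section

namespace KacCohomology

/-! ### The exponential law -/

/-- By density, an open set is the union of those countably many translates d i + N k that it
contains. -/
theorem measurable_of_sub_mem {Ω B : Type*} [MeasurableSpace Ω] [AddCommGroup B]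
    [TopologicalSpace B] [IsTopologicalAddGroup B] [MeasurableSpace B] [BorelSpace B]
    {N : ℕ → Set B} (hN : (𝓝 (0 : B)).HasBasis (fun _ => True) N) {d : ℕ → B} (hd : DenseRange d)
    {Φ : Ω → B} (h : ∀ i k, MeasurableSet {ω | Φ ω - d i ∈ N k}) : Measurable Φ := by
  refine measurable_of_isOpen fun O hO => ?_
  have : Φ ⁻¹' O = ⋃ p : {p : ℕ × ℕ // ∀ b, b - d p.1 ∈ N p.2 → b ∈ O},
      {ω | Φ ω - d p.1.1 ∈ N p.1.2} := by
    refine Set.Subset.antisymm (fun ω hω => ?_) (Set.iUnion_subset fun p ω hω => p.2 _ hω)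
    have hc : Filter.Tendsto (fun p : B × B => Φ ω - p.1 + p.2) (𝓝 0 ×ˢ 𝓝 0) (𝓝 (Φ ω)) := by
      rw [← nhds_prod_eq]
      exact Continuous.tendsto' (by fun_prop) _ _ (by simp)
    obtain ⟨k, -, hk⟩ := (hN.prod_self).mem_iff.1 (hc (hO.mem_nhds hω))
    obtain ⟨_, ⟨i, rfl⟩, hi⟩ := mem_closure_iff_nhds_zero.1 (hd (Φ ω)) (-N k)
      (neg_mem_nhds_zero B (hN.mem_of_mem trivial))
    have hi' : Φ ω - d i ∈ N k := by simpa using hi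
    refine Set.mem_iUnion.2 ⟨⟨(i, k), fun b hb => ?_⟩, hi'⟩
    have := hk (Set.mk_mem_prod hi' hb)
    simpa using this
  rw [this]
  exact MeasurableSet.iUnion fun p => h _ _

namespace LSp

variable {X : Type u} [MeasurableSpace X] [MeasurableSpace.CountablyGenerated X]
  {ν : Measure X} [IsFiniteMeasure ν] {A : Type v} [AddCommGroup A]
  [TopologicalSpace A] [IsTopologicalAddGroup A] [PolishSpace A]
  {Ω : Type*} [MeasurableSpace Ω] {μ : Measure Ω}

/-- Membership in a translate of a basic neighbourhood bounds the ν-measure of a section of a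
measurable subset of Ω × X, and this measure depends measurably on ω. -/
theorem stronglyMeasurable_of {g : Ω × X → A} (hg : StronglyMeasurable g) :
    StronglyMeasurable fun ω => (of (fun x => g (ω, x))
      (hg.comp_measurable measurable_prodMk_left).aestronglyMeasurable : LSp X ν A) := by
  borelize (LSp X ν A)
  borelize A
  refine Measurable.stronglyMeasurable ?_
  obtain ⟨U, hU⟩ := (𝓝 (0 : A)).exists_antitone_basis
  -- Open neighbourhoods make the exceptional sets measurable.
  have hU' : (𝓝 (0 : A)).HasAntitoneBasis fun k => interior (U k) := by
    refine ⟨Filter.hasBasis_iff.2 fun S => ⟨fun hS => ?_, ?_⟩, fun i j h => interior_mono (hU.2 h)⟩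
    · obtain ⟨i, -, hi⟩ := hU.1.mem_iff.1 hS
      exact ⟨i, trivial, interior_subset.trans hi⟩
    · rintro ⟨i, -, hi⟩
      exact Filter.mem_of_superset (interior_mem_nhds.2 (hU.1.mem_of_mem trivial)) hi
  refine measurable_of_sub_mem (hasAntitoneBasis_nhds_zero hU').1
    (TopologicalSpace.denseRange_denseSeq _) fun i k => ?_
  set d := (TopologicalSpace.denseSeq (LSp X ν A) i)
  have hd := d.aestronglyMeasurable_fn
  have hs : MeasurableSet {z : Ω × X | g z - hd.mk _ z.2 ∉ interior (U k)} :=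
    (hg.measurable.sub (hd.stronglyMeasurable_mk.measurable.comp measurable_snd))
      isOpen_interior.measurableSet.compl
  have : {ω | (of (fun x => g (ω, x))
      (hg.comp_measurable measurable_prodMk_left).aestronglyMeasurable : LSp X ν A) - d ∈
      basicNhd ν (interior (U k)) ((2⁻¹ : ℝ≥0∞) ^ k)} =
      {ω | ν (Prod.mk ω ⁻¹' {z : Ω × X | g z - hd.mk _ z.2 ∉ interior (U k)}) <
        (2⁻¹ : ℝ≥0∞) ^ k} := by
    ext ω
    change _ ∈ basicNhd _ _ _ ↔ (_ : ℝ≥0∞) < _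
    conv_lhs => rw [← of_fn d, of_sub, of_mem_basicNhd]
    refine iff_of_eq (congrArg (fun r : ℝ≥0∞ => r < (2⁻¹ : ℝ≥0∞) ^ k) (measure_congr ?_))
    filter_upwards [hd.ae_eq_mk] with x hx
    change (g (ω, x) - d.fn x ∉ _) = (g (ω, x) - hd.mk _ x ∉ _)
    rw [hx]
  rw [this]
  exact measurableSet_lt (measurable_measure_prodMk_left hs) measurable_const

/-- A jointly measurable function is a measurable function with values in `L(X, A)`. -/
theorem aestronglyMeasurable_of_prod [SFinite μ] {F : Ω → LSp X ν A} {f : Ω × X → A}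
    (hf : AEStronglyMeasurable f (μ.prod ν)) (hF : ∀ᵐ ω ∂μ, ∀ᵐ x ∂ν, (F ω).fn x = f (ω, x)) :
    AEStronglyMeasurable F μ := by
  refine ⟨_, stronglyMeasurable_of hf.stronglyMeasurable_mk, ?_⟩
  filter_upwards [hF, Measure.ae_ae_of_ae_prod hf.ae_eq_mk] with ω h1 h2
  conv_lhs => rw [← of_fn (F ω)]
  refine of_eq_of_iff.2 ?_
  filter_upwards [h1, h2] with x h1 h2
  rw [h1, h2]

/-- A measurable function with values in `L(X, A)` is given by a jointly measurable function. -/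
theorem exists_prod_of_aestronglyMeasurable [SFinite μ] {Φ : Ω → LSp X ν A}
    (hΦ : AEStronglyMeasurable Φ μ) : ∃ f : Ω × X → A, StronglyMeasurable f ∧
      ∀ᵐ ω ∂μ, ∀ᵐ x ∂ν, (Φ ω).fn x = f (ω, x) := by
  obtain ⟨Φ', hΦ', hΦΦ'⟩ := hΦ
  suffices h : ∃ f : Ω × X → A, StronglyMeasurable f ∧ ∀ᵐ ω ∂μ, ∀ᵐ x ∂ν, (Φ' ω).fn x = f (ω, x) by
    obtain ⟨f, hf, h⟩ := h
    refine ⟨f, hf, ?_⟩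
    filter_upwards [hΦΦ', h] with ω h1 h2
    rwa [h1]
  clear hΦΦ' Φ
  borelize (LSp X ν A)
  borelize A
  obtain ⟨U, hU, hadd⟩ := IsTopologicalAddGroup.exists_antitone_basis_nhds_zero A
  have hN := hasAntitoneBasis_nhds_zero (ν := ν) hU
  have hO : ∀ k, ∃ O : Set (LSp X ν A), IsOpen O ∧ (0 : LSp X ν A) ∈ O ∧ ∀ a ∈ O, ∀ b ∈ O,
      a - b ∈ basicNhd ν (U k) ((2⁻¹ : ℝ≥0∞) ^ k) := by
    intro k
    obtain ⟨V, hV, h⟩ := exists_nhds_half_neg (hN.1.mem_of_mem (i := k) trivial)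
    obtain ⟨O, hOV, hO, h0⟩ := mem_nhds_iff.1 hV
    exact ⟨O, hO, h0, fun a ha b hb => h a (hOV ha) b (hOV hb)⟩
  choose O hO h0 hsub using hO
  obtain ⟨e, he⟩ := TopologicalSpace.exists_dense_seq (LSp X ν A)
  -- The increment from step k to step k + 1 is controlled by `O k`, so the approximation number k +
  -- 1 must also be good enough for the index k. For k = 0 the second condition repeats the first.
  have hex : ∀ k ω, ∃ i, Φ' ω - e i ∈ O k ∩ O (k - 1) := by
    intro k ω
    obtain ⟨_, ⟨i, rfl⟩, hi⟩ := mem_closure_iff_nhds_zero.1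
      (he (Φ' ω)) (-(O k ∩ O (k - 1)))
      (neg_mem_nhds_zero _ (((hO k).inter (hO (k - 1))).mem_nhds ⟨h0 k, h0 _⟩))
    exact ⟨i, by simpa using hi⟩
  obtain ⟨ι, hιm, hι⟩ : ∃ ι : ℕ → Ω → ℕ, (∀ k, Measurable (ι k)) ∧
      ∀ k ω, Φ' ω - e (ι k ω) ∈ O k ∩ O (k - 1) := by
    classical
    exact ⟨fun k ω => Nat.find (hex k ω), fun k => measurable_find _ fun i =>
      (hΦ'.measurable.sub_const _) ((hO k).inter (hO (k - 1))).measurableSet,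
      fun k ω => Nat.find_spec (hex k ω)⟩
  choose r hr her using fun i => (e i).aestronglyMeasurable_fn
  -- The approximations take countably many values in L(X, A), so fixed representatives of these
  -- values give jointly measurable functions.
  let f : ℕ → Ω × X → A := fun k z => r (ι k z.1) z.2
  have hf : ∀ k, StronglyMeasurable (f k) := fun k => by
    have h1 : Measurable fun p : ℕ × X => r p.1 p.2 :=
      measurable_from_prod_countable_right fun i => (hr i).measurable
    exact (h1.comp (((hιm k).comp measurable_fst).prodMk measurable_snd)).stronglyMeasurable
  have hfω : ∀ k ω, of (fun x => f k (ω, x))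
      ((hf k).comp_measurable measurable_prodMk_left).aestronglyMeasurable = e (ι k ω) :=
    fun k ω => (of_eq_of_iff.2 (her (ι k ω)).symm).trans (of_fn _)
  have hlim : ∀ᵐ z ∂μ.prod ν, ∃ l, Filter.Tendsto (fun k => f k z) Filter.atTop (𝓝 l) := by
    refine (Measure.ae_prod_iff_ae_ae (measurableSet_exists_tendsto fun k => (hf k).measurable)).2 ?_
    refine Filter.Eventually.of_forall fun ω => ?_
    refine ae_exists_tendsto_of_measure_sub_le hU hadd (f := fun k x => f k (ω, x)) fun k => ?_
    refine le_of_lt (of_mem_basicNhd (f := (fun x => f (k + 1) (ω, x)) - fun x => f k (ω, x))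
      (hf := (((hf _).comp_measurable measurable_prodMk_left).sub
        ((hf _).comp_measurable measurable_prodMk_left)).aestronglyMeasurable) |>.1 ?_)
    have : (of (fun x => f (k + 1) (ω, x))
      ((hf _).comp_measurable measurable_prodMk_left).aestronglyMeasurable : LSp X ν A) -
      of (fun x => f k (ω, x)) ((hf _).comp_measurable measurable_prodMk_left).aestronglyMeasurable ∈
        basicNhd ν (U k) ((2⁻¹ : ℝ≥0∞) ^ k) := by
      rw [hfω, hfω, ← sub_sub_sub_cancel_left _ _ (Φ' ω)]
      exact hsub k _ (hι k ω).1 _ (hι (k + 1) ω).2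
    exact this
  obtain ⟨g, hg, hlim⟩ := exists_stronglyMeasurable_limit_of_tendsto_ae
    (fun k => (hf k).aestronglyMeasurable) hlim
  refine ⟨g, hg, ?_⟩
  filter_upwards [Measure.ae_ae_of_ae_prod hlim] with ω hω
  have h1 := tendsto_of_tendsto_ae (ν := ν)
    (fun k => ((hf k).comp_measurable (measurable_prodMk_left (x := ω))).aestronglyMeasurable)
    ((hg.comp_measurable (measurable_prodMk_left (x := ω))).aestronglyMeasurable) hω
  have h2 : Filter.Tendsto (fun k => e (ι k ω)) Filter.atTop
      (𝓝 (Φ' ω)) := by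
    have h3 : Filter.Tendsto (fun k => Φ' ω - e (ι k ω))
        Filter.atTop (𝓝 0) := hN.tendsto fun k => by
      simpa using hsub k _ (hι k ω).1 _ (h0 k)
    simpa using (tendsto_const_nhds (x := Φ' ω)).sub h3
  -- The section of the limit function and Φ' ω are limits in measure of the same sequence.
  have h3 := tendsto_nhds_unique (h1.congr fun k => hfω k ω) h2
  have h4 : (Φ' ω).fn =ᵐ[ν] _ := h3 ▸ fn_of _
  exact h4

end LSp

end KacCohomology

end

noncomputable section

namespace KacCohomology

/-! ### Functions modulo constants -/

namespace LSp

variable {X : Type u} [MeasurableSpace X] {ν : Measure X} [IsFiniteMeasure ν] {A : Type v}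
  [AddCommGroup A] [TopologicalSpace A] [IsTopologicalAddGroup A]

theorem fn_add (F F' : LSp X ν A) : (F + F').fn =ᵐ[ν] F.fn + F'.fn := AEEqFun.coeFn_add _ _

theorem aestronglyMeasurable_diff {f : X → A} (hf : AEStronglyMeasurable f ν) :
    AEStronglyMeasurable (fun z : X × X => f z.1 - f z.2) (ν.prod ν) :=
  (hf.comp_quasiMeasurePreserving quasiMeasurePreserving_fst).sub
    (hf.comp_quasiMeasurePreserving quasiMeasurePreserving_snd)

/-- The map `F ↦ ((x, y) ↦ F x - F y)`. -/
def diff (X : Type u) [MeasurableSpace X] (ν : Measure X) [IsFiniteMeasure ν] (A : Type v)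
    [AddCommGroup A] [TopologicalSpace A] [IsTopologicalAddGroup A] :
    LSp X ν A →+ LSp (X × X) (ν.prod ν) A :=
  AddMonoidHom.mk' (fun F => of _ (aestronglyMeasurable_diff F.aestronglyMeasurable_fn)) fun F F' => by
    rw [of_add]
    refine of_eq_of_iff.2 ?_
    filter_upwards [quasiMeasurePreserving_fst.ae (fn_add F F'),
      quasiMeasurePreserving_snd.ae (fn_add F F')] with z h1 h2
    simp only [h1, h2, Pi.add_apply]
    abel

theorem diff_of {f : X → A} (hf : AEStronglyMeasurable f ν) :
    diff X ν A (of f hf) = of _ (aestronglyMeasurable_diff hf) := by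
  refine of_eq_of_iff.2 ?_
  filter_upwards [quasiMeasurePreserving_fst.ae (fn_of hf),
    quasiMeasurePreserving_snd.ae (fn_of hf)] with z h1 h2
  rw [h1, h2]

theorem diff_const (a : A) : diff X ν A (const X ν A a) = 0 := by
  change diff X ν A (of _ aestronglyMeasurable_const) = 0
  rw [diff_of, ← of_zero]
  exact of_eq_of_iff.2 (Filter.Eventually.of_forall fun z => sub_self a)

/-- If F x - F y leaves U, then F x or F y leaves V, so the exceptional set is covered by two strips
in X × X. -/
theorem continuous_diff : Continuous (diff X ν A) := by
  refine continuous_of_continuousAt_zero _ (tendsto_nhds.2 fun S hS h0 => ?_)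
  rw [map_zero] at h0
  obtain ⟨U, hU, ε, hε, hUS⟩ := exists_basicNhd_subset (hS.mem_nhds h0)
  obtain ⟨V, hV, hVU⟩ := exists_nhds_half_neg hU
  obtain ⟨δ, hδ, hδε⟩ : ∃ δ : ℝ≥0∞, 0 < δ ∧ δ * ν Set.univ < ε / 2 := by
    have h1 : Filter.Tendsto (fun k : ℕ => (2⁻¹ : ℝ≥0∞) ^ k * ν Set.univ) Filter.atTop
        (𝓝 (0 * ν Set.univ)) :=
      ENNReal.Tendsto.mul_const (ENNReal.tendsto_pow_atTop_nhds_zero_of_lt_one (by simp))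
        (.inr (measure_ne_top _ _))
    rw [zero_mul] at h1
    obtain ⟨k, hk⟩ := (h1.eventually (gt_mem_nhds (ENNReal.half_pos hε.ne'))).exists
    exact ⟨_, ENNReal.pow_pos (by simp) k, hk⟩
  filter_upwards [basicNhd_mem_nhds (ν := ν) hV hδ] with F hF
  refine hUS (of_mem_basicNhd.2 ?_)
  have hF' : ν {x | F.fn x ∉ V} < δ := hF
  calc _ ≤ (ν.prod ν) ({x | F.fn x ∉ V} ×ˢ Set.univ ∪ Set.univ ×ˢ {x | F.fn x ∉ V}) := by
        refine measure_mono fun z hz => ?_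
        by_contra hc
        simp only [Set.mem_union, Set.mem_prod, Set.mem_ofPred_eq, Set.mem_univ, and_true, true_and,
          not_or, not_not] at hc
        exact hz (hVU _ hc.1 _ hc.2)
    _ ≤ _ := measure_union_le _ _
    _ ≤ δ * ν Set.univ + δ * ν Set.univ := by
        rw [prod_prod, prod_prod, mul_comm (ν Set.univ)]
        gcongr
    _ < ε / 2 + ε / 2 := ENNReal.add_lt_add hδε hδε
    _ = ε := ENNReal.add_halves ε

variable [NeZero ν]

theorem const_injective : Function.Injective (const X ν A) := by
  intro a b hab
  have h : (fun _ : X => a) =ᵐ[ν] fun _ => b := of_eq_of_iff.1 hab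
  exact h.exists.choose_spec

/-- By Fubini some x has F y = F x for almost every y. -/
theorem mem_range_const_iff {F : LSp X ν A} : F ∈ (const X ν A).range ↔ diff X ν A F = 0 := by
  constructor
  · rintro ⟨a, rfl⟩
    exact diff_const a
  · intro h
    have h1 : ∀ᵐ z ∂ν.prod ν, F.fn z.1 - F.fn z.2 = 0 := of_eq_of_iff.1 h
    obtain ⟨x, hx⟩ := (Measure.ae_ae_of_ae_prod h1).exists
    refine ⟨F.fn x, ?_⟩
    conv_rhs => rw [← of_fn F]
    refine of_eq_of_iff.2 ?_
    filter_upwards [hx] with y hy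
    exact sub_eq_zero.1 hy

theorem isInducing_const : IsInducing (const X ν A) := by
  refine ⟨IsTopologicalAddGroup.ext inferInstance (topologicalAddGroup_induced _) ?_⟩
  refine le_antisymm ?_ ?_
  · rw [nhds_induced]
    exact continuous_const.continuousAt.le_comap
  · rw [nhds_induced, map_zero]
    intro U hU
    have h0 : 0 < ν Set.univ := pos_iff_ne_zero.2 ((NeZero.ne _))
    -- With the radius ν(X), a constant outside U is excluded, since its exceptional set is all of
    -- X.
    refine ⟨_, basicNhd_mem_nhds hU h0, fun a ha => ?_⟩
    by_contra hc
    have h1 : (of (fun _ => a) aestronglyMeasurable_const : LSp X ν A) ∈ basicNhd ν U (ν Set.univ) := ha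
    rw [of_mem_basicNhd] at h1
    simp [hc] at h1

/-- The constants are the kernel of the continuous homomorphism `diff` to a Hausdorff group. -/
theorem isClosed_range_const [PolishSpace A] : IsClosed ((const X ν A).range : Set (LSp X ν A)) := by
  have : ((const X ν A).range : Set (LSp X ν A)) = {F | diff X ν A F = 0} :=
    Set.ext fun F => mem_range_const_iff
  rw [this]
  exact isClosed_eq continuous_diff _root_.continuous_const

theorem isClosedEmbedding_const [PolishSpace A] : IsClosedEmbedding (const X ν A) :=
  ⟨⟨isInducing_const, const_injective⟩, isClosed_range_const⟩

end LSp

namespace LModConst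

variable {X : Type u} [MeasurableSpace X] {ν : Measure X} [IsFiniteMeasure ν] [NeZero ν]
  {A : Type v} [AddCommGroup A] [TopologicalSpace A] [IsTopologicalAddGroup A]

theorem proj_eq_zero_iff {F : LSp X ν A} : proj X ν A F = 0 ↔ F ∈ (LSp.const X ν A).range :=
  QuotientAddGroup.eq_zero_iff F

theorem proj_surjective : Function.Surjective (proj X ν A) := QuotientAddGroup.mk_surjective

theorem isOpenQuotientMap_proj : IsOpenQuotientMap (proj X ν A) :=
  QuotientAddGroup.isOpenQuotientMap_mk

/-- A quotient of a complete first countable group by a closed subgroup is complete. Separation and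
second countability pass to the quotient as well. -/
theorem polishSpace [MeasurableSpace.CountablyGenerated X] [PolishSpace A] :
    PolishSpace (LModConst X ν A) := by
  have _ := LSp.completeSpace (X := X) (ν := ν) (A := A)
  have _ : IsClosed ((LSp.const X ν A).range : Set (LSp X ν A)) := LSp.isClosed_range_const
  have _ : T3Space (LModConst X ν A) :=
    inferInstanceAs (T3Space (LSp X ν A ⧸ (LSp.const X ν A).range))
  have _ : SecondCountableTopology (LModConst X ν A) :=
    inferInstanceAs (SecondCountableTopology (LSp X ν A ⧸ (LSp.const X ν A).range))
  let _ : UniformSpace (LModConst X ν A) := IsTopologicalAddGroup.rightUniformSpace (LModConst X ν A)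
  have _ : CompleteSpace (LModConst X ν A) :=
    QuotientAddGroup.completeSpace_right' (LSp X ν A) (LSp.const X ν A).range
  have _ := isUniformAddGroup_of_addCommGroup (G := LModConst X ν A)
  have _ : (uniformity (LModConst X ν A)).IsCountablyGenerated :=
    IsUniformAddGroup.uniformity_countably_generated
  infer_instance

theorem continuousSMul {G : Type w} [Group G] [TopologicalSpace G] [MulAction G X]
    [QuasiInvariant G ν] [DistribMulAction G A] [ContinuousConstSMul G A]
    [ContinuousSMul G (LSp X ν A)] : ContinuousSMul G (LModConst X ν A) where
  continuous_smul := by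
    refine (IsOpenQuotientMap.id.prodMap isOpenQuotientMap_proj).isQuotientMap.continuous_iff.2 ?_
    exact continuous_proj.comp (continuous_smul (M := G) (X := LSp X ν A))

/-- The injection of `L(X, A) / A` into `L(X × X, A)`. -/
def diff (X : Type u) [MeasurableSpace X] (ν : Measure X) [IsFiniteMeasure ν] (A : Type v)
    [AddCommGroup A] [TopologicalSpace A] [IsTopologicalAddGroup A] :
    LModConst X ν A →+ LSp (X × X) (ν.prod ν) A :=
  QuotientAddGroup.lift _ (LSp.diff X ν A) (by rintro _ ⟨a, rfl⟩; exact LSp.diff_const a)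

theorem diff_proj (F : LSp X ν A) : diff X ν A (proj X ν A F) = LSp.diff X ν A F := rfl

theorem continuous_diff : Continuous (diff X ν A) :=
  (isOpenQuotientMap_proj (X := X) (ν := ν) (A := A)).isQuotientMap.continuous_iff.2
    LSp.continuous_diff

theorem diff_injective : Function.Injective (diff X ν A) := by
  refine (injective_iff_map_eq_zero _).2 fun c hc => ?_
  obtain ⟨F, rfl⟩ := proj_surjective c
  rw [diff_proj] at hc
  exact proj_eq_zero_iff.2 (LSp.mem_range_const_iff.2 hc)

/-- Measurable functions with values in `L(X, A) / A` lift to `L(X, A)`. -/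
theorem exists_lift [MeasurableSpace.CountablyGenerated X] [PolishSpace A] {Ω : Type*}
    [MeasurableSpace Ω] {μ : Measure Ω} [SFinite μ] {c : Ω → LModConst X ν A}
    (hc : AEStronglyMeasurable c μ) : ∃ (f : Ω × X → A) (hf : StronglyMeasurable f), ∀ᵐ ω ∂μ,
      proj X ν A (LSp.of (fun x => f (ω, x))
        (hf.comp_measurable measurable_prodMk_left).aestronglyMeasurable) = c ω := by
  obtain ⟨f, hf, hfc⟩ := LSp.exists_prod_of_aestronglyMeasurable
    (continuous_diff.comp_aestronglyMeasurable hc)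
  -- If F represents c ω, then f(ω, x, y) = F x - F y. For generic y the function f(ω, ·, y) differs
  -- from F by a constant, so it has the same differences.
  have h1 : ∀ᵐ ω ∂μ, ∀ᵐ y ∂ν, ∀ᵐ z ∂ν.prod ν, f (ω, z.1, y) - f (ω, z.2, y) = f (ω, z) := by
    filter_upwards [hfc] with ω hω
    obtain ⟨F, hF⟩ := proj_surjective (c ω)
    have h2 : ∀ᵐ z ∂ν.prod ν, F.fn z.1 - F.fn z.2 = f (ω, z) := by
      have h3 : (diff X ν A (c ω)).fn =ᵐ[ν.prod ν] fun z => F.fn z.1 - F.fn z.2 := by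
        rw [← hF]
        exact LSp.fn_of _
      filter_upwards [hω, h3] with z h4 h5
      rw [← h5, ← h4]
    have h2' := (qmp_swap.ae h2 : ∀ᵐ z ∂ν.prod ν, _)
    filter_upwards [Measure.ae_ae_of_ae_prod h2'] with y hy
    filter_upwards [h2, quasiMeasurePreserving_fst.ae hy, quasiMeasurePreserving_snd.ae hy]
      with z h4 h5 h6
    simp only [Prod.swap] at h5 h6
    rw [← h5, ← h6, ← h4]
    abel
  borelize A
  have hQ : MeasurableSet {q : (Ω × X) × X × X | f (q.1.1, q.2.1, q.1.2) - f (q.1.1, q.2.2, q.1.2) =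
      f (q.1.1, q.2)} := by
    have := hf.measurable
    exact measurableSet_eq_fun (by fun_prop) (by fun_prop)
  have h2 : ∀ᵐ q ∂(μ.prod ν).prod (ν.prod ν), f (q.1.1, q.2.1, q.1.2) - f (q.1.1, q.2.2, q.1.2) =
      f (q.1.1, q.2) := by
    refine (Measure.ae_prod_iff_ae_ae hQ).2 ?_
    refine (Measure.ae_prod_iff_ae_ae ?_).2 h1
    exact (measurableSet_eq_fun (measurable_measure_prodMk_left hQ.compl) measurable_const)
  have h3 := qmp_swap.ae (Measure.ae_ae_of_ae_prod h2)
  -- A single y, good for almost every ω, normalises the representatives F - F y and thereby chooses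
  -- them measurably in ω.
  obtain ⟨y, hy⟩ := (Measure.ae_ae_of_ae_prod h3).exists
  have hfy : StronglyMeasurable fun p : Ω × X => f (p.1, p.2, y) :=
    hf.comp_measurable (by fun_prop)
  refine ⟨fun p => f (p.1, p.2, y), hfy, ?_⟩
  filter_upwards [hy, hfc] with ω h4 h5
  apply diff_injective
  rw [diff_proj, LSp.diff_of]
  conv_rhs => rw [← LSp.of_fn (diff X ν A (c ω))]
  refine LSp.of_eq_of_iff.2 ?_
  filter_upwards [h4, h5] with z h6 h7
  exact h6.trans h7.symm

end LModConst

end KacCohomology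

end

noncomputable section

namespace KacCohomology

/-! ### Measurable actions are continuous -/

section AutomaticContinuity

variable {G : Type*} [Group G] [TopologicalSpace G] [IsTopologicalGroup G]
  [LocallyCompactSpace G] [SecondCountableTopology G] [MeasurableSpace G] [BorelSpace G]
  {B : Type*} [AddCommGroup B] [TopologicalSpace B] [IsTopologicalAddGroup B] [T2Space B]
  [SecondCountableTopology B] [DistribMulAction G B] [ContinuousConstSMul G B]

/-- For each g continuity gives some k such that θ g carries N k into W. Testing on a dense sequence
makes the set of g with a given k measurable, and one of these countably many sets has positive
measure. The map θ will be the identity or the inversion. -/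
theorem exists_pos_measure_smul_mem (h : ∀ b : B, StronglyMeasurable fun g : G => g • b)
    {θ : G → G} (hθ : Measurable θ) {E : Set G} (hE : MeasurableSet E) (hE0 : 0 < haar E)
    {W : Set B} (hW : W ∈ 𝓝 0) : ∃ M : Set B, IsOpen M ∧ 0 ∈ M ∧ ∃ E' ⊆ E, MeasurableSet E' ∧
      0 < haar E' ∧ ∀ g ∈ E', ∀ b ∈ M, θ g • b ∈ W := by
  obtain ⟨W', ⟨hW', hc⟩, hWW'⟩ := (closed_nhds_basis (0 : B)).mem_iff.1 hW
  obtain ⟨N, hN⟩ := (𝓝 (0 : B)).exists_antitone_basis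
  obtain ⟨d, hd⟩ := TopologicalSpace.exists_dense_seq B
  borelize B
  let S : ℕ → Set G := fun k => E ∩ ⋂ n : {n // d n ∈ interior (N k)}, {g | θ g • d n ∈ W'}
  have hS : ∀ k, MeasurableSet (S k) := fun k => hE.inter <| MeasurableSet.iInter fun n =>
    ((h (d n)).measurable.comp hθ) hc.measurableSet
  have hU : E ⊆ ⋃ k, S k := by
    intro g hg
    have h1 : (fun b => θ g • b) ⁻¹' W' ∈ 𝓝 (0 : B) :=
      (continuous_const_smul (θ g)).tendsto' 0 0 (smul_zero _) hW'
    obtain ⟨k, -, hk⟩ := hN.1.mem_iff.1 h1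
    exact Set.mem_iUnion.2 ⟨k, hg, Set.mem_iInter.2 fun n => hk (interior_subset n.2)⟩
  obtain ⟨k, hk⟩ : ∃ k, 0 < haar (S k) := by
    by_contra hcon
    push Not at hcon
    exact hE0.ne' (measure_mono_null hU (measure_iUnion_null fun k => le_antisymm (hcon k) zero_le))
  refine ⟨interior (N k), isOpen_interior, mem_interior_iff_mem_nhds.2 (hN.1.mem_of_mem trivial),
    S k, Set.inter_subset_left, hS k, hk, fun g hg b hb => hWW' ?_⟩
  have h2 : b ∈ closure (interior (N k) ∩ Set.range d) := hd.open_subset_closure_inter isOpen_interior hb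
  refine hc.closure_subset (map_mem_closure (continuous_const_smul (θ g)) h2 ?_)
  rintro _ ⟨hx, n, rfl⟩
  exact Set.mem_iInter.1 hg.2 ⟨n, hx⟩

/-- One has xy⁻¹b - b = x(y⁻¹b - x⁻¹b). Take x and y in a set of positive measure on which g⁻¹b
varies little and g acts with uniform control; by Steinhaus the quotients xy⁻¹ fill a neighbourhood
of 1. -/
theorem eventually_smul_sub_mem (h : ∀ b : B, StronglyMeasurable fun g : G => g • b) (b : B)
    {W : Set B} (hW : W ∈ 𝓝 0) : ∀ᶠ g in 𝓝 (1 : G), g • b - b ∈ W := by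
  obtain ⟨M, hM, h0, E, -, hE, hE0, hEM⟩ := exists_pos_measure_smul_mem h measurable_id
    MeasurableSet.univ (measure_univ_pos.2 (NeZero.ne (haar : Measure G))) hW
  obtain ⟨V, hV, hVM⟩ := exists_nhds_half_neg (hM.mem_nhds h0)
  obtain ⟨d, hd⟩ := TopologicalSpace.exists_dense_seq B
  borelize B
  let S : ℕ → Set G := fun n => E ∩ {g | g⁻¹ • b - d n ∈ interior V}
  have hS : ∀ n, MeasurableSet (S n) := fun n => hE.inter
    (((h b).measurable.comp measurable_inv).sub_const _ isOpen_interior.measurableSet)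
  have hU : E ⊆ ⋃ n, S n := by
    intro g hg
    obtain ⟨_, ⟨n, rfl⟩, hn⟩ := mem_closure_iff_nhds_zero.1 (hd (g⁻¹ • b)) (-interior V)
      (neg_mem_nhds_zero B (interior_mem_nhds.2 hV))
    exact Set.mem_iUnion.2 ⟨n, hg, by simpa using hn⟩
  obtain ⟨n, hn⟩ : ∃ n, 0 < haar (S n) := by
    by_contra hcon
    push Not at hcon
    exact hE0.ne' (measure_mono_null hU (measure_iUnion_null fun k => le_antisymm (hcon k) zero_le))
  filter_upwards [div_mem_nhds_one_of_haar_pos haar _ (hS n) hn]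
  rintro _ ⟨x, hx, y, hy, rfl⟩
  have h1 := hVM _ (interior_subset hy.2) _ (interior_subset hx.2)
  rw [sub_sub_sub_cancel_right] at h1
  have h2 := hEM x hx.1 _ h1
  rwa [id, smul_sub, smul_inv_smul, smul_smul, ← div_eq_mul_inv] at h2

/-- Near 1 every element is a quotient xy⁻¹ of elements of a set of positive measure, chosen so that
y⁻¹ carries M' into M and x carries M into W. -/
theorem tendsto_smul_one_zero (h : ∀ b : B, StronglyMeasurable fun g : G => g • b) :
    Filter.Tendsto (fun p : G × B => p.1 • p.2) (𝓝 (1, 0)) (𝓝 0) := by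
  refine Filter.tendsto_def.2 fun W hW => ?_
  obtain ⟨M, hM, h0, E, -, hE, hE0, hEM⟩ := exists_pos_measure_smul_mem h measurable_id
    MeasurableSet.univ (measure_univ_pos.2 (NeZero.ne (haar : Measure G))) hW
  obtain ⟨M', hM', h0', E', hEE', hE', hE0', hEM'⟩ := exists_pos_measure_smul_mem h measurable_inv
    hE hE0 (hM.mem_nhds h0)
  rw [nhds_prod_eq]
  filter_upwards [Filter.prod_mem_prod (div_mem_nhds_one_of_haar_pos haar _ hE' hE0')
    (hM'.mem_nhds h0')]
  rintro ⟨_, b⟩ ⟨⟨x, hx, y, hy, rfl⟩, hb⟩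
  change (x / y) • b ∈ W
  rw [div_eq_mul_inv, mul_smul]
  exact hEM x (hEE' hx) _ (hEM' y hy b hb)

/-- An action by continuous automorphisms with measurable orbit maps is jointly continuous. -/
theorem continuousSMul_of_stronglyMeasurable
    (h : ∀ b : B, StronglyMeasurable fun g : G => g • b) : ContinuousSMul G B where
  continuous_smul := by
    refine continuous_iff_continuousAt.2 fun ⟨g, b⟩ => ?_
    -- Write g'b' as (g'g⁻¹)(g(b' - b)) + (g'g⁻¹)(gb). The first term is governed by continuity at
    -- (1, 0), the second by continuity of the orbit map of gb at 1.
    have h1 : Filter.Tendsto (fun p : G × B => (p.1 * g⁻¹, g • (p.2 - b))) (𝓝 (g, b)) (𝓝 (1, 0)) :=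
      Continuous.tendsto' (by fun_prop) _ _ (by simp)
    have h2 : Filter.Tendsto (fun x : G => x • (g • b) - g • b) (𝓝 1) (𝓝 0) :=
      Filter.tendsto_def.2 fun W hW => eventually_smul_sub_mem h (g • b) hW
    have h3 : Filter.Tendsto (fun p : G × B => p.1 * g⁻¹) (𝓝 (g, b)) (𝓝 1) :=
      Continuous.tendsto' (by fun_prop) _ _ (by simp)
    have h4 := (((tendsto_smul_one_zero h).comp h1).add (h2.comp h3)).add_const (g • b)
    rw [zero_add, zero_add] at h4
    refine h4.congr fun p => ?_
    simp only [Function.comp_apply, smul_sub, smul_smul]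
    rw [inv_mul_cancel_right]
    abel

end AutomaticContinuity

namespace LSp

/-- The ε–δ form of absolute continuity for finite measures: the push-forward has an integrable
density with respect to `ν'`. -/
theorem exists_pos_measure_preimage_lt {X Y : Type*} [MeasurableSpace X] [MeasurableSpace Y]
    {ν : Measure X} [IsFiniteMeasure ν] {ν' : Measure Y} [IsFiniteMeasure ν'] {τ : X → Y}
    (hτ : QuasiMeasurePreserving τ ν ν') {ε : ℝ≥0∞} (hε : 0 < ε) :
    ∃ δ > 0, ∀ s, ν' s < δ → ν (τ ⁻¹' s) < ε := by
  have h1 := withDensity_rnDeriv_eq _ _ hτ.absolutelyContinuous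
  have h2 : ∫⁻ x, (ν.map τ).rnDeriv ν' x ∂ν' ≠ ∞ := (lintegral_rnDeriv_lt_top _ _).ne
  obtain ⟨δ, hδ, h⟩ := exists_pos_setLIntegral_lt_of_measure_lt h2 hε.ne'
  refine ⟨δ, hδ, fun s hs => ?_⟩
  have h3 := h s hs
  rw [← withDensity_apply', h1] at h3
  exact (le_map_apply hτ.aemeasurable s).trans_lt h3

variable {X : Type u} [MeasurableSpace X] {ν : Measure X} [IsFiniteMeasure ν] {A : Type v}
  [AddCommGroup A] [TopologicalSpace A] [IsTopologicalAddGroup A]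
  {G : Type w} [Group G] [MulAction G X] [QuasiInvariant G ν] [DistribMulAction G A]

theorem smul_of [ContinuousConstSMul G A] (g : G) {f : X → A} (hf : AEStronglyMeasurable f ν) :
    g • of f hf = of (fun x => g • f (g⁻¹ • x)) ((continuous_const_smul g).comp_aestronglyMeasurable
      (hf.comp_quasiMeasurePreserving (QuasiInvariant.qmp g⁻¹))) := rfl

instance [ContinuousConstSMul G A] : ContinuousConstSMul G (LSp X ν A) where
  continuous_const_smul g := by
    refine continuous_of_continuousAt_zero (DistribSMul.toAddMonoidHom (LSp X ν A) g)
      (tendsto_nhds.2 fun S hS h0 => ?_)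
    rw [map_zero] at h0
    obtain ⟨U, hU, ε, hε, hUS⟩ := exists_basicNhd_subset (hS.mem_nhds h0)
    have hV : (fun a : A => g • a) ⁻¹' U ∈ 𝓝 (0 : A) :=
      (continuous_const_smul g).tendsto' 0 0 (smul_zero _) hU
    obtain ⟨δ, hδ, h⟩ := exists_pos_measure_preimage_lt (QuasiInvariant.qmp (ν := ν) g⁻¹) hε
    filter_upwards [basicNhd_mem_nhds (ν := ν) hV hδ] with F hF
    refine hUS ?_
    have h1 : g • of F.fn F.aestronglyMeasurable_fn ∈ basicNhd ν U ε := by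
      rw [smul_of, of_mem_basicNhd]
      exact h _ hF
    rwa [of_fn] at h1

variable [TopologicalSpace G] [IsTopologicalGroup G] [LocallyCompactSpace G]
  [SecondCountableTopology G] [MeasurableSpace G] [BorelSpace G] [MeasurableSMul₂ G X]
  [ContinuousSMul G A] [PolishSpace A] [MeasurableSpace.CountablyGenerated X]

/-- The function (g, x) ↦ g • f(g⁻¹x) is jointly measurable, so orbit maps are measurable, and
automatic continuity applies. -/
theorem continuousSMul : ContinuousSMul G (LSp X ν A) := by
  refine continuousSMul_of_stronglyMeasurable fun F => ?_
  obtain ⟨f, hf, hFf⟩ := F.aestronglyMeasurable_fn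
  have hF : of f hf.aestronglyMeasurable = F := (of_eq_of_iff.2 hFf.symm).trans (of_fn F)
  subst hF
  borelize A
  have h1 : Measurable fun z : G × X => f (z.1⁻¹ • z.2) :=
    hf.measurable.comp (measurable_fst.inv.smul measurable_snd)
  have h2 : StronglyMeasurable fun z : G × X => z.1 • f (z.1⁻¹ • z.2) :=
    ((continuous_smul (M := G) (X := A)).measurable.comp (measurable_fst.prodMk h1)).stronglyMeasurable
  exact stronglyMeasurable_of h2

end LSp

/-! ### Countable generation for disjoint unions -/

theorem measurableSet_generateFrom_image {γ δ : Type*} [MeasurableSpace γ]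
    [MeasurableSpace.CountablyGenerated γ] {g : Set (Set δ)} {f : γ → δ} (hf : Function.Injective f)
    (hr : Set.range f ∈ g) (hg : ∀ s ∈ MeasurableSpace.countableGeneratingSet γ, f '' s ∈ g)
    {s : Set γ} (hs : MeasurableSet s) : MeasurableSet[MeasurableSpace.generateFrom g] (f '' s) := by
  rw [← MeasurableSpace.generateFrom_countableGeneratingSet (α := γ)] at hs
  induction s, hs using MeasurableSpace.generateFrom_induction with
  | hC t ht _ => exact MeasurableSpace.measurableSet_generateFrom (hg t ht)
  | empty => simp
  | compl t _ ih =>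
    rw [Set.image_compl_eq_range_sdiff_image hf]
    exact (MeasurableSpace.measurableSet_generateFrom hr).diff ih
  | iUnion t _ ih =>
    rw [Set.image_iUnion]
    exact MeasurableSet.iUnion ih

theorem countablyGenerated_sum {α β : Type*} [MeasurableSpace α] [MeasurableSpace β]
    [MeasurableSpace.CountablyGenerated α] [MeasurableSpace.CountablyGenerated β] :
    MeasurableSpace.CountablyGenerated (α ⊕ β) := by
  let a := MeasurableSpace.countableGeneratingSet α
  let b := MeasurableSpace.countableGeneratingSet β
  let g : Set (Set (α ⊕ β)) := insert (Set.range Sum.inl) (insert (Set.range Sum.inr)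
    ((fun s => Sum.inl '' s) '' a ∪ (fun s => Sum.inr '' s) '' b))
  refine ⟨g, ?_, le_antisymm (fun s hs => ?_) (MeasurableSpace.generateFrom_le ?_)⟩
  · exact (((MeasurableSpace.countable_countableGeneratingSet.image _).union
      (MeasurableSpace.countable_countableGeneratingSet.image _)).insert _).insert _
  · rw [← Set.image_preimage_inl_union_image_preimage_inr s]
    refine MeasurableSet.union (measurableSet_generateFrom_image Sum.inl_injective
      (.inl rfl) ?_ (measurable_inl hs)) (measurableSet_generateFrom_image Sum.inr_injective
      (.inr (.inl rfl)) ?_ (measurable_inr hs))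
    · exact fun s hs => .inr (.inr (.inl ⟨s, hs, rfl⟩))
    · exact fun s hs => .inr (.inr (.inr ⟨s, hs, rfl⟩))
  · rintro _ (rfl | rfl | ⟨s, hs, rfl⟩ | ⟨s, hs, rfl⟩)
    · exact measurableSet_range_inl
    · exact measurableSet_range_inr
    · exact (MeasurableSpace.measurableSet_countableGeneratingSet hs).inl_image
    · exact (MeasurableSpace.measurableSet_countableGeneratingSet hs).inr_image

namespace MatchedPair

variable {G : Type u} [Group G] [TopologicalSpace G] [IsTopologicalGroup G]
  [T2Space G] [LocallyCompactSpace G] [SecondCountableTopology G] [MeasurableSpace G] [BorelSpace G]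
  (P : MatchedPair G)

instance countablyGenerated_quot : MeasurableSpace.CountablyGenerated P.Quot :=
  countablyGenerated_sum

instance neZero_quotMeasure : NeZero P.quotMeasure := by
  refine ⟨fun h => NeZero.ne (haar : Measure G) ?_⟩
  have h1 : P.quotMeasure Set.univ = 0 := by rw [h]; rfl
  rw [quotMeasure, add_apply, add_eq_zero, map_apply measurable_inl MeasurableSet.univ,
    Set.preimage_univ, KacCohomology.quotMeasure, map_apply (measurable_mk _) MeasurableSet.univ,
    Set.preimage_univ] at h1
  exact measure_univ_eq_zero.1 (absolutelyContinuous_toFinite _ h1.1)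

end MatchedPair

end KacCohomology

end

noncomputable section

namespace KacCohomology

/-! ### The mapping cone of a short exact sequence -/

namespace MeasComplex

universe w₁ w₂ w₃

variable {X : MeasComplex.{w₁}} {Y : MeasComplex.{w₂}} {Z : MeasComplex.{w₃}}

/-- Two morphisms of complexes forming a short exact sequence of measurable cochain groups. -/
structure ShortExact (r : WHom X Y) (s : WHom Y Z) : Prop where
  good₂ : Y.Good
  good₃ : Z.Good
  comp_null : ∀ n, ∀ x ∈ X.meas n, s.f n (r.f n x) ∈ Z.null n
  injective : ∀ n x, r.f n x ∈ Y.null n → x ∈ X.null n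
  exact : ∀ n, ∀ y ∈ Y.meas n, s.f n y ∈ Z.null n → ∃ x ∈ X.meas n, y - r.f n x ∈ Y.null n
  surjective : ∀ n, ∀ z ∈ Z.meas n, ∃ y ∈ Y.meas n, z - s.f n y ∈ Z.null n

namespace ShortExact

variable {r : WHom X Y} {s : WHom Y Z} (h : ShortExact r s)
include h

theorem map_coneZ (n : ℕ) (c : X.C (n + 1) × Y.C n) (hc : c ∈ coneZ r n) :
    s.f n c.2 ∈ Z.cocycles n := by
  obtain ⟨h1, h2, h3⟩ := hc
  refine ⟨s.map_meas n _ h2, ?_⟩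
  change Z.d n (s.f n c.2) ∈ Z.null (n + 1)
  have h4 := s.map_null _ _ h3
  have h5 := s.comm n _ h2
  have h6 := h.comp_null _ _ h1.1
  rw [map_sub] at h4
  have := sub_mem (sub_mem h6 h4) h5
  convert this using 1
  abel

theorem map_coneB (n : ℕ) (c : X.C (n + 1) × Y.C n) (hc : c ∈ coneB r n) :
    s.f n c.2 ∈ Z.coboundaries n := by
  obtain ⟨x, hx, -, h1⟩ := hc
  have h2 := add_mem (s.map_coboundaries n _ h1) (null_le_coboundaries n (h.comp_null n x hx))
  rw [map_sub] at h2
  simpa using h2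

/-- The map from the cohomology of the mapping cone of `r` to the cohomology of `Z`. -/
def coneH (n : ℕ) : ConeH r n →+ Z.H n :=
  QuotientAddGroup.map _ _
    (((s.f n).comp ((AddMonoidHom.snd _ _).comp (coneZ r n).subtype)).codRestrict (Z.cocycles n)
      fun c => h.map_coneZ n c.1 c.2)
    (fun c hc => h.map_coneB n c.1 hc)

theorem coneH_cls {n : ℕ} (c : coneZ r n) :
    h.coneH n (coneCls r c) = Z.cls ⟨s.f n c.1.2, h.map_coneZ n c.1 c.2⟩ := rfl

theorem coneH_coneIncl (n : ℕ) (y : Y.H n) : h.coneH n (coneIncl r n y) = s.H n y := by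
  obtain ⟨c, rfl⟩ := cls_surjective n y
  rfl

/-- The map is (F, K) ↦ s K. If s K bounds, lift the primitive to Y and subtract its coboundary w
from K; what remains comes from some x, and F = dx because r is injective modulo null functions.
Conversely, lift a cocycle z to y; the coboundary dy has null image in Z, so it comes from some x,
and (x, y) is a cone cocycle over z. -/
theorem coneH_bijective (n : ℕ) : Function.Bijective (h.coneH n) := by
  constructor
  · refine (injective_iff_map_eq_zero _).2 fun x hx => ?_
    obtain ⟨⟨⟨F, K⟩, hF, hK, hFK⟩, rfl⟩ := coneCls_surjective n x
    rw [coneH_cls, cls_eq_zero_iff] at hx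
    simp only at hF hK hFK hx
    refine coneCls_eq_zero_iff.2 ?_
    obtain ⟨w, hw, hwm, hdw, hws⟩ : ∃ w ∈ Y.coboundaries n, w ∈ Y.meas n ∧
        Y.d n w ∈ Y.null (n + 1) ∧ s.f n (K - w) ∈ Z.null n := by
      cases n with
      | zero => exact ⟨0, zero_mem _, zero_mem _, by simp, by rw [sub_zero]; exact hx⟩
      | succ n =>
        obtain ⟨z, hz, h1⟩ := mem_coboundaries_succ.1 hx
        obtain ⟨y, hy, h2⟩ := h.surjective n z hz
        refine ⟨Y.d n y, mem_coboundaries_succ.2 ⟨y, hy, by simp⟩, h.good₂.d_meas n y hy,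
          h.good₂.d_d n y hy, ?_⟩
        have h3 := h.good₃.d_null _ _ h2
        have h4 := s.comm n y hy
        rw [map_sub] at h3 ⊢
        have := sub_mem (add_mem h1 h3) h4
        convert this using 1
        abel
    obtain ⟨x, hx, hxK⟩ := h.exact n _ (sub_mem hK hwm) hws
    refine ⟨x, hx, h.injective _ _ ?_, ?_⟩
    · have h1 := h.good₂.d_null _ _ hxK
      have h2 := r.comm n x hx
      simp only [map_sub] at h1 ⊢
      have := sub_mem (add_mem (add_mem hFK h1) hdw) h2
      convert this using 1
      abel
    · have := add_mem (null_le_coboundaries n hxK) hw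
      convert this using 1
      simp only
      abel
  · intro z
    obtain ⟨⟨z, hz, hdz⟩, rfl⟩ := cls_surjective n z
    obtain ⟨y, hy, h1⟩ := h.surjective n z hz
    have h2 : s.f (n + 1) (Y.d n y) ∈ Z.null (n + 1) := by
      have h3 := h.good₃.d_null _ _ h1
      have h4 := s.comm n y hy
      have h5 : Z.d n z ∈ Z.null (n + 1) := hdz
      rw [map_sub] at h3
      have := add_mem (sub_mem h5 h3) h4
      convert this using 1
      abel
    obtain ⟨x, hx, h3⟩ := h.exact _ _ (h.good₂.d_meas n y hy) h2
    have h4 : X.d (n + 1) x ∈ X.null (n + 1 + 1) := h.injective _ _ (by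
      have h4 := h.good₂.d_null _ _ h3
      have h5 := r.comm _ x hx
      have h6 := h.good₂.d_d n y hy
      rw [map_sub] at h4
      have := add_mem (sub_mem h6 h4) h5
      convert this using 1
      abel)
    have h5 : (x, y) ∈ coneZ r n := ⟨⟨hx, h4⟩, hy, by
      have := neg_mem h3
      rwa [neg_sub] at this⟩
    refine ⟨coneCls r ⟨(x, y), h5⟩, ?_⟩
    rw [coneH_cls]
    exact cls_eq_iff.2 (null_le_coboundaries n h1)

/-- The cohomology of the mapping cone of `r` is the cohomology of `Z`. -/
def coneEquiv (n : ℕ) : ConeH r n ≃+ Z.H n := AddEquiv.ofBijective _ (h.coneH_bijective n)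

/-- The connecting homomorphism. -/
def connecting (n : ℕ) : Z.H n →+ X.H (n + 1) :=
  (coneProj r n).comp (h.coneEquiv n).symm.toAddMonoidHom

theorem connecting_coneH (n : ℕ) (c : ConeH r n) :
    h.connecting n (h.coneH n c) = coneProj r n c :=
  congrArg (coneProj r n) ((h.coneEquiv n).symm_apply_apply c)

/-- A cone cocycle (e, K) is precisely a zigzag of the snake lemma: a lift K of c with dK = r e. -/
theorem connecting_eq_iff (n : ℕ) (x : Z.H n) (y : X.H (n + 1)) : h.connecting n x = y ↔
    ∃ (K : Y.C n) (c : Z.cocycles n) (e : X.cocycles (n + 1)), K ∈ Y.meas n ∧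
      s.f n K - c.1 ∈ Z.null n ∧ Y.d n K - r.f (n + 1) e.1 ∈ Y.null (n + 1) ∧
      Z.cls c = x ∧ X.cls e = y := by
  constructor
  · rintro rfl
    obtain ⟨x, rfl⟩ := (h.coneH_bijective n).2 x
    obtain ⟨⟨⟨F, K⟩, hF, hK, hFK⟩, rfl⟩ := coneCls_surjective n x
    refine ⟨K, ⟨s.f n K, h.map_coneZ n (F, K) ⟨hF, hK, hFK⟩⟩, ⟨F, hF⟩, hK, by simp, ?_, rfl, ?_⟩
    · have := neg_mem hFK
      rwa [neg_sub] at this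
    · rw [connecting_coneH]
      rfl
  · rintro ⟨K, c, e, hK, h1, h2, rfl, rfl⟩
    have h3 : (e.1, K) ∈ coneZ r n := ⟨e.2, hK, by
      have := neg_mem h2
      rwa [neg_sub] at this⟩
    have h4 : Z.cls c = h.coneH n (coneCls r ⟨(e.1, K), h3⟩) := by
      rw [coneH_cls]
      refine cls_eq_iff.2 (null_le_coboundaries n ?_)
      have := neg_mem h1
      rwa [neg_sub] at this
    rw [h4, connecting_coneH]
    rfl

end ShortExact

end MeasComplex

end KacCohomology

end

noncomputable section

namespace KacCohomology

/-! ### Coefficients in `L(X, A)` -/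

section Curry

variable {G : Type u} [Group G] [TopologicalSpace G] [IsTopologicalGroup G]
  [T2Space G] [LocallyCompactSpace G] [SecondCountableTopology G] [MeasurableSpace G] [BorelSpace G]
  {X : Type u} [MeasurableSpace X] {ν : Measure X} [MulAction G X] [QuasiInvariant G ν]
  {A : Type v} [AddCommGroup A] [TopologicalSpace A] [IsTopologicalAddGroup A]
  [DistribMulAction G A] [ContinuousSMul G A]

theorem qmp_smul_pair [SigmaFinite ν] [MeasurableSMul₂ G X] (m : ℕ) : QuasiMeasurePreserving
    (fun z : (Fin (m + 1) → G) × X => ((fun i : Fin m => z.1 i.succ), (z.1 0)⁻¹ • z.2))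
    ((Measure.pi fun _ => (haar : Measure G)).prod ν) ((Measure.pi fun _ => haar).prod ν) :=
  (qmp_prodMap (qmp_succAbove (μa := (haar : Measure G)) (0 : Fin (m + 1))) (.id ν)).comp
    (qmp_skew (τ := fun (x : Fin (m + 1) → G) (a : X) => (x 0)⁻¹ • a)
      (((measurable_pi_apply 0).comp measurable_fst).inv.smul measurable_snd)
      (Filter.Eventually.of_forall fun _ => QuasiInvariant.qmp _))

theorem functionComplex_d_meas [SigmaFinite ν] [MeasurableSMul₂ G X] (m : ℕ)
    (F : (functionComplex G X ν A).C m) (hF : F ∈ (functionComplex G X ν A).meas m) :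
    (functionComplex G X ν A).d m F ∈ (functionComplex G X ν A).meas (m + 1) := by
  have key : ∀ F : (Fin m → G) → MFun X ν A,
      AEStronglyMeasurable (fun z : (Fin m → G) × X => (F z.1).eval z.2)
        ((Measure.pi fun _ => haar).prod ν) →
      AEStronglyMeasurable (fun z : (Fin (m + 1) → G) × X => (groupD G (MFun X ν A) m F z.1).eval z.2)
        ((Measure.pi fun _ => haar).prod ν) := by
    intro F hF
    have h : (fun z : (Fin (m + 1) → G) × X => (groupD G (MFun X ν A) m F z.1).eval z.2) =
        fun z => z.1 0 • (F fun i => z.1 i.succ).eval ((z.1 0)⁻¹ • z.2) + ∑ j : Fin (m + 1),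
          (-1 : ℤ) ^ ((j : ℕ) + 1) • (F (Fin.contractNth j (· * ·) z.1)).eval z.2 := by
      funext z
      change MFun.eval z.2 (z.1 0 • F (fun i => z.1 i.succ) + ∑ j : Fin (m + 1),
        (-1 : ℤ) ^ ((j : ℕ) + 1) • F (Fin.contractNth j (· * ·) z.1)) = _
      rw [map_add, MFun.eval_smul, _root_.map_sum]
      simp only [map_zsmul]
    rw [h]
    refine AEStronglyMeasurable.add ?_ ?_
    · exact ((measurable_pi_apply 0).comp measurable_fst).aestronglyMeasurable.smul
        (hF.comp_quasiMeasurePreserving (qmp_smul_pair m))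
    · exact Finset.aestronglyMeasurable_fun_sum Finset.univ fun k _ =>
        (hF.comp_quasiMeasurePreserving (qmp_prodMap (qmp_contractNth k) (.id ν))).const_smul
          ((-1 : ℤ) ^ ((k : ℕ) + 1))
  exact key F hF

/-- The class of a measurable function. -/
def MFun.toLSp : MFun X ν A →+ LSp X ν A :=
  AddMonoidHom.mk' (fun F => LSp.of (fun x => F.eval x) F.aestronglyMeasurable) fun _ _ => rfl

theorem MFun.toLSp_smul (g : G) (F : MFun X ν A) : (g • F).toLSp = g • F.toLSp := rfl

theorem MFun.toLSp_eq_zero_iff {F : MFun X ν A} : F.toLSp = 0 ↔ ∀ᵐ x ∂ν, F.eval x = 0 := by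
  rw [← LSp.of_zero]
  exact LSp.of_eq_of_iff

theorem groupD_toLSp {m : ℕ} (F : (Fin m → G) → MFun X ν A) :
    (fun g => (groupD G (MFun X ν A) m F g).toLSp) = groupD G (LSp X ν A) m fun g => (F g).toLSp := by
  funext g
  change MFun.toLSp (g 0 • F (fun i => g i.succ) + ∑ j : Fin (m + 1),
      (-1 : ℤ) ^ ((j : ℕ) + 1) • F (Fin.contractNth j (· * ·) g)) =
    g 0 • (F (fun i => g i.succ)).toLSp + ∑ j : Fin (m + 1),
      (-1 : ℤ) ^ ((j : ℕ) + 1) • (F (Fin.contractNth j (· * ·) g)).toLSp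
  rw [map_add, MFun.toLSp_smul, _root_.map_sum]
  simp only [map_zsmul]

variable [IsFiniteMeasure ν] [MeasurableSpace.CountablyGenerated X] [PolishSpace A]

variable (G X ν A) in
/-- Functions on `Gⁿ × X` as functions on `Gⁿ` with values in `L(X, A)`. -/
def curry : (functionComplex G X ν A).WHom (groupComplex G (LSp X ν A)) where
  f m := MFun.toLSp.compLeft (Fin m → G)
  comm m F _ := by
    have key : ∀ F : (Fin m → G) → MFun X ν A, (fun g => (groupD G (MFun X ν A) m F g).toLSp) -
        groupD G (LSp X ν A) m (fun g => (F g).toLSp) = 0 := fun F => by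
      rw [groupD_toLSp, sub_self]
    exact (congrArg (· ∈ (groupComplex G (LSp X ν A)).null (m + 1)) (key F)).mpr (zero_mem _)
  map_meas m F hF := by
    refine LSp.aestronglyMeasurable_of_prod hF (Filter.Eventually.of_forall fun g => ?_)
    exact LSp.fn_of _
  map_null m F hF := by
    filter_upwards [ae_ae_of_ae_prod hF] with g hg
    exact MFun.toLSp_eq_zero_iff.2 hg

/-- Surjectivity is the exponential law. For injectivity, a function that vanishes on almost every
slice is null only if it is jointly measurable, which is why the argument is confined to the
subgroup of measurable cochains. -/
theorem curry_bijective [MeasurableSMul₂ G X] (m : ℕ) :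
    Function.Bijective ((curry G X ν A).H m) := by
  have := LSp.continuousSMul (G := G) (X := X) (ν := ν) (A := A)
  refine MeasComplex.WHom.H_bijective_of_equiv_on _ (groupComplex_good G _)
    (functionComplex G X ν A).meas (fun _ => le_rfl) functionComplex_d_meas ?_ ?_ m
  · intro m F hF h
    have h1 : ∀ᵐ g ∂(Measure.pi fun _ : Fin m => (haar : Measure G)),
        ∀ᵐ x ∂ν, ((F : (Fin m → G) → MFun X ν A) g).eval x = 0 := by
      have h2 : ∀ᵐ g ∂(Measure.pi fun _ : Fin m => (haar : Measure G)),
        ((F : (Fin m → G) → MFun X ν A) g).toLSp = 0 := h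
      filter_upwards [h2] with g hg
      exact MFun.toLSp_eq_zero_iff.1 hg
    have hF' : AEStronglyMeasurable (fun z : (Fin m → G) × X =>
      ((F : (Fin m → G) → MFun X ν A) z.1).eval z.2) ((Measure.pi fun _ => haar).prod ν) := hF
    obtain ⟨f, hf, hFf⟩ := hF'
    have h3 : ∀ᵐ z ∂(Measure.pi fun _ : Fin m => (haar : Measure G)).prod ν, f z = 0 := by
      borelize A
      refine (ae_prod_iff_ae_ae (measurableSet_eq_fun hf.measurable measurable_const)).2 ?_
      filter_upwards [h1, ae_ae_of_ae_prod hFf] with g h4 h5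
      filter_upwards [h4, h5] with x h6 h7
      exact h7.symm.trans h6
    filter_upwards [h3, hFf] with z h4 h5
    exact h5.trans h4
  · intro m Φ hΦ
    obtain ⟨f, hf, h⟩ := LSp.exists_prod_of_aestronglyMeasurable
      (show AEStronglyMeasurable (Φ : (Fin m → G) → LSp X ν A) (Measure.pi fun _ => haar) from hΦ)
    have hg : ∀ g, AEStronglyMeasurable (fun x => f (g, x)) ν := fun g =>
      (hf.comp_measurable measurable_prodMk_left).aestronglyMeasurable
    let F : (Fin m → G) → MFun X ν A := fun g => MFun.of fun x => f (g, x)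
    have hF : ∀ g x, (F g).eval x = f (g, x) := fun g x => MFun.eval_of (hg g) x
    refine ⟨F, ?_, ?_⟩
    · have : AEStronglyMeasurable (fun z : (Fin m → G) × X => (F z.1).eval z.2)
          ((Measure.pi fun _ => haar).prod ν) := by
        simp only [hF]
        exact hf.aestronglyMeasurable
      exact this
    · have : ∀ᵐ g ∂(Measure.pi fun _ : Fin m => (haar : Measure G)),
          (Φ : (Fin m → G) → LSp X ν A) g - (F g).toLSp = 0 := by
        filter_upwards [h] with g hg'
        rw [sub_eq_zero]
        conv_lhs => rw [← LSp.of_fn ((Φ : (Fin m → G) → LSp X ν A) g)]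
        refine LSp.of_eq_of_iff.2 ?_
        filter_upwards [hg'] with x hx
        rw [hx, hF]
      exact this

/-- Exactness in the middle uses that A is embedded in L(X, A), so that a measurable function with
values in the constants is measurable into A. Exactness on the right is the measurable lifting of
L(X, A)/A. -/
theorem shortExact_const [NeZero ν] [MeasurableSMul₂ G X] : MeasComplex.ShortExact
    (coeffHom G (LSp.const X ν A) LSp.continuous_const LSp.const_smul).toWHom
    (coeffHom G (LModConst.proj X ν A) LModConst.continuous_proj LModConst.proj_smul).toWHom where
  good₂ := by
    have := LSp.continuousSMul (G := G) (X := X) (ν := ν) (A := A)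
    exact groupComplex_good G _
  good₃ := by
    have := LSp.continuousSMul (G := G) (X := X) (ν := ν) (A := A)
    have := LModConst.continuousSMul (G := G) (X := X) (ν := ν) (A := A)
    exact groupComplex_good G _
  comp_null n F _ := by
    have : ∀ᵐ g ∂(Measure.pi fun _ : Fin n => (haar : Measure G)),
        LModConst.proj X ν A (LSp.const X ν A ((F : (Fin n → G) → A) g)) = 0 :=
      Filter.Eventually.of_forall fun g => LModConst.proj_eq_zero_iff.2 ⟨_, rfl⟩
    exact this
  injective n F hF := by
    have hF' : ∀ᵐ g ∂(Measure.pi fun _ : Fin n => (haar : Measure G)),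
        LSp.const X ν A ((F : (Fin n → G) → A) g) = 0 := hF
    have : ∀ᵐ g ∂(Measure.pi fun _ : Fin n => (haar : Measure G)), (F : (Fin n → G) → A) g = 0 := by
      filter_upwards [hF'] with g hg
      exact LSp.const_injective (hg.trans (map_zero _).symm)
    exact this
  exact n Φ hΦ h := by
    have h' : ∀ᵐ g ∂(Measure.pi fun _ : Fin n => (haar : Measure G)),
        LModConst.proj X ν A ((Φ : (Fin n → G) → LSp X ν A) g) = 0 := h
    have hΦ' : AEStronglyMeasurable (Φ : (Fin n → G) → LSp X ν A) (Measure.pi fun _ => haar) := hΦ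
    -- The constants are chosen pointwise; measurability of the choice follows afterwards, as the
    -- embedding determines it.
    have h1 : ∀ g : Fin n → G, ∃ a : A, (Φ : (Fin n → G) → LSp X ν A) g ∈ (LSp.const X ν A).range →
        LSp.const X ν A a = (Φ : (Fin n → G) → LSp X ν A) g := fun g => by
      by_cases hg : (Φ : (Fin n → G) → LSp X ν A) g ∈ (LSp.const X ν A).range
      · obtain ⟨a, ha⟩ := hg
        exact ⟨a, fun _ => ha⟩
      · exact ⟨0, fun h => absurd h hg⟩
    choose F hF using h1
    have h2 : ∀ᵐ g ∂(Measure.pi fun _ : Fin n => (haar : Measure G)),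
        (Φ : (Fin n → G) → LSp X ν A) g = LSp.const X ν A (F g) := by
      filter_upwards [h'] with g hg
      exact (hF g (LModConst.proj_eq_zero_iff.1 hg)).symm
    refine ⟨F, ?_, ?_⟩
    · have : AEStronglyMeasurable F (Measure.pi fun _ : Fin n => (haar : Measure G)) :=
        LSp.isClosedEmbedding_const.isEmbedding.aestronglyMeasurable_comp_iff.1 (hΦ'.congr h2)
      exact this
    · have : ∀ᵐ g ∂(Measure.pi fun _ : Fin n => (haar : Measure G)),
          (Φ : (Fin n → G) → LSp X ν A) g - LSp.const X ν A (F g) = 0 := by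
        filter_upwards [h2] with g hg
        rw [hg, sub_self]
      exact this
  surjective n c hc := by
    have hc' : AEStronglyMeasurable (c : (Fin n → G) → LModConst X ν A) (Measure.pi fun _ => haar) := hc
    obtain ⟨f, hf, h⟩ := LModConst.exists_lift hc'
    refine ⟨_, (LSp.stronglyMeasurable_of hf).aestronglyMeasurable, ?_⟩
    have : ∀ᵐ g ∂(Measure.pi fun _ : Fin n => (haar : Measure G)),
        (c : (Fin n → G) → LModConst X ν A) g - LModConst.proj X ν A (LSp.of (fun x => f (g, x))
        (hf.comp_measurable measurable_prodMk_left).aestronglyMeasurable) = 0 := by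
      filter_upwards [h] with g hg
      rw [hg, sub_self]
    exact this

end Curry

end KacCohomology

end

/-! ### Assembly: the isomorphisms and their compatibility with the two sequences -/

noncomputable section

namespace KacCohomology

namespace MeasComplex

universe w₁

/-- The identity morphism. -/
def WHom.id (K : MeasComplex.{w₁}) : WHom K K where
  f _ := AddMonoidHom.id _
  comm n x _ := by simp
  map_meas _ _ h := h
  map_null _ _ h := h

theorem WHom.id_H (K : MeasComplex.{w₁}) (n : ℕ) (x : K.H n) : (WHom.id K).H n x = x := by
  obtain ⟨c, rfl⟩ := cls_surjective n x
  rfl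

theorem WHom.id_bijective (K : MeasComplex.{w₁}) (n : ℕ) : Function.Bijective ((WHom.id K).H n) :=
  (funext (WHom.id_H K n) : _ = _root_.id) ▸ Function.bijective_id

end MeasComplex

namespace MatchedPair

open MeasComplex

variable {G : Type u} [Group G] [TopologicalSpace G] [IsTopologicalGroup G]
  [T2Space G] [LocallyCompactSpace G] [SecondCountableTopology G] [MeasurableSpace G] [BorelSpace G]
  (P : MatchedPair G) (A : Type v) [AddCommGroup A] [TopologicalSpace A] [IsTopologicalAddGroup A]
  [DistribMulAction G A]

/-- The space Γ₀₀ is a point and in degree 0 only null functions are divided out, so the restriction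
to G₁ is already injective. -/
theorem kacRes_zero_injective : Function.Injective (P.kacRes A 0) := by
  refine (injective_iff_map_eq_zero _).2 fun x hx => ?_
  obtain ⟨c, rfl⟩ := cls_surjective 0 x
  have h1 : (P.J₁ A).toWHom.H 0 ((P.totalComplex A).cls c) = 0 := congrArg Prod.fst hx
  rw [WHom.H_cls, cls_eq_zero_iff] at h1
  have h2 : ∀ᵐ y ∂(Measure.pi fun _ : Fin 0 => (haar : Measure P.G₁)),
      (c.1 : DC P A 0) ⟨(0, 0), rfl⟩ (Grid.ofG₁ y) = 0 := h1
  have : (ae (Measure.pi fun _ : Fin 0 => (haar : Measure P.G₁))).NeBot := by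
    rw [pi_of_empty]
    infer_instance
  obtain ⟨y, hy⟩ := h2.exists
  refine cls_eq_zero_iff.2 ?_
  rintro ⟨⟨p, q⟩, hpq⟩ -
  obtain ⟨rfl, rfl⟩ : p = 0 ∧ q = 0 := by
    simp only at hpq
    omega
  have h3 : ∀ᵐ X ∂(Grid.measure P 0 0), (c.1 : DC P A 0) ⟨(0, 0), rfl⟩ X = 0 := by
    refine Filter.Eventually.of_forall fun X => ?_
    have : X = Grid.ofG₁ y := Subtype.ext (Prod.ext (Subsingleton.elim _ _)
      (funext fun _ => Subsingleton.elim _ _))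
    rw [this, hy]
  exact h3

variable [ContinuousSMul G A] [PolishSpace A]

/-- The isomorphism `Hⁿ(D(A)) ≅ Hⁿ(G, A)`. -/
def totalEquiv (n : ℕ) : (P.totalComplex A).H n ≃+ (groupComplex G A).H n :=
  (AddEquiv.ofBijective _ (P.gridTriple_bijective A n)).trans
    (AddEquiv.ofBijective _ (P.groupTriple_bijective A n)).symm

/-- The isomorphism of the cohomology of `G₁` and `G₂` with that of the function complex. -/
def pairFunctionEquiv (n : ℕ) : (groupComplex P.G₁ A).H n × (groupComplex P.G₂ A).H n ≃+
    (functionComplex G P.Quot P.quotMeasure A).H n :=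
  ((prodEquiv _ _ n).trans (AddEquiv.ofBijective _ (P.pairTriple_bijective A n))).trans
    (AddEquiv.ofBijective _ (P.functionTriple_bijective A n)).symm

/-- The isomorphism `Hⁿ(G₁, A) ⊕ Hⁿ(G₂, A) ≅ Hⁿ(G, L(G / G₁ ⊔ G / G₂, A))`. -/
def pairEquiv (n : ℕ) : (groupComplex P.G₁ A).H n × (groupComplex P.G₂ A).H n ≃+
    (groupComplex G (P.LQuot A)).H n :=
  (P.pairFunctionEquiv A n).trans (AddEquiv.ofBijective _ (curry_bijective n))

/-- The mapping cone of `J` in the triple complexes. -/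
def gridCone (n : ℕ) : ConeH (P.J A) n →+ ConeH (P.resTriple A) n :=
  coneMap (P.J A) (P.resTriple A) (P.gridTriple A) (P.pairTriple A)
    (fun m F _ => P.pairTriple_J A m F) n

theorem gridCone_bijective (n : ℕ) : Function.Bijective (P.gridCone A n) :=
  coneMap_bijective _ _ _ _ _ (P.gridTriple_bijective A) (P.pairTriple_bijective A) n

/-- The mapping cone of the inclusion of the constant functions in the triple complexes. -/
def functionCone (n : ℕ) : ConeH (P.constMap A) n →+ ConeH (P.resTriple A) n :=
  coneMap (P.constMap A) (P.resTriple A) (P.groupTriple A) (P.functionTriple A)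
    (fun m F _ => P.functionTriple_constMap A m F) n

theorem functionCone_bijective (n : ℕ) : Function.Bijective (P.functionCone A n) :=
  coneMap_bijective _ _ _ _ _ (P.groupTriple_bijective A) (P.functionTriple_bijective A) n

theorem curry_constMap (n : ℕ) (F : (groupComplex G A).C n) :
    (curry G P.Quot P.quotMeasure A).f n ((P.constMap A).f n F) -
      (coeffHom G (LSp.const P.Quot P.quotMeasure A) LSp.continuous_const
        LSp.const_smul).toWHom.f n ((WHom.id _).f n F) ∈ (groupComplex G (P.LQuot A)).null n := by
  have key : ∀ F : (Fin n → G) → A, (fun g => (P.constFun (F g)).toLSp) -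
      (fun g => LSp.const P.Quot P.quotMeasure A (F g)) = 0 := fun F => sub_self _
  exact (congrArg (· ∈ (groupComplex G (P.LQuot A)).null n) (key F)).mpr (zero_mem _)

/-- The mapping cone of the inclusion of the coefficients `A` in `L(G / G₁ ⊔ G / G₂, A)`. -/
def curryCone (n : ℕ) : ConeH (P.constMap A) n →+ ConeH (coeffHom G
    (LSp.const P.Quot P.quotMeasure A) LSp.continuous_const LSp.const_smul).toWHom n :=
  coneMap (P.constMap A) (coeffHom G (LSp.const P.Quot P.quotMeasure A) LSp.continuous_const
    LSp.const_smul).toWHom (WHom.id _) (curry G P.Quot P.quotMeasure A)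
    (fun m F _ => P.curry_constMap A m F) n

theorem curryCone_bijective (n : ℕ) : Function.Bijective (P.curryCone A n) :=
  coneMap_bijective _ _ _ _ _ (WHom.id_bijective _) (fun n => curry_bijective n) n

/-- The Kac cohomology in terms of the function complex. -/
def kacFunctionEquiv (n : ℕ) : P.KacH A n ≃+ ConeH (P.constMap A) n :=
  ((P.kacEquiv A n).trans (AddEquiv.ofBijective _ (P.gridCone_bijective A n))).trans
    (AddEquiv.ofBijective _ (P.functionCone_bijective A n)).symm

/-- The isomorphism `Hⁿ(m.p., A) ≅ Hⁿ(G, L(G / G₁ ⊔ G / G₂, A) / A)`. -/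
def kacModuleEquiv (n : ℕ) : P.KacH A n ≃+ (groupComplex G (P.KacModule A)).H n :=
  ((P.kacFunctionEquiv A n).trans (AddEquiv.ofBijective _ (P.curryCone_bijective A n))).trans
    ((shortExact_const (G := G) (X := P.Quot) (ν := P.quotMeasure) (A := A)).coneEquiv n)

theorem groupTriple_totalEquiv (n : ℕ) (x : (P.totalComplex A).H n) :
    (P.groupTriple A).H n (P.totalEquiv A n x) = (P.gridTriple A).H n x :=
  (AddEquiv.ofBijective _ (P.groupTriple_bijective A n)).apply_symm_apply _

theorem functionTriple_pairFunctionEquiv (n : ℕ)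
    (y : (groupComplex P.G₁ A).H n × (groupComplex P.G₂ A).H n) :
    (P.functionTriple A).H n (P.pairFunctionEquiv A n y) =
      (P.pairTriple A).H n (prodEquiv _ _ n y) :=
  (AddEquiv.ofBijective _ (P.functionTriple_bijective A n)).apply_symm_apply _

theorem functionCone_kacFunctionEquiv (n : ℕ) (x : P.KacH A n) :
    P.functionCone A n (P.kacFunctionEquiv A n x) = P.gridCone A n (P.kacEquiv A n x) :=
  (AddEquiv.ofBijective _ (P.functionCone_bijective A n)).apply_symm_apply _

/-- After the injective passage to the triple complexes both sides become `resTriple`, the common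
side of the squares for `J` and for the constants. -/
theorem pairFunctionEquiv_kacRes (n : ℕ) (x : (P.totalComplex A).H n) :
    P.pairFunctionEquiv A n (P.kacRes A n x) = (P.constMap A).H n (P.totalEquiv A n x) := by
  apply (P.functionTriple_bijective A n).1
  rw [functionTriple_pairFunctionEquiv, ← J_H,
    H_square (P.J A) (P.resTriple A) (P.gridTriple A) (P.pairTriple A)
      (fun m F _ => P.pairTriple_J A m F),
    H_square (P.constMap A) (P.resTriple A) (P.groupTriple A) (P.functionTriple A)
      (fun m F _ => P.functionTriple_constMap A m F), groupTriple_totalEquiv]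

theorem kacFunctionEquiv_kacIncl (n : ℕ)
    (y : (groupComplex P.G₁ A).H n × (groupComplex P.G₂ A).H n) :
    P.kacFunctionEquiv A n (P.kacIncl A n y) =
      coneIncl (P.constMap A) n (P.pairFunctionEquiv A n y) := by
  apply (P.functionCone_bijective A n).1
  rw [functionCone_kacFunctionEquiv, kacEquiv_kacIncl, gridCone, functionCone, coneMap_coneIncl,
    coneMap_coneIncl, functionTriple_pairFunctionEquiv]

theorem totalEquiv_kacProj (n : ℕ) (x : P.KacH A n) :
    P.totalEquiv A (n + 1) (P.kacProj A n x) =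
      coneProj (P.constMap A) n (P.kacFunctionEquiv A n x) := by
  apply (P.groupTriple_bijective A (n + 1)).1
  have h := congrArg (coneProj (P.resTriple A) n) (P.functionCone_kacFunctionEquiv A n x)
  rw [gridCone, functionCone, coneProj_coneMap, coneProj_coneMap, coneProj_kacEquiv] at h
  rw [groupTriple_totalEquiv, h]

theorem pairEquiv_kacRes (n : ℕ) (x : (P.totalComplex A).H n) :
    P.pairEquiv A n (P.kacRes A n x) = P.constH A n (P.totalEquiv A n x) := by
  change (curry G P.Quot P.quotMeasure A).H n (P.pairFunctionEquiv A n (P.kacRes A n x)) = _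
  rw [pairFunctionEquiv_kacRes, H_square _ _ _ _ (fun m F _ => P.curry_constMap A m F), WHom.id_H]
  rfl

theorem kacModuleEquiv_kacIncl (n : ℕ)
    (y : (groupComplex P.G₁ A).H n × (groupComplex P.G₂ A).H n) :
    P.kacModuleEquiv A n (P.kacIncl A n y) = P.projH A n (P.pairEquiv A n y) := by
  change (shortExact_const (G := G) (X := P.Quot) (ν := P.quotMeasure) (A := A)).coneH n
    (P.curryCone A n (P.kacFunctionEquiv A n (P.kacIncl A n y))) = _
  rw [kacFunctionEquiv_kacIncl, curryCone, coneMap_coneIncl, ShortExact.coneH_coneIncl]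
  rfl

/-- Both connecting maps are projections of a mapping cone to its first component, and maps of cones
respect these projections. -/
theorem totalEquiv_kacProj_eq_connecting (n : ℕ) (x : P.KacH A n) :
    P.totalEquiv A (n + 1) (P.kacProj A n x) =
      (shortExact_const (G := G) (X := P.Quot) (ν := P.quotMeasure) (A := A)).connecting n
        (P.kacModuleEquiv A n x) := by
  change _ = (shortExact_const (G := G) (X := P.Quot) (ν := P.quotMeasure) (A := A)).connecting n
    ((shortExact_const (G := G) (X := P.Quot) (ν := P.quotMeasure) (A := A)).coneH n
      (P.curryCone A n (P.kacFunctionEquiv A n x)))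
  rw [ShortExact.connecting_coneH, curryCone, coneProj_coneMap, WHom.id_H, totalEquiv_kacProj]

end MatchedPair

theorem isConnectingHom_connecting {G : Type u} [Group G] [TopologicalSpace G] [IsTopologicalGroup G]
    [T2Space G] [LocallyCompactSpace G] [SecondCountableTopology G] [MeasurableSpace G]
    [BorelSpace G] {X : Type u} [MeasurableSpace X] {ν : Measure X} [MulAction G X]
    [QuasiInvariant G ν] {A : Type v} [AddCommGroup A] [TopologicalSpace A]
    [IsTopologicalAddGroup A] [DistribMulAction G A] [ContinuousSMul G A] [IsFiniteMeasure ν]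
    [MeasurableSpace.CountablyGenerated X] [PolishSpace A] [NeZero ν] [MeasurableSMul₂ G X] (n : ℕ) :
    IsConnectingHom G (LSp.const X ν A) (LModConst.proj X ν A) n
      ((shortExact_const (G := G) (X := X) (ν := ν) (A := A)).connecting n) := by
  intro x y
  rw [MeasComplex.ShortExact.connecting_eq_iff]
  refine exists_congr fun F => exists_congr fun c => exists_congr fun e =>
    and_congr Iff.rfl (and_congr ?_ (and_congr ?_ Iff.rfl))
  · have : ∀ (f : (Fin n → G) → LSp X ν A) (k : (Fin n → G) → LModConst X ν A),
        (∀ᵐ g ∂(Measure.pi fun _ : Fin n => (haar : Measure G)),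
          LModConst.proj X ν A (f g) - k g = 0) ↔
        ∀ᵐ g ∂(Measure.pi fun _ : Fin n => (haar : Measure G)), LModConst.proj X ν A (f g) = k g :=
      fun f k => by simp only [sub_eq_zero]
    exact this F c.1
  · have : ∀ f k : (Fin (n + 1) → G) → LSp X ν A,
        (∀ᵐ g ∂(Measure.pi fun _ : Fin (n + 1) => (haar : Measure G)), f g - k g = 0) ↔
        ∀ᵐ g ∂(Measure.pi fun _ : Fin (n + 1) => (haar : Measure G)), f g = k g :=
      fun f k => by simp only [sub_eq_zero]
    exact this (groupD G (LSp X ν A) n F) fun g =>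
      LSp.const X ν A ((e.1 : (Fin (n + 1) → G) → A) g)

end KacCohomology

end

theorem mainTheorem4 {G : Type u} [Group G] [TopologicalSpace G] [IsTopologicalGroup G]
    [T2Space G] [LocallyCompactSpace G] [SecondCountableTopology G]
    [MeasurableSpace G] [BorelSpace G] (P : KacCohomology.MatchedPair G)
    {A : Type v} [AddCommGroup A] [TopologicalSpace A] [IsTopologicalAddGroup A] [PolishSpace A]
    [DistribMulAction G A] [ContinuousSMul G A] :
    -- `0 → A → L(G/G₁ ⊔ G/G₂, A) → L(G/G₁ ⊔ G/G₂, A) / A → 0` consists of Polish `G`-modules, and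
    -- `A` is embedded as a closed submodule
    (PolishSpace (P.LQuot A) ∧ ContinuousSMul G (P.LQuot A)) ∧
    (PolishSpace (P.KacModule A) ∧ ContinuousSMul G (P.KacModule A)) ∧
    IsClosedEmbedding (KacCohomology.LSp.const P.Quot P.quotMeasure A) ∧
    -- exactness of the Kac sequence
    Function.Injective (P.kacRes A 0) ∧
    (∀ n, Function.Exact (P.kacRes A n) (P.kacIncl A n)) ∧
    (∀ n, Function.Exact (P.kacIncl A n) (P.kacProj A n)) ∧
    (∀ n, Function.Exact (P.kacProj A n) (P.kacRes A (n + 1))) ∧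
    -- isomorphism with the long exact sequence of the above sequence of coefficient modules
    ∃ (δ : ∀ n, (KacCohomology.groupComplex G (P.KacModule A)).H n →+
        (KacCohomology.groupComplex G A).H (n + 1))
      (a : ∀ n, (P.totalComplex A).H n ≃+ (KacCohomology.groupComplex G A).H n)
      (b : ∀ n, ((KacCohomology.groupComplex P.G₁ A).H n × (KacCohomology.groupComplex P.G₂ A).H n)
        ≃+ (KacCohomology.groupComplex G (P.LQuot A)).H n)
      (c : ∀ n, P.KacH A n ≃+ (KacCohomology.groupComplex G (P.KacModule A)).H n),
      (∀ n, KacCohomology.IsConnectingHom G (KacCohomology.LSp.const P.Quot P.quotMeasure A)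
        (KacCohomology.LModConst.proj P.Quot P.quotMeasure A) n (δ n)) ∧
      (∀ n x, b n (P.kacRes A n x) = P.constH A n (a n x)) ∧
      (∀ n x, c n (P.kacIncl A n x) = P.projH A n (b n x)) ∧
      (∀ n x, a (n + 1) (P.kacProj A n x) = δ n (c n x)) := by
  have h₁ : ContinuousSMul G (P.LQuot A) := KacCohomology.LSp.continuousSMul
  refine ⟨⟨KacCohomology.LSp.polishSpace, h₁⟩, ⟨KacCohomology.LModConst.polishSpace,
    KacCohomology.LModConst.continuousSMul⟩, KacCohomology.LSp.isClosedEmbedding_const,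
    P.kacRes_zero_injective A, P.exact_kacRes_kacIncl A, P.exact_kacIncl_kacProj A,
    P.exact_kacProj_kacRes A,
    fun n => (KacCohomology.shortExact_const (G := G) (X := P.Quot) (ν := P.quotMeasure)
      (A := A)).connecting n,
    P.totalEquiv A, P.pairEquiv A, P.kacModuleEquiv A,
    KacCohomology.isConnectingHom_connecting, P.pairEquiv_kacRes A, P.kacModuleEquiv_kacIncl A,
    P.totalEquiv_kacProj_eq_connecting A⟩
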